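/- Let $0<L_0<L$, $l>0$, and let $\rho_j,\beta_j,k_j,\sigma_j,\lambda_j>0$ ($j=1,2$). For $\Phi=(\Phi^1,\Phi^2)$ with $\Phi^1=(\varphi,\psi,\omega)$ on $(0,L_0)$ and $\Phi^2=(u,v,w)$ on $(L_0,L)$, and for a triple $(\xi,\zeta,\eta)$, put $$Q_j=k_j(\xi_x+\zeta+l\eta),\qquad N_j=\sigma_j(\eta_x-l\xi),\qquad M_j=\lambda_j\zeta_x .$$ Let $H_v=[L^2(0,L_0)]^3\times[L^2(L_0,L)]^3$ with $\|\Phi\|_v^2=\sum_{j}\|\sqrt{R_j}\,\Phi^j\|_{L^2}^2$, $R_j=\mathrm{diag}(\rho_j,\beta_j,\rho_j)$, $R=\mathrm{diag}(R_1,R_2)$; let $H_d$ be the space of $\Phi\in[H^1(0,L_0)]^3\times[H^1(L_0,L)]^3$ with $\Phi^1(0)=\Phi^2(L)=0$ and $\Phi^1(L_0)=\Phi^2(L_0)$, with $\|\Phi\|_d^2=\sum_j(\|Q_j(\Phi^j)\|^2+\|N_j(\Phi^j)\|^2+\|M_j(\Phi^j)\|^2)$; and let $H=H_d\times H_v$.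 Consider the transmission problem for the Bresse beam $$\begin{aligned} &\rho_1\varphi_{tt}-k_1(\varphi_x+\psi+l\omega)_x-l\sigma_1(\omega_x-l\varphi)+f_1(\varphi,\psi,\omega)=p_1(x),\\ &\beta_1\psi_{tt}-\lambda_1\psi_{xx}+k_1(\varphi_x+\psi+l\omega)+\gamma(\psi_t)+h_1(\varphi,\psi,\omega)=r_1(x),\\ &\rho_1\omega_{tt}-\sigma_1(\omega_x-l\varphi)_x+lk_1(\varphi_x+\psi+l\omega)+g_1(\varphi,\psi,\omega)=q_1(x), \end{aligned}\qquad x\in(0,L_0),\ t>0,$$ $$\begin{aligned} &\rho_2u_{tt}-k_2(u_x+v+lw)_x-l\sigma_2(w_x-lu)+f_2(u,v,w)=p_2(x),\\ &\beta_2v_{tt}-\lambda_2v_{xx}+k_2(u_x+v+lw)+h_2(u,v,w)=r_2(x),\\ &\rho_2w_{tt}-\sigma_2(w_x-lu)_x+lk_2(u_x+v+lw)+g_2(u,v,w)=q_2(x), \end{aligned}\qquad x\in(L_0,L),\ t>0,$$ with $\Phi^1(0,t)=\Phi^2(L,t)=0$, $\Phi^1=\Phi^2$, $Q_1(\Phi^1)=Q_2(\Phi^2)$,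 $M_1(\Phi^1)=M_2(\Phi^2)$, $N_1(\Phi^1)=N_2(\Phi^2)$ at $x=L_0$, and initial data $(\Phi,\Phi_t)|_{t=0}=(\Phi_0,\Phi_1)\in H$. A weak solution on $(0,T)$ is a $\Phi\in L^\infty(0,T;H_d)$ with $\Phi_t\in L^\infty(0,T;H_v)$ and $\Phi(0)=\Phi_0$ such that for all $B\in L^2(0,T;H_d)$ with $B_t\in L^2(0,T;H_v)$ and $B(T)=0$ $$-\int_0^T(R\Phi_t,B_t)\,dt-(R\Phi_1,B(0))+\int_0^T\Big[a(\Phi,B)+(\Gamma(\Phi_t),B)+(F(\Phi),B)-(P,B)\Big]dt=0,$$ where $(\cdot,\cdot)$ is the $L^2$ inner product, $a(\Phi,B)=\sum_{j}\big[\tfrac1{k_j}(Q_j(\Phi^j),Q_j(B^j))+\tfrac1{\sigma_j}(N_j(\Phi^j),N_j(B^j))+\tfrac1{\lambda_j}(M_j(\Phi^j),M_j(B^j))\big]$, $\Gamma(\Phi_t)=(0,\gamma(\psi_t),0,0,0,0)$, and $F(\Phi)$, $P$ have the components $(f_j,h_j,g_j)(\Phi^j)$ and $(p_j,r_j,q_j)$.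 Assume: (i) $f_j,g_j,h_j:\mathbb R^3\to\mathbb R$ are Lipschitz on every ball, there are $\mathcal F_j:\mathbb R^3\to\mathbb R$ with $(f_j,h_j,g_j)=\nabla\mathcal F_j$, and $\mathcal F_j\ge-\delta$ on $\mathbb R^3$ for some $\delta>0$ ($j=1,2$); (ii) the load $P$ does not depend on $t$ and $P\in H_v$; (iii) $\gamma:\mathbb R\to\mathbb R$ is continuous and non-decreasing, $\gamma(0)=0$, and there are constants $m,M>0$ with $m\le\frac{\gamma(s_1)-\gamma(s_2)}{s_1-s_2}\le M$ for all $s_1\ne s_2$; (iv) $k_1=\sigma_1$ and $\dfrac{\rho_1}{k_1}=\dfrac{\beta_1}{\lambda_1}$. Then the problem generates a dynamical system $(H,S_t)$ by $S_t(\Phi_0,\Phi_1)=(\Phi(t),\Phi_t(t))$, where $\Phi$ is the (unique) weak solution with initial data $(\Phi_0,\Phi_1)$, and this dynamical system is asymptotically smooth: for every closed bounded set $B\subset H$ with $S_tB\subseteq B$ for all $t\ge0$ there is a compact set $K\subset H$ such that $\sup_{y\in B}\mathrm{dist}_H(S_ty,K)\to0$ as $t\to\infty$. -/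

import Mathlib

open MeasureTheory Set Filter Topology
open scoped NNReal ENNReal

noncomputable section

/-- Geometry and physical coefficients of a composite Bresse beam of length `L` and curvature `l`.
The index `0 : Fin 2` refers to the damped part `(0, L₀)`, the index `1 : Fin 2` to the undamped
part `(L₀, L)`. -/
structure BresseBeam where
  L₀ : ℝ
  L : ℝ
  l : ℝ
  ρ : Fin 2 → ℝ
  β : Fin 2 → ℝ
  k : Fin 2 → ℝ
  σ : Fin 2 → ℝ
  lam : Fin 2 → ℝ

namespace BresseBeam

/-- Left end of the `j`-th part. -/
def left (D : BresseBeam) (j : Fin 2) : ℝ := ![0, D.L₀] j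

/-- Right end of the `j`-th part. -/
def right (D : BresseBeam) (j : Fin 2) : ℝ := ![D.L₀, D.L] j

/-- `L²` on the `j`-th part of the beam. -/
abbrev L2 (D : BresseBeam) (j : Fin 2) : Type :=
  Lp ℝ 2 (volume.restrict (Ioo (D.left j) (D.right j)))

/-- Six-tuples `Φ = (Φ¹, Φ²)` of `L²` functions; `Φ j 0`, `Φ j 1`, `Φ j 2` are the transversal
displacement, the shear angle variation and the longitudinal displacement of the `j`-th part. -/
abbrev Fields (D : BresseBeam) : Type := ∀ j : Fin 2, Fin 3 → D.L2 j

/-- Diagonal entries of the inertia matrix `R_j = diag(ρ_j, β_j, ρ_j)`. -/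
def inertia (D : BresseBeam) (j : Fin 2) : Fin 3 → ℝ := ![D.ρ j, D.β j, D.ρ j]

/-- `f ∈ H¹(a,b)` with weak derivative `g ∈ L²(a,b)`, and `F` is on `[a,b]` the absolutely
continuous representative of `f`. -/
def IsSobolevRep (a b : ℝ) (f g : Lp ℝ 2 (volume.restrict (Ioo a b))) (F : ℝ → ℝ) : Prop :=
  (f =ᵐ[volume.restrict (Ioo a b)] F) ∧ ∀ x ∈ Icc a b, F x = F a + ∫ t in a..x, g t

theorem intervalIntegrable_Lp {a b x : ℝ} (hx : x ∈ Icc a b)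
    (g : Lp ℝ 2 (volume.restrict (Ioo a b))) : IntervalIntegrable g volume a x := by
  have h1 : Integrable g (volume.restrict (Ioo a b)) :=
    (Lp.memLp g).integrable (by norm_num)
  rw [intervalIntegrable_iff_integrableOn_Ioo_of_le hx.1]
  exact IntegrableOn.mono_set h1 (Ioo_subset_Ioo_right hx.2)

theorem intervalIntegral_congr_Lp {a b x : ℝ} (hx : x ∈ Icc a b) {u v : ℝ → ℝ}
    (h : u =ᵐ[volume.restrict (Ioo a b)] v) : ∫ t in a..x, u t = ∫ t in a..x, v t := by
  rw [intervalIntegral.integral_of_le hx.1, intervalIntegral.integral_of_le hx.1,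
    integral_Ioc_eq_integral_Ioo, integral_Ioc_eq_integral_Ioo]
  exact integral_congr_ae (ae_restrict_of_ae_restrict_of_subset (Ioo_subset_Ioo_right hx.2) h)

theorem IsSobolevRep.add {a b : ℝ} {f g f' g' : Lp ℝ 2 (volume.restrict (Ioo a b))}
    {F F' : ℝ → ℝ} (h : IsSobolevRep a b f g F) (h' : IsSobolevRep a b f' g' F') :
    IsSobolevRep a b (f + f') (g + g') (fun x => F x + F' x) := by
  refine ⟨?_, fun x hx => ?_⟩
  · filter_upwards [Lp.coeFn_add f f', h.1, h'.1] with x h1 h2 h3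
    rw [h1, Pi.add_apply, h2, h3]
  · rw [intervalIntegral_congr_Lp hx (Lp.coeFn_add g g')]
    simp only [Pi.add_apply]
    rw [intervalIntegral.integral_add (intervalIntegrable_Lp hx g) (intervalIntegrable_Lp hx g'),
      h.2 x hx, h'.2 x hx]
    ring

theorem IsSobolevRep.smul {a b : ℝ} {f g : Lp ℝ 2 (volume.restrict (Ioo a b))}
    {F : ℝ → ℝ} (c : ℝ) (h : IsSobolevRep a b f g F) :
    IsSobolevRep a b (c • f) (c • g) (fun x => c * F x) := by
  refine ⟨?_, fun x hx => ?_⟩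
  · filter_upwards [Lp.coeFn_smul c f, h.1] with x h1 h2
    rw [h1, Pi.smul_apply, h2, smul_eq_mul]
  · rw [intervalIntegral_congr_Lp hx (Lp.coeFn_smul c g)]
    simp only [Pi.smul_apply, smul_eq_mul]
    rw [intervalIntegral.integral_const_mul, h.2 x hx]
    ring

theorem IsSobolevRep.zero (a b : ℝ) : IsSobolevRep a b 0 0 (fun _ => 0) := by
  refine ⟨Lp.coeFn_zero _ _ _, fun x hx => ?_⟩
  rw [intervalIntegral_congr_Lp hx (Lp.coeFn_zero _ _ _)]
  simp

/-- Displacements: pairs `(Φ, Φ_x)` such that every component of `Φ` is in `H¹` of its part, with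
weak derivative the corresponding component of `Φ_x`, `Φ¹(0) = Φ²(L) = 0` and
`Φ¹(L₀) = Φ²(L₀)`. (The weak derivative `Φ_x` is determined by `Φ`.) -/
def hdSubmodule (D : BresseBeam) : Submodule ℝ (D.Fields × D.Fields) where
  carrier := {Φ | ∃ F : Fin 2 → Fin 3 → ℝ → ℝ,
    (∀ j i, IsSobolevRep (D.left j) (D.right j) (Φ.1 j i) (Φ.2 j i) (F j i)) ∧
    ∀ i, F 0 i 0 = 0 ∧ F 1 i D.L = 0 ∧ F 0 i D.L₀ = F 1 i D.L₀}
  add_mem' := by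
    rintro Φ Ψ ⟨F, hF, hF'⟩ ⟨G, hG, hG'⟩
    exact ⟨fun j i x => F j i x + G j i x, fun j i => (hF j i).add (hG j i), fun i => by
      simp [(hF' i).1, (hF' i).2.1, (hF' i).2.2, (hG' i).1, (hG' i).2.1, (hG' i).2.2]⟩
  zero_mem' := ⟨fun _ _ _ => 0, fun j i => IsSobolevRep.zero _ _, fun i => by simp⟩
  smul_mem' := by
    rintro c Φ ⟨F, hF, hF'⟩
    exact ⟨fun j i x => c * F j i x, fun j i => (hF j i).smul c, fun i => by
      simp [(hF' i).1, (hF' i).2.1, (hF' i).2.2]⟩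

/-- The space `H_v` of velocities. -/
def Hv (D : BresseBeam) : Type := D.Fields

/-- The space `H_d` of displacements. -/
def Hd (D : BresseBeam) : Type := D.hdSubmodule

instance (D : BresseBeam) : AddCommGroup D.Hv := inferInstanceAs (AddCommGroup D.Fields)
instance (D : BresseBeam) : Module ℝ D.Hv := inferInstanceAs (Module ℝ D.Fields)
instance (D : BresseBeam) : AddCommGroup D.Hd := inferInstanceAs (AddCommGroup D.hdSubmodule)
instance (D : BresseBeam) : Module ℝ D.Hd := inferInstanceAs (Module ℝ D.hdSubmodule)

/-- The components of a velocity field. -/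
def Hv.fld {D : BresseBeam} : D.Hv →ₗ[ℝ] D.Fields := LinearMap.id

/-- The components of a displacement field. -/
def Hd.fld {D : BresseBeam} : D.Hd →ₗ[ℝ] D.Fields :=
  (LinearMap.fst ℝ D.Fields D.Fields).comp D.hdSubmodule.subtype

/-- The weak derivatives `Φ_x` of the components of a displacement field. -/
def Hd.dx {D : BresseBeam} : D.Hd →ₗ[ℝ] D.Fields :=
  (LinearMap.snd ℝ D.Fields D.Fields).comp D.hdSubmodule.subtype

/-- Shear force `Q_j(Φ) = k_j (φ_x + ψ + l ω)`. -/
def Q (D : BresseBeam) (j : Fin 2) (Φ : D.Hd) : D.L2 j :=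
  D.k j • (Hd.dx Φ j 0 + Hd.fld Φ j 1 + D.l • Hd.fld Φ j 2)

/-- Axial force `N_j(Φ) = σ_j (ω_x - l φ)`. -/
def N (D : BresseBeam) (j : Fin 2) (Φ : D.Hd) : D.L2 j :=
  D.σ j • (Hd.dx Φ j 2 - D.l • Hd.fld Φ j 0)

/-- Bending moment `M_j(Φ) = λ_j ψ_x`. -/
def M (D : BresseBeam) (j : Fin 2) (Φ : D.Hd) : D.L2 j :=
  D.lam j • Hd.dx Φ j 1

/-- The Hilbert sum of the six `L²` spaces. -/
abbrev SixL2 (D : BresseBeam) : Type := PiLp 2 (fun p : Fin 2 × Fin 3 => D.L2 p.1)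

/-- `Φ ↦ (√R_1 Φ¹, √R_2 Φ²)`. -/
def hvEmb (D : BresseBeam) : D.Hv →ₗ[ℝ] D.SixL2 where
  toFun Φ := WithLp.toLp 2 fun p => √(D.inertia p.1 p.2) • Hv.fld Φ p.1 p.2
  map_add' Φ Ψ := by ext1 p; simp
  map_smul' c Φ := by ext1 p; simp [smul_comm c]

/-- `Φ ↦ (Q_j(Φ), N_j(Φ), M_j(Φ))_{j}`. -/
def hdEmb (D : BresseBeam) : D.Hd →ₗ[ℝ] D.SixL2 where
  toFun Φ := WithLp.toLp 2 fun p => ![D.Q p.1 Φ, D.N p.1 Φ, D.M p.1 Φ] p.2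
  map_add' Φ Ψ := by
    ext1 ⟨j, i⟩
    fin_cases i <;> simp [Q, N, M] <;> module
  map_smul' c Φ := by
    ext1 ⟨j, i⟩
    fin_cases i <;> simp [Q, N, M] <;> module

/-- `‖Φ‖_v² = ∑_j ‖√R_j Φ^j‖²`. -/
instance (D : BresseBeam) : SeminormedAddCommGroup D.Hv :=
  SeminormedAddCommGroup.induced D.Hv D.SixL2 D.hvEmb

/-- `‖Φ‖_d² = ∑_j (‖Q_j(Φ)‖² + ‖N_j(Φ)‖² + ‖M_j(Φ)‖²)`. For positive coefficients this is a norm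
which is equivalent to the `H¹` norm. -/
instance (D : BresseBeam) : SeminormedAddCommGroup D.Hd :=
  SeminormedAddCommGroup.induced D.Hd D.SixL2 D.hdEmb

/-- The phase space `H = H_d × H_v`. -/
abbrev H (D : BresseBeam) : Type := D.Hd × D.Hv

/-- The energy form `(A^{1/2}Φ, A^{1/2}B)`, where `A` is the static linear part of the system. -/
def energyForm (D : BresseBeam) (Φ B : D.Hd) : ℝ :=
  ∑ j, ((D.k j)⁻¹ * inner ℝ (D.Q j Φ) (D.Q j B) + (D.σ j)⁻¹ * inner ℝ (D.N j Φ) (D.N j B)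
    + (D.lam j)⁻¹ * inner ℝ (D.M j Φ) (D.M j B))

/-- The `L²` inner product `(Φ, B)` of six-tuples of functions. -/
def pairing (D : BresseBeam) (Φ B : D.Fields) : ℝ := ∑ j, ∑ i, inner ℝ (Φ j i) (B j i)

/-- `(RΦ, B)`. -/
def inertiaPairing (D : BresseBeam) (Φ B : D.Fields) : ℝ :=
  ∑ j, ∑ i, D.inertia j i * inner ℝ (Φ j i) (B j i)

/-- `(Γ(Φ_t), B) = ∫₀^{L₀} γ(ψ_t) B_ψ dx`: the damping acts on the shear angle of the first part
only. -/
def dampingPairing (D : BresseBeam) (γ : ℝ → ℝ) (V B : D.Fields) : ℝ :=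
  ∫ x in Ioo 0 D.L₀, γ (V 0 1 x) * B 0 1 x

/-- `(F(Φ), B)`, where the feedbacks `f_j, h_j, g_j` act in the equations of the transversal
displacement, of the shear angle and of the longitudinal displacement respectively. -/
def feedbackPairing (D : BresseBeam) (f h g : Fin 2 → EuclideanSpace ℝ (Fin 3) → ℝ)
    (Φ B : D.Fields) : ℝ :=
  ∑ j, ∫ x in Ioo (D.left j) (D.right j),
    (f j !₂[Φ j 0 x, Φ j 1 x, Φ j 2 x] * B j 0 x
      + h j !₂[Φ j 0 x, Φ j 1 x, Φ j 2 x] * B j 1 x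
      + g j !₂[Φ j 0 x, Φ j 1 x, Φ j 2 x] * B j 2 x)

/-- Test functions: `B ∈ L²(0,T;H_d)` with `B_t ∈ L²(0,T;H_v)` and `B(T) = 0`. -/
structure IsTestFunction (D : BresseBeam) (T : ℝ) (B : ℝ → D.Hd) (Bt : ℝ → D.Hv) : Prop where
  memLp : MemLp B 2 (volume.restrict (Ioo 0 T))
  memLp_t : MemLp Bt 2 (volume.restrict (Ioo 0 T))
  eq_integral : ∀ᵐ t ∂volume.restrict (Ioo 0 T), ∀ j i,
    Hd.fld (B t) j i = -∫ s in t..T, Hv.fld (Bt s) j i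

/-- The value `B(0) = -∫₀ᵀ B_t dt` of (the continuous `H_v`-valued representative of) a test
function. -/
def testInitial (D : BresseBeam) (T : ℝ) (Bt : ℝ → D.Hv) : D.Fields :=
  fun j i => -∫ s in (0 : ℝ)..T, Hv.fld (Bt s) j i

/-- `Φ`, with time derivative `Φt`, is a variational (weak) solution on `(0,T)` of the transmission
problem with feedbacks `f, h, g`, damping `γ` and stationary load `P` (where `P j = (p_j, r_j, q_j)`),
with initial data `Φ(0) = U₀.1`, `Φ_t(0) = U₀.2`. -/
structure IsWeakSolution (D : BresseBeam) (f h g : Fin 2 → EuclideanSpace ℝ (Fin 3) → ℝ)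
    (γ : ℝ → ℝ) (P : D.Hv) (T : ℝ) (U₀ : D.H) (Φ : ℝ → D.Hd) (Φt : ℝ → D.Hv) : Prop where
  memLp : MemLp Φ ∞ (volume.restrict (Ioo 0 T))
  memLp_t : MemLp Φt ∞ (volume.restrict (Ioo 0 T))
  /-- `Φt` is the time derivative of `Φ`, and `Φ(0) = Φ₀`. -/
  eq_integral : ∀ᵐ t ∂volume.restrict (Ioo 0 T), ∀ j i,
    Hd.fld (Φ t) j i = Hd.fld U₀.1 j i + ∫ s in (0 : ℝ)..t, Hv.fld (Φt s) j i
  variational : ∀ (B : ℝ → D.Hd) (Bt : ℝ → D.Hv), D.IsTestFunction T B Bt →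
    -(∫ t in (0 : ℝ)..T, D.inertiaPairing (Hv.fld (Φt t)) (Hv.fld (Bt t)))
      - D.inertiaPairing (Hv.fld U₀.2) (D.testInitial T Bt)
      + (∫ t in (0 : ℝ)..T, D.energyForm (Φ t) (B t))
      + (∫ t in (0 : ℝ)..T, D.dampingPairing γ (Hv.fld (Φt t)) (Hd.fld (B t)))
      + (∫ t in (0 : ℝ)..T, D.feedbackPairing f h g (Hd.fld (Φ t)) (Hd.fld (B t)))
      - (∫ t in (0 : ℝ)..T, D.pairing (Hv.fld P) (Hd.fld (B t))) = 0

/-- The dynamical system `S` is generated by the transmission problem: for all initial data `U₀`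
and all `T > 0`, the trajectory `t ↦ S_t U₀ = (Φ(t), Φ_t(t))` is the (unique) weak solution on
`(0,T)`. -/
def Generates (D : BresseBeam) (f h g : Fin 2 → EuclideanSpace ℝ (Fin 3) → ℝ)
    (γ : ℝ → ℝ) (P : D.Hv) (S : Flow ℝ≥0 D.H) : Prop :=
  ∀ (U₀ : D.H) (T : ℝ), 0 < T →
    D.IsWeakSolution f h g γ P T U₀ (fun t => (S t.toNNReal U₀).1) (fun t => (S t.toNNReal U₀).2) ∧
    ∀ (Φ : ℝ → D.Hd) (Φt : ℝ → D.Hv), D.IsWeakSolution f h g γ P T U₀ Φ Φt →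
      ∀ᵐ t ∂volume.restrict (Ioo 0 T), S t.toNNReal U₀ = (Φ t, Φt t)

end BresseBeam

/-- A dynamical system (semiflow) is asymptotically smooth if every closed bounded positively
invariant set `B` is uniformly attracted by some compact set `K`. -/
def AsymptoticallySmooth {X : Type*} [PseudoMetricSpace X] (S : Flow ℝ≥0 X) : Prop :=
  ∀ B : Set X, IsClosed B → Bornology.IsBounded B → (∀ t, MapsTo (S t) B B) →
    ∃ K : Set X, IsCompact K ∧
      Tendsto (fun t => ⨆ y ∈ B, Metric.infEDist (S t y) K) atTop (𝓝 0)

/-- `u` is Lipschitz on every ball of `ℝ³`. -/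
def IsLocLipschitz (u : EuclideanSpace ℝ (Fin 3) → ℝ) : Prop :=
  ∀ K : ℝ, ∃ C : ℝ, ∀ a b, ‖a‖ ≤ K → ‖b‖ ≤ K → |u a - u b| ≤ C * ‖a - b‖

end

/-! The system has the form `Φ_tt + AΦ = P - Γ(Φ_t) - F(Φ)`, where `A` is the static operator of the
energy form. The energy space embeds compactly, injectively and densely into the weighted `L²`
space, so the energy form and the inertia form are diagonalised simultaneously. With the
displacement coordinates as real parts and the velocity coordinates as imaginary parts, the
conservative linear evolution multiplies the `n`-th coordinate by `exp(-i w_n t)`, which gives a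
group of isometries for the energy norm. Displacements of bounded energy are bounded functions, so
the feedbacks are Lipschitz on bounded sets. The total energy does not increase and is bounded below
up to the linear load term, so mild solutions are global. Weak and mild solutions coincide: mode by
mode the variational identity is a forced oscillator, solved by variation of constants. This yields
the semiflow and the uniqueness of weak solutions.

Asymptotic smoothness is a quasi-stability argument. Let `z` be the difference of two trajectories
in a bounded invariant set, `p z` the observed velocity `ψ_t` and `κ z` the displacement in the
weaker `L²` norm, which is a compact quantity. The damping is strongly monotone, so on `[0,T]` the
energy of `z` drops by a multiple of `∫‖p z‖²`, up to terms in `κ z`. If every free solution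
satisfies `‖w‖² ≤ C ∫ (‖p U_t w‖ + ‖κ U_t w‖)²`, comparison with the Duhamel formula gives the same
kind of bound for `‖z(0)‖²`. Hence `S_T` contracts distances up to a precompact remainder
(`IsMild.norm_sq_sub_le`), and iterating produces the attracting compact set
(`exists_attracting_compact_of_quasiContraction`).

The observability inequality comes from multipliers. They are applied to time-independent triples
(displacement, velocity, acceleration), and the time derivative of a bounded bilinear functional `J`
is kept as an explicit term (`IsControlled`). Inside the damped part, with a cut-off, one climbs
from `ψ_t` to `ψ_x`, then to the shear (here the equal wave speeds enter), then to `φ_t`, then to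
the axial strain and `ω_t` (here `k₁ = σ₁` and `l > 0` enter). The Rellich multiplier `q Φ_x`
removes the cut-off and then bounds the traces at `L₀`. The transmission conditions carry these
traces across the interface, and a Rellich multiplier vanishing at the clamped end `L` recovers the
energy of the undamped part. The result is `exists_static_observability`; integration over a time
longer than `2‖J‖` gives the required inequality, first for finitely many modes and then by density.
-/

section Spectral

-- Simultaneous diagonalisation of energy and inertia

universe u v

variable {E : Type u} {X : Type v} [NormedAddCommGroup E] [InnerProductSpace ℝ E] [CompleteSpace E]
  [NormedAddCommGroup X] [InnerProductSpace ℝ X] [CompleteSpace X]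

/-- A compact symmetric operator has a Hilbert basis of eigenvectors. -/
theorem exists_hilbertBasis_eigenvectors (T : X →L[ℝ] X) (hT : IsCompactOperator T)
    (hs : T.IsSymmetric) :
    ∃ (ι : Type v) (b : HilbertBasis ι ℝ X) (μ : ι → ℝ), ∀ n, T (b n) = μ n • b n := by
  classical
  have hortho := hs.orthogonalFamily_eigenspaces
  have hcl : ∀ μ : ℝ, IsClosed (Module.End.eigenspace (T : Module.End ℝ X) μ : Set X) := by
    intro μ
    have : (Module.End.eigenspace (T : Module.End ℝ X) μ : Set X) = {x | T x = μ • x} := by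
      ext x; simp
    rw [this]
    exact isClosed_eq T.continuous (continuous_const_smul μ)
  have hcomp : ∀ μ : ℝ, CompleteSpace (Module.End.eigenspace (T : Module.End ℝ X) μ) := fun μ =>
    (hcl μ).isComplete.completeSpace_coe
  -- The kernel is treated as the eigenspace for `0` and may be infinite dimensional, so Hilbert
  -- bases of the eigenspaces are collected rather than finite orthonormal families.
  choose w b hb using fun μ : ℝ =>
    exists_hilbertBasis ℝ (Module.End.eigenspace (T : Module.End ℝ X) μ)
  let v : (Σ μ : ℝ, w μ) → X := fun p => (b p.1 p.2 : X)
  have hv : Orthonormal ℝ v := hortho.orthonormal_sigma_orthonormal fun μ => (b μ).orthonormal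
  have htot : (Submodule.span ℝ (Set.range v))ᗮ = ⊥ := by
    rw [Submodule.eq_bot_iff]
    intro x hx
    have hx' : ∀ p, inner ℝ (v p) x = 0 := fun p =>
      (Submodule.mem_orthogonal _ _).1 hx _ (Submodule.subset_span ⟨p, rfl⟩)
    have : x ∈ (⨆ μ, Module.End.eigenspace (T : Module.End ℝ X) μ)ᗮ := by
      rw [← Submodule.iInf_orthogonal, Submodule.mem_iInf]
      intro μ
      rw [Submodule.mem_orthogonal]
      intro u hu
      have h2 := ((b μ).hasSum_repr ⟨u, hu⟩).mapL
        (Module.End.eigenspace (T : Module.End ℝ X) μ).subtypeL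
      have h3 := h2.mapL (innerSL ℝ x)
      have h4 : ∀ n, (innerSL ℝ x) ((Module.End.eigenspace (T : Module.End ℝ X) μ).subtypeL
          (((b μ).repr ⟨u, hu⟩) n • b μ n)) = 0 := by
        intro n
        have := hx' ⟨μ, n⟩
        rw [real_inner_comm] at this
        simp only [map_smul, Submodule.subtypeL_apply, innerSL_apply_apply, smul_eq_mul]
        simp only [v] at this
        rw [this, mul_zero]
      simp only [h4] at h3
      have h5 := h3.unique hasSum_zero
      rw [real_inner_comm]
      simpa using h5
    rw [ContinuousLinearMap.orthogonalComplement_iSup_eigenspaces_eq_bot hT hs] at this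
    simpa using this
  refine ⟨_, HilbertBasis.mkOfOrthogonalEqBot hv htot, fun p => p.1, fun p => ?_⟩
  rw [HilbertBasis.coe_mkOfOrthogonalEqBot]
  exact Module.End.mem_eigenspace_iff.1 (b p.1 p.2).2

/-- Distinct basis vectors are at distance `√2`, so the balls of radius `1/2` around them are
disjoint nonempty open sets. Countability is what allows one null set of times for all modes and the
exchange of mode sums with time integrals. -/
theorem HilbertBasis.countable_index {ι X : Type*} [NormedAddCommGroup X] [InnerProductSpace ℝ X]
    [SecondCountableTopology X]
    (b : HilbertBasis ι ℝ X) : Countable ι := by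
  have h : Pairwise fun m n => Disjoint (Metric.ball (b m) (1 / 2)) (Metric.ball (b n) (1 / 2)) := by
    intro m n hmn
    refine Metric.ball_disjoint_ball ?_
    have h1 : ‖b m - b n‖ ^ 2 = 2 := by
      rw [norm_sub_sq_real, b.orthonormal.1 m, b.orthonormal.1 n, b.orthonormal.2 hmn]; norm_num
    rw [dist_eq_norm]
    nlinarith [norm_nonneg (b m - b n)]
  exact h.countable_of_isOpen_disjoint (fun _ => Metric.isOpen_ball)
    (fun n => ⟨b n, Metric.mem_ball_self (by norm_num)⟩)

/-- Simultaneous diagonalization of the two inner products of a compact dense embedding. -/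
theorem exists_modes (i : E →L[ℝ] X) (hc : IsCompactOperator i) (hi : Function.Injective i)
    (hd : DenseRange i) :
    ∃ (ι : Type v) (b : HilbertBasis ι ℝ X) (e : HilbertBasis ι ℝ E) (w : ι → ℝ),
      (∀ n, 0 < w n) ∧ ∀ n, i (e n) = (w n)⁻¹ • b n := by
  -- An eigenbasis of `i i*` in `X` does both jobs: since `⟨i* b_m, i* b_n⟩ = μ_n ⟨b_m, b_n⟩`, the
  -- vectors `i* b_n` are automatically orthogonal in `E`.
  let T : X →L[ℝ] X := i ∘L i.adjoint
  have hTc : IsCompactOperator T := hc.comp_clm _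
  have hTs : T.IsSymmetric := by
    intro x y
    change inner ℝ (i (i.adjoint x)) y = inner ℝ x (i (i.adjoint y))
    rw [← ContinuousLinearMap.adjoint_inner_right, ContinuousLinearMap.adjoint_inner_left]
  obtain ⟨ι, b, μ, hμ⟩ := exists_hilbertBasis_eigenvectors T hTc hTs
  -- Density of the range of `i` makes the adjoint injective, hence every `μ_n` is positive;
  -- injectivity of `i` will make the family in `E` complete.
  have hinj : ∀ x, i.adjoint x = 0 → x = 0 := by
    intro x hx
    have : ∀ y ∈ Set.range i, inner ℝ x y = 0 := by
      rintro _ ⟨u, rfl⟩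
      rw [← ContinuousLinearMap.adjoint_inner_left, hx, inner_zero_left]
    exact hd.eq_zero_of_inner_left ℝ (fun y => this _ ⟨y, rfl⟩)
  have hin : ∀ m n, inner ℝ (i.adjoint (b m)) (i.adjoint (b n)) = μ n * inner ℝ (b m) (b n) := by
    intro m n
    rw [ContinuousLinearMap.adjoint_inner_left]
    have := hμ n
    simp only [T, ContinuousLinearMap.comp_apply] at this
    rw [this, inner_smul_right]
  have hpos : ∀ n, 0 < μ n := by
    intro n
    have h1 := hin n n
    rw [real_inner_self_eq_norm_sq, real_inner_self_eq_norm_sq, b.orthonormal.1 n] at h1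
    have h2 : i.adjoint (b n) ≠ 0 := fun h => by
      have := hinj _ h
      have h3 := b.orthonormal.1 n
      rw [this] at h3; simp at h3
    have h3 : 0 < ‖i.adjoint (b n)‖ := norm_pos_iff.2 h2
    nlinarith
  let v : ι → E := fun n => (√(μ n))⁻¹ • i.adjoint (b n)
  have hv : Orthonormal ℝ v := by
    classical
    rw [orthonormal_iff_ite]
    intro m n
    simp only [v, inner_smul_left, inner_smul_right, hin,
      orthonormal_iff_ite.1 b.orthonormal m n]
    split_ifs with h
    · subst h
      have := Real.mul_self_sqrt (hpos m).le
      have h' := (Real.sqrt_pos.2 (hpos m)).ne'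
      simp only [RCLike.conj_to_real, mul_one]
      field_simp
      nlinarith
    · simp
  have htot : (Submodule.span ℝ (Set.range v))ᗮ = ⊥ := by
    rw [Submodule.eq_bot_iff]
    intro x hx
    have hx' : ∀ n, inner ℝ (b n) (i x) = 0 := by
      intro n
      have := (Submodule.mem_orthogonal _ _).1 hx _ (Submodule.subset_span ⟨n, rfl⟩)
      simp only [v, inner_smul_left, RCLike.conj_to_real, ContinuousLinearMap.adjoint_inner_left,
        mul_eq_zero, inv_eq_zero] at this
      exact this.resolve_left (Real.sqrt_pos.2 (hpos n)).ne'
    have h2 : i x = 0 := by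
      have h3 := b.hasSum_repr (i x)
      simp only [b.repr_apply_apply, hx', zero_smul] at h3
      exact h3.unique hasSum_zero
    exact hi (by rw [h2, map_zero])
  -- The frequency is `w_n = μ_n^{-1/2}`: normalising `i* b_n` divides by `√μ_n`, while `i i* b_n =
  -- μ_n b_n`, so `i e_n = √μ_n b_n`.
  refine ⟨ι, b, HilbertBasis.mkOfOrthogonalEqBot hv htot, fun n => (√(μ n))⁻¹,
    fun n => inv_pos.2 (Real.sqrt_pos.2 (hpos n)), fun n => ?_⟩
  rw [HilbertBasis.coe_mkOfOrthogonalEqBot]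
  have := hμ n
  simp only [T, ContinuousLinearMap.comp_apply] at this
  simp only [v, map_smul, this, inv_inv, smul_smul]
  congr 1
  have h1 := Real.mul_self_sqrt (hpos n).le
  have h' := (Real.sqrt_pos.2 (hpos n)).ne'
  field_simp
  nlinarith

end Spectral

/-! ### Modal phase space and the free evolution -/

noncomputable section

/-- Phase space of a second order system in modal coordinates: real parts are the coordinates of the
displacement, imaginary parts those of the velocity. -/
abbrev Phase (ι : Type*) : Type _ := lp (fun _ : ι => ℂ) 2

namespace Phase

variable {ι : Type*}

/-- Apply nonexpansive linear maps in every mode. -/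
def fiberMap {G : Type*} [NormedAddCommGroup G] [NormedSpace ℝ G] (A : ι → ℂ →ₗ[ℝ] G)
    (hA : ∀ n x, ‖A n x‖ ≤ ‖x‖) : Phase ι →ₗ[ℝ] lp (fun _ : ι => G) 2 where
  toFun z := ⟨fun n => A n (z n), (lp.memℓp z).mono' fun n => hA n (z n)⟩
  map_add' x y := by ext n; simp; rfl
  map_smul' c x := by ext n; exact map_smul (A n) c (x n)

@[simp] theorem fiberMap_apply {G : Type*} [NormedAddCommGroup G] [NormedSpace ℝ G]
    (A : ι → ℂ →ₗ[ℝ] G) (hA : ∀ n x, ‖A n x‖ ≤ ‖x‖) (z : Phase ι) (n : ι) :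
    fiberMap A hA z n = A n (z n) := rfl

theorem norm_le_norm {G G' : Type*} [NormedAddCommGroup G] [NormedAddCommGroup G']
    {x : lp (fun _ : ι => G) 2} {y : lp (fun _ : ι => G') 2} (h : ∀ n, ‖x n‖ ≤ ‖y n‖) :
    ‖x‖ ≤ ‖y‖ :=
  lp.norm_mono (by norm_num) h

/-- The free evolution. -/
def rot (w : ι → ℝ) (t : ℝ) : Phase ι →ₗᵢ[ℝ] Phase ι where
  toLinearMap := fiberMap
    (fun n => LinearMap.mulLeft ℝ (Complex.exp (((-(w n * t) : ℝ) : ℂ) * Complex.I)))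
    (fun n x => by rw [LinearMap.mulLeft_apply, norm_mul, Complex.norm_exp_ofReal_mul_I, one_mul])
  norm_map' z := by
    refine le_antisymm (norm_le_norm fun n => ?_) (norm_le_norm fun n => ?_) <;>
    rw [fiberMap_apply, LinearMap.mulLeft_apply, norm_mul, Complex.norm_exp_ofReal_mul_I, one_mul]

theorem rot_apply (w : ι → ℝ) (t : ℝ) (z : Phase ι) (n : ι) :
    rot w t z n = Complex.exp (((-(w n * t) : ℝ) : ℂ) * Complex.I) * z n := rfl

theorem rot_zero (w : ι → ℝ) (z : Phase ι) : rot w 0 z = z := by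
  ext n; simp [rot_apply]

theorem rot_add (w : ι → ℝ) (s t : ℝ) (z : Phase ι) : rot w (s + t) z = rot w s (rot w t z) := by
  ext n
  rw [rot_apply, rot_apply, rot_apply, ← mul_assoc, ← Complex.exp_add]
  congr 2; push_cast; ring

/-- The frequencies may be unbounded, so only strong continuity can be expected. Truncating to
finitely many modes changes the orbit by an amount independent of `t`, because the rotations are
isometries; the orbit is therefore a uniform limit of continuous curves. -/
theorem continuous_rot (w : ι → ℝ) (z : Phase ι) : Continuous fun t => rot w t z := by
  classical
  have hz := lp.hasSum_single (p := 2) (by norm_num) z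
  have hunif : TendstoUniformly
      (fun (s : Finset ι) t => rot w t (∑ n ∈ s, lp.single 2 n (z n))) (fun t => rot w t z) atTop := by
    rw [Metric.tendstoUniformly_iff]
    intro ε hε
    filter_upwards [Metric.tendsto_nhds.1 hz ε hε] with s hs t
    rw [(rot w t).dist_map, dist_comm]; exact hs
  refine hunif.continuous (Frequently.of_forall fun s => ?_)
  simp only [map_sum]
  refine continuous_finsetSum _ fun n _ => ?_
  have : (fun t => rot w t (lp.single 2 n (z n))) = fun t =>
      lp.single (E := fun _ : ι => ℂ) 2 n
        (Complex.exp (((-(w n * t) : ℝ) : ℂ) * Complex.I) * z n) := by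
    funext t; ext m
    rw [rot_apply, lp.single_apply, lp.single_apply]
    by_cases h : m = n
    · subst h; simp
    · simp [Pi.single_eq_of_ne h]
  rw [this]
  exact (lp.isometry_single n).continuous.comp (by fun_prop)

theorem norm_rot_sub_self_apply (w : ι → ℝ) (t : ℝ) (z : Phase ι) (n : ι) :
    ‖rot w t z n - z n‖ ≤ |w n| * |t| * ‖z n‖ := by
  rw [rot_apply, ← sub_one_mul, norm_mul]
  refine mul_le_mul_of_nonneg_right ?_ (norm_nonneg _)
  have h := Real.norm_exp_I_mul_ofReal_sub_one_le (x := -(w n * t))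
  rw [mul_comm] at h
  simpa [abs_mul] using h

variable {E X : Type*} [NormedAddCommGroup E] [InnerProductSpace ℝ E]
  [NormedAddCommGroup X] [InnerProductSpace ℝ X]

/-- The displacement with given modal coordinates. -/
def displ (e : HilbertBasis ι ℝ E) : Phase ι →L[ℝ] E :=
  LinearMap.mkContinuous (e.repr.symm.toLinearEquiv.toLinearMap ∘ₗ
    fiberMap (fun _ => Complex.reLm) (fun _ x => Complex.abs_re_le_norm x)) 1 fun z => by
      simp only [LinearMap.comp_apply, one_mul]
      refine (e.repr.symm.norm_map _).trans_le (norm_le_norm fun n => ?_)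
      exact Complex.abs_re_le_norm (z n)

/-- The velocity with given modal coordinates. -/
def veloc (b : HilbertBasis ι ℝ X) : Phase ι →L[ℝ] X :=
  LinearMap.mkContinuous (b.repr.symm.toLinearEquiv.toLinearMap ∘ₗ
    fiberMap (fun _ => Complex.imLm) (fun _ x => Complex.abs_im_le_norm x)) 1 fun z => by
      simp only [LinearMap.comp_apply, one_mul]
      refine (b.repr.symm.norm_map _).trans_le (norm_le_norm fun n => ?_)
      exact Complex.abs_im_le_norm (z n)

theorem inner_displ (e : HilbertBasis ι ℝ E) (z : Phase ι) (n : ι) :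
    inner ℝ (e n) (displ e z) = (z n).re := by
  rw [← e.repr_apply_apply]
  change e.repr (e.repr.symm _) n = _
  rw [LinearIsometryEquiv.apply_symm_apply]
  rfl

theorem inner_veloc (b : HilbertBasis ι ℝ X) (z : Phase ι) (n : ι) :
    inner ℝ (b n) (veloc b z) = (z n).im := by
  rw [← b.repr_apply_apply]
  change b.repr (b.repr.symm _) n = _
  rw [LinearIsometryEquiv.apply_symm_apply]
  rfl

theorem _root_.HilbertBasis.ext_inner (b : HilbertBasis ι ℝ X) {x y : X}
    (h : ∀ n, inner ℝ (b n) x = inner ℝ (b n) y) : x = y := by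
  apply b.repr.injective
  ext n
  rw [b.repr_apply_apply, b.repr_apply_apply, h]

theorem memℓp_coords (e : HilbertBasis ι ℝ E) (b : HilbertBasis ι ℝ X) (Φ : E) (V : X) :
    Memℓp (fun n => (⟨inner ℝ (e n) Φ, inner ℝ (b n) V⟩ : ℂ)) 2 := by
  have h1 : Memℓp (fun n => ‖inner ℝ (e n) Φ‖) 2 := memℓp_norm_iff.2 <| by
    rw [show (fun n => inner ℝ (e n) Φ) = ⇑(e.repr Φ) from
      funext fun n => (e.repr_apply_apply Φ n).symm]
    exact lp.memℓp (e.repr Φ)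
  have h2 : Memℓp (fun n => ‖inner ℝ (b n) V‖) 2 := memℓp_norm_iff.2 <| by
    rw [show (fun n => inner ℝ (b n) V) = ⇑(b.repr V) from
      funext fun n => (b.repr_apply_apply V n).symm]
    exact lp.memℓp (b.repr V)
  exact (h1.add h2).mono fun n => Complex.norm_le_abs_re_add_abs_im _

/-- Modal coordinates of a displacement and a velocity. -/
def mk (e : HilbertBasis ι ℝ E) (b : HilbertBasis ι ℝ X) : E × X →ₗ[ℝ] Phase ι where
  toFun p := ⟨fun n => ⟨inner ℝ (e n) p.1, inner ℝ (b n) p.2⟩, memℓp_coords e b p.1 p.2⟩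
  map_add' p q := by
    ext n
    exact Complex.ext (inner_add_right _ _ _) (inner_add_right _ _ _)
  map_smul' c p := by
    ext n
    rw [lp.coeFn_smul, Pi.smul_apply]
    refine Complex.ext ?_ ?_
    · rw [Complex.smul_re]; exact inner_smul_right _ _ _
    · rw [Complex.smul_im]; exact inner_smul_right _ _ _

theorem mk_re (e : HilbertBasis ι ℝ E) (b : HilbertBasis ι ℝ X) (p : E × X) (n : ι) :
    (mk e b p n).re = inner ℝ (e n) p.1 := rfl

theorem mk_im (e : HilbertBasis ι ℝ E) (b : HilbertBasis ι ℝ X) (p : E × X) (n : ι) :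
    (mk e b p n).im = inner ℝ (b n) p.2 := rfl

@[simp] theorem displ_mk (e : HilbertBasis ι ℝ E) (b : HilbertBasis ι ℝ X) (p : E × X) :
    displ e (mk e b p) = p.1 :=
  e.ext_inner fun n => by rw [inner_displ, mk_re]

@[simp] theorem veloc_mk (e : HilbertBasis ι ℝ E) (b : HilbertBasis ι ℝ X) (p : E × X) :
    veloc b (mk e b p) = p.2 :=
  b.ext_inner fun n => by rw [inner_veloc, mk_im]

@[simp] theorem mk_displ_veloc (e : HilbertBasis ι ℝ E) (b : HilbertBasis ι ℝ X) (z : Phase ι) :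
    mk e b (displ e z, veloc b z) = z := by
  ext n
  apply Complex.ext
  · rw [mk_re, inner_displ]
  · rw [mk_im, inner_veloc]

/-- Parseval in both bases. The complex `ℓ²` norm is thus twice the conservative energy, which is
why the free evolution is isometric and the energy identity takes a simple form. -/
theorem inner_eq (e : HilbertBasis ι ℝ E) (b : HilbertBasis ι ℝ X) (z z' : Phase ι) :
    inner ℝ z z' = inner ℝ (displ e z) (displ e z') + inner ℝ (veloc b z) (veloc b z') := by
  have h1 := e.hasSum_inner_mul_inner (displ e z) (displ e z')
  have h2 := b.hasSum_inner_mul_inner (veloc b z) (veloc b z')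
  have h3 := lp.hasSum_inner (𝕜 := ℝ) z z'
  refine h3.unique ?_
  convert h1.add h2 using 1
  funext n
  rw [real_inner_comm (e n) (displ e z), inner_displ, inner_displ, real_inner_comm (b n) (veloc b z),
    inner_veloc, inner_veloc, Complex.inner]
  simp [Complex.mul_re]
  ring

theorem norm_sq_eq (e : HilbertBasis ι ℝ E) (b : HilbertBasis ι ℝ X) (z : Phase ι) :
    ‖z‖ ^ 2 = ‖displ e z‖ ^ 2 + ‖veloc b z‖ ^ 2 := by
  rw [← real_inner_self_eq_norm_sq, inner_eq e b, real_inner_self_eq_norm_sq,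
    real_inner_self_eq_norm_sq]

theorem norm_displ_le (e : HilbertBasis ι ℝ E) (z : Phase ι) : ‖displ e z‖ ≤ ‖z‖ :=
  (LinearMap.mkContinuous_norm_le _ zero_le_one _ |> (displ e).le_of_opNorm_le) z |>.trans_eq
    (one_mul _)

theorem norm_veloc_le (b : HilbertBasis ι ℝ X) (z : Phase ι) : ‖veloc b z‖ ≤ ‖z‖ :=
  (LinearMap.mkContinuous_norm_le _ zero_le_one _ |> (veloc b).le_of_opNorm_le) z |>.trans_eq
    (one_mul _)

/-- The phase space is isomorphic to the space of displacements and velocities. -/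
def equivProd (e : HilbertBasis ι ℝ E) (b : HilbertBasis ι ℝ X) : Phase ι ≃L[ℝ] E × X where
  toFun z := (displ e z, veloc b z)
  invFun := mk e b
  map_add' := by simp
  map_smul' := by simp
  left_inv z := mk_displ_veloc e b z
  right_inv p := by simp
  continuous_toFun := (displ e).continuous.prodMk (veloc b).continuous
  continuous_invFun := by
    refine (LinearMap.mkContinuous (mk e b) 2 fun p => ?_).continuous
    have h := norm_sq_eq e b (mk e b p)
    rw [displ_mk, veloc_mk] at h
    have h1 := norm_fst_le p
    have h2 := norm_snd_le p
    have := norm_nonneg p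
    refine abs_le_of_sq_le_sq' ?_ (by positivity) |>.2
    nlinarith [norm_nonneg p.1, norm_nonneg p.2]

/-- Modal coordinates of the embedding. -/
theorem inner_embedding {e : HilbertBasis ι ℝ E} {b : HilbertBasis ι ℝ X} {w : ι → ℝ}
    {i : E →L[ℝ] X} (hi : ∀ n, i (e n) = (w n)⁻¹ • b n) (Φ : E) (n : ι) :
    inner ℝ (b n) (i Φ) = (w n)⁻¹ * inner ℝ (e n) Φ := by
  classical
  have h := ((e.hasSum_repr Φ).mapL i).mapL (innerSL ℝ (b n))
  have h2 : ∀ m, (innerSL ℝ (b n)) (i (e.repr Φ m • e m)) =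
      if m = n then (w n)⁻¹ * inner ℝ (e n) Φ else 0 := by
    intro m
    simp only [map_smul, hi, innerSL_apply_apply, smul_eq_mul, e.repr_apply_apply,
      orthonormal_iff_ite.1 b.orthonormal n m]
    by_cases hmn : m = n
    · subst hmn; simp; ring
    · simp [hmn, Ne.symm hmn]
  simp only [h2] at h
  exact h.unique (hasSum_ite_eq n _)

/-- The embedded displacement is Lipschitz in time along the free evolution. -/
theorem norm_embedding_rot_sub_le {e : HilbertBasis ι ℝ E} {b : HilbertBasis ι ℝ X} {w : ι → ℝ}
    (hw : ∀ n, 0 < w n) {i : E →L[ℝ] X} (hi : ∀ n, i (e n) = (w n)⁻¹ • b n) (t : ℝ) (z : Phase ι) :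
    ‖i (displ e (rot w t z - z))‖ ≤ |t| * ‖z‖ := by
  rw [← b.repr.norm_map]
  have h : ‖b.repr (i (displ e (rot w t z - z)))‖ ≤ ‖t • z‖ := by
    refine norm_le_norm fun n => ?_
    rw [b.repr_apply_apply, inner_embedding hi, inner_displ, norm_mul, Real.norm_eq_abs,
      abs_of_pos (inv_pos.2 (hw n))]
    -- The increment of a rotating mode costs a factor `w_n |t|`; the embedding contributes `w_n⁻¹`,
    -- so the bound is uniform in the mode.
    have h1 := norm_rot_sub_self_apply w t z n
    rw [abs_of_pos (hw n)] at h1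
    have h2 := Complex.abs_re_le_norm (rot w t z n - z n)
    have h3 : ‖(t • z) n‖ = |t| * ‖z n‖ := by
      rw [lp.coeFn_smul, Pi.smul_apply, norm_smul, Real.norm_eq_abs]
    rw [h3, inv_mul_le_iff₀ (hw n), ← mul_assoc]
    exact h2.trans h1
  rwa [norm_smul, Real.norm_eq_abs] at h

/-- Modal equations of a curve whose pull-back under the free evolution is differentiable. -/
theorem hasDerivWithinAt_rot_apply (w : ι → ℝ) {y : ℝ → Phase ι} {y' : Phase ι} {s : Set ℝ} {t : ℝ}
    (hy : HasDerivWithinAt y y' s t) (n : ι) :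
    HasDerivWithinAt (fun t => rot w t (y t) n)
      (-(w n * Complex.I) * rot w t (y t) n + rot w t y' n) s t := by
  -- The product rule is used in a single coordinate, where the generator acts as the number `-i
  -- w_n`; in the whole space it may be unbounded.
  have h1 : HasDerivWithinAt (fun t => y t n) (y' n) s t :=
    (lp.evalCLM ℝ (fun _ : ι => ℂ) (p := 2) n).hasFDerivAt.comp_hasDerivWithinAt t hy
  have h2 : HasDerivWithinAt (fun t : ℝ => Complex.exp (((-(w n * t) : ℝ) : ℂ) * Complex.I))
      (Complex.exp (((-(w n * t) : ℝ) : ℂ) * Complex.I) * (-(w n * Complex.I))) s t := by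
    refine HasDerivWithinAt.cexp ?_
    have : HasDerivWithinAt (fun t : ℝ => ((-(w n * t) : ℝ) : ℂ)) ((-(w n) : ℝ) : ℂ) s t := by
      refine HasDerivWithinAt.ofReal_comp ?_
      have := ((hasDerivWithinAt_id t s).const_mul (w n)).neg
      rw [mul_one] at this
      exact this
    exact (this.mul_const Complex.I).congr_deriv (by push_cast; ring)
  simp only [rot_apply]
  exact (h2.mul h1).congr_deriv (by ring)

end Phase
end

/-! ### Radial truncation, global Picard iteration and isometric groups -/

noncomputable section

section RadialRetraction

variable {V : Type*} [NormedAddCommGroup V] [NormedSpace ℝ V]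

/-- Radial retraction onto the ball of radius `R`. -/
def radialRetraction (R : ℝ) (x : V) : V := (R / max R ‖x‖) • x

theorem radialRetraction_of_norm_le {R : ℝ} (hR : 0 < R) {x : V} (hx : ‖x‖ ≤ R) :
    radialRetraction R x = x := by
  rw [radialRetraction, max_eq_left hx, div_self hR.ne', one_smul]

theorem norm_radialRetraction_le {R : ℝ} (hR : 0 < R) (x : V) : ‖radialRetraction R x‖ ≤ R := by
  have h1 : 0 < max R ‖x‖ := lt_max_of_lt_left hR
  rw [radialRetraction, norm_smul, Real.norm_eq_abs, abs_of_pos (div_pos hR h1), div_mul_eq_mul_div,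
    div_le_iff₀ h1]
  exact mul_le_mul_of_nonneg_left (le_max_right _ _) hR.le

/-- Valid in every normed space: the difference splits into a contracted `x - y` and a change of the
scaling factor, and each of the two contributes at most `‖x - y‖`. The constant is irrelevant, only
some global Lipschitz bound is needed. -/
theorem lipschitzWith_radialRetraction {R : ℝ} (hR : 0 < R) :
    LipschitzWith 2 (radialRetraction R : V → V) := by
  refine LipschitzWith.of_dist_le_mul fun x y => ?_
  rw [dist_eq_norm, dist_eq_norm]
  have ha : 0 < max R ‖x‖ := lt_max_of_lt_left hR
  have hb : 0 < max R ‖y‖ := lt_max_of_lt_left hR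
  have h1 : radialRetraction R x - radialRetraction R y =
      (R / max R ‖x‖) • (x - y) + ((R / max R ‖x‖) - (R / max R ‖y‖)) • y := by
    simp only [radialRetraction, smul_sub, sub_smul]; abel
  have h2 : ‖(R / max R ‖x‖) • (x - y)‖ ≤ ‖x - y‖ := by
    rw [norm_smul, Real.norm_eq_abs, abs_of_pos (div_pos hR ha)]
    exact mul_le_of_le_one_left (norm_nonneg _) ((div_le_one ha).2 (le_max_left _ _))
  have h3 : ‖((R / max R ‖x‖) - (R / max R ‖y‖)) • y‖ ≤ ‖x - y‖ := by
    have h4 : |max R ‖y‖ - max R ‖x‖| ≤ ‖x - y‖ := by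
      rw [max_comm R, max_comm R]
      refine (abs_max_sub_max_le_abs _ _ _).trans ?_
      rw [norm_sub_rev]
      exact abs_norm_sub_norm_le _ _
    have h5 : R / max R ‖x‖ - R / max R ‖y‖ =
        (R / max R ‖x‖) * ((max R ‖y‖ - max R ‖x‖) / max R ‖y‖) := by
      field_simp
    rw [norm_smul, h5, norm_mul, Real.norm_eq_abs, Real.norm_eq_abs, abs_of_pos (div_pos hR ha),
      abs_div, abs_of_pos hb, mul_assoc]
    refine (mul_le_of_le_one_left (by positivity) ((div_le_one ha).2 (le_max_left _ _))).trans ?_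
    rw [div_mul_eq_mul_div, div_le_iff₀ hb]
    exact mul_le_mul h4 (le_max_right _ _) (norm_nonneg _) (norm_nonneg _)
  rw [h1]
  refine (norm_add_le _ _).trans ?_
  norm_num
  linarith

end RadialRetraction

section GlobalODE

variable {V : Type*} [NormedAddCommGroup V] [NormedSpace ℝ V] [CompleteSpace V]

theorem intervalIntegral_exp_mul_le {r : ℝ} (hr : 0 < r) {C t : ℝ} (hC : 0 ≤ C) :
    ∫ s in (0 : ℝ)..t, C * Real.exp (r * s) ≤ C / r * Real.exp (r * t) := by
  have h : ∀ s ∈ uIcc 0 t, HasDerivAt (fun s => C / r * Real.exp (r * s))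
      (C * Real.exp (r * s)) s := by
    intro s _
    have := ((hasDerivAt_id s).const_mul r).exp.const_mul (C / r)
    refine this.congr_deriv ?_
    simp only [id]
    field_simp
  rw [intervalIntegral.integral_eq_sub_of_hasDerivAt h
    (Continuous.intervalIntegrable (by fun_prop) _ _)]
  have : 0 ≤ C / r * Real.exp (r * 0) := by positivity
  linarith

/-- Global solvability of `y' = G(t, y)` for `G` globally Lipschitz in `y`. -/
theorem exists_global_integral_solution {G : ℝ → V → V} (hG : Continuous (Function.uncurry G))
    {K : ℝ≥0} (hK : ∀ t, LipschitzWith K (G t)) {C : ℝ} (hC : ∀ t, ‖G t 0‖ ≤ C) (y₀ : V) :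
    ∃ y : ℝ → V, Continuous y ∧ ∀ t, 0 ≤ t → y t = y₀ + ∫ s in (0 : ℝ)..t, G s (y s) := by
  have hC0 : 0 ≤ C := (norm_nonneg _).trans (hC 0)
  -- Exponentially weighted norm: for the unknown `u = exp(-r t) y` the Picard map has Lipschitz
  -- constant `K / r = K / (K + 1) < 1`, so one fixed point gives the solution for all positive
  -- times.
  let r : ℝ := K + 1
  have hr : 0 < r := by positivity
  have hgc : ∀ u : BoundedContinuousFunction ℝ V,
      Continuous fun s => G s (Real.exp (r * s) • u s) := fun u =>
    hG.comp (continuous_id.prodMk ((by fun_prop : Continuous fun s : ℝ => Real.exp (r * s)).smul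
      u.continuous))
  have hgb : ∀ (u : BoundedContinuousFunction ℝ V) (s : ℝ), 0 ≤ s →
      ‖G s (Real.exp (r * s) • u s)‖ ≤ (C + K * ‖u‖) * Real.exp (r * s) := by
    intro u s hs
    have h1 := (hK s).norm_sub_le (Real.exp (r * s) • u s) 0
    rw [sub_zero, norm_smul, Real.norm_eq_abs, abs_of_pos (Real.exp_pos _)] at h1
    have h2 := norm_le_insert' (G s (Real.exp (r * s) • u s)) (G s 0)
    have h3 : (1 : ℝ) ≤ Real.exp (r * s) := Real.one_le_exp (by positivity)
    have h4 : C ≤ C * Real.exp (r * s) := le_mul_of_one_le_right hC0 h3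
    have h5 : (K : ℝ) * (Real.exp (r * s) * ‖u s‖) ≤ K * ‖u‖ * Real.exp (r * s) := by
      have := u.norm_coe_le_norm s
      rw [mul_assoc, mul_comm (Real.exp _)]
      gcongr
    have := hC s
    nlinarith
  have hprim : ∀ u : BoundedContinuousFunction ℝ V,
      Continuous fun t => ∫ s in (0 : ℝ)..t, G s (Real.exp (r * s) • u s) := fun u =>
    intervalIntegral.continuous_primitive (fun a b => (hgc u).intervalIntegrable a b) 0
  let T : BoundedContinuousFunction ℝ V → BoundedContinuousFunction ℝ V := fun u =>
    BoundedContinuousFunction.ofNormedAddCommGroup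
      -- Replacing `t` by `max t 0` makes the image constant for negative times, so that it is a
      -- bounded function on the whole line.
      (fun t => Real.exp (-(r * max t 0)) •
        (y₀ + ∫ s in (0 : ℝ)..(max t 0), G s (Real.exp (r * s) • u s)))
      ((by fun_prop : Continuous fun t : ℝ => Real.exp (-(r * max t 0))).smul
        (continuous_const.add ((hprim u).comp (continuous_id.max continuous_const))))
      (‖y₀‖ + (C + K * ‖u‖) / r) (by
        intro t
        have ht : 0 ≤ max t 0 := le_max_right _ _
        rw [norm_smul, Real.norm_eq_abs, abs_of_pos (Real.exp_pos _)]
        have h1 : ‖∫ s in (0 : ℝ)..(max t 0), G s (Real.exp (r * s) • u s)‖ ≤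
            (C + K * ‖u‖) / r * Real.exp (r * max t 0) := by
          refine (intervalIntegral.norm_integral_le_of_norm_le ht ?_
            (Continuous.intervalIntegrable (by fun_prop) _ _)).trans
            (intervalIntegral_exp_mul_le hr (by positivity))
          exact ae_of_all _ fun s hs => hgb u s hs.1.le
        have h2 := norm_add_le y₀ (∫ s in (0 : ℝ)..(max t 0), G s (Real.exp (r * s) • u s))
        have h3 : Real.exp (-(r * max t 0)) ≤ 1 := Real.exp_le_one_iff.2 (by
          have := mul_nonneg hr.le ht; linarith)
        have h4 : Real.exp (-(r * max t 0)) * Real.exp (r * max t 0) = 1 := by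
          rw [← Real.exp_add]; simp
        calc _ ≤ Real.exp (-(r * max t 0)) *
              (‖y₀‖ + (C + K * ‖u‖) / r * Real.exp (r * max t 0)) := by gcongr; linarith
          _ = Real.exp (-(r * max t 0)) * ‖y₀‖ + (C + K * ‖u‖) / r := by
              linear_combination ((C + K * ‖u‖) / r) * h4
          _ ≤ _ := by
              have := mul_le_of_le_one_left (norm_nonneg y₀) h3
              linarith)
  have hT : ∀ u t, T u t = Real.exp (-(r * max t 0)) •
        (y₀ + ∫ s in (0 : ℝ)..(max t 0), G s (Real.exp (r * s) • u s)) := fun u t => rfl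
  have hcontr : ContractingWith (K / (K + 1)) T := by
    refine ⟨by rw [div_lt_one (by positivity)]; exact lt_add_one K, ?_⟩
    refine LipschitzWith.of_dist_le_mul fun u v => ?_
    rw [BoundedContinuousFunction.dist_le (by positivity)]
    intro t
    have ht : 0 ≤ max t 0 := le_max_right _ _
    rw [hT, hT, dist_eq_norm, ← smul_sub, add_sub_add_left_eq_sub,
      ← intervalIntegral.integral_sub ((hgc u).intervalIntegrable _ _)
        ((hgc v).intervalIntegrable _ _), norm_smul, Real.norm_eq_abs, abs_of_pos (Real.exp_pos _)]
    have h1 : ‖∫ s in (0 : ℝ)..(max t 0), (G s (Real.exp (r * s) • u s) -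
        G s (Real.exp (r * s) • v s))‖ ≤ (K * dist u v) / r * Real.exp (r * max t 0) := by
      refine (intervalIntegral.norm_integral_le_of_norm_le ht ?_
        (Continuous.intervalIntegrable (by fun_prop) _ _)).trans
        (intervalIntegral_exp_mul_le hr (by positivity))
      refine ae_of_all _ fun s hs => ?_
      have h2 := (hK s).norm_sub_le (Real.exp (r * s) • u s) (Real.exp (r * s) • v s)
      rw [← smul_sub, norm_smul, Real.norm_eq_abs, abs_of_pos (Real.exp_pos _)] at h2
      have h3 := BoundedContinuousFunction.dist_coe_le_dist (f := u) (g := v) s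
      rw [dist_eq_norm] at h3
      calc _ ≤ _ := h2
        _ ≤ K * (Real.exp (r * s) * dist u v) := by gcongr
        _ = _ := by ring
    have h4 : Real.exp (-(r * max t 0)) * Real.exp (r * max t 0) = 1 := by
      rw [← Real.exp_add]; simp
    calc _ ≤ Real.exp (-(r * max t 0)) * ((K * dist u v) / r * Real.exp (r * max t 0)) := by gcongr
      _ = (K * dist u v) / r := by linear_combination ((K * dist u v) / r) * h4
      _ = _ := by push_cast; ring
  let u := hcontr.fixedPoint
  have hu : T u = u := hcontr.fixedPoint_isFixedPt
  refine ⟨fun t => Real.exp (r * t) • u t,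
    (by fun_prop : Continuous fun t : ℝ => Real.exp (r * t)).smul u.continuous, fun t ht => ?_⟩
  have h1 := hT u t
  rw [hu, max_eq_left ht] at h1
  simp only
  rw [h1, smul_smul, ← Real.exp_add]
  simp

end GlobalODE

/-- A strongly continuous one-parameter group of linear isometries. -/
structure IsIsometricGroup {V : Type*} [NormedAddCommGroup V] [NormedSpace ℝ V]
    (U : ℝ → V →ₗᵢ[ℝ] V) : Prop where
  zero : ∀ z, U 0 z = z
  add : ∀ s t z, U (s + t) z = U s (U t z)
  cont : ∀ z, Continuous fun t => U t z

namespace IsIsometricGroup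

variable {V : Type*} [NormedAddCommGroup V] [NormedSpace ℝ V] {U : ℝ → V →ₗᵢ[ℝ] V}

theorem neg_apply (hU : IsIsometricGroup U) (t : ℝ) (z : V) : U (-t) (U t z) = z := by
  rw [← hU.add, neg_add_cancel, hU.zero]

theorem apply_neg (hU : IsIsometricGroup U) (t : ℝ) (z : V) : U t (U (-t) z) = z := by
  rw [← hU.add, add_neg_cancel, hU.zero]

/-- Strong continuity upgrades to joint continuity because isometries are equicontinuous. -/
theorem continuous_uncurry (hU : IsIsometricGroup U) : Continuous fun p : ℝ × V => U p.1 p.2 := by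
  rw [continuous_iff_continuousAt]
  rintro ⟨t, z⟩
  rw [ContinuousAt, tendsto_iff_dist_tendsto_zero]
  have h1 : Tendsto (fun p : ℝ × V => dist p.2 z + dist (U p.1 z) (U t z)) (𝓝 (t, z)) (𝓝 0) := by
    have h2 : Continuous fun p : ℝ × V => dist p.2 z + dist (U p.1 z) (U t z) :=
      (continuous_snd.dist continuous_const).add
        (((hU.cont z).comp continuous_fst).dist continuous_const)
    simpa using h2.tendsto (t, z)
  refine squeeze_zero (fun _ => dist_nonneg) (fun p => ?_) h1
  refine (dist_triangle _ (U p.1 z) _).trans ?_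
  rw [(U p.1).dist_map]

theorem continuousOn_apply (hU : IsIsometricGroup U) {τ : ℝ → ℝ} {g : ℝ → V} {s : Set ℝ}
    (hτ : ContinuousOn τ s) (hg : ContinuousOn g s) : ContinuousOn (fun t => U (τ t) (g t)) s :=
  hU.continuous_uncurry.comp_continuousOn (hτ.prodMk hg)

end IsIsometricGroup

end

/-! ### Mild solutions and their semiflow -/

noncomputable section

set_option linter.unusedSectionVars false

section Duhamel

variable {V : Type*} [NormedAddCommGroup V] [InnerProductSpace ℝ V] [CompleteSpace V]
  {U : ℝ → V →ₗᵢ[ℝ] V}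

/-- On `[0,T]`, `z` is the mild solution of the linear equation with forcing `g`. -/
structure IsDuhamel (U : ℝ → V →ₗᵢ[ℝ] V) (T : ℝ) (g z : ℝ → V) : Prop where
  cont : ContinuousOn g (Icc 0 T)
  eq : ∀ t ∈ Icc 0 T, z t = U t (z 0 + ∫ s in (0 : ℝ)..t, U (-s) (g s))

namespace IsDuhamel

variable {T : ℝ} {g g' z z' : ℝ → V}

theorem continuousOn_pullback (hU : IsIsometricGroup U) (h : IsDuhamel U T g z) :
    ContinuousOn (fun s => U (-s) (g s)) (Icc 0 T) :=
  hU.continuousOn_apply continuousOn_neg h.cont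

theorem intervalIntegrable (hU : IsIsometricGroup U) (h : IsDuhamel U T g z) {t : ℝ}
    (ht : t ∈ Icc 0 T) : IntervalIntegrable (fun s => U (-s) (g s)) volume 0 t :=
  ((h.continuousOn_pullback hU).mono (by rw [uIcc_of_le ht.1]; exact Icc_subset_Icc_right ht.2)
    ).intervalIntegrable

theorem sub (hU : IsIsometricGroup U) (h : IsDuhamel U T g z) (h' : IsDuhamel U T g' z') :
    IsDuhamel U T (fun t => g t - g' t) (fun t => z t - z' t) := by
  refine ⟨h.cont.sub h'.cont, fun t ht => ?_⟩
  simp only [map_sub]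
  rw [h.eq t ht, h'.eq t ht,
    intervalIntegral.integral_sub (h.intervalIntegrable hU ht) (h'.intervalIntegrable hU ht),
    ← map_sub]
  congr 1
  abel

theorem pullback_eq (hU : IsIsometricGroup U) (h : IsDuhamel U T g z) {t : ℝ} (ht : t ∈ Icc 0 T) :
    U (-t) (z t) = z 0 + ∫ s in (0 : ℝ)..t, U (-s) (g s) := by
  rw [h.eq t ht, hU.neg_apply]

/-- A mild solution need not be differentiable, but its pull-back under the free group is. All
differential arguments below act on the pull-back. -/
theorem hasDerivWithinAt (hU : IsIsometricGroup U) (h : IsDuhamel U T g z) {t : ℝ}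
    (ht : t ∈ Icc 0 T) :
    HasDerivWithinAt (fun t => U (-t) (z t)) (U (-t) (g t)) (Icc 0 T) t := by
  have hT : 0 ≤ T := ht.1.trans ht.2
  have hc := h.continuousOn_pullback hU
  have hd : HasDerivWithinAt (fun t => z 0 + ∫ s in (0 : ℝ)..t, U (-s) (g s)) (U (-t) (g t))
      (Icc 0 T) t := by
    have : Fact (t ∈ Icc 0 T) := ⟨ht⟩
    exact (intervalIntegral.integral_hasDerivWithinAt_right (h.intervalIntegrable hU ht)
      (hc.stronglyMeasurableAtFilter_nhdsWithin measurableSet_Icc t) (hc t ht)).const_add _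
  exact hd.congr (fun s hs => h.pullback_eq hU hs) (h.pullback_eq hU ht)

theorem continuousOn (hU : IsIsometricGroup U) (h : IsDuhamel U T g z) :
    ContinuousOn z (Icc 0 T) := by
  have h1 : ContinuousOn (fun t => U (-t) (z t)) (Icc 0 T) := fun t ht =>
    (h.hasDerivWithinAt hU ht).continuousWithinAt
  have h2 := hU.continuousOn_apply continuousOn_id h1
  exact h2.congr fun t _ => (hU.apply_neg t _).symm

/-- The pull-back has the same norm as `z`, and pairing it with its derivative undoes the isometry;
the generator drops out. -/
theorem energy_hasDerivWithinAt (hU : IsIsometricGroup U) (h : IsDuhamel U T g z) {t : ℝ}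
    (ht : t ∈ Icc 0 T) :
    HasDerivWithinAt (fun t => ‖z t‖ ^ 2) (2 * inner ℝ (z t) (g t)) (Icc 0 T) t := by
  have h1 := (h.hasDerivWithinAt hU ht).norm_sq
  simp only [LinearIsometry.norm_map, LinearIsometry.inner_map_map] at h1
  exact h1

theorem energy (hU : IsIsometricGroup U) (h : IsDuhamel U T g z) {t : ℝ}
    (ht : t ∈ Icc 0 T) :
    ‖z t‖ ^ 2 = ‖z 0‖ ^ 2 + 2 * ∫ s in (0 : ℝ)..t, inner ℝ (z s) (g s) := by
  have hsub : Icc 0 t ⊆ Icc 0 T := Icc_subset_Icc_right ht.2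
  have hc : ContinuousOn (fun s => 2 * inner ℝ (z s) (g s)) (Icc 0 t) :=
    continuousOn_const.mul (((h.continuousOn hU).mono hsub).inner (h.cont.mono hsub))
  have h1 := intervalIntegral.integral_eq_sub_of_hasDeriv_right_of_le ht.1
    (f := fun t => ‖z t‖ ^ 2) (f' := fun s => 2 * inner ℝ (z s) (g s))
    ((((h.continuousOn hU).mono hsub).norm).pow 2)
    (fun s hs => ((h.energy_hasDerivWithinAt hU ⟨hs.1.le, hs.2.le.trans ht.2⟩).mono_of_mem_nhdsWithin
      (mem_nhdsWithin_of_mem_nhds (Icc_mem_nhds hs.1 (hs.2.trans_le ht.2)))))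
    (by rw [← uIcc_of_le ht.1] at hc; exact hc.intervalIntegrable)
  rw [intervalIntegral.integral_const_mul] at h1
  linarith

theorem norm_sub_free_le (h : IsDuhamel U T g z) {t : ℝ}
    (ht : t ∈ Icc 0 T) : ‖z t - U t (z 0)‖ ≤ ∫ s in (0 : ℝ)..t, ‖g s‖ := by
  rw [h.eq t ht, ← map_sub, (U t).norm_map, add_sub_cancel_left]
  refine (intervalIntegral.norm_integral_le_integral_norm ht.1).trans_eq ?_
  simp

theorem shift (hU : IsIsometricGroup U) (h : IsDuhamel U T g z) {τ : ℝ} (hτ : τ ∈ Icc 0 T) :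
    IsDuhamel U (T - τ) (fun t => g (t + τ)) (fun t => z (t + τ)) := by
  have hmaps : ∀ t ∈ Icc 0 (T - τ), t + τ ∈ Icc 0 T := fun t ht =>
    ⟨add_nonneg ht.1 hτ.1, by linarith [ht.2]⟩
  refine ⟨h.cont.comp (by fun_prop) hmaps, fun t ht => ?_⟩
  have ht' := hmaps t ht
  simp only [zero_add]
  rw [h.eq _ ht', h.eq τ hτ, hU.add]
  congr 1
  have h1 : ∫ s in (0 : ℝ)..(t + τ), U (-s) (g s) =
      (∫ s in (0 : ℝ)..τ, U (-s) (g s)) + ∫ s in τ..(t + τ), U (-s) (g s) := by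
    rw [intervalIntegral.integral_add_adjacent_intervals (h.intervalIntegrable hU hτ)]
    exact (h.intervalIntegrable hU hτ).symm.trans (h.intervalIntegrable hU ht')
  have h2 : U τ (∫ s in τ..(t + τ), U (-s) (g s)) = ∫ s in (0 : ℝ)..t, U (-s) (g (s + τ)) := by
    have h3 := (U τ).toContinuousLinearMap.intervalIntegral_comp_comm
      ((h.intervalIntegrable hU hτ).symm.trans (h.intervalIntegrable hU ht'))
    simp only [LinearIsometry.coe_toContinuousLinearMap] at h3
    have h4 := intervalIntegral.integral_comp_add_right (a := 0) (b := t)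
      (fun s => U τ (U (-s) (g s))) τ
    rw [zero_add] at h4
    rw [← h3, ← h4]
    refine intervalIntegral.integral_congr fun s _ => ?_
    rw [← hU.add]; congr 2; ring
  rw [h1, ← h2, ← map_add]
  congr 1
  abel

end IsDuhamel

/-- On `[0,T]`, `z` is a mild solution of `z' = A z + N z`, where `A` generates `U`. -/
def IsMild (U : ℝ → V →ₗᵢ[ℝ] V) (N : V → V) (T : ℝ) (z : ℝ → V) : Prop :=
  IsDuhamel U T (fun t => N (z t)) z

/-- Both pull-backs solve `y' = U(-t) N(U(t) y)`. As `U` is isometric this field has the Lipschitz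
constant of `N`, on the same ball, so the usual comparison of trajectories applies. -/
theorem IsMild.gronwall (hU : IsIsometricGroup U) {N : V → V} {T R : ℝ} {K : ℝ≥0} {z z' : ℝ → V}
    (hK : LipschitzOnWith K N (Metric.closedBall 0 R)) (h : IsMild U N T z) (h' : IsMild U N T z')
    (hz : ∀ t ∈ Icc 0 T, ‖z t‖ ≤ R) (hz' : ∀ t ∈ Icc 0 T, ‖z' t‖ ≤ R) {t : ℝ} (ht : t ∈ Icc 0 T) :
    ‖z t - z' t‖ ≤ ‖z 0 - z' 0‖ * Real.exp (K * t) := by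
  have key := dist_le_of_trajectories_ODE_of_mem (a := 0) (b := T) (K := K)
    (v := fun t y => U (-t) (N (U t y))) (s := fun _ => Metric.closedBall (0 : V) R)
    (f := fun t => U (-t) (z t)) (g := fun t => U (-t) (z' t)) (δ := ‖z 0 - z' 0‖)
    (fun t _ => by
      refine LipschitzOnWith.of_dist_le_mul fun x hx y hy => ?_
      rw [(U (-t)).dist_map]
      refine (hK.dist_le_mul _ ?_ _ ?_).trans_eq ?_
      · simpa using hx
      · simpa using hy
      · rw [(U t).dist_map])
    (fun t ht => (h.hasDerivWithinAt hU ht).continuousWithinAt)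
    (fun t ht => by
      simp only [hU.apply_neg]
      exact (h.hasDerivWithinAt hU ⟨ht.1, ht.2.le⟩).mono_of_mem_nhdsWithin
        (mem_of_superset (Icc_mem_nhdsGE ht.2) (Icc_subset_Icc_left ht.1)))
    (fun t ht => by simpa using hz t ⟨ht.1, ht.2.le⟩)
    (fun t ht => (h'.hasDerivWithinAt hU ht).continuousWithinAt)
    (fun t ht => by
      simp only [hU.apply_neg]
      exact (h'.hasDerivWithinAt hU ⟨ht.1, ht.2.le⟩).mono_of_mem_nhdsWithin
        (mem_of_superset (Icc_mem_nhdsGE ht.2) (Icc_subset_Icc_left ht.1)))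
    (fun t ht => by simpa using hz' t ⟨ht.1, ht.2.le⟩)
    (by rw [neg_zero, (U 0).dist_map, dist_eq_norm]) t ht
  rw [(U (-t)).dist_map, dist_eq_norm, sub_zero] at key
  exact key

theorem exists_mild_of_lipschitzWith (hU : IsIsometricGroup U) {N : V → V} {K : ℝ≥0}
    (hN : LipschitzWith K N) (z₀ : V) : ∃ z : ℝ → V, z 0 = z₀ ∧ ∀ T, IsMild U N T z := by
  obtain ⟨y, hy, hy'⟩ := exists_global_integral_solution (G := fun t y => U (-t) (N (U t y)))
    (K := K) (C := ‖N 0‖)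
    (hU.continuous_uncurry.comp ((continuous_neg.comp continuous_fst).prodMk
      (hN.continuous.comp hU.continuous_uncurry)))
    (fun t => LipschitzWith.of_dist_le_mul fun x y => by
      rw [(U (-t)).dist_map]
      exact (hN.dist_le_mul _ _).trans_eq (by rw [(U t).dist_map]))
    (fun t => by simp) z₀
  have h0 : y 0 = z₀ := by simpa using hy' 0 le_rfl
  refine ⟨fun t => U t (y t), (hU.zero _).trans h0, fun T => ⟨?_, fun t ht => ?_⟩⟩
  · exact (hN.continuous.comp (hU.continuous_uncurry.comp (continuous_id.prodMk hy))).continuousOn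
  · simp only
    rw [hU.zero, h0, hy' t ht.1]

/-- Global existence for locally Lipschitz nonlinearities under an a priori bound. -/
theorem exists_mild (hU : IsIsometricGroup U) {N : V → V}
    (hN : ∀ R : ℝ, ∃ K : ℝ≥0, LipschitzOnWith K N (Metric.closedBall 0 R))
    {z₀ : V} {R : ℝ}
    (hR : ∀ (T : ℝ) (z : ℝ → V), 0 ≤ T → IsMild U N T z → z 0 = z₀ → ‖z T‖ ≤ R) :
    ∃ z : ℝ → V, z 0 = z₀ ∧ ∀ T, IsMild U N T z := by
  have hR0 : ‖z₀‖ ≤ R := by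
    -- The a priori bound at time `0`, applied to the constant curve, shows that the initial state
    -- obeys it.
    refine hR 0 (fun _ => z₀) le_rfl ⟨continuousOn_const, fun t ht => ?_⟩ rfl
    obtain rfl : t = 0 := le_antisymm ht.2 ht.1
    simp [hU.zero]
  have hRp : 0 < R + 1 := by linarith [norm_nonneg z₀]
  obtain ⟨K, hK⟩ := hN (R + 1)
  -- Composition with the retraction onto the ball of radius `R + 1` gives a globally Lipschitz
  -- nonlinearity that agrees with `N` on that ball.
  have hL : LipschitzWith (K * 2) (fun x => N (radialRetraction (R + 1) x)) := by
    refine LipschitzWith.of_dist_le_mul fun x y => ?_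
    have h1 := hK.dist_le_mul _ (by simpa using norm_radialRetraction_le hRp x) _
      (by simpa using norm_radialRetraction_le hRp y)
    have h2 := (lipschitzWith_radialRetraction (V := V) hRp).dist_le_mul x y
    refine h1.trans ?_
    push_cast
    rw [mul_assoc]
    exact mul_le_mul_of_nonneg_left h2 K.2
  obtain ⟨z, hz0, hz⟩ := exists_mild_of_lipschitzWith hU hL z₀
  have hzc : ContinuousOn z (Ici 0) := by
    intro t ht
    refine (((hz (t + 1)).continuousOn hU) t ⟨ht, by linarith⟩).mono_of_mem_nhdsWithin ?_
    refine mem_nhdsWithin.2 ⟨Iio (t + 1), isOpen_Iio, by simp, fun s hs => ⟨hs.2, le_of_lt hs.1⟩⟩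
  have hconv : ∀ T, (∀ t ∈ Icc 0 T, ‖z t‖ ≤ R + 1) → IsMild U N T z := by
    intro T hT
    have heq : ∀ t ∈ Icc 0 T, N (radialRetraction (R + 1) (z t)) = N (z t) := fun t ht => by
      rw [radialRetraction_of_norm_le hRp (hT t ht)]
    refine ⟨(hz T).cont.congr fun t ht => (heq t ht).symm, fun t ht => ?_⟩
    rw [(hz T).eq t ht]
    congr 2
    refine intervalIntegral.integral_congr fun s hs => ?_
    rw [uIcc_of_le ht.1] at hs
    simp only [heq s ⟨hs.1, hs.2.trans ht.2⟩]
  -- Continuation argument. As long as the truncated solution stays below `R + 1/2` it solves the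
  -- true equation, so it is in fact bounded by `R`; by continuity it then remains below `R + 1/2` a
  -- little longer.
  have hbound : ∀ T, 0 ≤ T → ∀ t ∈ Icc 0 T, ‖z t‖ ≤ R + 1 / 2 := by
    intro T hT
    have hcl : IsClosed ({t | ‖z t‖ ≤ R + 1 / 2} ∩ Icc 0 T) := by
      have : ContinuousOn (fun t => ‖z t‖) (Icc 0 T) := (hzc.mono Icc_subset_Ici_self).norm
      have h2 := this.preimage_isClosed_of_isClosed isClosed_Icc (isClosed_Iic (a := R + 1 / 2))
      rwa [inter_comm] at h2
    have hsub : Icc 0 T ⊆ {t | ‖z t‖ ≤ R + 1 / 2} := by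
      refine hcl.Icc_subset_of_forall_mem_nhdsGT_of_Icc_subset ?_ fun t ht hts => ?_
      · change ‖z 0‖ ≤ _; rw [hz0]; linarith
      · have h1 : ‖z t‖ ≤ R := hR t z ht.1
          (hconv t fun s hs => (show ‖z s‖ ≤ R + 1 / 2 from hts hs).trans (by linarith)) hz0
        have h2 : ContinuousWithinAt (fun t => ‖z t‖) (Ioi t) t :=
          ((hzc t ht.1).mono fun s hs => ht.1.trans (le_of_lt hs)).norm
        filter_upwards [h2.eventually_lt_const (show ‖z t‖ < R + 1 / 2 by linarith)] with s hs
        exact hs.le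
    exact fun t ht => hsub ht
  exact ⟨z, hz0, fun T => by
    rcases le_or_gt 0 T with hT | hT
    · exact hconv T fun t ht => (hbound T hT t ht).trans (by linarith)
    · refine ⟨by rw [Icc_eq_empty (not_le.2 hT)]; exact continuousOn_empty _, fun t ht => ?_⟩
      exact absurd (ht.1.trans ht.2) (not_le.2 hT)⟩

theorem IsMild.congr {N : V → V} {T : ℝ} {z z' : ℝ → V} (h : IsMild U N T z)
    (hz : ∀ t ∈ Icc 0 T, z' t = z t) : IsMild U N T z' := by
  refine ⟨ContinuousOn.congr (IsDuhamel.cont h) fun t ht => by rw [hz t ht], fun t ht => ?_⟩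
  rw [hz t ht, IsDuhamel.eq h t ht, hz 0 ⟨le_rfl, ht.1.trans ht.2⟩]
  congr 2
  refine intervalIntegral.integral_congr fun s hs => ?_
  rw [uIcc_of_le ht.1] at hs
  simp only [hz s ⟨hs.1, hs.2.trans ht.2⟩]

theorem IsMild.eqOn (hU : IsIsometricGroup U) {N : V → V}
    (hN : ∀ R : ℝ, ∃ K : ℝ≥0, LipschitzOnWith K N (Metric.closedBall 0 R)) {T : ℝ} {z z' : ℝ → V}
    (h : IsMild U N T z) (h' : IsMild U N T z') (h0 : z 0 = z' 0) : EqOn z z' (Icc 0 T) := by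
  intro t ht
  obtain ⟨R, hR⟩ := isCompact_Icc.exists_bound_of_continuousOn (IsDuhamel.continuousOn hU h)
  obtain ⟨R', hR'⟩ := isCompact_Icc.exists_bound_of_continuousOn (IsDuhamel.continuousOn hU h')
  obtain ⟨K, hK⟩ := hN (max R R')
  have := h.gronwall hU hK h' (fun t ht => (hR t ht).trans (le_max_left _ _))
    (fun t ht => (hR' t ht).trans (le_max_right _ _)) ht
  rw [h0, sub_self, norm_zero, zero_mul] at this
  exact sub_eq_zero.1 (norm_le_zero_iff.1 this)

/-- The semiflow of mild solutions. -/
theorem exists_mildFlow (hU : IsIsometricGroup U) {N : V → V}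
    (hN : ∀ R : ℝ, ∃ K : ℝ≥0, LipschitzOnWith K N (Metric.closedBall 0 R))
    (hB : ∀ r : ℝ, ∃ R : ℝ, ∀ (T : ℝ) (z : ℝ → V), 0 ≤ T → IsMild U N T z → ‖z 0‖ ≤ r → ‖z T‖ ≤ R) :
    ∃ S : Flow ℝ≥0 V, ∀ z₀ T, IsMild U N T (fun t => S t.toNNReal z₀) := by
  have hex : ∀ z₀, ∃ z : ℝ → V, z 0 = z₀ ∧ ∀ T, IsMild U N T z := fun z₀ => by
    obtain ⟨R, hR⟩ := hB ‖z₀‖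
    exact exists_mild hU hN fun T z hT hz h0 => hR T z hT hz (by rw [h0])
  choose sol h0 hsol using hex
  have hcont : ∀ z₀, Continuous fun t : ℝ≥0 => sol z₀ t := by
    intro z₀
    have : ContinuousOn (sol z₀) (Ici 0) := by
      intro t ht
      refine (((hsol z₀ (t + 1)).continuousOn hU) t ⟨ht, by linarith⟩).mono_of_mem_nhdsWithin ?_
      refine mem_nhdsWithin.2 ⟨Iio (t + 1), isOpen_Iio, by simp, fun s hs => ⟨hs.2, le_of_lt hs.1⟩⟩
    exact this.comp_continuous NNReal.continuous_coe fun t => t.2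
  refine ⟨⟨fun t z₀ => sol z₀ t, ?_, ?_, ?_⟩, fun z₀ T => (hsol z₀ T).congr fun t ht => ?_⟩
  · rw [continuous_iff_continuousAt]
    rintro ⟨t₀, z₀⟩
    -- One a priori radius for all initial states near `z₀` provides one Lipschitz constant, hence
    -- one exponential rate in the comparison of trajectories.
    obtain ⟨R, hR⟩ := hB (‖z₀‖ + 1)
    obtain ⟨K, hK⟩ := hN R
    have hle : ∀ z₁, ‖z₁‖ ≤ ‖z₀‖ + 1 → ∀ t, 0 ≤ t → ‖sol z₁ t‖ ≤ R := fun z₁ hz₁ t ht =>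
      hR t _ ht (hsol z₁ t) (by rw [h0]; exact hz₁)
    rw [ContinuousAt, tendsto_iff_dist_tendsto_zero]
    have h1 : Tendsto (fun p : ℝ≥0 × V => ‖p.2 - z₀‖ * Real.exp (K * p.1) +
        dist (sol z₀ p.1) (sol z₀ t₀)) (𝓝 (t₀, z₀)) (𝓝 0) := by
      have h2 : Continuous fun p : ℝ≥0 × V => ‖p.2 - z₀‖ * Real.exp (K * p.1) +
          dist (sol z₀ p.1) (sol z₀ t₀) := by
        have := (hcont z₀).comp (continuous_fst (X := ℝ≥0) (Y := V))
        exact ((continuous_snd.sub continuous_const).norm.mul (by fun_prop)).add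
          (this.dist continuous_const)
      simpa using h2.tendsto (t₀, z₀)
    have hev : ∀ᶠ p : ℝ≥0 × V in 𝓝 (t₀, z₀), ‖p.2‖ ≤ ‖z₀‖ + 1 := by
      have h2 : Tendsto (fun p : ℝ≥0 × V => ‖p.2‖) (𝓝 (t₀, z₀)) (𝓝 ‖z₀‖) :=
        (continuous_norm.comp continuous_snd).tendsto (t₀, z₀)
      filter_upwards [h2.eventually_lt_const (show ‖z₀‖ < ‖z₀‖ + 1 by linarith)] with p hp
      exact hp.le
    refine squeeze_zero' (Eventually.of_forall fun _ => dist_nonneg) ?_ h1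
    filter_upwards [hev] with p hp
    refine (dist_triangle _ (sol z₀ p.1) _).trans (add_le_add ?_ le_rfl)
    have h3 := (hsol p.2 p.1).gronwall hU hK (hsol z₀ p.1)
      (fun t ht => hle _ hp t ht.1) (fun t ht => hle _ (by linarith) t ht.1)
      (t := p.1) ⟨p.1.2, le_rfl⟩
    rw [h0, h0] at h3
    rw [dist_eq_norm]
    exact h3
  · intro t₁ t₂ z₀
    have h1 : IsMild U N t₁ (fun t => sol z₀ (t + t₂)) := by
      have := IsDuhamel.shift hU (hsol z₀ (t₁ + t₂)) (τ := t₂) ⟨t₂.2, by simp⟩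
      rwa [add_sub_cancel_right] at this
    have h2 := h1.eqOn hU hN (hsol (sol z₀ t₂) t₁) (by simp [h0])
    simpa using h2 (x := (t₁ : ℝ)) ⟨t₁.2, le_rfl⟩
  · intro z₀; simp [h0]
  · change sol z₀ (t.toNNReal : ℝ) = _
    rw [Real.coe_toNNReal t ht.1]

end Duhamel

end

/-! ### Compact attraction from finite classifications -/

noncomputable section

section Criterion

variable {V : Type*} [PseudoMetricSpace V] {S : Flow ℝ≥0 V} {B : Set V}

/-- If, for large times, trajectories starting in `B` fall into finitely many classes of small
diameter, then `B` is asymptotically compact. -/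
theorem exists_convergent_subseq_of_finite_classes [CompleteSpace V] (hinv : ∀ t, MapsTo (S t) B B)
    (hcol : ∀ ε > 0, ∃ (t₀ : ℝ≥0) (κ : Type) (_ : Finite κ) (c : V → κ),
      ∀ x ∈ B, ∀ y ∈ B, c x = c y → dist (S t₀ x) (S t₀ y) < ε)
    {t : ℕ → ℝ≥0} {y : ℕ → V} (ht : Tendsto t atTop atTop) (hy : ∀ k, y k ∈ B) :
    ∃ x, ∃ φ : ℕ → ℕ, StrictMono φ ∧ Tendsto (fun k => S (t (φ k)) (y (φ k))) atTop (𝓝 x) := by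
  have htb : TotallyBounded (range fun k => S (t k) (y k)) := by
    refine Metric.totallyBounded_of_finite_discretization fun ε hε => ?_
    obtain ⟨t₀, κ, hκ, c, hc⟩ := hcol ε hε
    obtain ⟨k₀, hk₀⟩ := eventually_atTop.1 (ht.eventually_ge_atTop t₀)
    have : Fintype κ := Fintype.ofFinite κ
    choose k hk using fun x : range (fun k => S (t k) (y k)) => x.2
    -- The finitely many indices before `k₀` are classes of their own; a later point is `S t₀`
    -- applied to a point of `B`, and that point is classified by `c`.
    refine ⟨ULift (Fin k₀ ⊕ κ), inferInstance, fun x => ULift.up <|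
      if h : k x < k₀ then Sum.inl ⟨k x, h⟩ else Sum.inr (c (S (t (k x) - t₀) (y (k x)))), ?_⟩
    intro x x' hxx'
    rw [ULift.up_inj] at hxx'
    have hx := hk x
    have hx' := hk x'
    simp only [← hx, ← hx']
    by_cases h : k x < k₀ <;> by_cases h' : k x' < k₀ <;> simp only [h, h', dif_pos, dif_neg,
      not_false_eq_true, Sum.inl.injEq, Sum.inr.injEq, Fin.mk.injEq, reduceCtorEq] at hxx'
    · rw [hxx', dist_self]; exact hε
    · have h1 := hc _ (hinv _ (hy _)) _ (hinv _ (hy _)) hxx'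
      rwa [← S.map_add, ← S.map_add, add_tsub_cancel_of_le (hk₀ _ (not_lt.1 h)),
        add_tsub_cancel_of_le (hk₀ _ (not_lt.1 h'))] at h1
  have hcomp : IsCompact (closure (range fun k => S (t k) (y k))) :=
    isCompact_iff_totallyBounded_isComplete.2 ⟨htb.closure, isClosed_closure.isComplete⟩
  obtain ⟨x, -, φ, hφ, hx⟩ := hcomp.tendsto_subseq (x := fun k => S (t k) (y k))
    fun k => subset_closure ⟨k, rfl⟩
  exact ⟨x, φ, hφ, hx⟩

/-- The compact set is the ω-limit set of `B`. Sequences `S (t k) (y k)` with `t k → ∞` have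
convergent subsequences; this gives compactness, and attraction follows by contradiction. -/
theorem exists_attracting_compact_of_finite_classes [CompleteSpace V]
    (hinv : ∀ t, MapsTo (S t) B B)
    (hcol : ∀ ε > 0, ∃ (t₀ : ℝ≥0) (κ : Type) (_ : Finite κ) (c : V → κ),
      ∀ x ∈ B, ∀ y ∈ B, c x = c y → dist (S t₀ x) (S t₀ y) < ε) :
    ∃ K : Set V, IsCompact K ∧
      Tendsto (fun t => ⨆ y ∈ B, Metric.infEDist (S t y) K) atTop (𝓝 0) := by
  let K : Set V := ⋂ n : ℕ, closure (S (n : ℝ≥0) '' B)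
  have hmem : ∀ (n : ℕ) (t : ℝ≥0), (n : ℝ≥0) ≤ t → ∀ y ∈ B, S t y ∈ S (n : ℝ≥0) '' B := by
    intro n t ht y hy
    refine ⟨S (t - n) y, hinv _ hy, ?_⟩
    rw [← S.map_add, add_tsub_cancel_of_le ht]
  have hlim : ∀ {t : ℕ → ℝ≥0} {y : ℕ → V} {x : V}, Tendsto t atTop atTop → (∀ k, y k ∈ B) →
      Tendsto (fun k => S (t k) (y k)) atTop (𝓝 x) → x ∈ K := by
    intro t y x ht hy hx
    refine mem_iInter.2 fun n => mem_closure_of_tendsto hx ?_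
    filter_upwards [ht.eventually_ge_atTop (n : ℝ≥0)] with k hk
    exact hmem n _ hk _ (hy k)
  have hKcl : IsClosed K := isClosed_iInter fun n => isClosed_closure
  refine ⟨K, ?_, ?_⟩
  · refine IsSeqCompact.isCompact ?_
    intro x hx
    have hnear : ∀ k : ℕ, ∃ y ∈ B, dist (x k) (S (k : ℝ≥0) y) < 1 / ((k : ℝ) + 1) := by
      intro k
      obtain ⟨_, ⟨y, hy, rfl⟩, hd⟩ := Metric.mem_closure_iff.1 (mem_iInter.1 (hx k) k)
        (1 / ((k : ℝ) + 1)) (by positivity)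
      exact ⟨y, hy, hd⟩
    choose y hyB hy using hnear
    obtain ⟨a, φ, hφ, ha⟩ := exists_convergent_subseq_of_finite_classes hinv hcol
      (t := fun k => (k : ℝ≥0)) tendsto_natCast_atTop_atTop hyB
    refine ⟨a, hlim (tendsto_natCast_atTop_atTop.comp hφ.tendsto_atTop) (fun k => hyB _) ha,
      φ, hφ, ?_⟩
    have h0 : Tendsto (fun k => dist (S (φ k : ℝ≥0) (y (φ k))) (x (φ k))) atTop (𝓝 0) := by
      refine squeeze_zero (fun _ => dist_nonneg) (fun k => ?_)
        (tendsto_one_div_add_atTop_nhds_zero_nat.comp hφ.tendsto_atTop)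
      rw [dist_comm]; exact (hy _).le
    exact (tendsto_iff_of_dist h0).1 ha
  · rw [ENNReal.tendsto_nhds_zero]
    intro ε hε
    by_contra hcon
    rw [eventually_atTop] at hcon
    push Not at hcon
    have hbad : ∀ k : ℕ, ∃ t : ℝ≥0, (k : ℝ≥0) ≤ t ∧ ∃ y ∈ B, ε < Metric.infEDist (S t y) K := by
      intro k
      obtain ⟨t, ht, h⟩ := hcon k
      simp only [lt_iSup_iff] at h
      obtain ⟨y, hy, h⟩ := h
      exact ⟨t, ht, y, hy, h⟩
    choose t ht y hyB hy using hbad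
    have htt : Tendsto t atTop atTop := tendsto_atTop_mono ht tendsto_natCast_atTop_atTop
    obtain ⟨a, φ, hφ, ha⟩ := exists_convergent_subseq_of_finite_classes hinv hcol htt hyB
    have haK : a ∈ K := hlim (htt.comp hφ.tendsto_atTop) (fun k => hyB _) ha
    have h1 : Tendsto (fun k => edist (S (t (φ k)) (y (φ k))) a) atTop (𝓝 0) :=
      tendsto_iff_edist_tendsto_0.1 ha
    obtain ⟨k, hk⟩ := (h1.eventually (gt_mem_nhds hε)).exists
    exact absurd (Metric.infEDist_le_edist_of_mem haK) (not_le.2 (hk.trans (hy (φ k))))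

/-- A set is attracted by a compact set if some time map contracts distances up to a
precompact pseudometric. -/
theorem exists_attracting_compact_of_quasiContraction [CompleteSpace V]
    (hbdd : Bornology.IsBounded B) (hinv : ∀ t, MapsTo (S t) B B) {T : ℝ≥0} {q : ℝ} (hq0 : 0 ≤ q)
    (hq : q < 1)
    (hcon : ∀ η > 0, ∃ (κ : Type) (_ : Finite κ) (c : V → κ),
      ∀ x ∈ B, ∀ y ∈ B, c x = c y → dist (S T x) (S T y) ≤ q * dist x y + η) :
    ∃ K : Set V, IsCompact K ∧
      Tendsto (fun t => ⨆ y ∈ B, Metric.infEDist (S t y) K) atTop (𝓝 0) := by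
  refine exists_attracting_compact_of_finite_classes hinv fun ε hε => ?_
  obtain ⟨d, hd⟩ := Metric.isBounded_iff.1 hbdd
  have h1q : 0 < 1 - q := by linarith
  -- The remainder is chosen so that `ε/2` is a fixed point of the recursion `x ↦ q x + η`.
  obtain ⟨κ, hκ, c, hc⟩ := hcon (ε / 2 * (1 - q)) (by positivity)
  have hT : Tendsto (fun n : ℕ => q ^ n * d) atTop (𝓝 0) := by
    simpa using (tendsto_pow_atTop_nhds_zero_of_lt_one hq0 hq).mul_const d
  obtain ⟨n, hn⟩ := (hT.eventually_lt_const (show 0 < ε / 2 by positivity)).exists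
  -- A point is classified by its itinerary: the classes of its images at the first `n` multiples of
  -- `T`.
  refine ⟨n * T, Fin n → κ, inferInstance, fun x m => c (S ((m : ℕ) * T) x), fun x hx y hy hxy => ?_⟩
  have key : ∀ m : ℕ, m ≤ n →
      dist (S (m * T) x) (S (m * T) y) ≤ q ^ m * d + ε / 2 := by
    intro m
    induction m with
    | zero => intro _; simpa using (hd hx hy).trans (by linarith)
    | succ m ih =>
      intro hm
      have h1 := hc _ (hinv (m * T) hx) _ (hinv (m * T) hy) (congrFun hxy ⟨m, hm⟩)
      have h2 := ih (Nat.le_of_succ_le hm)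
      have h3 : ((m + 1 : ℕ) : ℝ≥0) * T = T + m * T := by push_cast; ring
      rw [h3, S.map_add, S.map_add]
      refine h1.trans ?_
      calc q * dist (S (m * T) x) (S (m * T) y) + ε / 2 * (1 - q)
          ≤ q * (q ^ m * d + ε / 2) + ε / 2 * (1 - q) := by gcongr
        _ = _ := by ring
  have := key n le_rfl
  linarith

end Criterion

/-! ### Contraction modulo compact terms from observability -/

section Mild

variable {V : Type*} [NormedAddCommGroup V] [InnerProductSpace ℝ V] [CompleteSpace V]
  {U : ℝ → V →ₗᵢ[ℝ] V}
  {Y Z : Type*} [NormedAddCommGroup Y] [NormedSpace ℝ Y] [NormedAddCommGroup Z] [NormedSpace ℝ Z]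

/-- Trajectories in a bounded invariant set fall into finitely many classes of trajectories which
are uniformly close on `[0,T]` after applying a compact operator. -/
theorem exists_finite_classes_of_isCompactOperator (hU : IsIsometricGroup U) {N : V → V}
    {S : Flow ℝ≥0 V} (hS : ∀ z₀ T, IsMild U N T (fun t => S t.toNNReal z₀))
    {κ : V →L[ℝ] Z} (hκ : IsCompactOperator κ) {b : ℝ}
    (hκU : ∀ h z, ‖κ (U h z - z)‖ ≤ b * |h| * ‖z‖)
    {B : Set V} {R C : ℝ} (hR : ∀ x ∈ B, ‖x‖ ≤ R) (hC : ∀ x ∈ B, ‖N x‖ ≤ C)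
    (hinv : ∀ t, MapsTo (S t) B B) {T : ℝ} (hT : 0 < T) {lam : ℝ} (hlam : 0 < lam) :
    ∃ (c : Type) (_ : Finite c) (f : V → c), ∀ x ∈ B, ∀ y ∈ B, f x = f y →
      ∀ t ∈ Icc 0 T, ‖κ (S t.toNNReal x - S t.toNNReal y)‖ ≤ lam := by
  -- Along trajectories in `B` the compact quantity is Lipschitz in time: the free part by `hκU`,
  -- the Duhamel part because `N` is bounded on `B`. This is an Arzelà–Ascoli argument, carried out
  -- by hand on a time grid.
  have hlip : ∀ x ∈ B, ∀ s ≥ 0, ∀ h ≥ 0, ‖κ (S (s + h).toNNReal x - S s.toNNReal x)‖ ≤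
      (|b| * |R| + ‖κ‖ * |C|) * h := by
    intro x hx s hs h hh
    have h1 := IsDuhamel.shift hU (hS x (s + h)) (τ := s) ⟨hs, by linarith⟩
    rw [add_sub_cancel_left] at h1
    have h2 := h1.norm_sub_free_le (t := h) ⟨hh, le_rfl⟩
    simp only [zero_add] at h2
    rw [add_comm h s] at h2
    have h3 : ∫ r in (0 : ℝ)..h, ‖N (S (r + s).toNNReal x)‖ ≤ |C| * h := by
      have := intervalIntegral.norm_integral_le_of_norm_le_const (a := 0) (b := h) (C := |C|)
        (f := fun r => ‖N (S (r + s).toNNReal x)‖)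
        (fun r _ => by rw [norm_norm]; exact (hC _ (hinv _ hx)).trans (le_abs_self _))
      rw [sub_zero, abs_of_nonneg hh] at this
      exact (le_abs_self _).trans this
    have h4 : κ (S (s + h).toNNReal x - S s.toNNReal x) =
        κ (U h (S s.toNNReal x) - S s.toNNReal x) +
          κ (S (s + h).toNNReal x - U h (S s.toNNReal x)) := by
      rw [← map_add]; congr 1; abel
    have h5 := hκU h (S s.toNNReal x)
    have h6 := κ.le_opNorm (S (s + h).toNNReal x - U h (S s.toNNReal x))
    have h7 : ‖S s.toNNReal x‖ ≤ |R| := (hR _ (hinv _ hx)).trans (le_abs_self _)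
    rw [abs_of_nonneg hh] at h5
    have h8 : b * h * ‖S s.toNNReal x‖ ≤ |b| * |R| * h := by
      calc _ ≤ |b| * h * |R| := by gcongr; exact le_abs_self b
        _ = _ := by ring
    have h9 : ‖κ‖ * ‖S (s + h).toNNReal x - U h (S s.toNNReal x)‖ ≤ ‖κ‖ * (|C| * h) := by
      gcongr; exact h2.trans h3
    rw [h4]
    refine (norm_add_le _ _).trans ?_
    nlinarith
  set A : ℝ := |b| * |R| + ‖κ‖ * |C| with hA
  have hA0 : 0 ≤ A := by positivity
  obtain ⟨n, hn⟩ := exists_nat_gt (4 * A * T / lam)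
  have hn0 : 0 < (n : ℝ) := lt_of_le_of_lt (by positivity) hn
  have hmesh : A * (T / n) ≤ lam / 4 := by
    rw [div_lt_iff₀ hlam] at hn
    rw [← mul_div_assoc, div_le_iff₀ hn0]
    linarith
  have htb : TotallyBounded (κ '' Metric.closedBall 0 |R|) := by
    obtain ⟨K, hK, hsub⟩ := hκ.image_closedBall_subset_compact (f := κ.toLinearMap) |R|
    exact hK.totallyBounded.subset hsub
  -- The budget for `lam`: a quarter for each of the two moves to a grid time, and two quarters for
  -- passing through a common net point.
  obtain ⟨net, hfin, hnet⟩ := Metric.totallyBounded_iff.1 htb (lam / 4) (by positivity)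
  have : Finite net := hfin
  obtain ⟨N', ⟨eqv⟩⟩ := Finite.exists_equiv_fin net
  classical
  choose! near hnear using fun (u : Z) (hu : u ∈ κ '' Metric.closedBall 0 |R|) =>
    mem_iUnion₂.1 (hnet hu)
  -- The class records the chosen net point at each of the `n + 1` grid times, both ends included.
  -- The value `none` only makes the classifier total; it does not occur for points of `B`.
  refine ⟨Fin (n + 1) → Option (Fin N'), inferInstance, fun x k =>
    if h : near (κ (S (k * (T / n)).toNNReal x)) ∈ net then some (eqv ⟨_, h⟩) else none,
    fun x hx y hy hxy t ht => ?_⟩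
  have hin : ∀ x ∈ B, ∀ s : ℝ≥0, κ (S s x) ∈ κ '' Metric.closedBall 0 |R| := fun x hx s =>
    ⟨_, by simpa using (hR _ (hinv s hx)).trans (le_abs_self _), rfl⟩
  have hTn : 0 < T / n := by positivity
  let k : ℕ := ⌊t / (T / n)⌋₊
  have hk1 : (k : ℝ) ≤ t / (T / n) := Nat.floor_le (div_nonneg ht.1 hTn.le)
  have hk2 : t / (T / n) < k + 1 := Nat.lt_floor_add_one _
  have hkn : k < n + 1 := by
    have h1 : (k : ℝ) ≤ n := hk1.trans (by
      rw [div_le_iff₀ hTn]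
      have : (n : ℝ) * (T / n) = T := by field_simp
      linarith [ht.2])
    have : k ≤ n := by exact_mod_cast h1
    omega
  rw [le_div_iff₀ hTn] at hk1
  rw [div_lt_iff₀ hTn] at hk2
  set s : ℝ := k * (T / n) with hs
  have hs0 : 0 ≤ s := by positivity
  have hts : t - s ≤ T / n := by linarith
  have hclose : ∀ x ∈ B, ‖κ (S t.toNNReal x - S s.toNNReal x)‖ ≤ lam / 4 := by
    intro x hx
    have := hlip x hx s hs0 (t - s) (by linarith)
    rw [add_sub_cancel] at this
    exact this.trans ((mul_le_mul_of_nonneg_left hts hA0).trans hmesh)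
  have hxk := congrFun hxy ⟨k, hkn⟩
  simp only [← hs] at hxk
  have hnx := hnear _ (hin x hx s.toNNReal)
  have hny := hnear _ (hin y hy s.toNNReal)
  rw [dif_pos hnx.1, dif_pos hny.1, Option.some_inj, eqv.injective.eq_iff, Subtype.mk.injEq] at hxk
  have h1 : ‖κ (S s.toNNReal x) - κ (S s.toNNReal y)‖ ≤ lam / 2 := by
    rw [← dist_eq_norm]
    have h2 := hnx.2
    have h3 := hny.2
    rw [Metric.mem_ball] at h2 h3
    rw [hxk] at h2
    have h4 := dist_triangle_right (κ (S s.toNNReal x)) (κ (S s.toNNReal y))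
      (near (κ (S s.toNNReal y)))
    linarith
  have h2 := hclose x hx
  have h3 := hclose y hy
  have h4 : κ (S t.toNNReal x - S t.toNNReal y) = κ (S t.toNNReal x - S s.toNNReal x) +
      (κ (S s.toNNReal x) - κ (S s.toNNReal y)) - κ (S t.toNNReal y - S s.toNNReal y) := by
    simp only [map_sub]; abel
  rw [h4]
  refine (norm_sub_le _ _).trans ?_
  have := norm_add_le (κ (S t.toNNReal x - S s.toNNReal x))
    (κ (S s.toNNReal x) - κ (S s.toNNReal y))
  linarith

/-- Cauchy–Schwarz, read off from `0 ≤ ∫ (T a - ∫ a)²`. -/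
theorem sq_intervalIntegral_le {T : ℝ} (hT : 0 ≤ T) {a : ℝ → ℝ} (ha : ContinuousOn a (Icc 0 T)) :
    (∫ t in (0 : ℝ)..T, a t) ^ 2 ≤ T * ∫ t in (0 : ℝ)..T, a t ^ 2 := by
  rw [← uIcc_of_le hT] at ha
  have hi := ha.intervalIntegrable (μ := volume)
  have hi2 : IntervalIntegrable (fun t => a t ^ 2) volume 0 T := (ha.pow 2).intervalIntegrable
  set I := ∫ t in (0 : ℝ)..T, a t with hI
  have h1 : 0 ≤ ∫ t in (0 : ℝ)..T, (T * a t - I) ^ 2 :=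
    intervalIntegral.integral_nonneg hT fun t _ => sq_nonneg _
  have h2 : ∫ t in (0 : ℝ)..T, (T * a t - I) ^ 2 =
      T ^ 2 * (∫ t in (0 : ℝ)..T, a t ^ 2) - T * I ^ 2 := by
    have : ∀ t, (T * a t - I) ^ 2 = T ^ 2 * a t ^ 2 - 2 * T * I * a t + I ^ 2 := fun t => by ring
    simp only [this]
    rw [intervalIntegral.integral_add ((hi2.const_mul _).sub (hi.const_mul _))
      intervalIntegrable_const, intervalIntegral.integral_sub (hi2.const_mul _) (hi.const_mul _),
      intervalIntegral.integral_const_mul, intervalIntegral.integral_const_mul,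
      intervalIntegral.integral_const, ← hI, smul_eq_mul]
    ring
  rw [h2] at h1
  rcases hT.eq_or_lt with rfl | hT'
  · simp [hI]
  · nlinarith

/-- Decay of differences of trajectories up to a precompact remainder, from observability of the
free evolution. -/
theorem IsMild.norm_sq_sub_le (hU : IsIsometricGroup U) {p : V →L[ℝ] Y} {κ : V →L[ℝ] Z}
    {T C : ℝ} (hT : 0 < T) (hC : 0 < C)
    (hobs : ∀ w : V, ‖w‖ ^ 2 ≤ C * ∫ t in (0 : ℝ)..T, (‖p (U t w)‖ + ‖κ (U t w)‖) ^ 2)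
    {g z : ℝ → V} (hz : IsDuhamel U T g z) {C₁ C₂ m lam : ℝ} (hC₁ : 0 ≤ C₁) (hC₂ : 0 ≤ C₂)
    (hm : 0 < m)
    (hg : ∀ t ∈ Icc 0 T, ‖g t‖ ≤ C₁ * (‖p (z t)‖ + ‖κ (z t)‖))
    (hg' : ∀ t ∈ Icc 0 T, inner ℝ (z t) (g t) ≤ -m * ‖p (z t)‖ ^ 2 + C₂ * ‖κ (z t)‖)
    (hlam : ∀ t ∈ Icc 0 T, ‖κ (z t)‖ ≤ lam) :
    ‖z T‖ ^ 2 ≤ (1 - m / (2 * C * (1 + T ^ 2 * ((‖p‖ + ‖κ‖) * C₁) ^ 2) + m)) * ‖z 0‖ ^ 2 +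
      (2 * m * T * lam ^ 2 + 2 * C₂ * T * lam) := by
  have hzc := hz.continuousOn hU
  have hpc : ContinuousOn (fun t => ‖p (z t)‖) (Icc 0 T) := (p.continuous.comp_continuousOn hzc).norm
  have hκc : ContinuousOn (fun t => ‖κ (z t)‖) (Icc 0 T) := (κ.continuous.comp_continuousOn hzc).norm
  have huIcc : uIcc 0 T = Icc 0 T := uIcc_of_le hT.le
  set a : ℝ → ℝ := fun t => ‖p (z t)‖ + ‖κ (z t)‖ with ha
  have hac : ContinuousOn a (Icc 0 T) := hpc.add hκc
  have hac2 : ContinuousOn (fun t => a t ^ 2) (Icc 0 T) := hac.pow 2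
  have hpc2 : ContinuousOn (fun t => ‖p (z t)‖ ^ 2) (Icc 0 T) := hpc.pow 2
  have hii : ∀ {f : ℝ → ℝ}, ContinuousOn f (Icc 0 T) → IntervalIntegrable f volume 0 T := fun hf => by
    rw [← huIcc] at hf; exact hf.intervalIntegrable
  set I := ∫ t in (0 : ℝ)..T, a t with hI
  have hI0 : 0 ≤ I := intervalIntegral.integral_nonneg hT.le fun t _ => by positivity
  set c := (‖p‖ + ‖κ‖) * C₁ with hc
  have hc0 : 0 ≤ c := by positivity
  -- The distance to the free solution with the same initial state is bounded by observed and
  -- compact quantities alone. Hence observing the free solution costs no more than observing `z`,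
  -- up to constants.
  have hfree : ∀ t ∈ Icc 0 T, ‖z t - U t (z 0)‖ ≤ C₁ * I := by
    intro t ht
    refine (hz.norm_sub_free_le ht).trans ?_
    rw [hI, ← intervalIntegral.integral_const_mul]
    have h1 : ∫ s in (0 : ℝ)..t, ‖g s‖ ≤ ∫ s in (0 : ℝ)..T, ‖g s‖ :=
      intervalIntegral.integral_mono_interval le_rfl ht.1 ht.2 (ae_of_all _ fun _ => norm_nonneg _)
        (hii hz.cont.norm)
    exact h1.trans (intervalIntegral.integral_mono_on hT.le (hii hz.cont.norm)
      ((hii hac).const_mul _) hg)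
  have hw : ∀ t ∈ Icc 0 T, (‖p (U t (z 0))‖ + ‖κ (U t (z 0))‖) ^ 2 ≤ 2 * a t ^ 2 + 2 * (c * I) ^ 2 := by
    intro t ht
    have h1 : ‖p (U t (z 0))‖ ≤ ‖p (z t)‖ + ‖p‖ * (C₁ * I) := by
      have h2 : U t (z 0) = z t - (z t - U t (z 0)) := by abel
      rw [h2, map_sub]
      refine (norm_sub_le _ _).trans (add_le_add le_rfl ((p.le_opNorm _).trans ?_))
      gcongr; exact hfree t ht
    have h1' : ‖κ (U t (z 0))‖ ≤ ‖κ (z t)‖ + ‖κ‖ * (C₁ * I) := by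
      have h2 : U t (z 0) = z t - (z t - U t (z 0)) := by abel
      rw [h2, map_sub]
      refine (norm_sub_le _ _).trans (add_le_add le_rfl ((κ.le_opNorm _).trans ?_))
      gcongr; exact hfree t ht
    have h3 : ‖p (U t (z 0))‖ + ‖κ (U t (z 0))‖ ≤ a t + c * I := by
      simp only [ha, hc]; linarith
    have h4 : 0 ≤ ‖p (U t (z 0))‖ + ‖κ (U t (z 0))‖ := by positivity
    calc _ ≤ (a t + c * I) ^ 2 := by gcongr
      _ ≤ _ := by nlinarith [sq_nonneg (a t - c * I)]
  have hUc : Continuous fun t => (‖p (U t (z 0))‖ + ‖κ (U t (z 0))‖) ^ 2 :=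
    (((p.continuous.comp (hU.cont _)).norm).add ((κ.continuous.comp (hU.cont _)).norm)).pow 2
  set A := ∫ t in (0 : ℝ)..T, a t ^ 2 with hA
  have h1 : ∫ t in (0 : ℝ)..T, (‖p (U t (z 0))‖ + ‖κ (U t (z 0))‖) ^ 2 ≤
      2 * A + 2 * (c * I) ^ 2 * T := by
    refine (intervalIntegral.integral_mono_on hT.le (hUc.intervalIntegrable _ _)
      (((hii hac2).const_mul 2).add intervalIntegrable_const) hw).trans_eq ?_
    rw [intervalIntegral.integral_add ((hii hac2).const_mul 2) intervalIntegrable_const,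
      intervalIntegral.integral_const_mul, intervalIntegral.integral_const, smul_eq_mul, sub_zero]
    ring
  have h2 : I ^ 2 ≤ T * A := sq_intervalIntegral_le hT.le hac
  set G := ∫ t in (0 : ℝ)..T, ‖p (z t)‖ ^ 2 with hG
  have hG0 : 0 ≤ G := intervalIntegral.integral_nonneg hT.le fun t _ => by positivity
  have h3 : A ≤ 2 * G + 2 * T * lam ^ 2 := by
    have h4 : ∀ t ∈ Icc 0 T, a t ^ 2 ≤ 2 * ‖p (z t)‖ ^ 2 + 2 * lam ^ 2 := by
      intro t ht
      have h5 : ‖κ (z t)‖ ^ 2 ≤ lam ^ 2 := by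
        have := hlam t ht; gcongr
      simp only [ha]
      nlinarith [sq_nonneg (‖p (z t)‖ - ‖κ (z t)‖)]
    refine (intervalIntegral.integral_mono_on hT.le (hii hac2)
      (((hii hpc2).const_mul 2).add intervalIntegrable_const) h4).trans_eq ?_
    rw [intervalIntegral.integral_add ((hii hpc2).const_mul 2) intervalIntegrable_const,
      intervalIntegral.integral_const_mul, intervalIntegral.integral_const, smul_eq_mul, sub_zero]
    ring
  -- Energy identity: the damping removes `2 m ∫ ‖p z‖²`, and the feedback contributes only through
  -- the compact quantity.
  have h4 : ‖z T‖ ^ 2 ≤ ‖z 0‖ ^ 2 - 2 * m * G + 2 * C₂ * T * lam := by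
    rw [hz.energy hU ⟨hT.le, le_rfl⟩]
    have h5 : ∫ s in (0 : ℝ)..T, inner ℝ (z s) (g s) ≤ -m * G + C₂ * lam * T := by
      refine (intervalIntegral.integral_mono_on hT.le (hii (hzc.inner hz.cont))
        (((hii hpc2).const_mul (-m)).add intervalIntegrable_const)
        (fun t ht => (hg' t ht).trans (add_le_add le_rfl
          (mul_le_mul_of_nonneg_left (hlam t ht) hC₂)))).trans_eq ?_
      rw [intervalIntegral.integral_add ((hii hpc2).const_mul (-m)) intervalIntegrable_const,
        intervalIntegral.integral_const_mul, intervalIntegral.integral_const, smul_eq_mul, sub_zero]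
      ring
    nlinarith
  set D := 2 * C * (1 + T ^ 2 * c ^ 2) with hD
  have hD0 : 0 < D := by positivity
  have h5 : ‖z 0‖ ^ 2 ≤ D * A := by
    have h6 := (hobs (z 0)).trans (mul_le_mul_of_nonneg_left h1 hC.le)
    have h7 : c ^ 2 * I ^ 2 * T ≤ c ^ 2 * (T * A) * T := by gcongr
    calc _ ≤ _ := h6
      _ ≤ C * (2 * A + 2 * (c ^ 2 * (T * A) * T)) := mul_le_mul_of_nonneg_left (by nlinarith) hC.le
      _ = _ := by rw [hD]; ring
  have hA0 : 0 ≤ A := intervalIntegral.integral_nonneg hT.le fun t _ => sq_nonneg _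
  -- `D` is enlarged to `D + m` so that the resulting factor `1 - m / (D + m)` is nonnegative and
  -- has a square root.
  have h6 : ‖z 0‖ ^ 2 / (D + m) ≤ A := by
    rw [div_le_iff₀ (by positivity)]
    nlinarith
  have h7 : (1 - m / (D + m)) * ‖z 0‖ ^ 2 = ‖z 0‖ ^ 2 - m * (‖z 0‖ ^ 2 / (D + m)) := by ring
  rw [h7]
  nlinarith

/-- Asymptotic smoothness of a semilinear flow whose damping observes the free evolution up to
compact terms. -/
theorem asymptoticallySmooth_of_observability (hU : IsIsometricGroup U) {N : V → V}
    {S : Flow ℝ≥0 V} (hS : ∀ z₀ T, IsMild U N T (fun t => S t.toNNReal z₀))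
    {p : V →L[ℝ] Y} {κ : V →L[ℝ] Z} (hκ : IsCompactOperator κ) {b : ℝ}
    (hκU : ∀ h z, ‖κ (U h z - z)‖ ≤ b * |h| * ‖z‖)
    {T C : ℝ} (hT : 0 < T) (hC : 0 < C)
    (hobs : ∀ w : V, ‖w‖ ^ 2 ≤ C * ∫ t in (0 : ℝ)..T, (‖p (U t w)‖ + ‖κ (U t w)‖) ^ 2)
    (hN : ∀ R : ℝ, ∃ C₁ : ℝ, 0 ≤ C₁ ∧ ∀ x y, ‖x‖ ≤ R → ‖y‖ ≤ R →
      ‖N x - N y‖ ≤ C₁ * (‖p (x - y)‖ + ‖κ (x - y)‖))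
    {m : ℝ} (hm : 0 < m)
    (hN' : ∀ R : ℝ, ∃ C₂ : ℝ, 0 ≤ C₂ ∧ ∀ x y, ‖x‖ ≤ R → ‖y‖ ≤ R →
      inner ℝ (x - y) (N x - N y) ≤ -m * ‖p (x - y)‖ ^ 2 + C₂ * ‖κ (x - y)‖) :
    AsymptoticallySmooth S := by
  intro B _ hbdd hinv
  obtain ⟨R₀, hR₀⟩ := hbdd.exists_norm_le
  set R := max R₀ 0 with hRdef
  have hR : ∀ x ∈ B, ‖x‖ ≤ R := fun x hx => (hR₀ x hx).trans (le_max_left _ _)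
  obtain ⟨C₁, hC₁, hN₁⟩ := hN R
  obtain ⟨C₂, hC₂, hN₂⟩ := hN' R
  have hNB : ∀ x ∈ B, ‖N x‖ ≤ ‖N 0‖ + C₁ * (‖p‖ * R + ‖κ‖ * R) := by
    intro x hx
    have h1 := hN₁ x 0 (hR x hx) (by simp [hRdef])
    rw [sub_zero] at h1
    have h2 := norm_le_insert' (N x) (N 0)
    have h3 := (p.le_opNorm x).trans (mul_le_mul_of_nonneg_left (hR x hx) (norm_nonneg p))
    have h4 := (κ.le_opNorm x).trans (mul_le_mul_of_nonneg_left (hR x hx) (norm_nonneg κ))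
    have h5 := mul_le_mul_of_nonneg_left (add_le_add h3 h4) hC₁
    linarith
  set D := 2 * C * (1 + T ^ 2 * ((‖p‖ + ‖κ‖) * C₁) ^ 2) with hD
  have hD0 : 0 < D := by positivity
  have hq0 : 0 ≤ 1 - m / (D + m) := by
    rw [sub_nonneg, div_le_one (by positivity)]; linarith
  have hq1 : 1 - m / (D + m) < 1 := by
    have : 0 < m / (D + m) := by positivity
    linarith
  -- The decay estimate is for squares; from `d_T² ≤ q² d_0² + η²` follows `d_T ≤ q d_0 + η`, with
  -- `q` the square root of the factor.
  refine exists_attracting_compact_of_quasiContraction hbdd hinv (T := T.toNNReal)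
    (q := √(1 - m / (D + m))) (Real.sqrt_nonneg _)
    (by rw [Real.sqrt_lt' one_pos]; simpa using hq1) fun η hη => ?_
  -- The error terms are continuous in `lam` and vanish at `0`, so a small positive value keeps them
  -- below `η²`.
  obtain ⟨lam, hlam, hlamη⟩ : ∃ lam : ℝ, 0 < lam ∧
      2 * m * T * lam ^ 2 + 2 * C₂ * T * lam ≤ η ^ 2 := by
    have hc : ContinuousAt (fun lam : ℝ => 2 * m * T * lam ^ 2 + 2 * C₂ * T * lam) 0 := by fun_prop
    have h1 : ∀ᶠ lam in 𝓝[>] (0 : ℝ), 2 * m * T * lam ^ 2 + 2 * C₂ * T * lam < η ^ 2 :=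
      (hc.mono_left nhdsWithin_le_nhds).eventually_lt_const (by simpa using by positivity)
    obtain ⟨lam, h2, h3⟩ := (h1.and self_mem_nhdsWithin).exists
    exact ⟨lam, h3, h2.le⟩
  obtain ⟨c, hfin, f, hf⟩ := exists_finite_classes_of_isCompactOperator hU hS hκ hκU hR hNB hinv
    hT hlam
  refine ⟨c, hfin, f, fun x hx y hy hxy => ?_⟩
  have hd := IsDuhamel.sub hU (hS x T) (hS y T)
  have key := IsMild.norm_sq_sub_le hU hT hC hobs hd hC₁ hC₂ hm
    (fun t _ => hN₁ _ _ (hR _ (hinv _ hx)) (hR _ (hinv _ hy)))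
    (fun t _ => hN₂ _ _ (hR _ (hinv _ hx)) (hR _ (hinv _ hy)))
    (fun t ht => hf x hx y hy hxy t ht)
  simp only [Real.toNNReal_zero, S.map_zero_apply, ← hD] at key
  rw [dist_eq_norm, dist_eq_norm]
  refine abs_le_of_sq_le_sq' ?_ (by positivity) |>.2
  have h1 := Real.sq_sqrt hq0
  have h2 : 0 ≤ √(1 - m / (D + m)) * ‖x - y‖ * η := by positivity
  calc _ ≤ _ := key
    _ ≤ (1 - m / (D + m)) * ‖x - y‖ ^ 2 + η ^ 2 := by linarith
    _ ≤ _ := by nlinarith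

end Mild
end

/-! ### Mild solutions are weak solutions -/

noncomputable section

section Primitives

theorem absolutelyContinuousOnInterval_const_add_primitive {f : ℝ → ℝ} {a b : ℝ} (c : ℝ)
    (hf : IntervalIntegrable f volume a b) :
    AbsolutelyContinuousOnInterval (fun x => c + ∫ t in a..x, f t) a b := by
  have h1 : AbsolutelyContinuousOnInterval (fun _ : ℝ => c) a b :=
    (LipschitzWith.const c).lipschitzOnWith.absolutelyContinuousOnInterval
  exact h1.add (hf.absolutelyContinuousOnInterval_intervalIntegral left_mem_uIcc)

/-- Integration by parts for primitives of integrable functions. -/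
theorem integral_primitive_mul {f g : ℝ → ℝ} {a b : ℝ} (c d : ℝ)
    (hf : IntervalIntegrable f volume a b) (hg : IntervalIntegrable g volume a b) :
    ∫ x in a..b, (f x * (d + ∫ t in a..x, g t) + (c + ∫ t in a..x, f t) * g x) =
      (c + ∫ t in a..b, f t) * (d + ∫ t in a..b, g t) - c * d := by
  have h := (absolutelyContinuousOnInterval_const_add_primitive c hf).integral_deriv_mul_eq_sub
    (absolutelyContinuousOnInterval_const_add_primitive d hg)
  simp only [intervalIntegral.integral_same, add_zero] at h
  rw [← h]
  refine intervalIntegral.integral_congr_ae ?_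
  filter_upwards [hf.ae_hasDerivAt_integral, hg.ae_hasDerivAt_integral] with x h1 h2 hx
  have hx' : x ∈ uIcc a b := uIoc_subset_uIcc hx
  rw [((h1 hx' a left_mem_uIcc).const_add c).deriv, ((h2 hx' a left_mem_uIcc).const_add d).deriv]

theorem continuousOn_const_add_primitive {f : ℝ → ℝ} {a b : ℝ} (c : ℝ)
    (hf : IntervalIntegrable f volume a b) :
    ContinuousOn (fun x => c + ∫ t in a..x, f t) (uIcc a b) :=
  (absolutelyContinuousOnInterval_const_add_primitive c hf).continuousOn

/-- Variant of integration by parts for given representatives. -/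
theorem integral_mul_add_mul_of_primitive {F G f g : ℝ → ℝ} {a b : ℝ} (hab : a ≤ b)
    (hf : IntervalIntegrable f volume a b) (hg : IntervalIntegrable g volume a b)
    (hF : ∀ x ∈ Icc a b, F x = F a + ∫ t in a..x, f t)
    (hG : ∀ x ∈ Icc a b, G x = G a + ∫ t in a..x, g t) :
    ∫ x in a..b, (f x * G x + F x * g x) = F b * G b - F a * G a := by
  rw [hF b (right_mem_Icc.2 hab), hG b (right_mem_Icc.2 hab), ← integral_primitive_mul _ _ hf hg]
  refine intervalIntegral.integral_congr fun x hx => ?_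
  rw [uIcc_of_le hab] at hx
  rw [hF x hx, hG x hx]

theorem continuousOn_of_primitive {F f : ℝ → ℝ} {a b : ℝ} (hab : a ≤ b)
    (hf : IntervalIntegrable f volume a b) (hF : ∀ x ∈ Icc a b, F x = F a + ∫ t in a..x, f t) :
    ContinuousOn F (Icc a b) := by
  have h := continuousOn_const_add_primitive (F a) hf
  rw [uIcc_of_le hab] at h
  exact h.congr hF

end Primitives

section BasisIntegrals

variable {X : Type*} [NormedAddCommGroup X] [InnerProductSpace ℝ X] {ι : Type*}
  {α : Type*} [MeasurableSpace α] {μ : Measure α}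

/-- Cauchy–Schwarz for finite sums followed by Bessel. It supplies the bound, uniform over finite
sets of modes, behind the exchange of sum and integral. -/
theorem HilbertBasis.sum_abs_inner_mul_le (b : HilbertBasis ι ℝ X) (x y : X) (s : Finset ι) :
    ∑ n ∈ s, |inner ℝ (b n) x * inner ℝ (b n) y| ≤ ‖x‖ * ‖y‖ := by
  have h1 := b.orthonormal.sum_inner_products_le (s := s) x
  have h2 := b.orthonormal.sum_inner_products_le (s := s) y
  simp only [Real.norm_eq_abs] at h1 h2
  have h3 := Finset.sum_mul_sq_le_sq_mul_sq s (fun n => |inner ℝ (b n) x|) (fun n => |inner ℝ (b n) y|)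
  simp only [abs_mul]
  refine abs_le_of_sq_le_sq' ?_ (by positivity) |>.2
  calc _ ≤ _ := h3
    _ ≤ ‖x‖ ^ 2 * ‖y‖ ^ 2 := by gcongr
    _ = _ := by ring

/-- Parseval's identity integrated over a measure space; it reduces identities between time
integrals to identities for each mode. -/
theorem HilbertBasis.hasSum_integral_inner [Countable ι] (b : HilbertBasis ι ℝ X) {f g : α → X}
    (hf : MemLp f 2 μ) (hg : MemLp g 2 μ) :
    HasSum (fun n => ∫ a, inner ℝ (b n) (f a) * inner ℝ (b n) (g a) ∂μ)
      (∫ a, inner ℝ (f a) (g a) ∂μ) := by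
  have hfg : Integrable (fun a => ‖f a‖ * ‖g a‖) μ := hf.norm.integrable_mul hg.norm
  have hmeas : ∀ n, AEStronglyMeasurable (fun a => inner ℝ (b n) (f a) * inner ℝ (b n) (g a)) μ :=
    fun n => (aestronglyMeasurable_const.inner hf.1).mul (aestronglyMeasurable_const.inner hg.1)
  have hint : ∀ n, Integrable (fun a => inner ℝ (b n) (f a) * inner ℝ (b n) (g a)) μ := fun n => by
    refine hfg.mono' (hmeas n) (ae_of_all _ fun a => ?_)
    simpa using b.sum_abs_inner_mul_le (f a) (g a) {n}
  have hsum : Summable fun n => ∫ a, ‖inner ℝ (b n) (f a) * inner ℝ (b n) (g a)‖ ∂μ := by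
    refine summable_of_sum_le (c := ∫ a, ‖f a‖ * ‖g a‖ ∂μ)
      (fun n => integral_nonneg fun _ => norm_nonneg _) fun s => ?_
    rw [← integral_finsetSum _ fun n _ => (hint n).norm]
    refine integral_mono (integrable_finsetSum _ fun n _ => (hint n).norm) hfg fun a => ?_
    exact b.sum_abs_inner_mul_le (f a) (g a) s
  have h := hasSum_integral_of_summable_integral_norm (μ := μ)
    (F := fun n a => inner ℝ (b n) (f a) * inner ℝ (b n) (g a)) hint hsum
  have heq : ∫ a, inner ℝ (f a) (g a) ∂μ =
      ∫ a, ∑' n, inner ℝ (b n) (f a) * inner ℝ (b n) (g a) ∂μ := by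
    refine integral_congr_ae (ae_of_all _ fun a => ?_)
    refine (b.hasSum_inner_mul_inner (f a) (g a)).tsum_eq.symm.trans (tsum_congr fun n => ?_)
    rw [real_inner_comm]
  rw [heq]
  exact h

end BasisIntegrals

set_option linter.unusedSectionVars false

namespace Phase

variable {ι : Type*} {E X : Type*} [NormedAddCommGroup E] [InnerProductSpace ℝ E]
  [NormedAddCommGroup X] [InnerProductSpace ℝ X] [CompleteSpace X]
  {e : HilbertBasis ι ℝ E} {b : HilbertBasis ι ℝ X} {w : ι → ℝ} {i : E →L[ℝ] X}

theorem isIsometricGroup_rot (w : ι → ℝ) : IsIsometricGroup (rot w) :=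
  ⟨rot_zero w, fun s t z => rot_add w s t z, continuous_rot w⟩

/-- Each mode is a forced oscillator. The two equations are antisymmetric because the displacement
is measured in the energy basis, so its coordinate already contains the factor `w_n`. -/
theorem hasDerivWithinAt_modes {T : ℝ} {G : ℝ → X} {z : ℝ → Phase ι}
    (hz : IsDuhamel (rot w) T (fun t => mk e b (0, G t)) z) {t : ℝ} (ht : t ∈ Icc 0 T) (n : ι) :
    HasDerivWithinAt (fun t => (z t n).re) (w n * (z t n).im) (Icc 0 T) t ∧
      HasDerivWithinAt (fun t => (z t n).im) (-(w n * (z t n).re) + inner ℝ (b n) (G t))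
        (Icc 0 T) t := by
  have hU := isIsometricGroup_rot w
  have h := hasDerivWithinAt_rot_apply w (hz.hasDerivWithinAt hU ht) n
  simp only [hU.apply_neg] at h
  have hre := Complex.reCLM.hasFDerivAt.comp_hasDerivWithinAt t h
  have him := Complex.imCLM.hasFDerivAt.comp_hasDerivWithinAt t h
  refine ⟨hre.congr_deriv ?_, him.congr_deriv ?_⟩
  · rw [Complex.reCLM_apply, Complex.add_re, mk_re]; simp
  · rw [Complex.imCLM_apply, Complex.add_im, mk_im]; simp

theorem integral_of_hasDerivWithinAt {f f' : ℝ → ℝ} {T : ℝ}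
    (hf : ∀ t ∈ Icc 0 T, HasDerivWithinAt f (f' t) (Icc 0 T) t) (hf' : ContinuousOn f' (Icc 0 T))
    {t : ℝ} (ht : t ∈ Icc 0 T) : f t = f 0 + ∫ s in (0 : ℝ)..t, f' s := by
  have hsub : Icc 0 t ⊆ Icc 0 T := Icc_subset_Icc_right ht.2
  have h1 := intervalIntegral.integral_eq_sub_of_hasDeriv_right_of_le ht.1 (f := f) (f' := f')
    (fun s hs => ((hf s (hsub hs)).continuousWithinAt).mono hsub)
    (fun s hs => (hf s (hsub (Ioo_subset_Icc_self hs))).mono_of_mem_nhdsWithin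
      (mem_nhdsWithin_of_mem_nhds (Icc_mem_nhds hs.1 (hs.2.trans_le ht.2))))
    (by have := hf'.mono hsub; rw [← uIcc_of_le ht.1] at this; exact this.intervalIntegrable)
  linarith

theorem continuousOn_apply {z : ℝ → Phase ι} {s : Set ℝ} (hz : ContinuousOn z s) (n : ι) :
    ContinuousOn (fun t => z t n) s :=
  (lp.evalCLM ℝ (fun _ : ι => ℂ) (p := 2) n).continuous.comp_continuousOn hz

theorem memLp_of_continuousOn {Y : Type*} [NormedAddCommGroup Y]
    {f : ℝ → Y} {T : ℝ} (hf : ContinuousOn f (Icc 0 T)) (p : ℝ≥0∞) :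
    MemLp f p (volume.restrict (Ioo 0 T)) := by
  obtain ⟨C, hC⟩ := isCompact_Icc.exists_bound_of_continuousOn hf
  refine MemLp.of_bound ((hf.mono Ioo_subset_Icc_self).aestronglyMeasurable measurableSet_Ioo) C ?_
  filter_upwards [ae_restrict_mem measurableSet_Ioo] with t ht
  exact hC t (Ioo_subset_Icc_self ht)

theorem intervalIntegral_eq_integral_Ioo {Y : Type*} [NormedAddCommGroup Y] [NormedSpace ℝ Y]
    {f : ℝ → Y} {T : ℝ} (hT : 0 ≤ T) : ∫ t in (0 : ℝ)..T, f t = ∫ t in Ioo 0 T, f t := by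
  rw [intervalIntegral.integral_of_le hT, integral_Ioc_eq_integral_Ioo]

theorem intervalIntegrable_of_memLp {Y : Type*} [NormedAddCommGroup Y]
    {f : ℝ → Y} {T : ℝ} (hT : 0 ≤ T) {p : ℝ≥0∞} (hp : 1 ≤ p)
    (hf : MemLp f p (volume.restrict (Ioo 0 T))) : IntervalIntegrable f volume 0 T := by
  rw [intervalIntegrable_iff_integrableOn_Ioo_of_le hT]
  exact hf.integrable hp

/-- Mild solutions satisfy the variational identity. -/
theorem weak_of_isDuhamel [Countable ι] (hw : ∀ n, 0 < w n)
    (hi : ∀ n, i (e n) = (w n)⁻¹ • b n) {T : ℝ} (hT : 0 ≤ T) {G : ℝ → X} {z : ℝ → Phase ι}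
    (hG : ContinuousOn G (Icc 0 T))
    (hz : IsDuhamel (rot w) T (fun t => mk e b (0, G t)) z) {B : ℝ → E} {Bt : ℝ → X}
    (hB : MemLp B 2 (volume.restrict (Ioo 0 T))) (hBt : MemLp Bt 2 (volume.restrict (Ioo 0 T)))
    (hBB : ∀ᵐ t ∂volume.restrict (Ioo 0 T), i (B t) = -∫ s in t..T, Bt s) :
    (∫ t in (0 : ℝ)..T, inner ℝ (veloc b (z t)) (Bt t)) +
        inner ℝ (veloc b (z 0)) (-∫ s in (0 : ℝ)..T, Bt s) =
      (∫ t in (0 : ℝ)..T, inner ℝ (displ e (z t)) (B t)) -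
        ∫ t in (0 : ℝ)..T, inner ℝ (G t) (i (B t)) := by
  have hU := isIsometricGroup_rot w
  have hzc := hz.continuousOn hU
  have hBti := intervalIntegrable_of_memLp hT (by norm_num) hBt
  have hiB : MemLp (fun t => i (B t)) 2 (volume.restrict (Ioo 0 T)) := i.comp_memLp' hB
  have s1 := b.hasSum_integral_inner
    (memLp_of_continuousOn ((veloc b).continuous.comp_continuousOn hzc) 2) hBt
  have s2 := b.hasSum_inner_mul_inner (veloc b (z 0)) (-∫ s in (0 : ℝ)..T, Bt s)
  have s3 := e.hasSum_integral_inner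
    (memLp_of_continuousOn ((displ e).continuous.comp_continuousOn hzc) 2) hB
  have s4 := b.hasSum_integral_inner (memLp_of_continuousOn hG 2) hiB
  simp only [intervalIntegral_eq_integral_Ioo hT] at s2 ⊢
  -- All integrals have been expanded by Parseval; it remains to prove the identity in one mode.
  refine (s1.add s2).tsum_eq.symm.trans ((tsum_congr fun n => ?_).trans (s3.sub s4).tsum_eq)
  simp only [← intervalIntegral_eq_integral_Ioo hT]
  simp only [Function.comp, inner_veloc, inner_displ]
  rw [real_inner_comm, inner_veloc]
  have hBn : IntervalIntegrable (fun t => inner ℝ (b n) (Bt t)) volume 0 T :=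
    ⟨(innerSL ℝ (b n)).integrable_comp hBti.1, (innerSL ℝ (b n)).integrable_comp hBti.2⟩
  have hcomm : ∀ t ∈ Icc 0 T, inner ℝ (b n) (-∫ s in t..T, Bt s) =
      -(∫ s in (0 : ℝ)..T, inner ℝ (b n) (Bt s)) + ∫ s in (0 : ℝ)..t, inner ℝ (b n) (Bt s) := by
    intro t ht
    have hsub1 : uIcc 0 t ⊆ uIcc 0 T := by
      rw [uIcc_of_le ht.1, uIcc_of_le hT]; exact Icc_subset_Icc_right ht.2
    have hsub2 : uIcc t T ⊆ uIcc 0 T := by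
      rw [uIcc_of_le ht.2, uIcc_of_le hT]; exact Icc_subset_Icc_left ht.1
    rw [← intervalIntegral.integral_add_adjacent_intervals (hBn.mono_set hsub1)
      (hBn.mono_set hsub2), inner_neg_right]
    have := (innerSL ℝ (b n)).intervalIntegral_comp_comm (hBti.mono_set hsub2)
    simp only [innerSL_apply_apply] at this
    rw [← this]; ring
  have hcont_re := Complex.continuous_re.comp_continuousOn (continuousOn_apply hzc n)
  have hcont_im := Complex.continuous_im.comp_continuousOn (continuousOn_apply hzc n)
  have hcG : ContinuousOn (fun t => inner ℝ (b n) (G t)) (Icc 0 T) := continuousOn_const.inner hG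
  have hv'c : ContinuousOn (fun t => -(w n * (z t n).re) + inner ℝ (b n) (G t)) (Icc 0 T) :=
    (continuousOn_const.mul hcont_re).neg.add hcG
  have hv : ∀ t ∈ Icc 0 T, (z t n).im = (z 0 n).im +
      ∫ s in (0 : ℝ)..t, (-(w n * (z s n).re) + inner ℝ (b n) (G s)) := fun t ht =>
    integral_of_hasDerivWithinAt (fun t ht => (hasDerivWithinAt_modes hz ht n).2) hv'c ht
  -- `β` is the continuous representative of the mode of the test function, equal to `-∫_t^T ⟨b_n,
  -- Bt⟩`. It vanishes at `T`, so integration by parts against the velocity leaves only the boundary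
  -- term at `0`.
  let β : ℝ → ℝ := fun t => -(∫ s in (0 : ℝ)..T, inner ℝ (b n) (Bt s)) +
    ∫ s in (0 : ℝ)..t, inner ℝ (b n) (Bt s)
  have hβ : ∀ t ∈ Icc 0 T, β t = β 0 + ∫ s in (0 : ℝ)..t, inner ℝ (b n) (Bt s) := by
    intro t _; simp [β]
  have hv'i : IntervalIntegrable (fun t => -(w n * (z t n).re) + inner ℝ (b n) (G t)) volume 0 T := by
    rw [← uIcc_of_le hT] at hv'c; exact hv'c.intervalIntegrable
  have hibp := integral_mul_add_mul_of_primitive hT hv'i hBn (F := fun t => (z t n).im) (G := β) hv hβ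
  have hβT : β T = 0 := by simp [β]
  have hβ0 : β 0 = inner ℝ (b n) (-∫ s in (0 : ℝ)..T, Bt s) := by
    rw [hcomm 0 ⟨le_rfl, hT⟩]
  have hβc : ContinuousOn β (uIcc 0 T) := continuousOn_const_add_primitive _ hBn
  have hi1 : IntervalIntegrable (fun t => (-(w n * (z t n).re) + inner ℝ (b n) (G t)) * β t)
      volume 0 T := hv'i.mul_continuousOn hβc
  have hi2 : IntervalIntegrable (fun t => (z t n).im * inner ℝ (b n) (Bt t)) volume 0 T :=
    hBn.continuousOn_mul (by rw [uIcc_of_le hT]; exact hcont_im)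
  rw [intervalIntegral.integral_add hi1 hi2, hβT, hβ0] at hibp
  have hae : ∀ᵐ t ∂volume.restrict (Ioo 0 T), inner ℝ (b n) (i (B t)) = β t := by
    filter_upwards [hBB, ae_restrict_mem measurableSet_Ioo] with t ht ht'
    rw [ht, hcomm t (Ioo_subset_Icc_self ht')]
  have hsplit : ∫ t in (0 : ℝ)..T, (-(w n * (z t n).re) + inner ℝ (b n) (G t)) * β t =
      -(∫ t in (0 : ℝ)..T, (z t n).re * inner ℝ (e n) (B t)) +
        ∫ t in (0 : ℝ)..T, inner ℝ (b n) (G t) * inner ℝ (b n) (i (B t)) := by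
    -- The energy coordinate of the test function is `w_n` times its inertia coordinate.
    have e1 : ∫ t in (0 : ℝ)..T, (z t n).re * inner ℝ (e n) (B t) =
        ∫ t in (0 : ℝ)..T, w n * (z t n).re * β t := by
      rw [intervalIntegral_eq_integral_Ioo hT, intervalIntegral_eq_integral_Ioo hT]
      refine integral_congr_ae ?_
      filter_upwards [hae] with t ht
      rw [← ht, inner_embedding hi]
      have := (hw n).ne'
      field_simp
    have e2 : ∫ t in (0 : ℝ)..T, inner ℝ (b n) (G t) * inner ℝ (b n) (i (B t)) =
        ∫ t in (0 : ℝ)..T, inner ℝ (b n) (G t) * β t := by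
      rw [intervalIntegral_eq_integral_Ioo hT, intervalIntegral_eq_integral_Ioo hT]
      refine integral_congr_ae ?_
      filter_upwards [hae] with t ht
      rw [ht]
    have c1 : IntervalIntegrable (fun t => w n * (z t n).re * β t) volume 0 T := by
      refine ContinuousOn.intervalIntegrable (ContinuousOn.mul ?_ hβc)
      rw [uIcc_of_le hT]; exact continuousOn_const.mul hcont_re
    have c2 : IntervalIntegrable (fun t => inner ℝ (b n) (G t) * β t) volume 0 T := by
      refine ContinuousOn.intervalIntegrable (ContinuousOn.mul ?_ hβc)
      rw [uIcc_of_le hT]; exact hcG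
    rw [e1, e2, neg_add_eq_sub, ← intervalIntegral.integral_sub c2 c1]
    refine intervalIntegral.integral_congr fun t _ => ?_
    simp only
    ring
  rw [hsplit] at hibp
  linarith

end Phase
end

/-! ### Weak solutions are given by the Duhamel formula -/

noncomputable section

set_option linter.unusedSectionVars false

namespace Phase

variable {ι : Type*} {E X : Type*} [NormedAddCommGroup E] [InnerProductSpace ℝ E]
  [NormedAddCommGroup X] [InnerProductSpace ℝ X] [CompleteSpace X]
  {e : HilbertBasis ι ℝ E} {b : HilbertBasis ι ℝ X} {w : ι → ℝ} {i : E →L[ℝ] X}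

/-- The embedded displacement is the primitive of the velocity. -/
theorem embedding_displ_eq_integral (hw : ∀ n, 0 < w n) (hi : ∀ n, i (e n) = (w n)⁻¹ • b n) {T : ℝ}
    {G : ℝ → X} {z : ℝ → Phase ι} (hz : IsDuhamel (rot w) T (fun t => mk e b (0, G t)) z) {t : ℝ}
    (ht : t ∈ Icc 0 T) :
    i (displ e (z t)) = i (displ e (z 0)) + ∫ s in (0 : ℝ)..t, veloc b (z s) := by
  have hzc := hz.continuousOn (isIsometricGroup_rot w)
  refine b.ext_inner fun n => ?_
  have hvc : ContinuousOn (fun s => veloc b (z s)) (uIcc 0 t) :=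
    (veloc b).continuous.comp_continuousOn (hzc.mono (by
      rw [uIcc_of_le ht.1]; exact Icc_subset_Icc_right ht.2))
  have h1 := (innerSL ℝ (b n)).intervalIntegral_comp_comm (hvc.intervalIntegrable (μ := volume))
  simp only [innerSL_apply_apply, inner_veloc] at h1
  have hcont_im := Complex.continuous_im.comp_continuousOn (continuousOn_apply hzc n)
  have h2 := integral_of_hasDerivWithinAt (fun t ht => (hasDerivWithinAt_modes hz ht n).1)
    (continuousOn_const.mul hcont_im) ht
  rw [inner_add_right, inner_embedding hi, inner_embedding hi, inner_displ, inner_displ, ← h1, h2]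
  rw [intervalIntegral.integral_const_mul]
  have := (hw n).ne'
  field_simp

/-- The displacement is differentiable in time only after passage to the weaker space `X`. This
suffices for the potential energy, which is estimated in the norm of `X`. -/
theorem hasDerivWithinAt_embedding_displ (hw : ∀ n, 0 < w n) (hi : ∀ n, i (e n) = (w n)⁻¹ • b n)
    {T : ℝ} {G : ℝ → X} {z : ℝ → Phase ι} (hz : IsDuhamel (rot w) T (fun t => mk e b (0, G t)) z)
    {t : ℝ} (ht : t ∈ Icc 0 T) :
    HasDerivWithinAt (fun t => i (displ e (z t))) (veloc b (z t)) (Icc 0 T) t := by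
  have hzc := hz.continuousOn (isIsometricGroup_rot w)
  have hvc : ContinuousOn (fun s => veloc b (z s)) (Icc 0 T) :=
    (veloc b).continuous.comp_continuousOn hzc
  have hd : HasDerivWithinAt (fun t => i (displ e (z 0)) + ∫ s in (0 : ℝ)..t, veloc b (z s))
      (veloc b (z t)) (Icc 0 T) t := by
    have : Fact (t ∈ Icc 0 T) := ⟨ht⟩
    refine (intervalIntegral.integral_hasDerivWithinAt_right ?_
      (hvc.stronglyMeasurableAtFilter_nhdsWithin measurableSet_Icc t) (hvc t ht)).const_add _
    refine (hvc.mono ?_).intervalIntegrable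
    rw [uIcc_of_le ht.1]; exact Icc_subset_Icc_right ht.2
  exact hd.congr (fun s hs => embedding_displ_eq_integral hw hi hz hs)
    (embedding_displ_eq_integral hw hi hz ht)

theorem cos_sin_primitive (c t : ℝ) :
    Real.cos (c * t) = Real.cos (c * 0) + ∫ s in (0 : ℝ)..t, -(c * Real.sin (c * s)) ∧
      Real.sin (c * t) = Real.sin (c * 0) + ∫ s in (0 : ℝ)..t, c * Real.cos (c * s) := by
  have h0 : ∀ s : ℝ, HasDerivAt (fun s => c * s) c s := fun s => by
    simpa using (hasDerivAt_id s).const_mul c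
  constructor
  · rw [intervalIntegral.integral_eq_sub_of_hasDerivAt (f := fun s => Real.cos (c * s))
      (fun s _ => ((h0 s).cos).congr_deriv (by ring))
      (Continuous.intervalIntegrable (by fun_prop) _ _)]
    ring
  · rw [intervalIntegral.integral_eq_sub_of_hasDerivAt (f := fun s => Real.sin (c * s))
      (fun s _ => ((h0 s).sin).congr_deriv (by ring))
      (Continuous.intervalIntegrable (by fun_prop) _ _)]
    ring

/-- Variation of constants for a forced harmonic oscillator with integrable forcing. -/
theorem oscillator_variation_of_constants {T c : ℝ} {x v g : ℝ → ℝ} {x₀ v₀ : ℝ} (hT : 0 ≤ T)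
    (hx : IntervalIntegrable x volume 0 T) (hv : IntervalIntegrable v volume 0 T)
    (hg : IntervalIntegrable g volume 0 T)
    (hxe : ∀ᵐ t ∂volume.restrict (Ioo 0 T), x t = x₀ + ∫ s in (0 : ℝ)..t, c * v s)
    (hve : ∀ᵐ t ∂volume.restrict (Ioo 0 T), v t = v₀ + ∫ s in (0 : ℝ)..t, (-(c * x s) + g s)) :
    ∀ᵐ t ∂volume.restrict (Ioo 0 T),
      Real.cos (c * t) * x t - Real.sin (c * t) * v t =
          x₀ + ∫ s in (0 : ℝ)..t, -(Real.sin (c * s) * g s) ∧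
        Real.sin (c * t) * x t + Real.cos (c * t) * v t =
          v₀ + ∫ s in (0 : ℝ)..t, Real.cos (c * s) * g s := by
  -- `x` and `v` are known only almost everywhere; `a` and `u` are their continuous representatives,
  -- to which integration by parts applies.
  let a : ℝ → ℝ := fun t => x₀ + ∫ s in (0 : ℝ)..t, c * v s
  let u : ℝ → ℝ := fun t => v₀ + ∫ s in (0 : ℝ)..t, (-(c * x s) + g s)
  have ha' : IntervalIntegrable (fun s => c * v s) volume 0 T := hv.const_mul c
  have hu' : IntervalIntegrable (fun s => -(c * x s) + g s) volume 0 T := (hx.const_mul c).neg.add hg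
  have hxe' : ∀ᵐ t, t ∈ Ioo 0 T → x t = a t := (ae_restrict_iff' measurableSet_Ioo).1 hxe
  have hve' : ∀ᵐ t, t ∈ Ioo 0 T → v t = u t := (ae_restrict_iff' measurableSet_Ioo).1 hve
  filter_upwards [hxe, hve, ae_restrict_mem measurableSet_Ioo] with t h1 h2 ht
  have htI : t ∈ Icc 0 T := Ioo_subset_Icc_self ht
  have hsub : uIcc 0 t ⊆ uIcc 0 T := by
    rw [uIcc_of_le htI.1, uIcc_of_le hT]; exact Icc_subset_Icc_right htI.2
  have hat := ha'.mono_set hsub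
  have hut := hu'.mono_set hsub
  have hgt := hg.mono_set hsub
  have hac : ContinuousOn a (uIcc 0 t) := continuousOn_const_add_primitive x₀ hat
  have huc : ContinuousOn u (uIcc 0 t) := continuousOn_const_add_primitive v₀ hut
  have haP : ∀ s ∈ Icc 0 t, a s = a 0 + ∫ r in (0 : ℝ)..s, c * v r := fun s _ => by simp [a]
  have huP : ∀ s ∈ Icc 0 t, u s = u 0 + ∫ r in (0 : ℝ)..s, (-(c * x r) + g r) := fun s _ => by
    simp [u]
  have hci : IntervalIntegrable (fun s => -(c * Real.sin (c * s))) volume 0 t :=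
    Continuous.intervalIntegrable (by fun_prop) _ _
  have hsi : IntervalIntegrable (fun s => c * Real.cos (c * s)) volume 0 t :=
    Continuous.intervalIntegrable (by fun_prop) _ _
  have hcc : ContinuousOn (fun s => Real.cos (c * s)) (uIcc 0 t) := by fun_prop
  have hsc : ContinuousOn (fun s => Real.sin (c * s)) (uIcc 0 t) := by fun_prop
  -- Rotating `(x, v)` back by the angle `c t` removes the oscillator: in the derivatives of the two
  -- combinations only the terms with `g` survive. The four identities are the products needed for
  -- these combinations.
  have e1 := integral_mul_add_mul_of_primitive htI.1 hci hat
    (F := fun s => Real.cos (c * s)) (G := a) (fun s _ => (cos_sin_primitive c s).1) haP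
  have e2 := integral_mul_add_mul_of_primitive htI.1 hsi hut
    (F := fun s => Real.sin (c * s)) (G := u) (fun s _ => (cos_sin_primitive c s).2) huP
  have e3 := integral_mul_add_mul_of_primitive htI.1 hsi hat
    (F := fun s => Real.sin (c * s)) (G := a) (fun s _ => (cos_sin_primitive c s).2) haP
  have e4 := integral_mul_add_mul_of_primitive htI.1 hci hut
    (F := fun s => Real.cos (c * s)) (G := u) (fun s _ => (cos_sin_primitive c s).1) huP
  have i1 := (hci.mul_continuousOn hac).add (hat.continuousOn_mul hcc)
  have i2 := (hsi.mul_continuousOn huc).add (hut.continuousOn_mul hsc)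
  have i3 := (hsi.mul_continuousOn hac).add (hat.continuousOn_mul hsc)
  have i4 := (hci.mul_continuousOn huc).add (hut.continuousOn_mul hcc)
  have d1 := intervalIntegral.integral_sub i1 i2
  have d2 := intervalIntegral.integral_add i3 i4
  have ha0 : a 0 = x₀ := by simp [a]
  have hu0 : u 0 = v₀ := by simp [u]
  have hat' : a t = x t := h1.symm
  have hut' : u t = v t := h2.symm
  rw [hat', ha0] at e1 e3
  rw [hut', hu0] at e2 e4
  simp only [mul_zero, Real.cos_zero, Real.sin_zero, one_mul, zero_mul, sub_zero] at e1 e2 e3 e4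
  constructor
  · have : ∫ s in (0 : ℝ)..t, -(Real.sin (c * s) * g s) =
        (Real.cos (c * t) * x t - x₀) - Real.sin (c * t) * v t := by
      rw [← e1, ← e2]
      refine Eq.trans ?_ d1
      refine intervalIntegral.integral_congr_ae ?_
      filter_upwards [hxe', hve'] with s hs1 hs2 hs
      rw [uIoc_of_le htI.1] at hs
      have hs' : s ∈ Ioo 0 T := ⟨hs.1, hs.2.trans_lt ht.2⟩
      simp only [← hs1 hs', ← hs2 hs']
      ring
    rw [this]; ring
  · have : ∫ s in (0 : ℝ)..t, Real.cos (c * s) * g s =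
        Real.sin (c * t) * x t + (Real.cos (c * t) * v t - v₀) := by
      rw [← e3, ← e4]
      refine Eq.trans ?_ d2
      refine intervalIntegral.integral_congr_ae ?_
      filter_upwards [hxe', hve'] with s hs1 hs2 hs
      rw [uIoc_of_le htI.1] at hs
      have hs' : s ∈ Ioo 0 T := ⟨hs.1, hs.2.trans_lt ht.2⟩
      simp only [← hs1 hs', ← hs2 hs']
      ring
    rw [this]; ring

theorem rot_apply_re_im (w : ι → ℝ) (t : ℝ) (z : Phase ι) (n : ι) :
    (rot w t z n).re = Real.cos (w n * t) * (z n).re + Real.sin (w n * t) * (z n).im ∧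
      (rot w t z n).im = -(Real.sin (w n * t) * (z n).re) + Real.cos (w n * t) * (z n).im := by
  rw [rot_apply, Complex.mul_re, Complex.mul_im, Complex.exp_ofReal_mul_I_re,
    Complex.exp_ofReal_mul_I_im, Real.cos_neg, Real.sin_neg]
  constructor <;> ring

/-- If `v` satisfies the once integrated variational equation of a mode against all test functions,
then it is the primitive of its formal derivative. -/
theorem ae_eq_primitive_of_forall_integral {T : ℝ} (hT : 0 ≤ T) {v k : ℝ → ℝ} {v₀ : ℝ}
    (hv : MemLp v ∞ (volume.restrict (Ioo 0 T))) (hk : MemLp k ∞ (volume.restrict (Ioo 0 T)))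
    (h : ∀ θ : ℝ → ℝ, MemLp θ 2 (volume.restrict (Ioo 0 T)) →
      -(∫ t in (0 : ℝ)..T, v t * θ t) + v₀ * (∫ t in (0 : ℝ)..T, θ t) +
        ∫ t in (0 : ℝ)..T, k t * (-∫ s in t..T, θ s) = 0) :
    ∀ᵐ t ∂volume.restrict (Ioo 0 T), v t = v₀ + ∫ s in (0 : ℝ)..t, -k s := by
  have hvi := intervalIntegrable_of_memLp hT (by simp) hv
  have hki := intervalIntegrable_of_memLp hT (by simp) hk
  have hPc : ContinuousOn (fun t => v₀ + ∫ s in (0 : ℝ)..t, -k s) (Icc 0 T) := by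
    have := continuousOn_const_add_primitive v₀ hki.neg
    rwa [uIcc_of_le hT] at this
  -- The test function is the difference of the two sides of the claim; the variational identity
  -- then says that the integral of its square vanishes.
  set θ : ℝ → ℝ := fun t => v t - (v₀ + ∫ s in (0 : ℝ)..t, -k s) with hθ
  have hθ2 : MemLp θ 2 (volume.restrict (Ioo 0 T)) :=
    (hv.mono_exponent le_top).sub (memLp_of_continuousOn hPc 2)
  have hθi := intervalIntegrable_of_memLp hT (by norm_num) hθ2
  have h1 := h θ hθ2
  have hkn : IntervalIntegrable (fun t => -k t) volume 0 T := hki.neg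
  have hibp := integral_mul_add_mul_of_primitive hT hkn hθi
    (F := fun t => v₀ + ∫ s in (0 : ℝ)..t, -k s)
    (G := fun t => -(∫ s in (0 : ℝ)..T, θ s) + ∫ s in (0 : ℝ)..t, θ s)
    (fun t _ => by simp) (fun t _ => by simp)
  have hcomm : ∀ t ∈ Icc 0 T, -∫ s in t..T, θ s =
      -(∫ s in (0 : ℝ)..T, θ s) + ∫ s in (0 : ℝ)..t, θ s := by
    intro t ht
    have hsub1 : uIcc 0 t ⊆ uIcc 0 T := by
      rw [uIcc_of_le ht.1, uIcc_of_le hT]; exact Icc_subset_Icc_right ht.2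
    have hsub2 : uIcc t T ⊆ uIcc 0 T := by
      rw [uIcc_of_le ht.2, uIcc_of_le hT]; exact Icc_subset_Icc_left ht.1
    rw [← intervalIntegral.integral_add_adjacent_intervals (hθi.mono_set hsub1)
      (hθi.mono_set hsub2)]
    ring
  have hkθ : ∫ t in (0 : ℝ)..T, k t * (-∫ s in t..T, θ s) =
      ∫ t in (0 : ℝ)..T, k t * (-(∫ s in (0 : ℝ)..T, θ s) + ∫ s in (0 : ℝ)..t, θ s) := by
    refine intervalIntegral.integral_congr fun t ht => ?_
    rw [uIcc_of_le hT] at ht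
    rw [hcomm t ht]
  have hGc : ContinuousOn (fun t => -(∫ s in (0 : ℝ)..T, θ s) + ∫ s in (0 : ℝ)..t, θ s) (uIcc 0 T) :=
    continuousOn_const_add_primitive _ hθi
  have j1 : IntervalIntegrable (fun t => -k t * (-(∫ s in (0 : ℝ)..T, θ s) +
      ∫ s in (0 : ℝ)..t, θ s)) volume 0 T := hki.neg.mul_continuousOn hGc
  have j2 : IntervalIntegrable (fun t => (v₀ + ∫ s in (0 : ℝ)..t, -k s) * θ t) volume 0 T :=
    hθi.continuousOn_mul (by rwa [uIcc_of_le hT])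
  rw [intervalIntegral.integral_add j1 j2] at hibp
  simp only [neg_mul, intervalIntegral.integral_neg, intervalIntegral.integral_same,
    neg_add_cancel, mul_zero, add_zero, mul_neg, zero_sub, neg_neg] at hibp
  rw [hkθ] at h1
  have j3 : IntervalIntegrable (fun t => v t * θ t) volume 0 T := by
    rw [intervalIntegrable_iff_integrableOn_Ioo_of_le hT]
    have hv2 : MemLp v 2 (volume.restrict (Ioo 0 T)) := hv.mono_exponent le_top
    exact hv2.integrable_mul hθ2
  have hsq : ∫ t in (0 : ℝ)..T, θ t * θ t = 0 := by
    have : ∀ t, θ t * θ t = v t * θ t - (v₀ + ∫ s in (0 : ℝ)..t, -k s) * θ t := fun t => by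
      simp only [hθ]; ring
    simp only [this]
    rw [intervalIntegral.integral_sub j3 j2]
    simp only [intervalIntegral.integral_neg]
    linarith
  rw [intervalIntegral_eq_integral_Ioo hT, integral_eq_zero_iff_of_nonneg
    (fun t => mul_self_nonneg _) (hθ2.integrable_mul hθ2)] at hsq
  filter_upwards [hsq] with t ht
  have := mul_self_eq_zero.1 ht
  simp only [hθ] at this
  linarith

/-- Variational solutions with bounded forcing are given by the Duhamel formula. -/
theorem ae_eq_duhamel_of_weak [Countable ι] (hw : ∀ n, 0 < w n)
    (hi : ∀ n, i (e n) = (w n)⁻¹ • b n) {T : ℝ} (hT : 0 ≤ T) {Φ : ℝ → E} {V G : ℝ → X}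
    {Φ₀ : E} {V₀ : X} (hΦ : MemLp Φ ∞ (volume.restrict (Ioo 0 T)))
    (hV : MemLp V ∞ (volume.restrict (Ioo 0 T))) (hG : MemLp G ∞ (volume.restrict (Ioo 0 T)))
    (hΦV : ∀ᵐ t ∂volume.restrict (Ioo 0 T), i (Φ t) = i Φ₀ + ∫ s in (0 : ℝ)..t, V s)
    (hvar : ∀ (B : ℝ → E) (Bt : ℝ → X), MemLp B 2 (volume.restrict (Ioo 0 T)) →
      MemLp Bt 2 (volume.restrict (Ioo 0 T)) →
      (∀ᵐ t ∂volume.restrict (Ioo 0 T), i (B t) = -∫ s in t..T, Bt s) →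
      (∫ t in (0 : ℝ)..T, inner ℝ (V t) (Bt t)) + inner ℝ V₀ (-∫ s in (0 : ℝ)..T, Bt s) =
        (∫ t in (0 : ℝ)..T, inner ℝ (Φ t) (B t)) - ∫ t in (0 : ℝ)..T, inner ℝ (G t) (i (B t))) :
    IntervalIntegrable (fun s => rot w (-s) (mk e b (0, G s))) volume 0 T ∧
    ∀ᵐ t ∂volume.restrict (Ioo 0 T), mk e b (Φ t, V t) =
      rot w t (mk e b (Φ₀, V₀) + ∫ s in (0 : ℝ)..t, rot w (-s) (mk e b (0, G s))) := by
  have hU := isIsometricGroup_rot w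
  have hint : IntervalIntegrable (fun s => rot w (-s) (mk e b (0, G s))) volume 0 T := by
    have h0 : Continuous fun x : X => mk e b (0, x) :=
      (equivProd e b).symm.continuous.comp (Continuous.prodMk_right (0 : E))
    have h1 : AEStronglyMeasurable (fun s => mk e b (0, G s)) (volume.restrict (Ioo 0 T)) :=
      h0.comp_aestronglyMeasurable hG.1
    have h2 : AEStronglyMeasurable (fun s => rot w (-s) (mk e b (0, G s)))
        (volume.restrict (Ioo 0 T)) :=
      hU.continuous_uncurry.comp_aestronglyMeasurable (f := fun s => (-s, mk e b (0, G s)))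
        (continuous_neg.aestronglyMeasurable.prodMk h1)
    refine intervalIntegrable_of_memLp hT (p := ∞) (by simp) (hG.of_le h2 (ae_of_all _ fun s => ?_))
    rw [LinearIsometry.norm_map]
    refine le_of_sq_le_sq ?_ (norm_nonneg _)
    rw [norm_sq_eq e b]; simp
  refine ⟨hint, ?_⟩
  have hmode : ∀ n, ∀ᵐ t ∂volume.restrict (Ioo 0 T),
      (rot w (-t) (mk e b (Φ t, V t))) n =
        (mk e b (Φ₀, V₀) + ∫ s in (0 : ℝ)..t, rot w (-s) (mk e b (0, G s))) n := by
    intro n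
    have hΦn : MemLp (fun t => inner ℝ (e n) (Φ t)) ∞ (volume.restrict (Ioo 0 T)) :=
      (innerSL ℝ (e n)).comp_memLp' hΦ
    have hVn : MemLp (fun t => inner ℝ (b n) (V t)) ∞ (volume.restrict (Ioo 0 T)) :=
      (innerSL ℝ (b n)).comp_memLp' hV
    have hGn : MemLp (fun t => inner ℝ (b n) (G t)) ∞ (volume.restrict (Ioo 0 T)) :=
      (innerSL ℝ (b n)).comp_memLp' hG
    have hk : MemLp (fun t => w n * inner ℝ (e n) (Φ t) - inner ℝ (b n) (G t)) ∞
        (volume.restrict (Ioo 0 T)) := (hΦn.const_mul (w n)).sub hGn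
    have hwn := (hw n).ne'
    have hve := ae_eq_primitive_of_forall_integral hT hVn hk (v₀ := inner ℝ (b n) V₀) (by
      intro θ hθ
      have hθi := intervalIntegrable_of_memLp hT (by norm_num) hθ
      have hc : ContinuousOn (fun t => ∫ s in t..T, θ s) (Icc 0 T) := by
        have := continuousOn_const_add_primitive (∫ s in (0 : ℝ)..T, θ s) (hθi.neg)
        rw [uIcc_of_le hT] at this
        refine this.congr fun t ht => ?_
        have hsub1 : uIcc 0 t ⊆ uIcc 0 T := by
          rw [uIcc_of_le ht.1, uIcc_of_le hT]; exact Icc_subset_Icc_right ht.2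
        have hsub2 : uIcc t T ⊆ uIcc 0 T := by
          rw [uIcc_of_le ht.2, uIcc_of_le hT]; exact Icc_subset_Icc_left ht.1
        rw [← intervalIntegral.integral_add_adjacent_intervals (hθi.mono_set hsub1)
          (hθi.mono_set hsub2)]
        simp
      -- Test functions concentrated on a single mode. The factor `w_n` compensates `i e_n = w_n⁻¹
      -- b_n`, so that the time derivative is exactly `θ b_n`.
      have hB : MemLp (fun t => (w n * -∫ s in t..T, θ s) • e n) 2 (volume.restrict (Ioo 0 T)) :=
        memLp_of_continuousOn ((continuousOn_const.mul hc.neg).smul continuousOn_const) 2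
      have hBt : MemLp (fun t => θ t • b n) 2 (volume.restrict (Ioo 0 T)) := by
        refine hθ.of_le (hθ.1.smul_const _) (ae_of_all _ fun t => ?_)
        rw [norm_smul, b.orthonormal.1 n, mul_one]
      have hiB : ∀ t, i ((w n * -∫ s in t..T, θ s) • e n) = (-∫ s in t..T, θ s) • b n := by
        intro t
        rw [map_smul, hi, smul_smul]
        congr 1
        field_simp
      have h := hvar _ _ hB hBt (ae_of_all _ fun t => by
        rw [hiB, intervalIntegral.integral_smul_const, neg_smul])
      simp only [hiB, intervalIntegral.integral_smul_const, inner_smul_right, inner_neg_right,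
        real_inner_comm (b n), real_inner_comm (e n)] at h
      have j1 : IntervalIntegrable (fun t => w n * (-∫ s in t..T, θ s) * inner ℝ (e n) (Φ t))
          volume 0 T :=
        (intervalIntegrable_of_memLp hT (by simp) hΦn).continuousOn_mul (by
          rw [uIcc_of_le hT]; exact continuousOn_const.mul hc.neg)
      have j2 : IntervalIntegrable (fun t => (-∫ s in t..T, θ s) * inner ℝ (b n) (G t))
          volume 0 T :=
        (intervalIntegrable_of_memLp hT (by simp) hGn).continuousOn_mul (by
          rw [uIcc_of_le hT]; exact hc.neg)
      rw [← intervalIntegral.integral_sub j1 j2] at h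
      have hl : ∀ t, (w n * inner ℝ (e n) (Φ t) - inner ℝ (b n) (G t)) * (-∫ s in t..T, θ s) =
        w n * (-∫ s in t..T, θ s) * inner ℝ (e n) (Φ t) -
          (-∫ s in t..T, θ s) * inner ℝ (b n) (G t) := fun t => by ring
      have hl' : ∀ t, inner ℝ (b n) (V t) * θ t = θ t * inner ℝ (b n) (V t) := fun t => mul_comm _ _
      simp only [hl, hl']
      linarith)
    have hxe : ∀ᵐ t ∂volume.restrict (Ioo 0 T), inner ℝ (e n) (Φ t) =
        inner ℝ (e n) Φ₀ + ∫ s in (0 : ℝ)..t, w n * inner ℝ (b n) (V s) := by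
      filter_upwards [hΦV, ae_restrict_mem measurableSet_Ioo] with t h1 ht
      have hVi := (intervalIntegrable_of_memLp hT (by simp) hV).mono_set (c := 0) (d := t) (by
        rw [uIcc_of_le ht.1.le, uIcc_of_le hT]; exact Icc_subset_Icc_right ht.2.le)
      have h2 := congrArg (fun x => inner ℝ (b n) x) h1
      have h3 := (innerSL ℝ (b n)).intervalIntegral_comp_comm hVi
      simp only [innerSL_apply_apply] at h3
      simp only [inner_add_right, inner_embedding hi, ← h3] at h2
      rw [intervalIntegral.integral_const_mul]
      field_simp at h2
      linarith
    have hosc := oscillator_variation_of_constants hT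
      (intervalIntegrable_of_memLp hT (by simp) hΦn) (intervalIntegrable_of_memLp hT (by simp) hVn)
      (intervalIntegrable_of_memLp hT (by simp) hGn) hxe (v₀ := inner ℝ (b n) V₀) (by
        filter_upwards [hve] with t ht
        rw [ht]
        congr 1
        refine intervalIntegral.integral_congr fun s _ => ?_
        ring)
    filter_upwards [hosc, ae_restrict_mem measurableSet_Ioo] with t h1 ht
    have hit := hint.mono_set (c := 0) (d := t) (by
      rw [uIcc_of_le ht.1.le, uIcc_of_le hT]; exact Icc_subset_Icc_right ht.2.le)
    have hr : ∫ s in (0 : ℝ)..t, (rot w (-s) (mk e b (0, G s)) n).re =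
        ((∫ s in (0 : ℝ)..t, rot w (-s) (mk e b (0, G s)) : Phase ι) n).re :=
      (Complex.reCLM.comp
        (lp.evalCLM ℝ (fun _ : ι => ℂ) (p := 2) n)).intervalIntegral_comp_comm hit
    have hm : ∫ s in (0 : ℝ)..t, (rot w (-s) (mk e b (0, G s)) n).im =
        ((∫ s in (0 : ℝ)..t, rot w (-s) (mk e b (0, G s)) : Phase ι) n).im :=
      (Complex.imCLM.comp
        (lp.evalCLM ℝ (fun _ : ι => ℂ) (p := 2) n)).intervalIntegral_comp_comm hit
    rw [lp.coeFn_add, Pi.add_apply]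
    apply Complex.ext
    · rw [Complex.add_re, ← hr, (rot_apply_re_im w _ _ n).1, mk_re, mk_im, mk_re]
      simp only [(rot_apply_re_im w _ _ n).1, mk_re, mk_im, inner_zero_right, mul_neg, Real.cos_neg,
        Real.sin_neg, mul_zero, zero_add, neg_mul]
      linarith [h1.1]
    · rw [Complex.add_im, ← hm, (rot_apply_re_im w _ _ n).2, mk_re, mk_im, mk_im]
      simp only [(rot_apply_re_im w _ _ n).2, mk_re, mk_im, inner_zero_right, mul_neg, Real.cos_neg,
        Real.sin_neg, mul_zero, zero_add, neg_mul, neg_zero, neg_neg]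
      linarith [h1.2]
  -- Countably many modes share one null set of exceptional times.
  filter_upwards [ae_all_iff.2 hmode] with t ht
  have : rot w (-t) (mk e b (Φ t, V t)) =
      mk e b (Φ₀, V₀) + ∫ s in (0 : ℝ)..t, rot w (-s) (mk e b (0, G s)) := lp.ext (funext ht)
  rw [← this, hU.apply_neg]

end Phase
end

/-! ### Primitives on an interval and `L²` estimates -/

noncomputable section

/-- `F` is on `[a, b]` a primitive of the integrable function `f`. -/
structure IsPrimitiveOn (a b : ℝ) (F f : ℝ → ℝ) : Prop where
  le : a ≤ b
  integrable : IntervalIntegrable f volume a b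
  eq : ∀ x ∈ Icc a b, F x = F a + ∫ t in a..x, f t

namespace IsPrimitiveOn

variable {a b : ℝ} {F f G g : ℝ → ℝ}

theorem integrable_sub (h : IsPrimitiveOn a b F f) {x y : ℝ} (hx : x ∈ Icc a b) (hy : y ∈ Icc a b) :
    IntervalIntegrable f volume x y :=
  h.integrable.mono_set (by
    rw [uIcc_of_le (hx.1.trans hx.2)]
    exact uIcc_subset_Icc hx hy)

theorem continuousOn (h : IsPrimitiveOn a b F f) : ContinuousOn F (Icc a b) :=
   continuousOn_of_primitive h.le h.integrable h.eq

theorem sub_eq (h : IsPrimitiveOn a b F f) {x y : ℝ} (hx : x ∈ Icc a b) (hy : y ∈ Icc a b) :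
    F y - F x = ∫ t in x..y, f t := by
  have ha : a ∈ Icc a b := ⟨le_rfl, hx.1.trans hx.2⟩
  rw [h.eq x hx, h.eq y hy, ← intervalIntegral.integral_add_adjacent_intervals
    (h.integrable_sub ha hx) (h.integrable_sub hx hy)]
  ring

theorem integral_eq (h : IsPrimitiveOn a b F f) : ∫ t in a..b, f t = F b - F a :=
  (h.sub_eq ⟨le_rfl, h.le⟩ ⟨h.le, le_rfl⟩).symm

theorem congr_ae (h : IsPrimitiveOn a b F f) (hfg : f =ᵐ[volume.restrict (Ioo a b)] g) :
    IsPrimitiveOn a b F g := by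
  refine ⟨h.le, ?_, fun x hx => ?_⟩
  · have := h.integrable
    rw [intervalIntegrable_iff_integrableOn_Ioo_of_le h.le] at this ⊢
    exact this.congr hfg
  · rw [h.eq x hx, BresseBeam.intervalIntegral_congr_Lp hx hfg]

theorem congr (h : IsPrimitiveOn a b F f) (hFG : ∀ x ∈ Icc a b, G x = F x) :
    IsPrimitiveOn a b G f := by
  refine ⟨h.le, h.integrable, fun x hx => ?_⟩
  rw [hFG x hx, hFG a ⟨le_rfl, hx.1.trans hx.2⟩, h.eq x hx]

theorem mul (hF : IsPrimitiveOn a b F f) (hG : IsPrimitiveOn a b G g) :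
    IsPrimitiveOn a b (fun x => F x * G x) (fun x => f x * G x + F x * g x) := by
  refine ⟨hF.le, ?_, fun x hx => ?_⟩
  · exact (hF.integrable.mul_continuousOn (by rw [uIcc_of_le hF.le]; exact hG.continuousOn)).add
      (hG.integrable.continuousOn_mul (by rw [uIcc_of_le hF.le]; exact hF.continuousOn))
  · have ha : a ∈ Icc a b := ⟨le_rfl, hx.1.trans hx.2⟩
    rw [integral_mul_add_mul_of_primitive hx.1 (hF.integrable_sub ha hx) (hG.integrable_sub ha hx)
      (fun y hy => hF.eq y ⟨hy.1, hy.2.trans hx.2⟩) (fun y hy => hG.eq y ⟨hy.1, hy.2.trans hx.2⟩)]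
    ring

theorem add (hF : IsPrimitiveOn a b F f) (hG : IsPrimitiveOn a b G g) :
    IsPrimitiveOn a b (fun x => F x + G x) (fun x => f x + g x) := by
  refine ⟨hF.le, hF.integrable.add hG.integrable, fun x hx => ?_⟩
  have ha : a ∈ Icc a b := ⟨le_rfl, hx.1.trans hx.2⟩
  rw [intervalIntegral.integral_add (hF.integrable_sub ha hx) (hG.integrable_sub ha hx), hF.eq x hx,
    hG.eq x hx]
  ring

theorem const_mul (c : ℝ) (hF : IsPrimitiveOn a b F f) :
    IsPrimitiveOn a b (fun x => c * F x) (fun x => c * f x) := by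
  refine ⟨hF.le, hF.integrable.const_mul c, fun x hx => ?_⟩
  rw [intervalIntegral.integral_const_mul, hF.eq x hx]
  ring

theorem sub (hF : IsPrimitiveOn a b F f) (hG : IsPrimitiveOn a b G g) :
    IsPrimitiveOn a b (fun x => F x - G x) (fun x => f x - g x) := by
  simpa [sub_eq_add_neg] using hF.add (hG.const_mul (-1))

theorem of_hasDerivAt (hF : ∀ x, HasDerivAt F (f x) x) (hf : Continuous f) (hab : a ≤ b) :
    IsPrimitiveOn a b F f := by
  refine ⟨hab, hf.intervalIntegrable _ _, fun x _ => ?_⟩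
  rw [intervalIntegral.integral_eq_sub_of_hasDerivAt (fun x _ => hF x) (hf.intervalIntegrable _ _)]
  ring

end IsPrimitiveOn

/-- A rotating pair of functions is controlled by the inhomogeneities of its equations. -/
theorem abs_le_of_isPrimitiveOn_rotation {a b c l : ℝ} {φ ω s y : ℝ → ℝ}
    (hφ : IsPrimitiveOn a b φ (fun x => s x - l * ω x))
    (hω : IsPrimitiveOn a b ω (fun x => y x + l * φ x)) (hc : c ∈ Icc a b)
    (hs : IntervalIntegrable s volume a b) (hy : IntervalIntegrable y volume a b)
    (hφc : φ c = 0) (hωc : ω c = 0) {x : ℝ} (hx : x ∈ Icc a b) :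
    |φ x| ≤ 2 * ∫ t in a..b, (|s t| + |y t|) ∧ |ω x| ≤ 2 * ∫ t in a..b, (|s t| + |y t|) := by
  have hab : a ≤ b := hx.1.trans hx.2
  -- The terms with `l` cancel in the derivative of `φ² + ω²`, so no smallness of `l (b - a)` is
  -- needed.
  have hr : IsPrimitiveOn a b (fun x => φ x * φ x + ω x * ω x)
      (fun x => 2 * (φ x * s x + ω x * y x)) := by
    refine ((hφ.mul hφ).add (hω.mul hω)).congr_ae (ae_of_all _ fun x => ?_)
    ring
  obtain ⟨x₀, hx₀, hmax⟩ := isCompact_Icc.exists_isMaxOn ⟨x, hx⟩ hr.continuousOn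
  set m := √(φ x₀ * φ x₀ + ω x₀ * ω x₀) with hm
  have hm0 : 0 ≤ m := Real.sqrt_nonneg _
  have hmm : m * m = φ x₀ * φ x₀ + ω x₀ * ω x₀ :=
    Real.mul_self_sqrt (add_nonneg (mul_self_nonneg _) (mul_self_nonneg _))
  have hb : ∀ t ∈ Icc a b, |φ t| ≤ m ∧ |ω t| ≤ m := fun t ht => by
    have h1 : φ t * φ t + ω t * ω t ≤ φ x₀ * φ x₀ + ω x₀ * ω x₀ := hmax ht
    constructor <;> refine Real.le_sqrt_of_sq_le ?_ <;> rw [sq_abs, sq] <;>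
      nlinarith [mul_self_nonneg (φ t), mul_self_nonneg (ω t)]
  have hI : IntervalIntegrable (fun t => |s t| + |y t|) volume a b := hs.abs.add hy.abs
  have h1 := hr.sub_eq hc hx₀
  have h2 : |∫ t in c..x₀, 2 * (φ t * s t + ω t * y t)| ≤ ∫ t in a..b, 2 * m * (|s t| + |y t|) := by
    rw [← Real.norm_eq_abs]
    refine intervalIntegral.norm_integral_le_abs_integral_norm.trans ?_
    refine (intervalIntegral.abs_integral_mono_interval (c := a) (d := b) ?_
      (ae_of_all _ fun t => norm_nonneg _) ?_).trans ?_
    · rw [uIoc_of_le hab]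
      exact fun t ht => ⟨(le_min hc.1 hx₀.1).trans_lt ht.1, ht.2.trans (max_le hc.2 hx₀.2)⟩
    · exact hr.integrable.norm
    · rw [abs_of_nonneg (intervalIntegral.integral_nonneg hab fun t _ => norm_nonneg _)]
      refine intervalIntegral.integral_mono_on hab hr.integrable.norm (hI.const_mul _) fun t ht => ?_
      rw [Real.norm_eq_abs, abs_mul, abs_two]
      have h3 := abs_add_le (φ t * s t) (ω t * y t)
      rw [abs_mul, abs_mul] at h3
      have h4 := mul_le_mul_of_nonneg_right (hb t ht).1 (abs_nonneg (s t))
      have h5 := mul_le_mul_of_nonneg_right (hb t ht).2 (abs_nonneg (y t))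
      nlinarith
  rw [← h1, intervalIntegral.integral_const_mul] at h2
  have hI0 : 0 ≤ ∫ t in a..b, (|s t| + |y t|) :=
    intervalIntegral.integral_nonneg hab fun t _ => by positivity
  have hmI : m ≤ 2 * ∫ t in a..b, (|s t| + |y t|) := by
    rw [hφc, hωc, ← hmm] at h2
    have h3 := (le_abs_self _).trans h2
    simp only [mul_zero, add_zero, sub_zero] at h3
    -- At the maximum of `φ² + ω²` the identity reads `m² ≤ 2 m ∫ (|s| + |y|)`; one factor `m` is
    -- divided out.
    rcases hm0.eq_or_lt with h0 | h0
    · rw [← h0]; positivity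
    · refine le_of_mul_le_mul_left ?_ h0
      linarith
  exact ⟨(hb x hx).1.trans hmI, (hb x hx).2.trans hmI⟩

section LTwo

variable {a b : ℝ}

theorem norm_sq_Lp_Ioo (g : Lp ℝ 2 (volume.restrict (Ioo a b))) :
    ‖g‖ ^ 2 = ∫ x in Ioo a b, g x ^ 2 := by
  rw [← real_inner_self_eq_norm_sq, L2.inner_def]
  refine integral_congr_ae (ae_of_all _ fun x => ?_)
  simp [sq]

theorem integrableOn_Lp_Ioo (g : Lp ℝ 2 (volume.restrict (Ioo a b))) :
    IntegrableOn g (Ioo a b) := (Lp.memLp g).integrable (by norm_num)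

theorem abs_integral_Lp_le {x y : ℝ} (hx : x ∈ Icc a b) (hy : y ∈ Icc a b)
    (g : Lp ℝ 2 (volume.restrict (Ioo a b))) : ∫ t in uIoc x y, |g t| ≤ √|y - x| * ‖g‖ := by
  have hsub : uIoc x y ⊆ Ioc a b := fun t ht =>
    ⟨(le_min hx.1 hy.1).trans_lt ht.1, ht.2.trans (max_le hx.2 hy.2)⟩
  have hg : MemLp g 2 (volume.restrict (Ioc a b)) := by
    rw [restrict_Ioo_eq_restrict_Ioc.symm]; exact Lp.memLp g
  have hg' : MemLp g 2 (volume.restrict (uIoc x y)) := hg.mono_measure (Measure.restrict_mono hsub le_rfl)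
  have : IsFiniteMeasure (volume.restrict (uIoc x y)) := ⟨by simp [uIoc]⟩
  have h1 := integral_mul_le_Lp_mul_Lq_of_nonneg (μ := volume.restrict (uIoc x y)) (p := 2) (q := 2)
    Real.HolderConjugate.two_two (f := fun _ => 1) (g := fun t => |g t|)
    (ae_of_all _ fun _ => zero_le_one) (ae_of_all _ fun t => abs_nonneg _)
    (memLp_const 1) (by simpa using hg'.norm)
  simp only [one_mul, Real.rpow_two, one_pow, sq_abs, integral_const, smul_eq_mul, mul_one,
    ← Real.sqrt_eq_rpow] at h1
  refine h1.trans (mul_le_mul (Real.sqrt_le_sqrt (le_of_eq ?_)) ?_ (Real.sqrt_nonneg _)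
    (Real.sqrt_nonneg _))
  · simp [measureReal_def, uIoc, Real.volume_Ioc, max_sub_min_eq_abs']
    rw [abs_sub_comm]
  · refine Real.sqrt_le_iff.2 ⟨norm_nonneg _, ?_⟩
    rw [norm_sq_Lp_Ioo, ← integral_Ioc_eq_integral_Ioo]
    exact setIntegral_mono_set hg.integrable_sq (ae_of_all _ fun t => sq_nonneg _)
      hsub.eventuallyLE

theorem abs_intervalIntegral_Lp_le {x y : ℝ} (hx : x ∈ Icc a b) (hy : y ∈ Icc a b)
    (g : Lp ℝ 2 (volume.restrict (Ioo a b))) : |∫ t in x..y, g t| ≤ √|y - x| * ‖g‖ :=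
  (intervalIntegral.norm_integral_le_integral_norm_uIoc (f := g)).trans (abs_integral_Lp_le hx hy g)

theorem isPrimitiveOn_Lp (c : ℝ) (g : Lp ℝ 2 (volume.restrict (Ioo a b))) (hab : a ≤ b) :
    IsPrimitiveOn a b (fun x => c + ∫ t in a..x, g t) g :=
  ⟨hab, BresseBeam.intervalIntegrable_Lp ⟨hab, le_rfl⟩ g, fun x _ => by simp⟩

/-- `L²` functions with values bounded by `C`. -/
theorem norm_Lp_le_of_ae_bound {C : ℝ} (hab : a ≤ b) (hC : 0 ≤ C)
    (g : Lp ℝ 2 (volume.restrict (Ioo a b)))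
    (h : ∀ᵐ x ∂volume.restrict (Ioo a b), |g x| ≤ C) : ‖g‖ ≤ √(b - a) * C := by
  refine le_of_sq_le_sq ?_ (by positivity)
  rw [norm_sq_Lp_Ioo, mul_pow, Real.sq_sqrt (sub_nonneg.2 hab)]
  have h1 : ∫ x in Ioo a b, g x ^ 2 ≤ ∫ _ in Ioo a b, C ^ 2 := by
    refine integral_mono_ae (by simpa using (Lp.memLp g).integrable_sq) (integrable_const _) ?_
    filter_upwards [h] with x hx
    rw [← sq_abs]
    gcongr
  refine h1.trans (le_of_eq ?_)
  simp [measureReal_def, hab]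

end LTwo
end

/-! ### Displacement fields, strains and a Korn-type inequality -/

noncomputable section

namespace BresseBeam

/-- Positivity of the lengths and of the coefficients. -/
class Regular (D : BresseBeam) : Prop where
  L₀_pos : 0 < D.L₀
  L₀_lt : D.L₀ < D.L
  ρ_pos : ∀ j, 0 < D.ρ j
  β_pos : ∀ j, 0 < D.β j
  k_pos : ∀ j, 0 < D.k j
  σ_pos : ∀ j, 0 < D.σ j
  lam_pos : ∀ j, 0 < D.lam j

variable {D : BresseBeam}

theorem L_pos [D.Regular] : 0 < D.L := Regular.L₀_pos.trans (Regular.L₀_lt (D := D))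

theorem left_lt_right [D.Regular] (j : Fin 2) : D.left j < D.right j := by
  fin_cases j
  · exact Regular.L₀_pos
  · exact Regular.L₀_lt

theorem right_sub_left_le [D.Regular] (j : Fin 2) : D.right j - D.left j ≤ D.L := by
  have h1 := Regular.L₀_pos (D := D)
  have h2 := Regular.L₀_lt (D := D)
  fin_cases j
  · change D.L₀ - 0 ≤ D.L; linarith
  · change D.L - D.L₀ ≤ D.L; linarith

theorem inertia_pos [D.Regular] (j : Fin 2) (i : Fin 3) : 0 < D.inertia j i := by
  fin_cases i
  · exact Regular.ρ_pos j
  · exact Regular.β_pos j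
  · exact Regular.ρ_pos j

/-- The end of the `j`-th part at which the beam is clamped. -/
def clamped (D : BresseBeam) (j : Fin 2) : ℝ := ![0, D.L] j

theorem clamped_mem [D.Regular] (j : Fin 2) : D.clamped j ∈ Icc (D.left j) (D.right j) := by
  have h := (left_lt_right (D := D) j).le
  fin_cases j
  · exact ⟨le_rfl, h⟩
  · exact ⟨h, le_rfl⟩

/-- The continuous representatives of the functions with weak derivatives `g` which vanish at `0`
and are continuous at `L₀`. -/
def primitive (D : BresseBeam) (g : D.Fields) (j : Fin 2) (i : Fin 3) (x : ℝ) : ℝ :=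
  (![0, ∫ t in (0 : ℝ)..D.L₀, g 0 i t] : Fin 2 → ℝ) j + ∫ t in D.left j..x, g j i t

theorem isPrimitiveOn_primitive [D.Regular] (g : D.Fields) (j : Fin 2) (i : Fin 3) :
    IsPrimitiveOn (D.left j) (D.right j) (D.primitive g j i) (g j i) :=
  isPrimitiveOn_Lp _ _ (left_lt_right j).le

theorem primitive_zero_left (g : D.Fields) (i : Fin 3) : D.primitive g 0 i 0 = 0 := by
  simp [primitive, left]

theorem primitive_interface (g : D.Fields) (i : Fin 3) :
    D.primitive g 0 i D.L₀ = D.primitive g 1 i D.L₀ := by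
  simp [primitive, left]

theorem primitive_right (g : D.Fields) (i : Fin 3) : D.primitive g 1 i D.L =
    (∫ t in (0 : ℝ)..D.L₀, g 0 i t) + ∫ t in D.L₀..D.L, g 1 i t := by
  simp [primitive, left]

/-- The continuous representatives of the components of a displacement field. -/
def Hd.rep (Φ : D.Hd) : Fin 2 → Fin 3 → ℝ → ℝ := D.primitive (Hd.dx Φ)

theorem Hd.isPrimitiveOn_rep [D.Regular] (Φ : D.Hd) (j : Fin 2) (i : Fin 3) :
    IsPrimitiveOn (D.left j) (D.right j) (Hd.rep Φ j i) (Hd.dx Φ j i) :=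
  isPrimitiveOn_primitive _ j i

/-- Clamping at `0` and continuity at `L₀` fix both integration constants, so every admissible
representative agrees on the closed parts with the one built from the weak derivatives. -/
theorem Hd.rep_eq [D.Regular] (Φ : D.Hd) : ∃ F : Fin 2 → Fin 3 → ℝ → ℝ,
    (∀ j i, IsSobolevRep (D.left j) (D.right j) (Hd.fld Φ j i) (Hd.dx Φ j i) (F j i)) ∧
    (∀ i, F 0 i 0 = 0 ∧ F 1 i D.L = 0 ∧ F 0 i D.L₀ = F 1 i D.L₀) ∧
    ∀ j i, ∀ x ∈ Icc (D.left j) (D.right j), F j i x = Hd.rep Φ j i x := by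
  obtain ⟨F, hF, hF'⟩ := Φ.2
  have h0 : ∀ i, ∀ x ∈ Icc (D.left 0) (D.right 0), F 0 i x = Hd.rep Φ 0 i x := fun i x hx => by
    rw [(hF 0 i).2 x hx]
    change F 0 i 0 + _ = 0 + _
    rw [(hF' i).1]; rfl
  refine ⟨F, hF, hF', fun j => ?_⟩
  fin_cases j
  · exact h0
  · intro i x hx
    change F 1 i x = _
    rw [(hF 1 i).2 x hx]
    change F 1 i D.L₀ + _ = (∫ t in (0 : ℝ)..D.L₀, Hd.dx Φ 0 i t) + _
    rw [← (hF' i).2.2, h0 i D.L₀ ⟨(Regular.L₀_pos (D := D)).le, le_rfl⟩]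
    change (0 + ∫ t in (0 : ℝ)..D.L₀, Hd.dx Φ 0 i t) + _ = _
    rw [zero_add]; rfl

theorem Hd.fld_ae_eq [D.Regular] (Φ : D.Hd) (j : Fin 2) (i : Fin 3) :
    Hd.fld Φ j i =ᵐ[volume.restrict (Ioo (D.left j) (D.right j))] Hd.rep Φ j i := by
  obtain ⟨F, hF, -, hF''⟩ := Hd.rep_eq Φ
  filter_upwards [(hF j i).1, ae_restrict_mem measurableSet_Ioo] with x hx hx'
  rw [hx, hF'' j i x (Ioo_subset_Icc_self hx')]

theorem Hd.rep_clamped [D.Regular] (Φ : D.Hd) (j : Fin 2) (i : Fin 3) :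
    Hd.rep Φ j i (D.clamped j) = 0 := by
  obtain ⟨F, -, hF', hF''⟩ := Hd.rep_eq Φ
  rw [← hF'' j i _ (clamped_mem j)]
  fin_cases j
  · exact (hF' i).1
  · exact (hF' i).2.1

theorem Hd.rep_interface (Φ : D.Hd) (i : Fin 3) : Hd.rep Φ 0 i D.L₀ = Hd.rep Φ 1 i D.L₀ :=
  primitive_interface _ i

/-- Clamping at `L` as a linear condition on the derivatives. With `exists_hd_of_dx` it describes
exactly which derivative fields occur. -/
theorem Hd.sum_integral_dx [D.Regular] (Φ : D.Hd) (i : Fin 3) :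
    (∫ t in (0 : ℝ)..D.L₀, Hd.dx Φ 0 i t) + ∫ t in D.L₀..D.L, Hd.dx Φ 1 i t = 0 := by
  rw [← primitive_right]
  exact Hd.rep_clamped Φ 1 i

/-- The displacement field with given weak derivatives. -/
theorem exists_hd_of_dx [D.Regular] (g : D.Fields)
    (hg : ∀ i, (∫ t in (0 : ℝ)..D.L₀, g 0 i t) + ∫ t in D.L₀..D.L, g 1 i t = 0) :
    ∃ Φ : D.Hd, Hd.dx Φ = g := by
  have hm : ∀ j i, MemLp (D.primitive g j i) 2 (volume.restrict (Ioo (D.left j) (D.right j))) := by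
    intro j i
    have hc := (isPrimitiveOn_primitive g j i).continuousOn
    obtain ⟨C, hC⟩ := isCompact_Icc.exists_bound_of_continuousOn hc
    refine MemLp.of_bound ((hc.mono Ioo_subset_Icc_self).aestronglyMeasurable measurableSet_Ioo) C ?_
    filter_upwards [ae_restrict_mem measurableSet_Ioo] with t ht
    exact hC t (Ioo_subset_Icc_self ht)
  refine ⟨⟨(fun j i => (hm j i).toLp, g), D.primitive g, fun j i =>
    ⟨(hm j i).coeFn_toLp, (isPrimitiveOn_primitive g j i).eq⟩, fun i => ⟨primitive_zero_left g i, ?_,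
    primitive_interface g i⟩⟩, rfl⟩
  rw [primitive_right, hg]

/-- Stiffnesses of the shear, bending and axial strains. -/
def stiffness (D : BresseBeam) (j : Fin 2) : Fin 3 → ℝ := ![D.k j, D.lam j, D.σ j]

theorem stiffness_pos [D.Regular] (j : Fin 2) (i : Fin 3) : 0 < D.stiffness j i := by
  fin_cases i
  · exact Regular.k_pos j
  · exact Regular.lam_pos j
  · exact Regular.σ_pos j

/-- The strains `(φ_x + ψ + l ω, ψ_x, ω_x - l φ)`. -/
def strain (D : BresseBeam) (j : Fin 2) : D.Hd →ₗ[ℝ] Fin 3 → D.L2 j where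
  toFun Φ := ![Hd.dx Φ j 0 + Hd.fld Φ j 1 + D.l • Hd.fld Φ j 2, Hd.dx Φ j 1,
    Hd.dx Φ j 2 - D.l • Hd.fld Φ j 0]
  map_add' Φ Ψ := by
    funext i
    fin_cases i <;> simp <;> module
  map_smul' c Φ := by
    funext i
    fin_cases i <;> simp <;> module

/-- `Φ ↦ (√k S, √λ ψ_x, √σ Y)`. -/
def energyEmb (D : BresseBeam) : D.Hd →ₗ[ℝ] D.SixL2 where
  toFun Φ := WithLp.toLp 2 fun p => √(D.stiffness p.1 p.2) • D.strain p.1 Φ p.2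
  map_add' Φ Ψ := by ext1 p; simp
  map_smul' c Φ := by ext1 p; simp [smul_comm c]

theorem energyEmb_apply (Φ : D.Hd) (p : Fin 2 × Fin 3) :
    D.energyEmb Φ p = √(D.stiffness p.1 p.2) • D.strain p.1 Φ p.2 := rfl

/-- The forces carry the full stiffness and the form divides by it once, so each strain enters with
its stiffness to the first power; hence square roots in `energyEmb`, in contrast to `hdEmb`. -/
theorem energyForm_eq [D.Regular] (Φ B : D.Hd) :
    D.energyForm Φ B = inner ℝ (D.energyEmb Φ) (D.energyEmb B) := by
  rw [PiLp.inner_apply, Fintype.sum_prod_type]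
  refine Finset.sum_congr rfl fun j _ => ?_
  have h1 := (Regular.k_pos (D := D) j)
  have h2 := (Regular.σ_pos (D := D) j)
  have h3 := (Regular.lam_pos (D := D) j)
  rw [Fin.sum_univ_three]
  simp only [energyEmb_apply, Q, N, M, inner_smul_left, inner_smul_right, stiffness, strain,
    LinearMap.coe_mk, AddHom.coe_mk, Matrix.cons_val_zero, Matrix.cons_val_one,
    Matrix.cons_val, RCLike.conj_to_real, ← mul_assoc, Real.mul_self_sqrt h1.le,
    Real.mul_self_sqrt h2.le, Real.mul_self_sqrt h3.le]
  field_simp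
  ring

theorem norm_strain_le [D.Regular] : ∃ C, 0 < C ∧ ∀ (Φ : D.Hd) j i,
    ‖D.strain j Φ i‖ ≤ C * ‖D.energyEmb Φ‖ := by
  refine ⟨∑ j, ∑ i, (√(D.stiffness j i))⁻¹, ?_, fun Φ j i => ?_⟩
  · refine Finset.sum_pos (fun j _ => Finset.sum_pos (fun i _ => ?_) ⟨0, by simp⟩) ⟨0, by simp⟩
    have := stiffness_pos (D := D) j i
    positivity
  · have h := PiLp.norm_apply_le (D.energyEmb Φ) (j, i)
    rw [energyEmb_apply, norm_smul, Real.norm_of_nonneg (Real.sqrt_nonneg _)] at h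
    have hs := Real.sqrt_pos.2 (stiffness_pos (D := D) j i)
    have h1 : ‖D.strain j Φ i‖ ≤ (√(D.stiffness j i))⁻¹ * ‖D.energyEmb Φ‖ := by
      rw [inv_mul_eq_div, le_div_iff₀ hs, mul_comm]; exact h
    refine h1.trans (mul_le_mul_of_nonneg_right ?_ (norm_nonneg _))
    refine (Finset.single_le_sum (f := fun i => (√(D.stiffness j i))⁻¹)
      (fun i _ => by positivity) (Finset.mem_univ i)).trans ?_
    exact Finset.single_le_sum (f := fun j => ∑ i, (√(D.stiffness j i))⁻¹)
      (fun j _ => Finset.sum_nonneg fun i _ => by positivity) (Finset.mem_univ j)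

theorem strain_ae_eq (Φ : D.Hd) (j : Fin 2) :
    ∀ᵐ x ∂volume.restrict (Ioo (D.left j) (D.right j)),
      D.strain j Φ 0 x = Hd.dx Φ j 0 x + Hd.fld Φ j 1 x + D.l * Hd.fld Φ j 2 x ∧
      D.strain j Φ 1 x = Hd.dx Φ j 1 x ∧
      D.strain j Φ 2 x = Hd.dx Φ j 2 x - D.l * Hd.fld Φ j 0 x := by
  filter_upwards [Lp.coeFn_add (Hd.dx Φ j 0 + Hd.fld Φ j 1) (D.l • Hd.fld Φ j 2),
    Lp.coeFn_add (Hd.dx Φ j 0) (Hd.fld Φ j 1), Lp.coeFn_smul D.l (Hd.fld Φ j 2),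
    Lp.coeFn_sub (Hd.dx Φ j 2) (D.l • Hd.fld Φ j 0), Lp.coeFn_smul D.l (Hd.fld Φ j 0)]
    with x h1 h2 h3 h4 h5
  refine ⟨?_, rfl, ?_⟩
  · change (Hd.dx Φ j 0 + Hd.fld Φ j 1 + D.l • Hd.fld Φ j 2 : D.L2 j) x = _
    rw [h1, Pi.add_apply, h2, h3]; simp
  · change (Hd.dx Φ j 2 - D.l • Hd.fld Φ j 0 : D.L2 j) x = _
    rw [h4, Pi.sub_apply, h5]; simp

theorem strain_ae_eq_rep [D.Regular] (Φ : D.Hd) (j : Fin 2) :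
    ∀ᵐ x ∂volume.restrict (Ioo (D.left j) (D.right j)),
      Hd.dx Φ j 0 x = D.strain j Φ 0 x - Hd.rep Φ j 1 x - D.l * Hd.rep Φ j 2 x ∧
      Hd.dx Φ j 1 x = D.strain j Φ 1 x ∧
      Hd.dx Φ j 2 x = D.strain j Φ 2 x + D.l * Hd.rep Φ j 0 x := by
  filter_upwards [strain_ae_eq Φ j, Hd.fld_ae_eq Φ j 0, Hd.fld_ae_eq Φ j 1, Hd.fld_ae_eq Φ j 2]
    with x h h0 h1 h2
  rw [h0, h1, h2] at h
  refine ⟨by linarith [h.1], h.2.1.symm, by linarith [h.2.2]⟩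

/-- First `ψ`, whose derivative is a strain, is bounded from the clamped end by Cauchy–Schwarz. Then
`(φ, ω)` is a rotating pair with inhomogeneities `S - ψ` and `Y`, bounded by
`abs_le_of_isPrimitiveOn_rotation`. Each part contains a clamped end, so no interface condition is
needed here. -/
theorem abs_rep_le [D.Regular] : ∃ C, 0 < C ∧ ∀ (Φ : D.Hd) j i,
    ∀ x ∈ Icc (D.left j) (D.right j), |Hd.rep Φ j i x| ≤ C * ‖D.energyEmb Φ‖ := by
  obtain ⟨C, hC, hCs⟩ := norm_strain_le (D := D)
  have hL := L_pos (D := D)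
  have hψ : ∀ (Φ : D.Hd) j, ∀ x ∈ Icc (D.left j) (D.right j),
      |Hd.rep Φ j 1 x| ≤ √D.L * (C * ‖D.energyEmb Φ‖) := by
    intro Φ j x hx
    have h1 := (Hd.isPrimitiveOn_rep Φ j 1).sub_eq (clamped_mem j) hx
    rw [Hd.rep_clamped, sub_zero] at h1
    rw [h1]
    refine (abs_intervalIntegral_Lp_le (clamped_mem j) hx _).trans ?_
    refine mul_le_mul (Real.sqrt_le_sqrt ?_) (hCs Φ j 1) (norm_nonneg _) (Real.sqrt_nonneg _)
    have h2 := clamped_mem (D := D) j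
    exact (abs_sub_le_of_le_of_le hx.1 hx.2 h2.1 h2.2).trans (right_sub_left_le j)
  have hint : ∀ (Φ : D.Hd) j i, ∫ t in D.left j..D.right j, |D.strain j Φ i t| ≤
      √D.L * (C * ‖D.energyEmb Φ‖) := by
    intro Φ j i
    have hlr := (left_lt_right (D := D) j).le
    have h1 := abs_integral_Lp_le (left_mem_Icc.2 hlr) (right_mem_Icc.2 hlr) (D.strain j Φ i)
    rw [uIoc_of_le hlr, ← intervalIntegral.integral_of_le hlr] at h1
    refine h1.trans (mul_le_mul (Real.sqrt_le_sqrt ?_) (hCs Φ j i) (norm_nonneg _)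
      (Real.sqrt_nonneg _))
    rw [abs_of_nonneg (by linarith)]
    exact right_sub_left_le j
  set K : ℝ := 2 * (2 * √D.L * C + D.L * √D.L * C) with hK
  have hφω : ∀ (Φ : D.Hd) j, ∀ x ∈ Icc (D.left j) (D.right j),
      |Hd.rep Φ j 0 x| ≤ K * ‖D.energyEmb Φ‖ ∧ |Hd.rep Φ j 2 x| ≤ K * ‖D.energyEmb Φ‖ := by
    intro Φ j x hx
    have hlr := (left_lt_right (D := D) j).le
    have hs0 := intervalIntegrable_Lp (right_mem_Icc.2 hlr) (D.strain j Φ 0)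
    have hs2 := intervalIntegrable_Lp (right_mem_Icc.2 hlr) (D.strain j Φ 2)
    have hψc : ContinuousOn (Hd.rep Φ j 1) (uIcc (D.left j) (D.right j)) := by
      rw [uIcc_of_le hlr]; exact (Hd.isPrimitiveOn_rep Φ j 1).continuousOn
    have hψi := hψc.intervalIntegrable (μ := volume)
    have hs : IntervalIntegrable (fun x => D.strain j Φ 0 x - Hd.rep Φ j 1 x) volume (D.left j)
        (D.right j) := hs0.sub hψi
    have h1 : IsPrimitiveOn (D.left j) (D.right j) (Hd.rep Φ j 0)
        (fun x => (D.strain j Φ 0 x - Hd.rep Φ j 1 x) - D.l * Hd.rep Φ j 2 x) := by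
      refine (Hd.isPrimitiveOn_rep Φ j 0).congr_ae ?_
      filter_upwards [strain_ae_eq_rep Φ j] with x hx
      exact hx.1
    have h2 : IsPrimitiveOn (D.left j) (D.right j) (Hd.rep Φ j 2)
        (fun x => D.strain j Φ 2 x + D.l * Hd.rep Φ j 0 x) := by
      refine (Hd.isPrimitiveOn_rep Φ j 2).congr_ae ?_
      filter_upwards [strain_ae_eq_rep Φ j] with x hx
      exact hx.2.2
    have h3 := abs_le_of_isPrimitiveOn_rotation h1 h2 (clamped_mem j) hs hs2 (Hd.rep_clamped Φ j 0)
      (Hd.rep_clamped Φ j 2) hx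
    have h4 : ∫ t in D.left j..D.right j, (|D.strain j Φ 0 t - Hd.rep Φ j 1 t| + |D.strain j Φ 2 t|)
        ≤ (2 * √D.L * C + D.L * √D.L * C) * ‖D.energyEmb Φ‖ := by
      have h5 : ∫ t in D.left j..D.right j,
          (|D.strain j Φ 0 t - Hd.rep Φ j 1 t| + |D.strain j Φ 2 t|) ≤
          ∫ t in D.left j..D.right j,
            (|D.strain j Φ 0 t| + |D.strain j Φ 2 t| + √D.L * (C * ‖D.energyEmb Φ‖)) := by
        refine intervalIntegral.integral_mono_on hlr (hs.abs.add hs2.abs)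
          ((hs0.abs.add hs2.abs).add intervalIntegrable_const) fun t ht => ?_
        have h6 := abs_sub (D.strain j Φ 0 t) (Hd.rep Φ j 1 t)
        have h7 := hψ Φ j t ht
        linarith
      rw [intervalIntegral.integral_add (hs0.abs.add hs2.abs) intervalIntegrable_const,
        intervalIntegral.integral_add hs0.abs hs2.abs, intervalIntegral.integral_const] at h5
      have h8 := hint Φ j 0
      have h9 := hint Φ j 2
      have h10 : (D.right j - D.left j) * (√D.L * (C * ‖D.energyEmb Φ‖)) ≤
          D.L * (√D.L * (C * ‖D.energyEmb Φ‖)) :=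
        mul_le_mul_of_nonneg_right (right_sub_left_le j) (by positivity)
      rw [smul_eq_mul] at h5
      linarith
    constructor
    · rw [hK]; linarith [h3.1]
    · rw [hK]; linarith [h3.2]
  refine ⟨K, by positivity, fun Φ j i x hx => ?_⟩
  fin_cases i
  · exact (hφω Φ j x hx).1
  · refine (hψ Φ j x hx).trans ?_
    rw [← mul_assoc]
    refine mul_le_mul_of_nonneg_right ?_ (norm_nonneg _)
    have : 0 ≤ √D.L * C := by positivity
    have : 0 ≤ D.L * √D.L * C := by positivity
    rw [hK]; linarith
  · exact (hφω Φ j x hx).2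

end BresseBeam
end

/-! ### The energy space as a Hilbert space -/

noncomputable section

open scoped ContDiff

theorem PiLp.norm_le_sum_norm {α : Type*} [Fintype α] {E : α → Type*}
    [∀ a, NormedAddCommGroup (E a)] (x : PiLp 2 E) : ‖x‖ ≤ ∑ a, ‖x a‖ := by
  refine le_of_sq_le_sq ?_ (Finset.sum_nonneg fun _ _ => norm_nonneg _)
  rw [PiLp.norm_sq_eq_of_L2]
  exact Finset.sum_sq_le_sq_sum_of_nonneg fun _ _ => norm_nonneg _

/-- A square integrable function which is orthogonal to all test functions vanishes. -/
theorem Lp_eq_zero_of_forall_integral_smooth {a b : ℝ} (g : Lp ℝ 2 (volume.restrict (Ioo a b)))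
    (h : ∀ θ : ℝ → ℝ, ContDiff ℝ ∞ θ → HasCompactSupport θ → tsupport θ ⊆ Ioo a b →
      ∫ x in Ioo a b, θ x * g x = 0) : g = 0 := by
  have h1 := isOpen_Ioo.ae_eq_zero_of_integral_contDiff_smul_eq_zero (μ := volume)
    (integrableOn_Lp_Ioo g).locallyIntegrableOn fun θ h1 h2 h3 => by
      rw [← h θ h1 h2 h3, ← setIntegral_eq_integral_of_forall_compl_eq_zero]
      · rfl
      · intro x hx
        rw [image_eq_zero_of_notMem_tsupport fun hx' => hx (h3 hx'), zero_smul]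
  rw [Lp.eq_zero_iff_ae_eq_zero]
  exact (ae_restrict_iff' measurableSet_Ioo).2 h1

/-- Integration over a subinterval. -/
def integralLp {a b x y : ℝ} (hx : x ∈ Icc a b) (hy : y ∈ Icc a b) :
    Lp ℝ 2 (volume.restrict (Ioo a b)) →L[ℝ] ℝ :=
  LinearMap.mkContinuous
    { toFun := fun g => ∫ t in x..y, g t
      map_add' := fun g g' => by
        have h1 := ((isPrimitiveOn_Lp 0 g (hx.1.trans hx.2)).add
          (isPrimitiveOn_Lp 0 g' (hx.1.trans hx.2))).congr_ae (Lp.coeFn_add g g').symm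
        rw [← h1.sub_eq hx hy, ← (isPrimitiveOn_Lp 0 g (hx.1.trans hx.2)).sub_eq hx hy,
          ← (isPrimitiveOn_Lp 0 g' (hx.1.trans hx.2)).sub_eq hx hy]
        ring
      map_smul' := fun c g => by
        have h1 := ((isPrimitiveOn_Lp 0 g (hx.1.trans hx.2)).const_mul c).congr_ae
          (Lp.coeFn_smul c g).symm
        rw [← h1.sub_eq hx hy, ← (isPrimitiveOn_Lp 0 g (hx.1.trans hx.2)).sub_eq hx hy]
        simp only [RingHom.id_apply, smul_eq_mul]
        ring } (√|y - x|) fun g => abs_intervalIntegral_Lp_le hx hy g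

/-- An operator which is, up to an arbitrarily small multiple of the norm, bounded by operators of
finite rank, is compact. -/
theorem isCompactOperator_of_forall_norm_le {E X : Type*} [NormedAddCommGroup E] [NormedSpace ℝ E]
    [NormedAddCommGroup X] [NormedSpace ℝ X] [CompleteSpace X] (i : E →L[ℝ] X)
    (h : ∀ ε > 0, ∃ (α : Type) (_ : Fintype α) (κ : E →L[ℝ] (α → ℝ)) (C : ℝ),
      ∀ x, ‖i x‖ ≤ C * ‖κ x‖ + ε * ‖x‖) : IsCompactOperator i := by
  rw [← ContinuousLinearMap.coe_coe,
    isCompactOperator_iff_isCompact_closure_image_closedBall _ one_pos,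
    isCompact_iff_totallyBounded_isComplete]
  refine ⟨TotallyBounded.closure ?_, isClosed_closure.isComplete⟩
  rw [Metric.totallyBounded_iff]
  intro ε hε
  obtain ⟨α, _, κ, C, hC⟩ := h (ε / 8) (by positivity)
  have hb : TotallyBounded (κ '' Metric.closedBall 0 1) := by
    have : Bornology.IsBounded (κ '' Metric.closedBall 0 1) :=
      κ.lipschitz.isBounded_image Metric.isBounded_closedBall
    exact (Metric.isCompact_of_isClosed_isBounded isClosed_closure this.closure).totallyBounded.subset
      subset_closure
  -- The net contributes at most `ε/4`; two points of the unit ball are at distance at most `2`, so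
  -- the small multiple `ε/8` contributes another `ε/4`.
  obtain ⟨t, hts, htf, htc⟩ := Metric.finite_approx_of_totallyBounded hb (ε / (4 * (|C| + 1)))
    (by positivity)
  have hts' : ∀ y ∈ t, ∃ x, x ∈ Metric.closedBall (0 : E) 1 ∧ κ x = y := fun y hy => hts hy
  choose! f hf hf' using hts'
  refine ⟨(fun y => i (f y)) '' t, htf.image _, ?_⟩
  rintro _ ⟨x, hx, rfl⟩
  obtain ⟨y, hy, hxy⟩ := mem_iUnion₂.1 (htc ⟨x, hx, rfl⟩)
  refine mem_iUnion₂.2 ⟨i (f y), ⟨y, hy, rfl⟩, ?_⟩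
  have h1 := hC (x - f y)
  rw [map_sub, map_sub, hf' y hy] at h1
  rw [Metric.mem_ball, dist_eq_norm] at hxy ⊢
  refine h1.trans_lt ?_
  have h2 : ‖x - f y‖ ≤ 2 := by
    have h3 := norm_sub_le x (f y)
    have h4 := hf y hy
    rw [mem_closedBall_zero_iff] at hx h4
    linarith
  have h3 : C * ‖κ x - y‖ ≤ (|C| + 1) * (ε / (4 * (|C| + 1))) :=
    mul_le_mul ((le_abs_self C).trans (by linarith)) hxy.le (norm_nonneg _) (by positivity)
  have h4 : (|C| + 1) * (ε / (4 * (|C| + 1))) = ε / 4 := by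
    have : |C| + 1 ≠ 0 := by positivity
    field_simp
  nlinarith

namespace BresseBeam

variable {D : BresseBeam}

/-- The clamped ends exclude rigid motions: vanishing strains force vanishing displacements through
`abs_rep_le`, and then vanishing derivatives. -/
theorem Hd.rep_eq_zero_of_energyEmb [D.Regular] {Φ : D.Hd} (h : D.energyEmb Φ = 0) : Φ = 0 := by
  obtain ⟨C, -, hC⟩ := abs_rep_le (D := D)
  obtain ⟨C', -, hC'⟩ := norm_strain_le (D := D)
  have hr : ∀ j i, ∀ x ∈ Icc (D.left j) (D.right j), Hd.rep Φ j i x = 0 := fun j i x hx => by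
    have := hC Φ j i x hx
    rw [h, norm_zero, mul_zero] at this
    exact abs_nonpos_iff.1 this
  have hf : ∀ j i, Hd.fld Φ j i = 0 := fun j i => by
    rw [Lp.eq_zero_iff_ae_eq_zero]
    filter_upwards [Hd.fld_ae_eq Φ j i, ae_restrict_mem measurableSet_Ioo] with x hx hx'
    rw [hx, hr j i x (Ioo_subset_Icc_self hx')]; rfl
  have hs : ∀ j i, D.strain j Φ i = 0 := fun j i => by
    have := hC' Φ j i
    rw [h, norm_zero, mul_zero] at this
    exact norm_le_zero_iff.1 this
  have hd : ∀ j i, Hd.dx Φ j i = 0 := fun j i => by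
    have h0 := hs j 0
    have h1 := hs j 1
    have h2 := hs j 2
    simp only [strain, LinearMap.coe_mk, AddHom.coe_mk, Matrix.cons_val, hf, smul_zero, add_zero,
      sub_zero] at h0 h1 h2
    fin_cases i
    exacts [h0, h1, h2]
  apply Subtype.ext
  exact Prod.ext (funext fun j => funext fun i => hf j i) (funext fun j => funext fun i => hd j i)

/-- The space of displacements, with the norm of the energy form. -/
def Energy (D : BresseBeam) : Type := D.Hd

namespace Energy

instance : AddCommGroup D.Energy := inferInstanceAs (AddCommGroup D.Hd)
instance : Module ℝ D.Energy := inferInstanceAs (Module ℝ D.Hd)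

/-- The displacement field of an element of the energy space. -/
def toHd : D.Energy ≃ₗ[ℝ] D.Hd := LinearEquiv.refl ℝ D.Hd

/-- The weighted strains. -/
def emb (D : BresseBeam) : D.Energy →ₗ[ℝ] D.SixL2 := D.energyEmb ∘ₗ toHd.toLinearMap

theorem emb_injective [D.Regular] : Function.Injective (emb D) := by
  rw [injective_iff_map_eq_zero]
  exact fun Φ h => Hd.rep_eq_zero_of_energyEmb h

/-- The norm of `H_d` in the problem weights the strains by the stiffnesses, this one by their
square roots. The two are equivalent, but the linear evolution is isometric for the energy norm. -/
instance [D.Regular] : NormedAddCommGroup D.Energy :=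
  NormedAddCommGroup.induced D.Energy D.SixL2 (emb D) emb_injective

instance [D.Regular] : InnerProductSpace ℝ D.Energy where
  toNormedSpace := NormedSpace.induced ℝ D.Energy D.SixL2 (emb D)
  inner Φ B := inner ℝ (emb D Φ) (emb D B)
  norm_sq_eq_re_inner Φ := norm_sq_eq_re_inner (𝕜 := ℝ) (emb D Φ)
  conj_inner_symm Φ B := inner_conj_symm (𝕜 := ℝ) (emb D Φ) (emb D B)
  add_left Φ Ψ B := by
    change inner ℝ (emb D (Φ + Ψ)) _ = _
    rw [map_add, inner_add_left]
  smul_left Φ B r := by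
    change inner ℝ (emb D (r • Φ)) _ = _
    rw [map_smul, inner_smul_left]

variable [D.Regular]

theorem norm_eq (Φ : D.Energy) : ‖Φ‖ = ‖D.energyEmb (toHd Φ)‖ := rfl

theorem inner_eq (Φ B : D.Energy) : inner ℝ Φ B = D.energyForm (toHd Φ) (toHd B) :=
  (energyForm_eq _ _).symm

/-- The strains, as bounded operators. -/
def strainL (j : Fin 2) (i : Fin 3) : D.Energy →L[ℝ] D.L2 j :=
  LinearMap.mkContinuous
    { toFun := fun Φ => D.strain j (toHd Φ) i
      map_add' := fun Φ Ψ => by rw [map_add, map_add]; rfl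
      map_smul' := fun c Φ => by rw [map_smul, map_smul]; rfl }
    (norm_strain_le (D := D)).choose fun Φ =>
      (norm_strain_le (D := D)).choose_spec.2 (toHd Φ) j i

theorem norm_fld_le : ∃ C, 0 < C ∧ ∀ (Φ : D.Energy) j i, ‖Hd.fld (toHd Φ) j i‖ ≤ C * ‖Φ‖ := by
  obtain ⟨C, hC, h⟩ := abs_rep_le (D := D)
  have hL := L_pos (D := D)
  refine ⟨√D.L * C, by positivity, fun Φ j i => ?_⟩
  have h1 := norm_Lp_le_of_ae_bound (left_lt_right j).le (C := C * ‖Φ‖) (by positivity)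
    (Hd.fld (toHd Φ) j i) (by
      filter_upwards [Hd.fld_ae_eq (toHd Φ) j i, ae_restrict_mem measurableSet_Ioo] with x hx hx'
      rw [hx]
      exact h (toHd Φ) j i x (Ioo_subset_Icc_self hx'))
  refine h1.trans ?_
  rw [mul_assoc]
  exact mul_le_mul_of_nonneg_right (Real.sqrt_le_sqrt (right_sub_left_le j)) (by positivity)

/-- The components of a displacement field, as bounded operators. -/
def fldL (j : Fin 2) (i : Fin 3) : D.Energy →L[ℝ] D.L2 j :=
  LinearMap.mkContinuous
    { toFun := fun Φ => Hd.fld (toHd Φ) j i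
      map_add' := fun Φ Ψ => by rw [map_add, map_add]; rfl
      map_smul' := fun c Φ => by rw [map_smul, map_smul]; rfl }
    (norm_fld_le (D := D)).choose fun Φ => (norm_fld_le (D := D)).choose_spec.2 Φ j i

/-- The weak derivatives, as bounded operators. -/
def dxL (j : Fin 2) (i : Fin 3) : D.Energy →L[ℝ] D.L2 j :=
  (![strainL j 0 - fldL j 1 - D.l • fldL j 2, strainL j 1, strainL j 2 + D.l • fldL j 0] :
    Fin 3 → _) i

theorem dxL_apply (j : Fin 2) (i : Fin 3) (Φ : D.Energy) :
    dxL j i Φ = Hd.dx (toHd Φ) j i := by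
  fin_cases i
  · change D.strain j (toHd Φ) 0 - Hd.fld (toHd Φ) j 1 - D.l • Hd.fld (toHd Φ) j 2 = _
    simp only [strain, LinearMap.coe_mk, AddHom.coe_mk, Matrix.cons_val]
    abel_nf
    rfl
  · rfl
  · change D.strain j (toHd Φ) 2 + D.l • Hd.fld (toHd Φ) j 0 = _
    simp only [strain, LinearMap.coe_mk, AddHom.coe_mk, Matrix.cons_val]
    abel_nf
    rfl

/-- All weak derivatives. -/
def dxAll (D : BresseBeam) [D.Regular] : D.Energy →L[ℝ] D.Fields :=
  ContinuousLinearMap.pi fun j => ContinuousLinearMap.pi fun i => dxL j i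

theorem dxAll_apply (Φ : D.Energy) : dxAll D Φ = Hd.dx (toHd Φ) :=
  funext fun j => funext fun i => dxL_apply j i Φ

/-- Poincaré from the clamped ends. With continuity of `dxAll` it shows that a displacement field is
equivalent to its derivatives, which transfers completeness. -/
theorem norm_le_norm_dx : ∃ C : ℝ≥0, ∀ Φ : D.Energy, ‖Φ‖ ≤ C * ‖dxAll D Φ‖ := by
  have hL := L_pos (D := D)
  have hdx : ∀ (Φ : D.Energy) j i, ‖Hd.dx (toHd Φ) j i‖ ≤ ‖dxAll D Φ‖ := fun Φ j i => by
    rw [dxAll_apply]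
    exact (norm_le_pi_norm _ i).trans (norm_le_pi_norm (Hd.dx (toHd Φ)) j)
  have hfld : ∀ (Φ : D.Energy) j i, ‖Hd.fld (toHd Φ) j i‖ ≤ D.L * ‖dxAll D Φ‖ := by
    intro Φ j i
    have h1 := norm_Lp_le_of_ae_bound (left_lt_right j).le (C := √D.L * ‖dxAll D Φ‖) (by positivity)
      (Hd.fld (toHd Φ) j i) (by
        filter_upwards [Hd.fld_ae_eq (toHd Φ) j i, ae_restrict_mem measurableSet_Ioo] with x hx hx'
        have hxI := Ioo_subset_Icc_self hx'
        have h1 := (Hd.isPrimitiveOn_rep (toHd Φ) j i).sub_eq (clamped_mem j) hxI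
        rw [Hd.rep_clamped, sub_zero] at h1
        rw [hx, h1]
        refine (abs_intervalIntegral_Lp_le (clamped_mem j) hxI _).trans ?_
        refine mul_le_mul (Real.sqrt_le_sqrt ?_) (hdx Φ j i) (norm_nonneg _) (Real.sqrt_nonneg _)
        have h2 := clamped_mem (D := D) j
        exact (abs_sub_le_of_le_of_le hxI.1 hxI.2 h2.1 h2.2).trans (right_sub_left_le j))
    refine h1.trans ?_
    rw [← mul_assoc]
    refine mul_le_mul_of_nonneg_right ?_ (norm_nonneg _)
    calc √(D.right j - D.left j) * √D.L ≤ √D.L * √D.L := by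
          gcongr; exact right_sub_left_le j
      _ = D.L := Real.mul_self_sqrt hL.le
  have hstr : ∀ (Φ : D.Energy) j i, ‖D.strain j (toHd Φ) i‖ ≤
      (1 + D.L + |D.l| * D.L) * ‖dxAll D Φ‖ := by
    intro Φ j i
    have hn : 0 ≤ ‖dxAll D Φ‖ := norm_nonneg _
    have h0 : 0 ≤ D.L * ‖dxAll D Φ‖ := by positivity
    have h1 : 0 ≤ |D.l| * (D.L * ‖dxAll D Φ‖) := by positivity
    have h2 : ∀ i', ‖D.l • Hd.fld (toHd Φ) j i'‖ ≤ |D.l| * (D.L * ‖dxAll D Φ‖) := fun i' => by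
      rw [norm_smul, Real.norm_eq_abs]
      exact mul_le_mul_of_nonneg_left (hfld Φ j i') (abs_nonneg _)
    fin_cases i
    · refine (norm_add_le _ _).trans ((add_le_add (norm_add_le _ _) le_rfl).trans ?_)
      linarith [hdx Φ j 0, hfld Φ j 1, h2 2]
    · exact (hdx Φ j 1).trans (by linarith)
    · refine (norm_sub_le _ _).trans ?_
      linarith [hdx Φ j 2, h2 0]
  refine ⟨⟨∑ p : Fin 2 × Fin 3, √(D.stiffness p.1 p.2) * (1 + D.L + |D.l| * D.L),
    Finset.sum_nonneg fun p _ => by positivity⟩, fun Φ => ?_⟩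
  change _ ≤ (∑ p : Fin 2 × Fin 3, √(D.stiffness p.1 p.2) * (1 + D.L + |D.l| * D.L)) * _
  rw [norm_eq, Finset.sum_mul]
  refine (PiLp.norm_le_sum_norm _).trans (Finset.sum_le_sum fun p _ => ?_)
  rw [energyEmb_apply, norm_smul, Real.norm_of_nonneg (Real.sqrt_nonneg _), mul_assoc]
  exact mul_le_mul_of_nonneg_left (hstr Φ p.1 p.2) (Real.sqrt_nonneg _)

/-- The derivative map is a uniform embedding whose range is the common kernel of three continuous
functionals, the total integrals over the beam; this range is closed. -/
instance : CompleteSpace D.Energy := by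
  obtain ⟨C, hC⟩ := norm_le_norm_dx (D := D)
  have hu : IsUniformInducing (dxAll D) :=
    (AddMonoidHomClass.antilipschitz_of_bound (dxAll D) hC).isUniformInducing
      (dxAll D).uniformContinuous
  rw [completeSpace_iff_isComplete_range hu]
  have hr : range (dxAll D) = {g : D.Fields | ∀ i,
      (∫ t in (0 : ℝ)..D.L₀, g 0 i t) + ∫ t in D.L₀..D.L, g 1 i t = 0} := by
    ext g
    constructor
    · rintro ⟨Φ, rfl⟩ i
      rw [dxAll_apply]
      exact Hd.sum_integral_dx (toHd Φ) i
    · intro hg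
      obtain ⟨Φ, hΦ⟩ := exists_hd_of_dx g hg
      exact ⟨toHd.symm Φ, (dxAll_apply _).trans hΦ⟩
  rw [hr, ofPred_forall]
  refine IsClosed.isComplete (isClosed_iInter fun i => isClosed_eq (Continuous.add ?_ ?_)
    continuous_const)
  · have h := (left_lt_right (D := D) 0).le
    exact (integralLp (left_mem_Icc.2 h) (right_mem_Icc.2 h)).continuous.comp
      ((continuous_apply i).comp (continuous_apply 0))
  · have h := (left_lt_right (D := D) 1).le
    exact (integralLp (left_mem_Icc.2 h) (right_mem_Icc.2 h)).continuous.comp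
      ((continuous_apply i).comp (continuous_apply 1))

end Energy
end BresseBeam
end

/-! ### The embedding of the energy space into weighted `L²` -/

noncomputable section

open scoped ContDiff

namespace BresseBeam

variable {D : BresseBeam}

theorem memLp_of_continuousOn_Icc {a b : ℝ} {f : ℝ → ℝ} (hf : ContinuousOn f (Icc a b)) (p : ℝ≥0∞) :
    MemLp f p (volume.restrict (Ioo a b)) := by
  obtain ⟨C, hC⟩ := isCompact_Icc.exists_bound_of_continuousOn hf
  refine MemLp.of_bound ((hf.mono Ioo_subset_Icc_self).aestronglyMeasurable measurableSet_Ioo) C ?_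
  filter_upwards [ae_restrict_mem measurableSet_Ioo] with t ht
  exact hC t (Ioo_subset_Icc_self ht)

namespace Energy

variable [D.Regular]

/-- The embedding of the energy space into the weighted `L²` space. -/
def embX (D : BresseBeam) [D.Regular] : D.Energy →L[ℝ] D.SixL2 :=
  (PiLp.continuousLinearEquiv 2 ℝ fun p : Fin 2 × Fin 3 => D.L2 p.1).symm.toContinuousLinearMap ∘L
    ContinuousLinearMap.pi fun p => √(D.inertia p.1 p.2) • fldL p.1 p.2

theorem embX_apply (Φ : D.Energy) (p : Fin 2 × Fin 3) :
    embX D Φ p = √(D.inertia p.1 p.2) • Hd.fld (toHd Φ) p.1 p.2 := rfl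

/-- Point evaluations. -/
def repL (j : Fin 2) (i : Fin 3) {x : ℝ} (hx : x ∈ Icc (D.left j) (D.right j)) : D.Energy →L[ℝ] ℝ :=
  integralLp (clamped_mem j) hx ∘L dxL j i

theorem repL_apply (j : Fin 2) (i : Fin 3) {x : ℝ} (hx : x ∈ Icc (D.left j) (D.right j))
    (Φ : D.Energy) : repL j i hx Φ = Hd.rep (toHd Φ) j i x := by
  have h1 := (Hd.isPrimitiveOn_rep (toHd Φ) j i).sub_eq (clamped_mem j) hx
  rw [Hd.rep_clamped, sub_zero] at h1
  rw [h1, ← dxL_apply]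
  rfl

theorem norm_dx_le (Φ : D.Energy) (j : Fin 2) (i : Fin 3) :
    ‖Hd.dx (toHd Φ) j i‖ ≤ ‖dxAll D‖ * ‖Φ‖ := by
  refine le_trans ?_ ((dxAll D).le_opNorm Φ)
  rw [dxAll_apply]
  exact (norm_le_pi_norm _ i).trans (norm_le_pi_norm (Hd.dx (toHd Φ)) j)

/-- The nodes of a uniform grid. -/
theorem exists_grid {a b : ℝ} (hab : a < b) {n : ℕ} (hn : 0 < n) : ∃ y : Fin (n + 1) → ℝ,
    (∀ m, y m ∈ Icc a b) ∧ ∀ x ∈ Icc a b, ∃ m, |x - y m| ≤ (b - a) / n := by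
  have hn' : (0 : ℝ) < n := by exact_mod_cast hn
  have hba : 0 < b - a := sub_pos.2 hab
  refine ⟨fun m => a + (b - a) * (m / n), fun m => ⟨?_, ?_⟩, fun x hx => ?_⟩
  · have : (0 : ℝ) ≤ (b - a) * ((m : ℕ) / n) := by positivity
    linarith
  · have hm : ((m : ℕ) : ℝ) / n ≤ 1 := by
      rw [div_le_one hn']; exact_mod_cast Nat.lt_succ_iff.1 m.2
    nlinarith
  · set r := (x - a) / (b - a) * n with hr
    have hr0 : 0 ≤ r := by
      have := sub_nonneg.2 hx.1
      positivity
    have hrn : r ≤ n := by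
      have : (x - a) / (b - a) ≤ 1 := by rw [div_le_one hba]; linarith [hx.2]
      nlinarith
    have hfl : ⌊r⌋₊ < n + 1 := Nat.lt_succ_of_le (Nat.floor_le_of_le hrn)
    refine ⟨⟨⌊r⌋₊, hfl⟩, ?_⟩
    have h1 := Nat.floor_le hr0
    have h2 := Nat.lt_floor_add_one r
    have hx' : x = a + (b - a) * (r / n) := by rw [hr]; field_simp; ring
    have h3 : x - (a + (b - a) * ((⌊r⌋₊ : ℝ) / n)) = (b - a) / n * (r - ⌊r⌋₊) := by
      rw [hx']; field_simp; ring
    simp only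
    rw [h3, abs_of_nonneg (mul_nonneg (by positivity) (by linarith))]
    have : (0 : ℝ) ≤ (b - a) / n := by positivity
    nlinarith

/-- Fields of finite energy are Hölder continuous of exponent `1/2`, so the values at finitely many
grid points determine them uniformly up to a small multiple of the energy norm. -/
theorem isCompactOperator_embX : IsCompactOperator (embX D) := by
  have hL := L_pos (D := D)
  refine isCompactOperator_of_forall_norm_le _ fun ε hε => ?_
  set A : ℝ := ∑ p : Fin 2 × Fin 3, √(D.inertia p.1 p.2) * √D.L with hA
  have hA0 : 0 ≤ A := Finset.sum_nonneg fun p _ => by positivity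
  set M : ℝ := ‖dxAll D‖
  have hM0 : 0 ≤ M := norm_nonneg (dxAll D)
  -- The grid is so fine that `√(L/n) ≤ ε / (A M + 1)`; the added `1` avoids a division by zero and
  -- the error is still at most `ε ‖Φ‖`.
  obtain ⟨n, hn⟩ := exists_nat_gt (D.L / (ε / (A * M + 1)) ^ 2)
  have hn0 : (0 : ℝ) < n := lt_of_le_of_lt (by positivity) hn
  have hnn : 0 < n := by exact_mod_cast hn0
  have hsq : √(D.L / n) ≤ ε / (A * M + 1) := by
    rw [Real.sqrt_le_left (by positivity), div_le_iff₀ hn0]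
    rw [div_lt_iff₀ (by positivity)] at hn
    linarith
  choose y hy hy' using fun j => exists_grid (left_lt_right (D := D) j) hnn
  refine ⟨Fin 2 × Fin 3 × Fin (n + 1), inferInstance,
    ContinuousLinearMap.pi fun q => repL q.1 q.2.1 (hy q.1 q.2.2), A, fun Φ => ?_⟩
  set κ := (ContinuousLinearMap.pi fun q : Fin 2 × Fin 3 × Fin (n + 1) =>
    repL q.1 q.2.1 (hy q.1 q.2.2) : D.Energy →L[ℝ] _)
  have hfld : ∀ j i, ‖Hd.fld (toHd Φ) j i‖ ≤ √D.L * (‖κ Φ‖ + ε / (A * M + 1) * (M * ‖Φ‖)) := by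
    intro j i
    refine (norm_Lp_le_of_ae_bound (left_lt_right j).le
      (C := ‖κ Φ‖ + ε / (A * M + 1) * (M * ‖Φ‖)) (by positivity) _ ?_).trans
      (mul_le_mul_of_nonneg_right (Real.sqrt_le_sqrt (right_sub_left_le j)) (by positivity))
    filter_upwards [Hd.fld_ae_eq (toHd Φ) j i, ae_restrict_mem measurableSet_Ioo] with x hx hx'
    have hxI := Ioo_subset_Icc_self hx'
    obtain ⟨m, hm⟩ := hy' j x hxI
    have h1 : |Hd.rep (toHd Φ) j i (y j m)| ≤ ‖κ Φ‖ := by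
      have := norm_le_pi_norm (κ Φ) (j, i, m)
      rwa [show κ Φ (j, i, m) = Hd.rep (toHd Φ) j i (y j m) from repL_apply j i (hy j m) Φ] at this
    have h2 := (Hd.isPrimitiveOn_rep (toHd Φ) j i).sub_eq (hy j m) hxI
    have h3 := abs_intervalIntegral_Lp_le (hy j m) hxI (Hd.dx (toHd Φ) j i)
    rw [← h2] at h3
    have h4 : √|x - y j m| ≤ ε / (A * M + 1) := by
      refine (Real.sqrt_le_sqrt (hm.trans ?_)).trans hsq
      exact div_le_div_of_nonneg_right (right_sub_left_le j) hn0.le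
    have h5 := mul_le_mul h4 (norm_dx_le Φ j i) (norm_nonneg _) (by positivity)
    have h6 := abs_add_le (Hd.rep (toHd Φ) j i (y j m))
      (Hd.rep (toHd Φ) j i x - Hd.rep (toHd Φ) j i (y j m))
    rw [add_sub_cancel] at h6
    rw [hx]
    linarith
  have h1 : ‖embX D Φ‖ ≤ A * (‖κ Φ‖ + ε / (A * M + 1) * (M * ‖Φ‖)) := by
    refine (PiLp.norm_le_sum_norm _).trans ?_
    rw [hA, Finset.sum_mul]
    refine Finset.sum_le_sum fun p _ => ?_
    rw [embX_apply, norm_smul, Real.norm_of_nonneg (Real.sqrt_nonneg _), mul_assoc]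
    exact mul_le_mul_of_nonneg_left (hfld p.1 p.2) (Real.sqrt_nonneg _)
  refine h1.trans ?_
  rw [mul_add]
  have h2 : A * (ε / (A * M + 1) * (M * ‖Φ‖)) = (A * M) / (A * M + 1) * (ε * ‖Φ‖) := by
    field_simp
  have h3 : (A * M) / (A * M + 1) ≤ 1 := by
    rw [div_le_one (by positivity)]; linarith
  rw [h2]
  have h4 : 0 ≤ ε * ‖Φ‖ := by positivity
  nlinarith

/-- The weak derivative is stored with the field, so it must be shown that a vanishing field has
vanishing derivative; this follows by testing with smooth functions. -/
theorem embX_injective : Function.Injective (embX D) := by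
  rw [injective_iff_map_eq_zero]
  intro Φ h
  have hf : ∀ j i, Hd.fld (toHd Φ) j i = 0 := fun j i => by
    have h1 : embX D Φ (j, i) = 0 := by rw [h]; rfl
    rw [embX_apply] at h1
    exact (smul_eq_zero.1 h1).resolve_left (Real.sqrt_pos.2 (inertia_pos j i)).ne'
  have hr : ∀ j i, Hd.rep (toHd Φ) j i =ᵐ[volume.restrict (Ioo (D.left j) (D.right j))] 0 := by
    intro j i
    have h1 := Hd.fld_ae_eq (toHd Φ) j i
    rw [hf] at h1
    exact h1.symm.trans (Lp.coeFn_zero _ _ _)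
  have hd : ∀ j i, Hd.dx (toHd Φ) j i = 0 := by
    intro j i
    refine Lp_eq_zero_of_forall_integral_smooth _ fun θ h1 h2 h3 => ?_
    have hle := (left_lt_right (D := D) j).le
    have hp := (IsPrimitiveOn.of_hasDerivAt
      (fun x => ((h1.differentiable (by simp)) x).hasDerivAt)
      (h1.continuous_deriv (by simp)) hle).mul (Hd.isPrimitiveOn_rep (toHd Φ) j i)
    have h4 := hp.integral_eq
    have h5 : ∀ x, x ∉ Ioo (D.left j) (D.right j) → θ x = 0 := fun x hx =>
      image_eq_zero_of_notMem_tsupport fun hx' => hx (h3 hx')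
    rw [h5 _ (by simp), h5 _ (by simp), zero_mul, zero_mul, sub_zero,
      intervalIntegral.integral_of_le hle, integral_Ioc_eq_integral_Ioo] at h4
    rw [← h4]
    refine integral_congr_ae ?_
    filter_upwards [hr j i] with x hx
    rw [hx]; simp
  have : dxAll D Φ = 0 := by
    rw [dxAll_apply]
    exact funext fun j => funext fun i => hd j i
  obtain ⟨C, hC⟩ := norm_le_norm_dx (D := D)
  have h1 := hC Φ
  rw [this, norm_zero, mul_zero] at h1
  exact norm_le_zero_iff.1 h1

/-- Fields with a single nonzero component, smooth and compactly supported inside one part, satisfy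
all end and interface conditions. A vector orthogonal to the range is orthogonal to all of these. -/
theorem denseRange_embX : DenseRange (embX D) := by
  have h0 : (LinearMap.range (embX D).toLinearMap)ᗮ = ⊥ := by
    rw [eq_bot_iff]
    intro V hV
    rw [Submodule.mem_bot]
    ext1 ⟨j, i⟩
    refine Lp_eq_zero_of_forall_integral_smooth _ fun θ h1 h2 h3 => ?_
    have hle := fun j => (left_lt_right (D := D) j).le
    have hθ' := h1.continuous_deriv (by simp)
    have hθp : ∀ j, IsPrimitiveOn (D.left j) (D.right j) θ (deriv θ) := fun j =>
      IsPrimitiveOn.of_hasDerivAt (fun x => ((h1.differentiable (by simp)) x).hasDerivAt) hθ' (hle j)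
    have h5 : ∀ x, x ∉ Ioo (D.left j) (D.right j) → θ x = 0 := fun x hx =>
      image_eq_zero_of_notMem_tsupport fun hx' => hx (h3 hx')
    have hm : ∀ j, MemLp (deriv θ) 2 (volume.restrict (Ioo (D.left j) (D.right j))) := fun j =>
      memLp_of_continuousOn_Icc hθ'.continuousOn 2
    let g : D.Fields := fun j' i' => if j' = j ∧ i' = i then (hm j').toLp else 0
    have hg1 : g j i = (hm j).toLp := if_pos ⟨rfl, rfl⟩
    have hg0 : ∀ j' i', ¬(j' = j ∧ i' = i) → g j' i' = 0 := fun j' i' h => if_neg h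
    have hgi : ∀ j' i', ∫ t in D.left j'..D.right j', g j' i' t = 0 := by
      intro j' i'
      by_cases hji : j' = j ∧ i' = i
      · obtain ⟨rfl, rfl⟩ := hji
        rw [hg1, intervalIntegral_congr_Lp (right_mem_Icc.2 (hle _)) (hm _).coeFn_toLp,
          (hθp _).integral_eq, h5 _ (by simp), h5 _ (by simp), sub_zero]
      · rw [hg0 _ _ hji, intervalIntegral_congr_Lp (right_mem_Icc.2 (hle _)) (Lp.coeFn_zero _ _ _)]
        simp
    obtain ⟨Φ, hΦ⟩ := exists_hd_of_dx g fun i' => by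
      have e0 := hgi 0 i'
      have e1 := hgi 1 i'
      change ∫ t in (0 : ℝ)..D.L₀, g 0 i' t = 0 at e0
      change ∫ t in D.L₀..D.L, g 1 i' t = 0 at e1
      rw [e0, e1, add_zero]
    have hrep : ∀ j' i', ∀ x ∈ Icc (D.left j') (D.right j'),
        Hd.rep Φ j' i' x = ∫ t in D.left j'..x, g j' i' t := by
      intro j' i' x hx
      rw [Hd.rep, hΦ, primitive]
      fin_cases j'
      · exact zero_add _
      · change (∫ t in (0 : ℝ)..D.L₀, g 0 i' t) + _ = _
        have e0 := hgi 0 i'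
        change ∫ t in (0 : ℝ)..D.L₀, g 0 i' t = 0 at e0
        rw [e0, zero_add]
    have hf1 : Hd.fld Φ j i =ᵐ[volume.restrict (Ioo (D.left j) (D.right j))] θ := by
      filter_upwards [Hd.fld_ae_eq Φ j i, ae_restrict_mem measurableSet_Ioo] with x hx hx'
      have hxI := Ioo_subset_Icc_self hx'
      rw [hx, hrep j i x hxI, hg1, intervalIntegral_congr_Lp hxI (hm _).coeFn_toLp,
        ← (hθp j).sub_eq (left_mem_Icc.2 (hle j)) hxI, h5 (D.left j) (by simp), sub_zero]
    have hf0 : ∀ j' i', ¬(j' = j ∧ i' = i) → Hd.fld Φ j' i' = 0 := by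
      intro j' i' hji
      rw [Lp.eq_zero_iff_ae_eq_zero]
      filter_upwards [Hd.fld_ae_eq Φ j' i', ae_restrict_mem measurableSet_Ioo] with x hx hx'
      have hxI := Ioo_subset_Icc_self hx'
      rw [hx, hrep j' i' x hxI, hg0 _ _ hji, intervalIntegral_congr_Lp hxI (Lp.coeFn_zero _ _ _)]
      simp
    have horth : inner ℝ (embX D (toHd.symm Φ)) V = 0 := hV _ ⟨_, rfl⟩
    rw [PiLp.inner_apply, Finset.sum_eq_single (j, i) (fun p _ hp => by
      rw [embX_apply]
      have : Hd.fld (toHd (toHd.symm Φ)) p.1 p.2 = 0 := hf0 p.1 p.2 fun h => hp (Prod.ext h.1 h.2)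
      rw [this, smul_zero, inner_zero_left]) (fun h => absurd (Finset.mem_univ _) h),
      embX_apply, inner_smul_left] at horth
    have h6 := (mul_eq_zero.1 horth).resolve_left (by
      simpa using (Real.sqrt_pos.2 (inertia_pos (D := D) j i)).ne')
    rw [L2.inner_def] at h6
    rw [← h6]
    refine integral_congr_ae ?_
    filter_upwards [hf1] with x hx
    change θ x * V (j, i) x = inner ℝ (Hd.fld Φ j i x) (V (j, i) x)
    rw [hx]; simp [mul_comm]
  have h1 := Submodule.topologicalClosure_eq_top_iff.2 h0
  rw [← Submodule.dense_iff_topologicalClosure_eq_top] at h1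
  exact h1

end Energy
end BresseBeam
end

/-! ### Regularity: continuity of the forces -/

noncomputable section

namespace BresseBeam

variable {D : BresseBeam} [D.Regular]

theorem inner_L2_eq (j : Fin 2) (f g : D.L2 j) :
    inner ℝ f g = ∫ x in D.left j..D.right j, f x * g x := by
  rw [L2.inner_def, intervalIntegral.integral_of_le (left_lt_right j).le,
    integral_Ioc_eq_integral_Ioo]
  refine integral_congr_ae (ae_of_all _ fun x => ?_)
  simp [mul_comm]

theorem intervalIntegral_congr_part (j : Fin 2) {u v : ℝ → ℝ}
    (h : u =ᵐ[volume.restrict (Ioo (D.left j) (D.right j))] v) :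
    ∫ x in D.left j..D.right j, u x = ∫ x in D.left j..D.right j, v x :=
  intervalIntegral_congr_Lp (right_mem_Icc.2 (left_lt_right j).le) h

/-- Integration by parts on each part: the boundary terms vanish at the clamped ends because of `B`,
and those at `L₀` cancel because both factors are continuous there. -/
theorem sum_inner_dx_add_inner_fld (g : D.Fields) (K : D.Fields)
    (hK : ∀ j i, K j i =ᵐ[volume.restrict (Ioo (D.left j) (D.right j))] D.primitive g j i)
    (B : D.Hd) (i : Fin 3) :
    ∑ j, (inner ℝ (K j i) (Hd.dx B j i) + inner ℝ (g j i) (Hd.fld B j i)) = 0 := by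
  have h : ∀ j, inner ℝ (K j i) (Hd.dx B j i) + inner ℝ (g j i) (Hd.fld B j i) =
      D.primitive g j i (D.right j) * Hd.rep B j i (D.right j) -
        D.primitive g j i (D.left j) * Hd.rep B j i (D.left j) := by
    intro j
    have hp := (isPrimitiveOn_primitive g j i).mul (Hd.isPrimitiveOn_rep B j i)
    rw [← hp.integral_eq, inner_L2_eq, inner_L2_eq, ← intervalIntegral.integral_add]
    · refine intervalIntegral_congr_part j ?_
      filter_upwards [hK j i, Hd.fld_ae_eq B j i] with x h1 h2
      rw [h1, h2]; ring
    · rw [intervalIntegrable_iff_integrableOn_Ioo_of_le (left_lt_right j).le]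
      exact (Lp.memLp _).integrable_mul (Lp.memLp _)
    · rw [intervalIntegrable_iff_integrableOn_Ioo_of_le (left_lt_right j).le]
      exact (Lp.memLp _).integrable_mul (Lp.memLp _)
  rw [Fin.sum_univ_two, h, h]
  have h0 := Hd.rep_clamped B 0 i
  have h1 := Hd.rep_clamped B 1 i
  change D.primitive g 0 i D.L₀ * Hd.rep B 0 i D.L₀ - D.primitive g 0 i 0 * Hd.rep B 0 i 0 +
    (D.primitive g 1 i D.L * Hd.rep B 1 i D.L - D.primitive g 1 i D.L₀ * Hd.rep B 1 i D.L₀) = 0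
  change Hd.rep B 0 i 0 = 0 at h0
  change Hd.rep B 1 i D.L = 0 at h1
  rw [h0, h1, primitive_interface, Hd.rep_interface]
  ring

/-- Fields which are orthogonal to all derivatives of displacement fields are constant. -/
theorem exists_const_of_forall_inner_dx (f : D.Fields)
    (h : ∀ B : D.Hd, ∑ j, ∑ i, inner ℝ (f j i) (Hd.dx B j i) = 0) :
    ∃ c : Fin 3 → ℝ, ∀ j i, f j i =ᵐ[volume.restrict (Ioo (D.left j) (D.right j))] fun _ => c i := by
  have hL := L_pos (D := D)
  -- `c` is the mean over the whole beam. Then `f - c` has total integral zero, hence is itself the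
  -- derivative of a displacement field, and testing with this field gives `‖f - c‖ = 0`.
  let c : Fin 3 → ℝ := fun i => D.L⁻¹ *
    ((∫ t in (0 : ℝ)..D.L₀, f 0 i t) + ∫ t in D.L₀..D.L, f 1 i t)
  have hm : ∀ (j : Fin 2) (i : Fin 3),
      MemLp (fun _ : ℝ => c i) 2 (volume.restrict (Ioo (D.left j) (D.right j))) :=
    fun j i => memLp_of_continuousOn_Icc continuousOn_const 2
  let C : D.Fields := fun j i => (hm j i).toLp
  let G : D.Fields := fun j i => f j i - C j i
  have hGi : ∀ j i, ∫ t in D.left j..D.right j, G j i t =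
      (∫ t in D.left j..D.right j, f j i t) - (D.right j - D.left j) * c i := by
    intro j i
    have hr := right_mem_Icc.2 (left_lt_right (D := D) j).le
    rw [← smul_eq_mul, ← intervalIntegral.integral_const,
      ← intervalIntegral.integral_sub (intervalIntegrable_Lp hr _) intervalIntegrable_const]
    refine intervalIntegral_congr_part j ?_
    filter_upwards [Lp.coeFn_sub (f j i) (C j i), (hm j i).coeFn_toLp] with x h1 h2
    rw [h1, Pi.sub_apply, h2]
  have hG0 : ∀ i, (∫ t in (0 : ℝ)..D.L₀, G 0 i t) + ∫ t in D.L₀..D.L, G 1 i t = 0 := by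
    intro i
    have h0 : ∫ t in (0 : ℝ)..D.L₀, G 0 i t = (∫ t in (0 : ℝ)..D.L₀, f 0 i t) - (D.L₀ - 0) * c i :=
      hGi 0 i
    have h1 : ∫ t in D.L₀..D.L, G 1 i t = (∫ t in D.L₀..D.L, f 1 i t) - (D.L - D.L₀) * c i := hGi 1 i
    rw [h0, h1]
    simp only [c]
    field_simp
    ring
  obtain ⟨B, hB⟩ := exists_hd_of_dx G hG0
  have h1 := h B
  rw [hB] at h1
  have h2 : ∑ j, ∑ i, inner ℝ (C j i) (G j i) = 0 := by
    rw [Finset.sum_comm]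
    refine Finset.sum_eq_zero fun i _ => ?_
    have : ∀ j, inner ℝ (C j i) (G j i) = c i * ∫ t in D.left j..D.right j, G j i t := fun j => by
      rw [inner_L2_eq, ← intervalIntegral.integral_const_mul]
      refine intervalIntegral_congr_part j ?_
      filter_upwards [(hm j i).coeFn_toLp] with x h2
      rw [h2]
    rw [Fin.sum_univ_two, this, this, ← mul_add]
    exact mul_eq_zero_of_right _ (hG0 i)
  have h3 : ∑ j, ∑ i, ‖G j i‖ ^ 2 = 0 := by
    have : ∀ j i, ‖G j i‖ ^ 2 = inner ℝ (f j i) (G j i) - inner ℝ (C j i) (G j i) := fun j i => by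
      rw [← inner_sub_left, ← real_inner_self_eq_norm_sq]
    simp only [this, Finset.sum_sub_distrib, h1, h2, sub_zero]
  refine ⟨c, fun j i => ?_⟩
  have h4 := (Finset.sum_eq_zero_iff_of_nonneg fun j _ =>
    Finset.sum_nonneg fun i _ => sq_nonneg _).1 h3 j (Finset.mem_univ _)
  have h5 := (Finset.sum_eq_zero_iff_of_nonneg fun i _ => sq_nonneg _).1 h4 i (Finset.mem_univ _)
  have h6 : f j i = C j i := sub_eq_zero.1 (norm_eq_zero.1 (pow_eq_zero_iff two_ne_zero |>.1 h5))
  rw [h6]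
  exact (hm j i).coeFn_toLp

/-- Regularity: for a displacement field `Φ` with `AΦ = -W` in the weak sense the forces are
continuous on the whole beam, and `W` is the acceleration given by the equations of motion. -/
theorem exists_continuous_forces (Φ : D.Energy) (W : D.SixL2)
    (h : ∀ B : D.Energy, inner ℝ Φ B = -inner ℝ W (Energy.embX D B)) :
    ∃ T : Fin 2 → Fin 3 → ℝ → ℝ,
      (∀ j i, (fun x => D.stiffness j i * D.strain j (Energy.toHd Φ) i x)
        =ᵐ[volume.restrict (Ioo (D.left j) (D.right j))] T j i) ∧
      (∀ j, IsPrimitiveOn (D.left j) (D.right j) (T j 0)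
          (fun x => √(D.inertia j 0) * W (j, 0) x - D.l * T j 2 x) ∧
        IsPrimitiveOn (D.left j) (D.right j) (T j 1)
          (fun x => √(D.inertia j 1) * W (j, 1) x + T j 0 x) ∧
        IsPrimitiveOn (D.left j) (D.right j) (T j 2)
          (fun x => √(D.inertia j 2) * W (j, 2) x + D.l * T j 0 x)) ∧
      ∀ i, T 0 i D.L₀ = T 1 i D.L₀ := by
  let F : D.Fields := fun j i => D.stiffness j i • D.strain j (Energy.toHd Φ) i
  let A : D.Fields := fun j i => √(D.inertia j i) • W (j, i)
  -- `g` is what the equations of motion prescribe for the derivatives of the forces `F`; `K` is its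
  -- primitive, continuous across `L₀`.
  let g : D.Fields := fun j => ![A j 0 - D.l • F j 2, A j 1 + F j 0, A j 2 + D.l • F j 0]
  have hm : ∀ j i, MemLp (D.primitive g j i) 2 (volume.restrict (Ioo (D.left j) (D.right j))) :=
    fun j i => memLp_of_continuousOn_Icc (isPrimitiveOn_primitive g j i).continuousOn 2
  let K : D.Fields := fun j i => (hm j i).toLp
  have hform : ∀ B : D.Hd,
      ∑ j, ∑ i, (inner ℝ (F j i) (Hd.dx B j i) + inner ℝ (g j i) (Hd.fld B j i)) = 0 := by
    intro B
    have h1 := h (Energy.toHd.symm B)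
    have h2 : inner ℝ Φ (Energy.toHd.symm B) = ∑ j, ∑ i, inner ℝ (F j i) (D.strain j B i) := by
      change inner ℝ (D.energyEmb (Energy.toHd Φ)) (D.energyEmb B) = _
      rw [PiLp.inner_apply, Fintype.sum_prod_type]
      refine Finset.sum_congr rfl fun j _ => Finset.sum_congr rfl fun i _ => ?_
      rw [energyEmb_apply, energyEmb_apply, inner_smul_left, inner_smul_right, inner_smul_left,
        RCLike.conj_to_real, RCLike.conj_to_real, ← mul_assoc,
        Real.mul_self_sqrt (stiffness_pos j i).le]
    have h3 : inner ℝ W (Energy.embX D (Energy.toHd.symm B)) =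
        ∑ j, ∑ i, inner ℝ (A j i) (Hd.fld B j i) := by
      rw [PiLp.inner_apply, Fintype.sum_prod_type]
      refine Finset.sum_congr rfl fun j _ => Finset.sum_congr rfl fun i _ => ?_
      rw [Energy.embX_apply, inner_smul_right, inner_smul_left, RCLike.conj_to_real]
      rfl
    rw [h2, h3, eq_neg_iff_add_eq_zero, ← Finset.sum_add_distrib] at h1
    rw [← h1]
    refine Finset.sum_congr rfl fun j _ => ?_
    rw [← Finset.sum_add_distrib, Fin.sum_univ_three, Fin.sum_univ_three]
    simp only [g, strain, LinearMap.coe_mk, AddHom.coe_mk, Matrix.cons_val_zero,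
      Matrix.cons_val_one, Matrix.cons_val, inner_add_left, inner_add_right, inner_sub_left,
      inner_sub_right, inner_smul_left, inner_smul_right, RCLike.conj_to_real]
    ring
  -- The difference of the forces and the primitive is orthogonal to all derivatives, so it is one
  -- constant for both parts. This yields the force transmission conditions at `L₀`.
  obtain ⟨c, hc⟩ := exists_const_of_forall_inner_dx (fun j i => F j i - K j i) (by
    intro B
    have h1 := hform B
    have h2 : ∑ j, ∑ i, (inner ℝ (K j i) (Hd.dx B j i) + inner ℝ (g j i) (Hd.fld B j i)) = 0 := by
      rw [Finset.sum_comm]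
      exact Finset.sum_eq_zero fun i _ =>
        sum_inner_dx_add_inner_fld g K (fun j i => (hm j i).coeFn_toLp) B i
    rw [← sub_eq_zero.2 (h1.trans h2.symm), ← Finset.sum_sub_distrib]
    refine Finset.sum_congr rfl fun j _ => ?_
    rw [← Finset.sum_sub_distrib]
    refine Finset.sum_congr rfl fun i _ => ?_
    rw [inner_sub_left]; ring)
  let T : Fin 2 → Fin 3 → ℝ → ℝ := fun j i x => D.primitive g j i x + c i
  have hT : ∀ j i, (fun x => D.stiffness j i * D.strain j (Energy.toHd Φ) i x)
        =ᵐ[volume.restrict (Ioo (D.left j) (D.right j))] T j i := by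
    intro j i
    filter_upwards [hc j i, Lp.coeFn_sub (F j i) (K j i), (hm j i).coeFn_toLp,
      Lp.coeFn_smul (D.stiffness j i) (D.strain j (Energy.toHd Φ) i)] with x h1 h2 h3 h4
    rw [h2, Pi.sub_apply, h3, h4, Pi.smul_apply, smul_eq_mul] at h1
    simp only [T]
    linarith
  have hF : ∀ j i, F j i =ᵐ[volume.restrict (Ioo (D.left j) (D.right j))] T j i := fun j i =>
    (Lp.coeFn_smul _ _).trans (hT j i)
  have hTp : ∀ j i, IsPrimitiveOn (D.left j) (D.right j) (T j i) (g j i) := fun j i => by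
    have h1 := isPrimitiveOn_primitive g j i
    refine ⟨h1.le, h1.integrable, fun x hx => ?_⟩
    simp only [T]
    rw [h1.eq x hx]; ring
  refine ⟨T, hT, fun j => ⟨(hTp j 0).congr_ae ?_, (hTp j 1).congr_ae ?_, (hTp j 2).congr_ae ?_⟩,
    fun i => ?_⟩
  · change (A j 0 - D.l • F j 2 : D.L2 j) =ᵐ[_] _
    filter_upwards [Lp.coeFn_sub (A j 0) (D.l • F j 2), Lp.coeFn_smul D.l (F j 2), hF j 2,
      Lp.coeFn_smul √(D.inertia j 0) (W (j, 0))] with x h1 h2 h3 h4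
    rw [h1, Pi.sub_apply, h2, Pi.smul_apply, h3, h4]; rfl
  · change (A j 1 + F j 0 : D.L2 j) =ᵐ[_] _
    filter_upwards [Lp.coeFn_add (A j 1) (F j 0), hF j 0,
      Lp.coeFn_smul √(D.inertia j 1) (W (j, 1))] with x h1 h3 h4
    rw [h1, Pi.add_apply, h3, h4]; rfl
  · change (A j 2 + D.l • F j 0 : D.L2 j) =ᵐ[_] _
    filter_upwards [Lp.coeFn_add (A j 2) (D.l • F j 0), Lp.coeFn_smul D.l (F j 0), hF j 0,
      Lp.coeFn_smul √(D.inertia j 2) (W (j, 2))] with x h1 h2 h3 h4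
    rw [h1, Pi.add_apply, h2, Pi.smul_apply, h3, h4]; rfl
  · simp only [T, primitive_interface]

end BresseBeam
end

/-! ### Strong states and the calculus of controlled quantities -/

noncomputable section

section Multiplication

variable {a b : ℝ}

theorem exists_ae_abs_le {m : ℝ → ℝ} (hm : Continuous m) (a b : ℝ) :
    ∃ C, 0 ≤ C ∧ ∀ᵐ x ∂volume.restrict (Ioo a b), |m x| ≤ C := by
  obtain ⟨C, hC⟩ := isCompact_Icc.exists_bound_of_continuousOn (s := Icc a b) hm.continuousOn
  refine ⟨|C|, abs_nonneg _, ?_⟩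
  filter_upwards [ae_restrict_mem measurableSet_Ioo] with x hx
  exact (hC x (Ioo_subset_Icc_self hx)).trans (le_abs_self C)

theorem memLp_continuous_mul {m : ℝ → ℝ} (hm : Continuous m)
    (g : Lp ℝ 2 (volume.restrict (Ioo a b))) :
    MemLp (fun x => m x * g x) 2 (volume.restrict (Ioo a b)) := by
  obtain ⟨C, -, hC⟩ := exists_ae_abs_le hm a b
  refine (Lp.memLp g).of_le_mul (c := C) (hm.aestronglyMeasurable.mul (Lp.memLp g).1) ?_
  filter_upwards [hC] with x hx
  rw [norm_mul]
  exact mul_le_mul_of_nonneg_right hx (norm_nonneg _)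

/-- Multiplication by a continuous function on `L²(a, b)`. -/
def mulLp {m : ℝ → ℝ} (hm : Continuous m) :
    Lp ℝ 2 (volume.restrict (Ioo a b)) →L[ℝ] Lp ℝ 2 (volume.restrict (Ioo a b)) :=
  LinearMap.mkContinuous
    { toFun := fun g => (memLp_continuous_mul hm g).toLp
      map_add' := fun g g' => by
        rw [← MemLp.toLp_add]
        refine MemLp.toLp_congr _ _ ?_
        filter_upwards [Lp.coeFn_add g g'] with x hx
        rw [hx, Pi.add_apply, Pi.add_apply, mul_add]
      map_smul' := fun c g => by
        rw [RingHom.id_apply, ← MemLp.toLp_const_smul]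
        refine MemLp.toLp_congr _ _ ?_
        filter_upwards [Lp.coeFn_smul c g] with x hx
        rw [hx, Pi.smul_apply, Pi.smul_apply, smul_eq_mul, smul_eq_mul]
        ring } (exists_ae_abs_le hm a b).choose fun g => by
    refine Lp.norm_le_mul_norm_of_ae_le_mul ?_
    filter_upwards [(memLp_continuous_mul hm g).coeFn_toLp, (exists_ae_abs_le hm a b).choose_spec.2]
      with x hx hx'
    change ‖(MemLp.toLp _ (memLp_continuous_mul hm g)) x‖ ≤ _
    rw [hx, norm_mul]
    exact mul_le_mul_of_nonneg_right hx' (norm_nonneg _)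

theorem mulLp_ae_eq {m : ℝ → ℝ} (hm : Continuous m) (g : Lp ℝ 2 (volume.restrict (Ioo a b))) :
    mulLp hm g =ᵐ[volume.restrict (Ioo a b)] fun x => m x * g x :=
  (memLp_continuous_mul hm g).coeFn_toLp

end Multiplication

/-- The functions which describe a strong state of a part of the beam: displacements `u`,
strains `s`, velocities `v` with derivatives `d`, and accelerations `w`, where `R` are the inertias
and `K` the stiffnesses. -/
structure IsStrongPart (a b l : ℝ) (R K : Fin 3 → ℝ) (u s v d w : Fin 3 → ℝ → ℝ) : Prop where
  u_zero : IsPrimitiveOn a b (u 0) (fun x => s 0 x - u 1 x - l * u 2 x)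
  u_one : IsPrimitiveOn a b (u 1) (s 1)
  u_two : IsPrimitiveOn a b (u 2) (fun x => s 2 x + l * u 0 x)
  s_zero : IsPrimitiveOn a b (fun x => K 0 * s 0 x) (fun x => R 0 * w 0 x - l * (K 2 * s 2 x))
  s_one : IsPrimitiveOn a b (fun x => K 1 * s 1 x) (fun x => R 1 * w 1 x + K 0 * s 0 x)
  s_two : IsPrimitiveOn a b (fun x => K 2 * s 2 x) (fun x => R 2 * w 2 x + l * (K 0 * s 0 x))
  vel : ∀ i, IsPrimitiveOn a b (v i) (d i)

namespace BresseBeam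

/-- A displacement field `Φ`, a velocity field `V` with finite energy and an acceleration `W`
which satisfy the linear conservative equations of motion. -/
structure StrongTriple (D : BresseBeam) [D.Regular] where
  Φ : D.Energy
  V : D.Energy
  W : D.SixL2
  eq : ∀ B : D.Energy, inner ℝ Φ B = -inner ℝ W (Energy.embX D B)

namespace StrongTriple

variable {D : BresseBeam} [D.Regular] (τ : D.StrongTriple)

def force : Fin 2 → Fin 3 → ℝ → ℝ := (exists_continuous_forces τ.Φ τ.W τ.eq).choose

def u (j : Fin 2) (i : Fin 3) : ℝ → ℝ := Hd.rep (Energy.toHd τ.Φ) j i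

def s (j : Fin 2) (i : Fin 3) (x : ℝ) : ℝ := (D.stiffness j i)⁻¹ * τ.force j i x

def v (j : Fin 2) (i : Fin 3) : ℝ → ℝ := Hd.rep (Energy.toHd τ.V) j i

def d (j : Fin 2) (i : Fin 3) : ℝ → ℝ := Hd.dx (Energy.toHd τ.V) j i

def w (j : Fin 2) (i : Fin 3) (x : ℝ) : ℝ := (√(D.inertia j i))⁻¹ * τ.W (j, i) x

/-- The strain rates. -/
def r (j : Fin 2) (i : Fin 3) : ℝ → ℝ :=
  (![fun x => τ.d j 0 x + τ.v j 1 x + D.l * τ.v j 2 x, τ.d j 1,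
    fun x => τ.d j 2 x - D.l * τ.v j 0 x] : Fin 3 → ℝ → ℝ) i

theorem stiffness_mul_s (j : Fin 2) (i : Fin 3) (x : ℝ) :
    D.stiffness j i * τ.s j i x = τ.force j i x := by
  rw [s, mul_inv_cancel_left₀ (stiffness_pos j i).ne']

theorem force_interface (i : Fin 3) : τ.force 0 i D.L₀ = τ.force 1 i D.L₀ :=
  (exists_continuous_forces τ.Φ τ.W τ.eq).choose_spec.2.2 i

theorem strain_ae_eq_s (j : Fin 2) (i : Fin 3) :
    D.strain j (Energy.toHd τ.Φ) i =ᵐ[volume.restrict (Ioo (D.left j) (D.right j))] τ.s j i := by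
  filter_upwards [(exists_continuous_forces τ.Φ τ.W τ.eq).choose_spec.1 j i] with x hx
  have h := (stiffness_pos (D := D) j i).ne'
  rw [s, force, ← hx, inv_mul_cancel_left₀ h]

theorem strain_ae_eq_r (j : Fin 2) (i : Fin 3) :
    D.strain j (Energy.toHd τ.V) i =ᵐ[volume.restrict (Ioo (D.left j) (D.right j))] τ.r j i := by
  filter_upwards [strain_ae_eq_rep (Energy.toHd τ.V) j] with x hx
  fin_cases i
  · change _ = Hd.dx (Energy.toHd τ.V) j 0 x + Hd.rep (Energy.toHd τ.V) j 1 x +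
      D.l * Hd.rep (Energy.toHd τ.V) j 2 x
    rw [hx.1]
    simp only [Fin.zero_eta]
    ring
  · exact hx.2.1.symm
  · change _ = Hd.dx (Energy.toHd τ.V) j 2 x - D.l * Hd.rep (Energy.toHd τ.V) j 0 x
    rw [hx.2.2]
    simp only [Fin.reduceFinMk]
    ring

theorem sqrt_mul_W (j : Fin 2) (i : Fin 3) (x : ℝ) :
    √(D.inertia j i) * τ.W (j, i) x = D.inertia j i * τ.w j i x := by
  have h := Real.sqrt_pos.2 (inertia_pos (D := D) j i)
  nth_rewrite 2 [← Real.mul_self_sqrt (inertia_pos (D := D) j i).le]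
  rw [w]
  field_simp

theorem isStrongPart (j : Fin 2) : IsStrongPart (D.left j) (D.right j) D.l (D.inertia j)
    (D.stiffness j) (τ.u j) (τ.s j) (τ.v j) (τ.d j) (τ.w j) := by
  have hF := (exists_continuous_forces τ.Φ τ.W τ.eq).choose_spec.2.1 j
  have hf : ∀ i, (fun x => D.stiffness j i * τ.s j i x) = τ.force j i := fun i =>
    funext fun x => τ.stiffness_mul_s j i x
  refine ⟨?_, ?_, ?_, ?_, ?_, ?_, fun i => Hd.isPrimitiveOn_rep _ j i⟩
  · refine (Hd.isPrimitiveOn_rep (Energy.toHd τ.Φ) j 0).congr_ae ?_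
    filter_upwards [strain_ae_eq_rep (Energy.toHd τ.Φ) j, τ.strain_ae_eq_s j 0] with x h1 h2
    rw [h1.1, h2]; rfl
  · refine (Hd.isPrimitiveOn_rep (Energy.toHd τ.Φ) j 1).congr_ae ?_
    filter_upwards [strain_ae_eq_rep (Energy.toHd τ.Φ) j, τ.strain_ae_eq_s j 1] with x h1 h2
    rw [h1.2.1, h2]
  · refine (Hd.isPrimitiveOn_rep (Energy.toHd τ.Φ) j 2).congr_ae ?_
    filter_upwards [strain_ae_eq_rep (Energy.toHd τ.Φ) j, τ.strain_ae_eq_s j 2] with x h1 h2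
    rw [h1.2.2, h2]; rfl
  · rw [hf]
    simp only [← τ.sqrt_mul_W, stiffness_mul_s]
    exact hF.1
  · rw [hf]
    simp only [← τ.sqrt_mul_W, stiffness_mul_s]
    exact hF.2.1
  · rw [hf]
    simp only [← τ.sqrt_mul_W, stiffness_mul_s]
    exact hF.2.2

/-- The density of the kinetic and elastic energies, without coefficients. -/
def density (j : Fin 2) (x : ℝ) : ℝ :=
  τ.v j 0 x ^ 2 + τ.v j 1 x ^ 2 + τ.v j 2 x ^ 2 + τ.s j 0 x ^ 2 + τ.s j 1 x ^ 2 + τ.s j 2 x ^ 2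

def dispDensity (j : Fin 2) (x : ℝ) : ℝ := τ.u j 0 x ^ 2 + τ.u j 1 x ^ 2 + τ.u j 2 x ^ 2

/-- The energy of the `j`-th part. -/
def en (j : Fin 2) : ℝ := ∫ x in D.left j..D.right j, τ.density j x

/-- The observed quantities: the angular velocity of the damped part, and the displacements. -/
def ob : ℝ := (∫ x in D.left 0..D.right 0, τ.v 0 1 x ^ 2) +
  ((∫ x in D.left 0..D.right 0, τ.dispDensity 0 x) + ∫ x in D.left 1..D.right 1, τ.dispDensity 1 x)

/-- The time derivative of the bilinear quantity `J(Φ, V)`. -/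
def rate (J : D.Energy →L[ℝ] D.SixL2 →L[ℝ] ℝ) : ℝ :=
  J τ.V (Energy.embX D τ.V) + J τ.Φ τ.W

theorem en_nonneg (j : Fin 2) : 0 ≤ τ.en j :=
  intervalIntegral.integral_nonneg (left_lt_right j).le fun x _ => by unfold density; positivity

theorem disp_nonneg (j : Fin 2) : 0 ≤ ∫ x in D.left j..D.right j, τ.dispDensity j x :=
  intervalIntegral.integral_nonneg (left_lt_right j).le fun x _ => by unfold dispDensity; positivity

theorem obs_nonneg : 0 ≤ ∫ x in D.left 0..D.right 0, τ.v 0 1 x ^ 2 :=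
  intervalIntegral.integral_nonneg (left_lt_right 0).le fun _ _ => sq_nonneg _

theorem ob_nonneg : 0 ≤ τ.ob :=
  add_nonneg τ.obs_nonneg (add_nonneg (τ.disp_nonneg 0) (τ.disp_nonneg 1))

end StrongTriple

variable {D : BresseBeam} [D.Regular]

/-- `g` is the density of the time derivative of a bounded bilinear quantity. -/
def IsRateDensity (j : Fin 2) (g : D.StrongTriple → ℝ → ℝ) : Prop :=
  (∀ τ, IntervalIntegrable (g τ) volume (D.left j) (D.right j)) ∧
    ∃ J : D.Energy →L[ℝ] D.SixL2 →L[ℝ] ℝ, ∀ τ, τ.rate J = ∫ x in D.left j..D.right j, g τ x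

theorem IsRateDensity.add {j : Fin 2} {g g' : D.StrongTriple → ℝ → ℝ} (h : IsRateDensity j g)
    (h' : IsRateDensity j g') : IsRateDensity j fun τ x => g τ x + g' τ x := by
  obtain ⟨hi, J, hJ⟩ := h
  obtain ⟨hi', J', hJ'⟩ := h'
  refine ⟨fun τ => (hi τ).add (hi' τ), J + J', fun τ => ?_⟩
  rw [intervalIntegral.integral_add (hi τ) (hi' τ), ← hJ, ← hJ']
  simp only [StrongTriple.rate, add_apply]
  ring

/-- The functional is `∫ m (AΦ) v_i`; by the product rule its rate has the two terms `(A V) v_i` and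
`(AΦ) w_i`. In weighted coordinates velocity and acceleration carry `√R`, which the factor
`R^{-1/2}` in `J` removes. -/
theorem isRateDensity_of_operator {j : Fin 2} (i : Fin 3) {m : ℝ → ℝ} (hm : Continuous m)
    (A : D.Energy →L[ℝ] D.L2 j) (p q : D.StrongTriple → ℝ → ℝ)
    (hp : ∀ τ, A τ.V =ᵐ[volume.restrict (Ioo (D.left j) (D.right j))] p τ)
    (hq : ∀ τ, A τ.Φ =ᵐ[volume.restrict (Ioo (D.left j) (D.right j))] q τ) :
    IsRateDensity j fun τ x => m x * (p τ x * τ.v j i x + q τ x * τ.w j i x) := by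
  have hle := (left_lt_right (D := D) j).le
  have hR := Real.sqrt_pos.2 (inertia_pos (D := D) j i)
  have hv : ∀ τ : D.StrongTriple, Energy.embX D τ.V (j, i)
      =ᵐ[volume.restrict (Ioo (D.left j) (D.right j))] fun x => √(D.inertia j i) * τ.v j i x := by
    intro τ
    filter_upwards [Lp.coeFn_smul √(D.inertia j i) (Hd.fld (Energy.toHd τ.V) j i),
      Hd.fld_ae_eq (Energy.toHd τ.V) j i] with x h1 h2
    change (√(D.inertia j i) • Hd.fld (Energy.toHd τ.V) j i : D.L2 j) x = _
    rw [h1, Pi.smul_apply, h2]; rfl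
  have i1 : ∀ τ, (fun x => m x * (p τ x * τ.v j i x)) =ᵐ[volume.restrict (Ioo (D.left j) (D.right j))]
      fun x => (√(D.inertia j i))⁻¹ * (mulLp hm (A τ.V) x * Energy.embX D τ.V (j, i) x) := by
    intro τ
    filter_upwards [hp τ, mulLp_ae_eq hm (A τ.V), hv τ] with x h1 h2 h3
    rw [h2, h3, h1]
    field_simp
  have i2 : ∀ τ, (fun x => m x * (q τ x * τ.w j i x)) =ᵐ[volume.restrict (Ioo (D.left j) (D.right j))]
      fun x => (√(D.inertia j i))⁻¹ * (mulLp hm (A τ.Φ) x * τ.W (j, i) x) := by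
    intro τ
    filter_upwards [hq τ, mulLp_ae_eq hm (A τ.Φ)] with x h1 h2
    rw [h2, h1, StrongTriple.w]
    ring
  have hint : ∀ f g : D.L2 j, IntervalIntegrable (fun x => (√(D.inertia j i))⁻¹ * (f x * g x)) volume
      (D.left j) (D.right j) := fun f g => by
    refine IntervalIntegrable.const_mul ?_ _
    rw [intervalIntegrable_iff_integrableOn_Ioo_of_le hle]
    exact (Lp.memLp f).integrable_mul (Lp.memLp g)
  have c1 : ∀ τ, IntervalIntegrable (fun x => m x * (p τ x * τ.v j i x)) volume (D.left j) (D.right j) :=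
    fun τ => by
      have := hint (mulLp hm (A τ.V)) (Energy.embX D τ.V (j, i))
      rw [intervalIntegrable_iff_integrableOn_Ioo_of_le hle] at this ⊢
      exact this.congr (i1 τ).symm
  have c2 : ∀ τ, IntervalIntegrable (fun x => m x * (q τ x * τ.w j i x)) volume (D.left j) (D.right j) :=
    fun τ => by
      have := hint (mulLp hm (A τ.Φ)) (τ.W (j, i))
      rw [intervalIntegrable_iff_integrableOn_Ioo_of_le hle] at this ⊢
      exact this.congr (i2 τ).symm
  refine ⟨fun τ => ?_, (√(D.inertia j i))⁻¹ • ((innerSL ℝ : D.L2 j →L[ℝ] _).bilinearComp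
    (mulLp hm ∘L A) (PiLp.proj 2 (fun p : Fin 2 × Fin 3 => D.L2 p.1) (j, i) : D.SixL2 →L[ℝ] D.L2 j)),
    fun τ => ?_⟩
  · simpa [mul_add] using (c1 τ).add (c2 τ)
  · simp only [mul_add]
    rw [intervalIntegral.integral_add (c1 τ) (c2 τ), intervalIntegral_congr_part j (i1 τ),
      intervalIntegral_congr_part j (i2 τ), intervalIntegral.integral_const_mul,
      intervalIntegral.integral_const_mul, ← inner_L2_eq, ← inner_L2_eq]
    rfl

theorem isRateDensity_strain {j : Fin 2} (a i : Fin 3) {m : ℝ → ℝ} (hm : Continuous m) :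
    IsRateDensity (D := D) j fun τ x => m x * (τ.r j a x * τ.v j i x + τ.s j a x * τ.w j i x) :=
  isRateDensity_of_operator i hm (Energy.strainL j a) (fun τ => τ.r j a) (fun τ => τ.s j a)
    (fun τ => τ.strain_ae_eq_r j a) (fun τ => τ.strain_ae_eq_s j a)

theorem isRateDensity_disp {j : Fin 2} (a i : Fin 3) {m : ℝ → ℝ} (hm : Continuous m) :
    IsRateDensity (D := D) j fun τ x => m x * (τ.v j a x * τ.v j i x + τ.u j a x * τ.w j i x) :=
  isRateDensity_of_operator i hm (Energy.fldL j a) (fun τ => τ.v j a) (fun τ => τ.u j a)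
    (fun τ => Hd.fld_ae_eq (Energy.toHd τ.V) j a) (fun τ => Hd.fld_ae_eq (Energy.toHd τ.Φ) j a)

/-- `q` is bounded by the time derivative of a bounded bilinear quantity, a small part of the energy
and the observed quantities. -/
def IsControlled (q : D.StrongTriple → ℝ) : Prop :=
  ∀ ε > 0, ∃ (J : D.Energy →L[ℝ] D.SixL2 →L[ℝ] ℝ) (C : ℝ), 0 ≤ C ∧
    ∀ τ, q τ ≤ τ.rate J + ε * (τ.en 0 + τ.en 1) + C * τ.ob

/-- The step of every multiplier argument: once the rate `g` is accounted for, a large multiple of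
an already controlled quantity `r` is harmless, because the tolerance for `r` may be chosen after
the constant. -/
theorem IsControlled.of_le {q r g : D.StrongTriple → ℝ}
    (hg : ∃ J : D.Energy →L[ℝ] D.SixL2 →L[ℝ] ℝ, ∀ τ, τ.rate J = g τ)
    (hr : IsControlled r) (h : ∀ ε > 0, ∃ C, 0 ≤ C ∧ ∀ τ,
      q τ ≤ g τ + ε * (τ.en 0 + τ.en 1) + C * (τ.ob + r τ)) : IsControlled q := by
  intro ε hε
  obtain ⟨J₀, hJ₀⟩ := hg
  obtain ⟨C, hC, h1⟩ := h (ε / 2) (by positivity)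
  -- This tolerance, multiplied by `C`, uses at most the remaining half of `ε`; the added `1` covers
  -- `C = 0`.
  obtain ⟨J, C', hC', h2⟩ := hr (ε / (2 * (C + 1))) (by positivity)
  refine ⟨J₀ + C • J, C + C * C', by positivity, fun τ => ?_⟩
  have h3 := h1 τ
  have h4 := mul_le_mul_of_nonneg_left (h2 τ) hC
  have h5 : C * (ε / (2 * (C + 1)) * (τ.en 0 + τ.en 1)) ≤ ε / 2 * (τ.en 0 + τ.en 1) := by
    rw [← mul_assoc]
    refine mul_le_mul_of_nonneg_right ?_ (add_nonneg (τ.en_nonneg 0) (τ.en_nonneg 1))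
    rw [← mul_div_assoc, div_le_div_iff₀ (by positivity) (by positivity)]
    nlinarith
  have h6 : τ.rate (J₀ + C • J) = g τ + C * τ.rate J := by
    rw [← hJ₀]
    simp only [StrongTriple.rate, add_apply, smul_apply,
      smul_eq_mul]
    ring
  rw [h6]
  nlinarith

theorem IsControlled.zero : IsControlled fun _ : D.StrongTriple => (0 : ℝ) := fun ε hε =>
  ⟨0, 0, le_rfl, fun τ => by
    have := add_nonneg (τ.en_nonneg 0) (τ.en_nonneg 1)
    simp only [StrongTriple.rate, zero_apply, add_zero, zero_add, zero_mul]
    positivity⟩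

theorem IsControlled.add {q r : D.StrongTriple → ℝ} (hq : IsControlled q) (hr : IsControlled r) :
    IsControlled fun τ => q τ + r τ := by
  intro ε hε
  obtain ⟨J, C, hC, h1⟩ := hq (ε / 2) (by positivity)
  obtain ⟨J', C', hC', h2⟩ := hr (ε / 2) (by positivity)
  refine ⟨J + J', C + C', by positivity, fun τ => ?_⟩
  have h3 : τ.rate (J + J') = τ.rate J + τ.rate J' := by
    simp only [StrongTriple.rate, add_apply]
    ring
  have h1 := h1 τ
  have h2 := h2 τ
  rw [h3]
  linarith

theorem IsControlled.mono {q r : D.StrongTriple → ℝ} (hr : IsControlled r)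
    (h : ∃ C, 0 ≤ C ∧ ∀ τ, q τ ≤ C * (τ.ob + r τ)) : IsControlled q := by
  obtain ⟨C, hC, h⟩ := h
  refine IsControlled.of_le (g := fun _ => 0) ⟨0, fun τ => by simp [StrongTriple.rate]⟩ hr
    fun ε hε => ⟨C, hC, fun τ => ?_⟩
  have := add_nonneg (τ.en_nonneg 0) (τ.en_nonneg 1)
  have := h τ
  nlinarith

end BresseBeam
end

/-! ### Pointwise inequalities and multiplier identities -/

noncomputable section

section PointwiseInequalities

/-- Young's inequality with the coefficient kept beside the controlled factor: only `c² y²` has to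
be bounded, so `y` may be controlled merely with a weight that `c` brings along. -/
theorem exists_young {δ : ℝ} (hδ : 0 < δ) {K : ℝ} (hK : 0 ≤ K) :
    ∃ C, 0 ≤ C ∧ ∀ c x y O : ℝ, c ^ 2 * y ^ 2 ≤ K * O → c * x * y ≤ δ * x ^ 2 + C * O := by
  refine ⟨K / (4 * δ), by positivity, fun c x y O h => ?_⟩
  have h1 : K / (4 * δ) * O = K * O / (4 * δ) := by ring
  have h2 : c ^ 2 * y ^ 2 / (4 * δ) ≤ K * O / (4 * δ) := div_le_div_of_nonneg_right h (by positivity)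
  have h3 : δ * x ^ 2 - c * x * y + c ^ 2 * y ^ 2 / (4 * δ) = δ * (x - c * y / (2 * δ)) ^ 2 := by
    field_simp; ring
  have h4 : 0 ≤ δ * (x - c * y / (2 * δ)) ^ 2 := by positivity
  rw [h1]; linarith

theorem sq_mul_sq_le {c y K O : ℝ} (hc : c ^ 2 ≤ K) (hy : y ^ 2 ≤ O) :
    c ^ 2 * y ^ 2 ≤ K * O :=
  mul_le_mul hc hy (sq_nonneg _) ((sq_nonneg _).trans hc)

theorem sq_mul_sq_le_of_weight {c y K O χ : ℝ} (hK : 0 ≤ K) (hc : c ^ 2 ≤ K * χ)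
    (hy : χ * y ^ 2 ≤ O) : c ^ 2 * y ^ 2 ≤ K * O := by
  have h1 := mul_le_mul_of_nonneg_right hc (sq_nonneg y)
  have h2 := mul_le_mul_of_nonneg_left hy hK
  linarith

/-- Values of a weight function and of its derivative. -/
structure IsWeight (X χ χ' : ℝ) : Prop where
  nonneg : 0 ≤ χ
  le : χ ≤ X
  sq_le : χ ^ 2 ≤ X * χ
  -- This makes terms with the derivative of the weight absorbable when one factor is controlled
  -- only in the form `χ y²`.
  sq_le' : χ' ^ 2 ≤ X * χ

namespace IsWeight

variable {X χ χ' : ℝ}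

theorem bound_nonneg (h : IsWeight X χ χ') : 0 ≤ X := h.nonneg.trans h.le

theorem mul_sq_le (h : IsWeight X χ χ') (a : ℝ) : (χ * a) ^ 2 ≤ a ^ 2 * X * χ := by
  have := mul_le_mul_of_nonneg_right h.sq_le (sq_nonneg a)
  nlinarith

theorem mul_sq_le' (h : IsWeight X χ χ') (a : ℝ) : (χ' * a) ^ 2 ≤ a ^ 2 * X * χ := by
  have := mul_le_mul_of_nonneg_right h.sq_le' (sq_nonneg a)
  nlinarith

theorem mul_sq_le_const (h : IsWeight X χ χ') (a : ℝ) : (χ * a) ^ 2 ≤ a ^ 2 * X ^ 2 := by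
  refine (h.mul_sq_le a).trans ?_
  have := mul_le_mul_of_nonneg_left h.le (mul_nonneg (sq_nonneg a) h.bound_nonneg)
  nlinarith

theorem mul_sq_le_const' (h : IsWeight X χ χ') (a : ℝ) : (χ' * a) ^ 2 ≤ a ^ 2 * X ^ 2 := by
  refine (h.mul_sq_le' a).trans ?_
  have := mul_le_mul_of_nonneg_left h.le (mul_nonneg (sq_nonneg a) h.bound_nonneg)
  nlinarith

end IsWeight

/-- The bracket is the integrand left by the multiplier `χ ψ`. Besides the bending term, each term
contains `ψ` or `ψ_t`, both observed. -/
theorem exists_bending_bound {X ε : ℝ} (hX : 0 ≤ X) (hε : 0 < ε) (R K : Fin 3 → ℝ) (hR : 0 ≤ R 1) :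
    ∃ C, 0 ≤ C ∧ ∀ χ χ' u₁ s₀ s₁ s₂ v₀ v₁ v₂ O : ℝ, IsWeight X χ χ' → u₁ ^ 2 ≤ O → v₁ ^ 2 ≤ O →
      K 1 * χ * s₁ ^ 2 ≤ (χ' * u₁ * (K 1 * s₁) + χ * s₁ * (K 1 * s₁) + χ * u₁ * (K 0 * s₀)
        - R 1 * χ * v₁ ^ 2) +
        ε * (v₀ ^ 2 + v₁ ^ 2 + v₂ ^ 2 + s₀ ^ 2 + s₁ ^ 2 + s₂ ^ 2) + C * O := by
  obtain ⟨C₁, hC₁, h₁⟩ := exists_young hε (K := (-K 1) ^ 2 * X ^ 2) (by positivity)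
  obtain ⟨C₂, hC₂, h₂⟩ := exists_young hε (K := (-K 0) ^ 2 * X ^ 2) (by positivity)
  refine ⟨C₁ + C₂ + R 1 * X, by positivity, fun χ χ' u₁ s₀ s₁ s₂ v₀ v₁ v₂ O hχ hu hv => ?_⟩
  have y₁ := h₁ (χ' * -K 1) s₁ u₁ O (sq_mul_sq_le (hχ.mul_sq_le_const' _) hu)
  have y₂ := h₂ (χ * -K 0) s₀ u₁ O (sq_mul_sq_le (hχ.mul_sq_le_const _) hu)
  have y₃ : R 1 * (χ * v₁ ^ 2) ≤ R 1 * (X * O) :=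
    mul_le_mul_of_nonneg_left (mul_le_mul hχ.le hv (sq_nonneg _) hX) hR
  have p₀ : 0 ≤ ε * v₀ ^ 2 := by positivity
  have p₁ : 0 ≤ ε * v₁ ^ 2 := by positivity
  have p₂ : 0 ≤ ε * v₂ ^ 2 := by positivity
  have p₃ : 0 ≤ ε * s₂ ^ 2 := by positivity
  linarith

/-- Besides the shear term, each term contains `ψ_t`, or `ψ_x` with a coefficient dominated by `√χ`;
here `O` also bounds `χ ψ_x²`. -/
theorem exists_shear_bound {X ε : ℝ} (hX : 0 ≤ X) (hε : 0 < ε) (R K : Fin 3 → ℝ) (l : ℝ)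
    (hR : 0 ≤ R 1) :
    ∃ C, 0 ≤ C ∧ ∀ χ χ' s₀ s₁ s₂ v₀ v₁ v₂ O : ℝ, IsWeight X χ χ' → v₁ ^ 2 ≤ O → χ * s₁ ^ 2 ≤ O →
      K 0 * χ * s₀ ^ 2 ≤ (R 1 * χ' * v₁ * v₀ + χ' * s₀ * (K 1 * s₁) - R 1 * χ * v₁ ^ 2
        - R 1 * l * χ * v₁ * v₂ + χ * s₀ * (K 0 * s₀) - l * χ * (K 1 / K 0) * s₁ * (K 2 * s₂)) +
        ε * (v₀ ^ 2 + v₁ ^ 2 + v₂ ^ 2 + s₀ ^ 2 + s₁ ^ 2 + s₂ ^ 2) + C * O := by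
  obtain ⟨C₁, hC₁, h₁⟩ := exists_young hε (K := (-R 1) ^ 2 * X ^ 2) (by positivity)
  obtain ⟨C₂, hC₂, h₂⟩ := exists_young hε (K := (-K 1) ^ 2 * X) (by positivity)
  obtain ⟨C₃, hC₃, h₃⟩ := exists_young hε (K := (R 1 * l) ^ 2 * X ^ 2) (by positivity)
  obtain ⟨C₄, hC₄, h₄⟩ := exists_young hε (K := (l * (K 1 / K 0) * K 2) ^ 2 * X) (by positivity)
  refine ⟨C₁ + C₂ + C₃ + C₄ + R 1 * X, by positivity, fun χ χ' s₀ s₁ s₂ v₀ v₁ v₂ O hχ hv hs => ?_⟩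
  have y₁ := h₁ (χ' * -R 1) v₀ v₁ O (sq_mul_sq_le (hχ.mul_sq_le_const' _) hv)
  have y₂ := h₂ (χ' * -K 1) s₀ s₁ O (sq_mul_sq_le_of_weight (by positivity) (hχ.mul_sq_le' _) hs)
  have y₃ := h₃ (χ * (R 1 * l)) v₂ v₁ O (sq_mul_sq_le (hχ.mul_sq_le_const _) hv)
  have y₄ := h₄ (χ * (l * (K 1 / K 0) * K 2)) s₂ s₁ O
    (sq_mul_sq_le_of_weight (by positivity) (hχ.mul_sq_le _) hs)
  have y₅ : R 1 * (χ * v₁ ^ 2) ≤ R 1 * (X * O) :=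
    mul_le_mul_of_nonneg_left (mul_le_mul hχ.le hv (sq_nonneg _) hX) hR
  have p₁ : 0 ≤ ε * v₁ ^ 2 := by positivity
  have p₃ : 0 ≤ ε * s₁ ^ 2 := by positivity
  linarith

/-- The kinetic term stands on both sides. The rest contains a displacement, or is the shear term
already bounded through `χ s₀² ≤ O`. -/
theorem exists_transversal_bound {X ε : ℝ} (hε : 0 < ε) (R K : Fin 3 → ℝ) (l : ℝ)
    (hK : 0 ≤ K 0) :
    ∃ C, 0 ≤ C ∧ ∀ χ χ' u₀ u₁ u₂ s₀ s₁ s₂ v₀ v₁ v₂ O : ℝ, IsWeight X χ χ' → u₀ ^ 2 ≤ O →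
      u₁ ^ 2 ≤ O → u₂ ^ 2 ≤ O → χ * s₀ ^ 2 ≤ O →
      R 0 * χ * v₀ ^ 2 ≤ (R 0 * χ * v₀ ^ 2 - χ' * u₀ * (K 0 * s₀)
        - χ * (s₀ - u₁ - l * u₂) * (K 0 * s₀) + l * χ * u₀ * (K 2 * s₂)) +
        ε * (v₀ ^ 2 + v₁ ^ 2 + v₂ ^ 2 + s₀ ^ 2 + s₁ ^ 2 + s₂ ^ 2) + C * O := by
  have hε3 : 0 < ε / 3 := by positivity
  obtain ⟨C₁, hC₁, h₁⟩ := exists_young hε3 (K := (K 0) ^ 2 * X ^ 2) (by positivity)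
  obtain ⟨C₂, hC₂, h₂⟩ := exists_young hε3 (K := (-K 0) ^ 2 * X ^ 2) (by positivity)
  obtain ⟨C₃, hC₃, h₃⟩ := exists_young hε3 (K := (-(l * K 0)) ^ 2 * X ^ 2) (by positivity)
  obtain ⟨C₄, hC₄, h₄⟩ := exists_young hε (K := (-(l * K 2)) ^ 2 * X ^ 2) (by positivity)
  refine ⟨C₁ + C₂ + C₃ + C₄ + K 0, by positivity,
    fun χ χ' u₀ u₁ u₂ s₀ s₁ s₂ v₀ v₁ v₂ O hχ hu₀ hu₁ hu₂ hs => ?_⟩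
  have y₁ := h₁ (χ' * K 0) s₀ u₀ O (sq_mul_sq_le (hχ.mul_sq_le_const' _) hu₀)
  have y₂ := h₂ (χ * -K 0) s₀ u₁ O (sq_mul_sq_le (hχ.mul_sq_le_const _) hu₁)
  have y₃ := h₃ (χ * -(l * K 0)) s₀ u₂ O (sq_mul_sq_le (hχ.mul_sq_le_const _) hu₂)
  have y₄ := h₄ (χ * -(l * K 2)) s₂ u₀ O (sq_mul_sq_le (hχ.mul_sq_le_const _) hu₀)
  have y₅ := mul_le_mul_of_nonneg_left hs hK
  have p₀ : 0 ≤ ε * v₀ ^ 2 := by positivity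
  have p₁ : 0 ≤ ε * v₁ ^ 2 := by positivity
  have p₂ : 0 ≤ ε * v₂ ^ 2 := by positivity
  have p₃ : 0 ≤ ε * s₁ ^ 2 := by positivity
  linarith

/-- The two good terms come with the factor `l`. The others contain the shear or `φ_t`, controlled
with weight `χ`, or the observed `ψ_t`. -/
theorem exists_axial_bound {X ε : ℝ} (hX : 0 ≤ X) (hε : 0 < ε) (R K : Fin 3 → ℝ) {l : ℝ}
    (hl : 0 ≤ l) (hR : 0 ≤ R 0) (hK : 0 ≤ K 0) :
    ∃ C, 0 ≤ C ∧ ∀ χ χ' s₀ s₁ s₂ v₀ v₁ v₂ O : ℝ, IsWeight X χ χ' →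
      v₁ ^ 2 ≤ O → χ * s₀ ^ 2 ≤ O → χ * v₀ ^ 2 ≤ O →
      l * (R 0 * χ * v₂ ^ 2 + K 2 * χ * s₂ ^ 2) ≤ (-(χ' * s₂ * (K 0 * s₀)) - R 0 * χ' * v₀ * v₂ +
        R 0 * χ * (-(l * v₀ ^ 2) + v₁ * v₂ + l * v₂ ^ 2) + l * χ * s₂ * (K 2 * s₂)
        - l * χ * s₀ * (K 0 * s₀)) +
        ε * (v₀ ^ 2 + v₁ ^ 2 + v₂ ^ 2 + s₀ ^ 2 + s₁ ^ 2 + s₂ ^ 2) + C * O := by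
  have hε2 : 0 < ε / 2 := by positivity
  obtain ⟨C₁, hC₁, h₁⟩ := exists_young hε (K := (K 0) ^ 2 * X) (by positivity)
  obtain ⟨C₂, hC₂, h₂⟩ := exists_young hε2 (K := (R 0) ^ 2 * X) (by positivity)
  obtain ⟨C₃, hC₃, h₃⟩ := exists_young hε2 (K := (-R 0) ^ 2 * X ^ 2) (by positivity)
  refine ⟨C₁ + C₂ + C₃ + R 0 * l + l * K 0, by positivity,
    fun χ χ' s₀ s₁ s₂ v₀ v₁ v₂ O hχ hv₁ hs hv₀ => ?_⟩
  have y₁ := h₁ (χ' * K 0) s₂ s₀ O (sq_mul_sq_le_of_weight (by positivity) (hχ.mul_sq_le' _) hs)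
  have y₂ := h₂ (χ' * R 0) v₂ v₀ O (sq_mul_sq_le_of_weight (by positivity) (hχ.mul_sq_le' _) hv₀)
  have y₃ := h₃ (χ * -R 0) v₂ v₁ O (sq_mul_sq_le (hχ.mul_sq_le_const _) hv₁)
  have y₄ := mul_le_mul_of_nonneg_left hv₀ (mul_nonneg hR hl)
  have y₅ := mul_le_mul_of_nonneg_left hs (mul_nonneg hl hK)
  have p₀ : 0 ≤ ε * v₀ ^ 2 := by positivity
  have p₁ : 0 ≤ ε * v₁ ^ 2 := by positivity
  have p₂ : 0 ≤ ε * s₀ ^ 2 := by positivity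
  have p₃ : 0 ≤ ε * s₁ ^ 2 := by positivity
  linarith

/-- The coupling between displacements and forces. -/
theorem exists_coupling_bound {X ε : ℝ} (hε : 0 < ε) (K : Fin 3 → ℝ) (l : ℝ) :
    ∃ C, 0 ≤ C ∧ ∀ q u₀ u₁ u₂ s₀ s₁ s₂ v₀ v₁ v₂ O : ℝ, q ^ 2 ≤ X → u₀ ^ 2 ≤ O →
      u₁ ^ 2 ≤ O → u₂ ^ 2 ≤ O →
      |q * ((u₁ + l * u₂) * (K 0 * s₀) - l * u₀ * (K 2 * s₂))| ≤
        ε * (v₀ ^ 2 + v₁ ^ 2 + v₂ ^ 2 + s₀ ^ 2 + s₁ ^ 2 + s₂ ^ 2) + C * O := by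
  rcases lt_or_ge X 0 with hX | hX
  · exact ⟨0, le_rfl, fun q _ _ _ _ _ _ _ _ _ _ h => absurd (sq_nonneg q) (by linarith)⟩
  have hε2 : 0 < ε / 2 := by positivity
  have hb : ∀ (q a : ℝ), q ^ 2 ≤ X → (q * a) ^ 2 ≤ a ^ 2 * X := fun q a h => by
    have := mul_le_mul_of_nonneg_right h (sq_nonneg a)
    nlinarith
  obtain ⟨C₁, hC₁, h₁⟩ := exists_young hε2 (K := (K 0) ^ 2 * X) (by positivity)
  obtain ⟨C₂, hC₂, h₂⟩ := exists_young hε2 (K := (l * K 0) ^ 2 * X) (by positivity)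
  obtain ⟨C₃, hC₃, h₃⟩ := exists_young hε (K := (-(l * K 2)) ^ 2 * X) (by positivity)
  refine ⟨C₁ + C₂ + C₃, by positivity,
    fun q u₀ u₁ u₂ s₀ s₁ s₂ v₀ v₁ v₂ O hq hu₀ hu₁ hu₂ => ?_⟩
  have hq' : (-q) ^ 2 ≤ X := by rwa [neg_sq]
  have p₀ : 0 ≤ ε * v₀ ^ 2 := by positivity
  have p₁ : 0 ≤ ε * v₁ ^ 2 := by positivity
  have p₂ : 0 ≤ ε * v₂ ^ 2 := by positivity
  have p₃ : 0 ≤ ε * s₁ ^ 2 := by positivity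
  rw [abs_le]
  constructor
  · have y₁ := h₁ (-q * K 0) s₀ u₁ O (sq_mul_sq_le (hb _ _ hq') hu₁)
    have y₂ := h₂ (-q * (l * K 0)) s₀ u₂ O (sq_mul_sq_le (hb _ _ hq') hu₂)
    have y₃ := h₃ (-q * -(l * K 2)) s₂ u₀ O (sq_mul_sq_le (hb _ _ hq') hu₀)
    linarith
  · have y₁ := h₁ (q * K 0) s₀ u₁ O (sq_mul_sq_le (hb _ _ hq) hu₁)
    have y₂ := h₂ (q * (l * K 0)) s₀ u₂ O (sq_mul_sq_le (hb _ _ hq) hu₂)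
    have y₃ := h₃ (q * -(l * K 2)) s₂ u₀ O (sq_mul_sq_le (hb _ _ hq) hu₀)
    linarith

end PointwiseInequalities

namespace IsStrongPart

variable {a b l : ℝ} {R K : Fin 3 → ℝ} {u s v d w : Fin 3 → ℝ → ℝ} {q q' : ℝ → ℝ}

theorem strain_isPrimitiveOn (h : IsStrongPart a b l R K u s v d w) (hK : ∀ i, 0 < K i) :
    IsPrimitiveOn a b (s 0) (fun x => (K 0)⁻¹ * (R 0 * w 0 x - l * (K 2 * s 2 x))) ∧
    IsPrimitiveOn a b (s 1) (fun x => (K 1)⁻¹ * (R 1 * w 1 x + K 0 * s 0 x)) ∧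
    IsPrimitiveOn a b (s 2) (fun x => (K 2)⁻¹ * (R 2 * w 2 x + l * (K 0 * s 0 x))) := by
  refine ⟨(h.s_zero.const_mul (K 0)⁻¹).congr fun x _ => ?_,
    (h.s_one.const_mul (K 1)⁻¹).congr fun x _ => ?_, (h.s_two.const_mul (K 2)⁻¹).congr fun x _ => ?_⟩
  all_goals rw [inv_mul_cancel_left₀ (hK _).ne']

/-- The multiplier `q ψ` for the shear angle equation. As in the following identities, the
subtracted group is a rate density. -/
theorem bending_flux (h : IsStrongPart a b l R K u s v d w) (hq : IsPrimitiveOn a b q q') :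
    IsPrimitiveOn a b (fun x => q x * u 1 x * (K 1 * s 1 x)) (fun x =>
      (q' x * u 1 x * (K 1 * s 1 x) + q x * s 1 x * (K 1 * s 1 x) + q x * u 1 x * (K 0 * s 0 x)
        - R 1 * q x * v 1 x ^ 2) - -(R 1 * q x) * (v 1 x * v 1 x + u 1 x * w 1 x)) :=
  ((hq.mul h.u_one).mul h.s_one).congr_ae (ae_of_all _ fun x => by ring)

/-- The multiplier `q S` for the shear angle equation, with `S = φ_x + ψ + l ω`. The derivative of
`S` produces `(K₁ R₀ / K₀) ψ_x φ_tt`. Equal wave speeds turn its coefficient into `R₁`, so this term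
joins the product of `S` and `ψ_tt`, and the mixed derivatives of the velocities combine into the
derivative of `φ_t ψ_t`. -/
theorem shear_flux (h : IsStrongPart a b l R K u s v d w) (hK : ∀ i, 0 < K i)
    (hRK : R 0 * K 1 = R 1 * K 0) (hq : IsPrimitiveOn a b q q') :
    IsPrimitiveOn a b (fun x => R 1 * (q x * v 0 x * v 1 x) + q x * s 0 x * (K 1 * s 1 x)) (fun x =>
      (R 1 * q' x * v 1 x * v 0 x + q' x * s 0 x * (K 1 * s 1 x) - R 1 * q x * v 1 x ^ 2
        - R 1 * l * q x * v 1 x * v 2 x + q x * s 0 x * (K 0 * s 0 x)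
        - l * q x * (K 1 / K 0) * s 1 x * (K 2 * s 2 x)) -
      (-(R 1 * q x) * ((d 0 x + v 1 x + l * v 2 x) * v 1 x + s 0 x * w 1 x) +
        -(R 1 * q x) * (d 1 x * v 0 x + s 1 x * w 0 x))) := by
  have h0 := (hK 0).ne'
  refine ((((hq.mul (h.vel 0)).mul (h.vel 1)).const_mul (R 1)).add
    ((hq.mul (h.strain_isPrimitiveOn hK).1).mul h.s_one)).congr_ae (ae_of_all _ fun x => ?_)
  have h1 : R 1 = R 0 * K 1 / K 0 := by rw [hRK]; field_simp
  simp only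
  rw [h1]
  field_simp
  ring

/-- The multiplier `-q φ` for the transversal equation: equipartition between `φ_t` and the shear,
up to displacement terms. -/
theorem transversal_flux (h : IsStrongPart a b l R K u s v d w) (hq : IsPrimitiveOn a b q q') :
    IsPrimitiveOn a b (fun x => -1 * (q x * u 0 x * (K 0 * s 0 x))) (fun x =>
      (R 0 * q x * v 0 x ^ 2 - q' x * u 0 x * (K 0 * s 0 x)
        - q x * (s 0 x - u 1 x - l * u 2 x) * (K 0 * s 0 x) + l * q x * u 0 x * (K 2 * s 2 x)) -
      R 0 * q x * (v 0 x * v 0 x + u 0 x * w 0 x)) :=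
  (((hq.mul h.u_zero).mul h.s_zero).const_mul (-1)).congr_ae (ae_of_all _ fun x => by ring)

/-- The axial strain multiplies the transversal equation and the shear multiplies the axial one.
With equal stiffnesses and inertias the acceleration products match, and the mixed velocity
derivatives form the derivative of `φ_t ω_t`. The curvature couplings leave `l ω_t²` and `l Y²`. -/
theorem axial_flux (h : IsStrongPart a b l R K u s v d w) (hK : ∀ i, 0 < K i)
    (hK02 : K 0 = K 2) (hR02 : R 0 = R 2) (hq : IsPrimitiveOn a b q q') :
    IsPrimitiveOn a b (fun x => -1 * (q x * s 2 x * (K 0 * s 0 x) + R 0 * (q x * v 0 x * v 2 x)))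
      (fun x => (-(q' x * s 2 x * (K 0 * s 0 x)) - R 0 * q' x * v 0 x * v 2 x +
        R 0 * q x * (-(l * v 0 x ^ 2) + v 1 x * v 2 x + l * v 2 x ^ 2) + l * q x * s 2 x * (K 2 * s 2 x)
        - l * q x * s 0 x * (K 0 * s 0 x)) -
      (R 0 * q x * ((d 2 x - l * v 0 x) * v 0 x + s 2 x * w 0 x) +
        R 0 * q x * ((d 0 x + v 1 x + l * v 2 x) * v 2 x + s 0 x * w 2 x))) := by
  have h0 := (hK 2).ne'
  refine ((((hq.mul (h.strain_isPrimitiveOn hK).2.2).mul h.s_zero).add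
    (((hq.mul (h.vel 0)).mul (h.vel 2)).const_mul (R 0))).const_mul (-1)).congr_ae
    (ae_of_all _ fun x => ?_)
  simp only [hK02, hR02]
  field_simp
  ring

/-- The energy density and the flux of the Rellich multiplier `q Φ_x`. -/
theorem rellich_flux (h : IsStrongPart a b l R K u s v d w) (hK : ∀ i, 0 < K i)
    (hq : IsPrimitiveOn a b q q') :
    IsPrimitiveOn a b (fun x => q x * (2⁻¹ * (R 0 * v 0 x ^ 2 + R 1 * v 1 x ^ 2 + R 2 * v 2 x ^ 2 +
        K 0 * s 0 x ^ 2 + K 1 * s 1 x ^ 2 + K 2 * s 2 x ^ 2) -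
        ((u 1 x + l * u 2 x) * (K 0 * s 0 x) - l * u 0 x * (K 2 * s 2 x))))
      (fun x => q' x * (2⁻¹ * (R 0 * v 0 x ^ 2 + R 1 * v 1 x ^ 2 + R 2 * v 2 x ^ 2 +
        K 0 * s 0 x ^ 2 + K 1 * s 1 x ^ 2 + K 2 * s 2 x ^ 2) -
        ((u 1 x + l * u 2 x) * (K 0 * s 0 x) - l * u 0 x * (K 2 * s 2 x))) -
      (-(R 0 * q x) * ((d 0 x + v 1 x + l * v 2 x) * v 0 x + s 0 x * w 0 x) +
        R 0 * q x * (v 1 x * v 0 x + u 1 x * w 0 x) +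
        R 0 * l * q x * (v 2 x * v 0 x + u 2 x * w 0 x) +
        -(R 1 * q x) * (d 1 x * v 1 x + s 1 x * w 1 x) +
        -(R 2 * q x) * ((d 2 x - l * v 0 x) * v 2 x + s 2 x * w 2 x) +
        -(R 2 * l * q x) * (v 0 x * v 2 x + u 0 x * w 2 x))) := by
  obtain ⟨g0, g1, g2⟩ := h.strain_isPrimitiveOn hK
  have k0 := (hK 0).ne'
  have k1 := (hK 1).ne'
  have k2 := (hK 2).ne'
  have p := hq.mul (((((((((h.vel 0).mul (h.vel 0)).const_mul (R 0)).add
    (((h.vel 1).mul (h.vel 1)).const_mul (R 1))).add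
    (((h.vel 2).mul (h.vel 2)).const_mul (R 2))).add
    (g0.mul h.s_zero)).add (g1.mul h.s_one)).add (g2.mul h.s_two)).const_mul 2⁻¹ |>.sub
    (((h.u_one.add (h.u_two.const_mul l)).mul h.s_zero).sub
      ((h.u_zero.const_mul l).mul h.s_two)))
  refine (p.congr fun x _ => by ring).congr_ae (ae_of_all _ fun x => ?_)
  field_simp
  ring

end IsStrongPart
end

/-! ### Interior estimates on the damped part -/

noncomputable section

namespace BresseBeam

variable {D : BresseBeam}

/-- The cut-off function `x² (L₀ - x)²`. -/
def cutoff (D : BresseBeam) (x : ℝ) : ℝ := x ^ 2 * (D.L₀ - x) ^ 2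

/-- The derivative of the cut-off function. -/
def cutoff' (D : BresseBeam) (x : ℝ) : ℝ := 2 * x * (D.L₀ - x) ^ 2 - x ^ 2 * (2 * (D.L₀ - x))

theorem continuous_cutoff : Continuous D.cutoff := by unfold cutoff; fun_prop

theorem continuous_cutoff' : Continuous D.cutoff' := by unfold cutoff'; fun_prop

theorem hasDerivAt_cutoff (x : ℝ) : HasDerivAt D.cutoff (D.cutoff' x) x := by
  have h := ((hasDerivAt_id x).pow 2).mul (((hasDerivAt_id x).const_sub D.L₀).pow 2)
  refine h.congr_deriv ?_
  simp [cutoff']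
  ring

/-- The cut-off is a square, so its derivative is dominated by its root: `χ'² = 4 (L₀ - 2x)² χ`. -/
theorem isWeight_cutoff {x : ℝ} (hx : x ∈ Icc (D.left 0) (D.right 0)) :
    IsWeight (D.L₀ ^ 4 + 4 * D.L₀ ^ 2) (D.cutoff x) (D.cutoff' x) := by
  change 0 ≤ x ∧ x ≤ D.L₀ at hx
  obtain ⟨h1, h2⟩ := hx
  have h0 : 0 ≤ D.cutoff x := by unfold cutoff; positivity
  have h3 : D.cutoff x ≤ D.L₀ ^ 4 := by
    have h4 : x ^ 2 ≤ D.L₀ ^ 2 := by gcongr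
    have h5 : (D.L₀ - x) ^ 2 ≤ D.L₀ ^ 2 := by
      have : D.L₀ - x ≤ D.L₀ := by linarith
      have : 0 ≤ D.L₀ - x := by linarith
      gcongr
    have := mul_le_mul h4 h5 (sq_nonneg _) (sq_nonneg _)
    unfold cutoff
    linarith
  have h4 : D.cutoff' x ^ 2 = 4 * (D.L₀ - 2 * x) ^ 2 * D.cutoff x := by
    unfold cutoff cutoff'; ring
  have h5 : (D.L₀ - 2 * x) ^ 2 ≤ D.L₀ ^ 2 := by nlinarith
  have h6 : 0 ≤ D.L₀ ^ 2 := sq_nonneg _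
  have h7 : 0 ≤ D.L₀ ^ 4 := by positivity
  refine ⟨h0, by linarith, ?_, ?_⟩
  · nlinarith
  · rw [h4]
    nlinarith

theorem cutoff_left : D.cutoff (D.left 0) = 0 := by simp [cutoff, left]

theorem cutoff_right : D.cutoff (D.right 0) = 0 := by simp [cutoff, right]

variable [D.Regular]

theorem isPrimitiveOn_cutoff : IsPrimitiveOn (D.left 0) (D.right 0) D.cutoff D.cutoff' :=
  IsPrimitiveOn.of_hasDerivAt hasDerivAt_cutoff continuous_cutoff' (left_lt_right 0).le

namespace StrongTriple

variable (τ : D.StrongTriple) (j : Fin 2)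

theorem continuousOn_u (i : Fin 3) : ContinuousOn (τ.u j i) (Icc (D.left j) (D.right j)) :=
  (Hd.isPrimitiveOn_rep (Energy.toHd τ.Φ) j i).continuousOn

theorem continuousOn_v (i : Fin 3) : ContinuousOn (τ.v j i) (Icc (D.left j) (D.right j)) :=
  (Hd.isPrimitiveOn_rep (Energy.toHd τ.V) j i).continuousOn

theorem continuousOn_s (i : Fin 3) : ContinuousOn (τ.s j i) (Icc (D.left j) (D.right j)) := by
  obtain ⟨h0, h1, h2⟩ := (τ.isStrongPart j).strain_isPrimitiveOn (stiffness_pos j)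
  fin_cases i
  exacts [h0.continuousOn, h1.continuousOn, h2.continuousOn]

theorem continuousOn_density : ContinuousOn (τ.density j) (Icc (D.left j) (D.right j)) := by
  unfold density
  have hv := τ.continuousOn_v j
  have hs := τ.continuousOn_s j
  exact ((((((hv 0).pow 2).add ((hv 1).pow 2)).add ((hv 2).pow 2)).add ((hs 0).pow 2)).add
    ((hs 1).pow 2)).add ((hs 2).pow 2)

theorem continuousOn_dispDensity : ContinuousOn (τ.dispDensity j) (Icc (D.left j) (D.right j)) := by
  unfold dispDensity
  have hu := τ.continuousOn_u j
  exact (((hu 0).pow 2).add ((hu 1).pow 2)).add ((hu 2).pow 2)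

end StrongTriple

theorem intervalIntegrable_part {j : Fin 2} {f : ℝ → ℝ}
    (hf : ContinuousOn f (Icc (D.left j) (D.right j))) :
    IntervalIntegrable f volume (D.left j) (D.right j) := by
  rw [← uIcc_of_le (left_lt_right j).le] at hf
  exact hf.intervalIntegrable

theorem integral_rateDensity {j : Fin 2} {g c P : ℝ → ℝ}
    (hg : IntervalIntegrable g volume (D.left j) (D.right j))
    (hc : ContinuousOn c (Icc (D.left j) (D.right j)))
    (hP : IsPrimitiveOn (D.left j) (D.right j) P (fun x => c x - g x)) :
    ∫ x in D.left j..D.right j, c x =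
      (∫ x in D.left j..D.right j, g x) + (P (D.right j) - P (D.left j)) := by
  rw [← hP.integral_eq, intervalIntegral.integral_sub (intervalIntegrable_part hc) hg]
  ring

/-- Integrates a multiplier identity `P' = c - g` whose boundary terms cancel, and then absorbs what
the pointwise comparison leaves. The bound `O` stands for the sum of all quantities known so far:
displacements, `ψ_t` and `r`. -/
theorem IsControlled.of_flux {q r c g P : D.StrongTriple → ℝ → ℝ} (hg : IsRateDensity 0 g)
    (hP : ∀ τ, IsPrimitiveOn (D.left 0) (D.right 0) (P τ) (fun x => c τ x - g τ x))
    (hPb : ∀ τ, P τ (D.right 0) = P τ (D.left 0))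
    (hc : ∀ τ, ContinuousOn (c τ) (Icc (D.left 0) (D.right 0)))
    (hq : ∀ τ, ContinuousOn (q τ) (Icc (D.left 0) (D.right 0)))
    (hrc : ∀ τ, ContinuousOn (r τ) (Icc (D.left 0) (D.right 0)))
    (hr0 : ∀ τ, ∀ x ∈ Icc (D.left 0) (D.right 0), 0 ≤ r τ x)
    (hr : IsControlled fun τ => ∫ x in D.left 0..D.right 0, r τ x)
    (h : ∀ ε > 0, ∃ C, 0 ≤ C ∧ ∀ τ, ∀ x ∈ Icc (D.left 0) (D.right 0), ∀ O,
      τ.u 0 0 x ^ 2 ≤ O → τ.u 0 1 x ^ 2 ≤ O → τ.u 0 2 x ^ 2 ≤ O → τ.v 0 1 x ^ 2 ≤ O → r τ x ≤ O →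
      q τ x ≤ c τ x + ε * τ.density 0 x + C * O) :
    IsControlled fun τ => ∫ x in D.left 0..D.right 0, q τ x := by
  obtain ⟨hgi, hgJ⟩ := hg
  refine IsControlled.of_le hgJ hr fun ε hε => ?_
  obtain ⟨C, hC, h⟩ := h ε hε
  refine ⟨C, hC, fun τ => ?_⟩
  have hle := (left_lt_right (D := D) 0).le
  have i1 := intervalIntegrable_part (hc τ)
  have i2 := intervalIntegrable_part (τ.continuousOn_density 0)
  have i3 : IntervalIntegrable (fun x => τ.v 0 1 x ^ 2) volume (D.left 0) (D.right 0) :=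
    intervalIntegrable_part ((τ.continuousOn_v 0 1).pow 2)
  have i4 := intervalIntegrable_part (τ.continuousOn_dispDensity 0)
  have i5 := intervalIntegrable_part (hrc τ)
  have h1 : ∫ x in D.left 0..D.right 0, q τ x ≤ ∫ x in D.left 0..D.right 0,
      (c τ x + ε * τ.density 0 x + C * (τ.v 0 1 x ^ 2 + τ.dispDensity 0 x + r τ x)) := by
    refine intervalIntegral.integral_mono_on hle (intervalIntegrable_part (hq τ))
      ((i1.add (i2.const_mul ε)).add (((i3.add i4).add i5).const_mul C)) fun x hx => ?_
    have hr' := hr0 τ x hx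
    have hu0 := sq_nonneg (τ.u 0 0 x)
    have hu1 := sq_nonneg (τ.u 0 1 x)
    have hu2 := sq_nonneg (τ.u 0 2 x)
    have hv1 := sq_nonneg (τ.v 0 1 x)
    refine h τ x hx _ ?_ ?_ ?_ ?_ ?_ <;> simp only [StrongTriple.dispDensity] <;> linarith
  rw [intervalIntegral.integral_add (i1.add (i2.const_mul ε)) (((i3.add i4).add i5).const_mul C),
    intervalIntegral.integral_add i1 (i2.const_mul ε), intervalIntegral.integral_const_mul,
    intervalIntegral.integral_const_mul, intervalIntegral.integral_add (i3.add i4) i5,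
    intervalIntegral.integral_add i3 i4, integral_rateDensity (hgi τ) (hc τ) (hP τ), hPb,
    sub_self, add_zero] at h1
  have h2 := mul_nonneg hε.le (τ.en_nonneg 1)
  have h3 := mul_nonneg hC (τ.disp_nonneg 1)
  simp only [StrongTriple.ob, StrongTriple.en] at h2 ⊢
  linarith

/-- First rung: the bending strain from `ψ` and `ψ_t` alone; the comparison quantity `r` is zero. -/
theorem isControlled_bending :
    IsControlled (D := D) fun τ => ∫ x in D.left 0..D.right 0, D.cutoff x * τ.s 0 1 x ^ 2 := by
  have hK := stiffness_pos (D := D) 0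
  have hχ := continuous_cutoff (D := D)
  have hχ' := continuous_cutoff' (D := D)
  have h : IsControlled (D := D) fun τ => ∫ x in D.left 0..D.right 0,
      D.stiffness 0 1 * D.cutoff x * τ.s 0 1 x ^ 2 := by
    refine IsControlled.of_flux (r := fun _ _ => 0)
      (isRateDensity_disp 1 1 (m := fun x => -(D.inertia 0 1 * D.cutoff x)) (by fun_prop))
      (fun τ => (τ.isStrongPart 0).bending_flux isPrimitiveOn_cutoff) (fun τ => ?_) (fun τ => ?_)
      (fun τ => ?_) (fun _ => continuousOn_const) (fun _ _ _ => le_rfl) ?_ fun ε hε => ?_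
    · simp [cutoff_left, cutoff_right]
    · have := τ.continuousOn_u 0 1
      have := τ.continuousOn_v 0 1
      have := τ.continuousOn_s 0 1
      have := τ.continuousOn_s 0 0
      fun_prop
    · have := τ.continuousOn_s 0 1
      fun_prop
    · simpa using IsControlled.zero
    · obtain ⟨C, hC, h⟩ := exists_bending_bound (X := D.L₀ ^ 4 + 4 * D.L₀ ^ 2) (by positivity) hε
        (D.inertia 0) (D.stiffness 0) (inertia_pos 0 1).le
      exact ⟨C, hC, fun τ x hx O _ hu _ hv _ => h _ _ _ _ _ _ _ _ _ _ (isWeight_cutoff hx) hu hv⟩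
  refine h.mono ⟨(D.stiffness 0 1)⁻¹, (inv_pos.2 (hK 1)).le, fun τ => ?_⟩
  simp only [mul_assoc]
  rw [intervalIntegral.integral_const_mul, mul_add, inv_mul_cancel_left₀ (hK 1).ne']
  linarith [mul_nonneg (inv_pos.2 (hK 1)).le τ.ob_nonneg]

/-- Second rung: the shear from the bending strain. This is where the equality of the two wave
speeds is indispensable to the argument. -/
theorem isControlled_shear (hspeed : D.inertia 0 0 * D.stiffness 0 1 = D.inertia 0 1 * D.stiffness 0 0) :
    IsControlled (D := D) fun τ => ∫ x in D.left 0..D.right 0, D.cutoff x * τ.s 0 0 x ^ 2 := by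
  have hK := stiffness_pos (D := D) 0
  have hχ := continuous_cutoff (D := D)
  have hχ' := continuous_cutoff' (D := D)
  have h : IsControlled (D := D) fun τ => ∫ x in D.left 0..D.right 0,
      D.stiffness 0 0 * D.cutoff x * τ.s 0 0 x ^ 2 := by
    refine IsControlled.of_flux (r := fun τ x => D.cutoff x * τ.s 0 1 x ^ 2)
      ((isRateDensity_strain 0 1 (m := fun x => -(D.inertia 0 1 * D.cutoff x)) (by fun_prop)).add
        (isRateDensity_strain 1 0 (m := fun x => -(D.inertia 0 1 * D.cutoff x)) (by fun_prop)))
      (fun τ => (τ.isStrongPart 0).shear_flux hK hspeed isPrimitiveOn_cutoff) (fun τ => ?_)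
      (fun τ => ?_) (fun τ => ?_) (fun τ => ?_) (fun τ x hx => ?_) isControlled_bending
      fun ε hε => ?_
    · simp [cutoff_left, cutoff_right]
    · have := τ.continuousOn_v 0 0
      have := τ.continuousOn_v 0 1
      have := τ.continuousOn_v 0 2
      have := τ.continuousOn_s 0 0
      have := τ.continuousOn_s 0 1
      have := τ.continuousOn_s 0 2
      fun_prop
    · have := τ.continuousOn_s 0 0
      fun_prop
    · have := τ.continuousOn_s 0 1
      fun_prop
    · exact mul_nonneg (isWeight_cutoff hx).nonneg (sq_nonneg _)
    · obtain ⟨C, hC, h⟩ := exists_shear_bound (X := D.L₀ ^ 4 + 4 * D.L₀ ^ 2) (by positivity) hε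
        (D.inertia 0) (D.stiffness 0) D.l (inertia_pos 0 1).le
      exact ⟨C, hC, fun τ x hx O _ _ _ hv hr => h _ _ _ _ _ _ _ _ _ (isWeight_cutoff hx) hv hr⟩
  refine h.mono ⟨(D.stiffness 0 0)⁻¹, (inv_pos.2 (hK 0)).le, fun τ => ?_⟩
  simp only [mul_assoc]
  rw [intervalIntegral.integral_const_mul, mul_add, inv_mul_cancel_left₀ (hK 0).ne']
  linarith [mul_nonneg (inv_pos.2 (hK 0)).le τ.ob_nonneg]

/-- Third rung: `φ_t` from the shear and the displacements. -/
theorem isControlled_transversal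
    (hspeed : D.inertia 0 0 * D.stiffness 0 1 = D.inertia 0 1 * D.stiffness 0 0) :
    IsControlled (D := D) fun τ => ∫ x in D.left 0..D.right 0, D.cutoff x * τ.v 0 0 x ^ 2 := by
  have hR := inertia_pos (D := D) 0
  have hχ := continuous_cutoff (D := D)
  have hχ' := continuous_cutoff' (D := D)
  have h : IsControlled (D := D) fun τ => ∫ x in D.left 0..D.right 0,
      D.inertia 0 0 * D.cutoff x * τ.v 0 0 x ^ 2 := by
    refine IsControlled.of_flux (r := fun τ x => D.cutoff x * τ.s 0 0 x ^ 2)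
      (isRateDensity_disp 0 0 (m := fun x => D.inertia 0 0 * D.cutoff x) (by fun_prop))
      (fun τ => (τ.isStrongPart 0).transversal_flux isPrimitiveOn_cutoff) (fun τ => ?_)
      (fun τ => ?_) (fun τ => ?_) (fun τ => ?_) (fun τ x hx => ?_) (isControlled_shear hspeed)
      fun ε hε => ?_
    · simp [cutoff_left, cutoff_right]
    · have := τ.continuousOn_v 0 0
      have := τ.continuousOn_u 0 0
      have := τ.continuousOn_u 0 1
      have := τ.continuousOn_u 0 2
      have := τ.continuousOn_s 0 0
      have := τ.continuousOn_s 0 2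
      fun_prop
    · have := τ.continuousOn_v 0 0
      fun_prop
    · have := τ.continuousOn_s 0 0
      fun_prop
    · exact mul_nonneg (isWeight_cutoff hx).nonneg (sq_nonneg _)
    · obtain ⟨C, hC, h⟩ := exists_transversal_bound (X := D.L₀ ^ 4 + 4 * D.L₀ ^ 2) hε
        (D.inertia 0) (D.stiffness 0) D.l (stiffness_pos 0 0).le
      exact ⟨C, hC, fun τ x hx O hu0 hu1 hu2 _ hr =>
        h _ _ _ _ _ _ _ _ _ _ _ _ (isWeight_cutoff hx) hu0 hu1 hu2 hr⟩
  refine h.mono ⟨(D.inertia 0 0)⁻¹, (inv_pos.2 (hR 0)).le, fun τ => ?_⟩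
  simp only [mul_assoc]
  rw [intervalIntegral.integral_const_mul, mul_add, inv_mul_cancel_left₀ (hR 0).ne']
  linarith [mul_nonneg (inv_pos.2 (hR 0)).le τ.ob_nonneg]

/-- Last rung: `ω_t` and the axial strain from the shear and `φ_t`, through the curvature coupling;
it needs `k₁ = σ₁` and `l > 0`. -/
theorem isControlled_axial (hl : 0 < D.l) (hkσ : D.stiffness 0 0 = D.stiffness 0 2)
    (hspeed : D.inertia 0 0 * D.stiffness 0 1 = D.inertia 0 1 * D.stiffness 0 0) :
    IsControlled (D := D) fun τ => ∫ x in D.left 0..D.right 0,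
      D.cutoff x * (τ.v 0 2 x ^ 2 + τ.s 0 2 x ^ 2) := by
  have hR := inertia_pos (D := D) 0
  have hK := stiffness_pos (D := D) 0
  have hχ := continuous_cutoff (D := D)
  have hχ' := continuous_cutoff' (D := D)
  have hc0 : ∀ τ : D.StrongTriple, ContinuousOn (fun x => D.cutoff x * τ.s 0 0 x ^ 2)
      (Icc (D.left 0) (D.right 0)) := fun τ => by
    have := τ.continuousOn_s 0 0
    fun_prop
  have hc1 : ∀ τ : D.StrongTriple, ContinuousOn (fun x => D.cutoff x * τ.v 0 0 x ^ 2)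
      (Icc (D.left 0) (D.right 0)) := fun τ => by
    have := τ.continuousOn_v 0 0
    fun_prop
  have hc2 : ∀ τ : D.StrongTriple, ContinuousOn (fun x => D.l * (D.inertia 0 0 * D.cutoff x *
      τ.v 0 2 x ^ 2 + D.stiffness 0 2 * D.cutoff x * τ.s 0 2 x ^ 2))
      (Icc (D.left 0) (D.right 0)) := fun τ => by
    have := τ.continuousOn_v 0 2
    have := τ.continuousOn_s 0 2
    fun_prop
  have hr : IsControlled (D := D) fun τ => ∫ x in D.left 0..D.right 0,
      (D.cutoff x * τ.s 0 0 x ^ 2 + D.cutoff x * τ.v 0 0 x ^ 2) := by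
    have h := (isControlled_shear hspeed).add (isControlled_transversal hspeed)
    convert h using 2 with τ
    exact intervalIntegral.integral_add (intervalIntegrable_part (hc0 τ))
      (intervalIntegrable_part (hc1 τ))
  have h : IsControlled (D := D) fun τ => ∫ x in D.left 0..D.right 0,
      D.l * (D.inertia 0 0 * D.cutoff x * τ.v 0 2 x ^ 2 +
        D.stiffness 0 2 * D.cutoff x * τ.s 0 2 x ^ 2) := by
    refine IsControlled.of_flux
      (r := fun τ x => D.cutoff x * τ.s 0 0 x ^ 2 + D.cutoff x * τ.v 0 0 x ^ 2)
      ((isRateDensity_strain 2 0 (m := fun x => D.inertia 0 0 * D.cutoff x) (by fun_prop)).add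
        (isRateDensity_strain 0 2 (m := fun x => D.inertia 0 0 * D.cutoff x) (by fun_prop)))
      (fun τ => (τ.isStrongPart 0).axial_flux hK hkσ rfl isPrimitiveOn_cutoff) (fun τ => ?_)
      (fun τ => ?_) hc2 (fun τ => (hc0 τ).add (hc1 τ)) (fun τ x hx => ?_) hr fun ε hε => ?_
    · simp [cutoff_left, cutoff_right]
    · have := τ.continuousOn_v 0 0
      have := τ.continuousOn_v 0 1
      have := τ.continuousOn_v 0 2
      have := τ.continuousOn_s 0 0
      have := τ.continuousOn_s 0 2
      fun_prop
    · have := (isWeight_cutoff hx).nonneg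
      positivity
    · obtain ⟨C, hC, h⟩ := exists_axial_bound (X := D.L₀ ^ 4 + 4 * D.L₀ ^ 2) (by positivity) hε
        (D.inertia 0) (D.stiffness 0) hl.le (hR 0).le (hK 0).le
      refine ⟨C, hC, fun τ x hx O _ _ _ hv hr =>
        h _ _ _ _ _ _ _ _ _ (isWeight_cutoff hx) hv ?_ ?_⟩
      · have := mul_nonneg (isWeight_cutoff hx).nonneg (sq_nonneg (τ.v 0 0 x))
        linarith
      · have := mul_nonneg (isWeight_cutoff hx).nonneg (sq_nonneg (τ.s 0 0 x))
        linarith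
  set C : ℝ := (D.l * D.inertia 0 0)⁻¹ + (D.l * D.stiffness 0 2)⁻¹ with hC
  have hC0 : 0 < C := by
    have := hR 0
    have := hK 2
    positivity
  refine h.mono ⟨C, hC0.le, fun τ => ?_⟩
  have h1 : ∫ x in D.left 0..D.right 0, D.cutoff x * (τ.v 0 2 x ^ 2 + τ.s 0 2 x ^ 2) ≤
      ∫ x in D.left 0..D.right 0, C * (D.l * (D.inertia 0 0 * D.cutoff x * τ.v 0 2 x ^ 2 +
        D.stiffness 0 2 * D.cutoff x * τ.s 0 2 x ^ 2)) := by
    refine intervalIntegral.integral_mono_on (left_lt_right 0).le (intervalIntegrable_part ?_)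
      ((intervalIntegrable_part (hc2 τ)).const_mul C) fun x hx => ?_
    · have := τ.continuousOn_v 0 2
      have := τ.continuousOn_s 0 2
      fun_prop
    · have h0 := (isWeight_cutoff hx).nonneg
      have hR0 := hR 0
      have hK2 := hK 2
      have e1 : 1 ≤ C * (D.l * D.inertia 0 0) := by
        rw [hC, add_mul, inv_mul_cancel₀ (by positivity)]
        have : 0 ≤ (D.l * D.stiffness 0 2)⁻¹ * (D.l * D.inertia 0 0) := by positivity
        linarith
      have e2 : 1 ≤ C * (D.l * D.stiffness 0 2) := by
        rw [hC, add_mul, inv_mul_cancel₀ (a := D.l * D.stiffness 0 2) (by positivity)]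
        have : 0 ≤ (D.l * D.inertia 0 0)⁻¹ * (D.l * D.stiffness 0 2) := by positivity
        linarith
      have f1 := mul_le_mul_of_nonneg_right e1 (mul_nonneg h0 (sq_nonneg (τ.v 0 2 x)))
      have f2 := mul_le_mul_of_nonneg_right e2 (mul_nonneg h0 (sq_nonneg (τ.s 0 2 x)))
      linarith
  rw [intervalIntegral.integral_const_mul] at h1
  have h2 := mul_nonneg hC0.le τ.ob_nonneg
  linarith

/-- Comparison of the energy density with coefficients and without. -/
theorem exists_density_bounds : ∃ c C : ℝ, 0 < c ∧ 0 < C ∧ ∀ (j : Fin 2) (τ : D.StrongTriple) (x : ℝ),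
    c * τ.density j x ≤ D.inertia j 0 * τ.v j 0 x ^ 2 + D.inertia j 1 * τ.v j 1 x ^ 2 +
        D.inertia j 2 * τ.v j 2 x ^ 2 + D.stiffness j 0 * τ.s j 0 x ^ 2 +
        D.stiffness j 1 * τ.s j 1 x ^ 2 + D.stiffness j 2 * τ.s j 2 x ^ 2 ∧
      D.inertia j 0 * τ.v j 0 x ^ 2 + D.inertia j 1 * τ.v j 1 x ^ 2 +
        D.inertia j 2 * τ.v j 2 x ^ 2 + D.stiffness j 0 * τ.s j 0 x ^ 2 +
        D.stiffness j 1 * τ.s j 1 x ^ 2 + D.stiffness j 2 * τ.s j 2 x ^ 2 ≤ C * τ.density j x := by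
  have hR := inertia_pos (D := D)
  have hK := stiffness_pos (D := D)
  obtain ⟨c, hc, hcR, hcK⟩ : ∃ c : ℝ, 0 < c ∧ (∀ j i, c ≤ D.inertia j i) ∧
      ∀ j i, c ≤ D.stiffness j i := by
    obtain ⟨p, hp⟩ := Finite.exists_min (fun p : Fin 2 × Fin 3 => min (D.inertia p.1 p.2)
      (D.stiffness p.1 p.2))
    exact ⟨_, lt_min (hR p.1 p.2) (hK p.1 p.2), fun j i => (hp (j, i)).trans (min_le_left _ _),
      fun j i => (hp (j, i)).trans (min_le_right _ _)⟩
  obtain ⟨C, hCR, hCK⟩ : ∃ C : ℝ, (∀ j i, D.inertia j i ≤ C) ∧ ∀ j i, D.stiffness j i ≤ C := by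
    obtain ⟨p, hp⟩ := Finite.exists_max (fun p : Fin 2 × Fin 3 => max (D.inertia p.1 p.2)
      (D.stiffness p.1 p.2))
    exact ⟨_, fun j i => (le_max_left _ _).trans (hp (j, i)),
      fun j i => (le_max_right _ _).trans (hp (j, i))⟩
  refine ⟨c, C, hc, (hR 0 0).trans_le (hCR 0 0), fun j τ x => ⟨?_, ?_⟩⟩
  · have f := fun i => mul_le_mul_of_nonneg_right (hcR j i) (sq_nonneg (τ.v j i x))
    have g := fun i => mul_le_mul_of_nonneg_right (hcK j i) (sq_nonneg (τ.s j i x))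
    unfold StrongTriple.density
    linarith [f 0, f 1, f 2, g 0, g 1, g 2]
  · have f := fun i => mul_le_mul_of_nonneg_right (hCR j i) (sq_nonneg (τ.v j i x))
    have g := fun i => mul_le_mul_of_nonneg_right (hCK j i) (sq_nonneg (τ.s j i x))
    unfold StrongTriple.density
    linarith [f 0, f 1, f 2, g 0, g 1, g 2]

/-- The density of the rate of the Rellich functional. -/
theorem isRateDensity_rellich (j : Fin 2) {q : ℝ → ℝ} (hq : Continuous q) :
    IsRateDensity (D := D) j fun τ x =>
      -(D.inertia j 0 * q x) * (τ.r j 0 x * τ.v j 0 x + τ.s j 0 x * τ.w j 0 x) +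
        D.inertia j 0 * q x * (τ.v j 1 x * τ.v j 0 x + τ.u j 1 x * τ.w j 0 x) +
        D.inertia j 0 * D.l * q x * (τ.v j 2 x * τ.v j 0 x + τ.u j 2 x * τ.w j 0 x) +
        -(D.inertia j 1 * q x) * (τ.r j 1 x * τ.v j 1 x + τ.s j 1 x * τ.w j 1 x) +
        -(D.inertia j 2 * q x) * (τ.r j 2 x * τ.v j 2 x + τ.s j 2 x * τ.w j 2 x) +
        -(D.inertia j 2 * D.l * q x) * (τ.v j 0 x * τ.v j 2 x + τ.u j 0 x * τ.w j 2 x) :=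
  (((((isRateDensity_strain 0 0 (m := fun x => -(D.inertia j 0 * q x)) (by fun_prop)).add
    (isRateDensity_disp 1 0 (m := fun x => D.inertia j 0 * q x) (by fun_prop))).add
    (isRateDensity_disp 2 0 (m := fun x => D.inertia j 0 * D.l * q x) (by fun_prop))).add
    (isRateDensity_strain 1 1 (m := fun x => -(D.inertia j 1 * q x)) (by fun_prop))).add
    (isRateDensity_strain 2 2 (m := fun x => -(D.inertia j 2 * q x)) (by fun_prop))).add
    (isRateDensity_disp 0 2 (m := fun x => -(D.inertia j 2 * D.l * q x)) (by fun_prop))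

end BresseBeam
end

/-! ### Energy of the damped part and displacements at the interface -/

noncomputable section

namespace BresseBeam

variable {D : BresseBeam} [D.Regular]

namespace StrongTriple

variable (τ : D.StrongTriple) (j : Fin 2)

/-- The energy density. -/
def energyDensity (x : ℝ) : ℝ :=
  D.inertia j 0 * τ.v j 0 x ^ 2 + D.inertia j 1 * τ.v j 1 x ^ 2 +
    D.inertia j 2 * τ.v j 2 x ^ 2 + D.stiffness j 0 * τ.s j 0 x ^ 2 +
    D.stiffness j 1 * τ.s j 1 x ^ 2 + D.stiffness j 2 * τ.s j 2 x ^ 2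

/-- The coupling of displacements and forces. -/
def coupling (x : ℝ) : ℝ :=
  (τ.u j 1 x + D.l * τ.u j 2 x) * (D.stiffness j 0 * τ.s j 0 x) -
    D.l * τ.u j 0 x * (D.stiffness j 2 * τ.s j 2 x)

theorem continuousOn_energyDensity :
    ContinuousOn (τ.energyDensity j) (Icc (D.left j) (D.right j)) := by
  have := τ.continuousOn_v j 0
  have := τ.continuousOn_v j 1
  have := τ.continuousOn_v j 2
  have := τ.continuousOn_s j 0
  have := τ.continuousOn_s j 1
  have := τ.continuousOn_s j 2
  unfold energyDensity
  fun_prop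

theorem continuousOn_coupling : ContinuousOn (τ.coupling j) (Icc (D.left j) (D.right j)) := by
  have := τ.continuousOn_u j 0
  have := τ.continuousOn_u j 1
  have := τ.continuousOn_u j 2
  have := τ.continuousOn_s j 0
  have := τ.continuousOn_s j 2
  unfold coupling
  fun_prop

theorem density_nonneg (x : ℝ) : 0 ≤ τ.density j x := by unfold density; positivity

theorem dispDensity_nonneg (x : ℝ) : 0 ≤ τ.dispDensity j x := by unfold dispDensity; positivity

end StrongTriple

theorem exists_abs_coupling_le (X : ℝ) {ε : ℝ} (hε : 0 < ε) (j : Fin 2) : ∃ C, 0 ≤ C ∧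
    ∀ (τ : D.StrongTriple) (q x O : ℝ), q ^ 2 ≤ X → τ.u j 0 x ^ 2 ≤ O → τ.u j 1 x ^ 2 ≤ O →
      τ.u j 2 x ^ 2 ≤ O → |q * τ.coupling j x| ≤ ε * τ.density j x + C * O := by
  obtain ⟨C, hC, h⟩ := exists_coupling_bound (X := X) hε (D.stiffness j) D.l
  exact ⟨C, hC, fun τ q x O hq h0 h1 h2 => h q _ _ _ _ _ _ _ _ _ O hq h0 h1 h2⟩

theorem exists_abs_coupling_le_disp (X : ℝ) {ε : ℝ} (hε : 0 < ε) (j : Fin 2) : ∃ C, 0 ≤ C ∧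
    ∀ (τ : D.StrongTriple) (q x : ℝ), q ^ 2 ≤ X →
      |q * τ.coupling j x| ≤ ε * τ.density j x + C * τ.dispDensity j x := by
  obtain ⟨C, hC, h⟩ := exists_abs_coupling_le (D := D) X hε j
  refine ⟨C, hC, fun τ q x hq => ?_⟩
  have hu0 := sq_nonneg (τ.u j 0 x)
  have hu1 := sq_nonneg (τ.u j 1 x)
  have hu2 := sq_nonneg (τ.u j 2 x)
  refine h τ q x _ hq ?_ ?_ ?_ <;> unfold StrongTriple.dispDensity <;> linarith

theorem isPrimitiveOn_rellich (τ : D.StrongTriple) (j : Fin 2) {q q' : ℝ → ℝ}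
    (hq : IsPrimitiveOn (D.left j) (D.right j) q q') :
    IsPrimitiveOn (D.left j) (D.right j)
      (fun x => q x * (2⁻¹ * τ.energyDensity j x - τ.coupling j x))
      (fun x => q' x * (2⁻¹ * τ.energyDensity j x - τ.coupling j x) -
        (-(D.inertia j 0 * q x) * (τ.r j 0 x * τ.v j 0 x + τ.s j 0 x * τ.w j 0 x) +
        D.inertia j 0 * q x * (τ.v j 1 x * τ.v j 0 x + τ.u j 1 x * τ.w j 0 x) +
        D.inertia j 0 * D.l * q x * (τ.v j 2 x * τ.v j 0 x + τ.u j 2 x * τ.w j 0 x) +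
        -(D.inertia j 1 * q x) * (τ.r j 1 x * τ.v j 1 x + τ.s j 1 x * τ.w j 1 x) +
        -(D.inertia j 2 * q x) * (τ.r j 2 x * τ.v j 2 x + τ.s j 2 x * τ.w j 2 x) +
        -(D.inertia j 2 * D.l * q x) * (τ.v j 0 x * τ.v j 2 x + τ.u j 0 x * τ.w j 2 x))) :=
  (τ.isStrongPart j).rellich_flux (stiffness_pos j) hq

/-- The four rungs together with `ψ_t`, which is observed directly, exhaust the density. -/
theorem isControlled_cutoff_density (hl : 0 < D.l) (hkσ : D.stiffness 0 0 = D.stiffness 0 2)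
    (hspeed : D.inertia 0 0 * D.stiffness 0 1 = D.inertia 0 1 * D.stiffness 0 0) :
    IsControlled (D := D) fun τ => ∫ x in D.left 0..D.right 0, D.cutoff x * τ.density 0 x := by
  have hχ := continuous_cutoff (D := D)
  have hle := (left_lt_right (D := D) 0).le
  have h := ((isControlled_axial hl hkσ hspeed).add (isControlled_transversal hspeed)).add
    ((isControlled_shear hspeed).add isControlled_bending)
  refine h.mono ⟨D.L₀ ^ 4 + 4 * D.L₀ ^ 2 + 1, by positivity, fun τ => ?_⟩
  have i1 := intervalIntegrable_part (D := D) (j := 0)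
    (f := fun x => D.cutoff x * (τ.v 0 2 x ^ 2 + τ.s 0 2 x ^ 2)) (by
      have := τ.continuousOn_v 0 2
      have := τ.continuousOn_s 0 2
      fun_prop)
  have i2 := intervalIntegrable_part (D := D) (j := 0) (f := fun x => D.cutoff x * τ.v 0 0 x ^ 2) (by
      have := τ.continuousOn_v 0 0
      fun_prop)
  have i3 := intervalIntegrable_part (D := D) (j := 0) (f := fun x => D.cutoff x * τ.s 0 0 x ^ 2) (by
      have := τ.continuousOn_s 0 0
      fun_prop)
  have i4 := intervalIntegrable_part (D := D) (j := 0) (f := fun x => D.cutoff x * τ.s 0 1 x ^ 2) (by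
      have := τ.continuousOn_s 0 1
      fun_prop)
  have i5 := intervalIntegrable_part (D := D) (j := 0)
    (f := fun x => (D.L₀ ^ 4 + 4 * D.L₀ ^ 2) * τ.v 0 1 x ^ 2) (by
      have := τ.continuousOn_v 0 1
      fun_prop)
  have h1 : ∫ x in D.left 0..D.right 0, D.cutoff x * τ.density 0 x ≤
      ∫ x in D.left 0..D.right 0, (D.cutoff x * (τ.v 0 2 x ^ 2 + τ.s 0 2 x ^ 2) +
        D.cutoff x * τ.v 0 0 x ^ 2 + (D.cutoff x * τ.s 0 0 x ^ 2 + D.cutoff x * τ.s 0 1 x ^ 2) +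
        (D.L₀ ^ 4 + 4 * D.L₀ ^ 2) * τ.v 0 1 x ^ 2) := by
    refine intervalIntegral.integral_mono_on hle (intervalIntegrable_part
      (hχ.continuousOn.mul (τ.continuousOn_density 0))) (((i1.add i2).add (i3.add i4)).add i5)
      fun x hx => ?_
    have := mul_le_mul_of_nonneg_right (isWeight_cutoff hx).le (sq_nonneg (τ.v 0 1 x))
    unfold StrongTriple.density
    linarith
  rw [intervalIntegral.integral_add ((i1.add i2).add (i3.add i4)) i5,
    intervalIntegral.integral_add (i1.add i2) (i3.add i4), intervalIntegral.integral_add i1 i2,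
    intervalIntegral.integral_add i3 i4, intervalIntegral.integral_const_mul] at h1
  have hn : ∀ f : ℝ → ℝ, (∀ x, 0 ≤ f x) → 0 ≤ ∫ x in D.left 0..D.right 0, D.cutoff x * f x :=
    fun f hf => intervalIntegral.integral_nonneg hle fun x hx =>
      mul_nonneg (isWeight_cutoff hx).nonneg (hf x)
  have n1 := hn (fun x => τ.v 0 2 x ^ 2 + τ.s 0 2 x ^ 2) fun x => by positivity
  have n2 := hn (fun x => τ.v 0 0 x ^ 2) fun x => by positivity
  have n3 := hn (fun x => τ.s 0 0 x ^ 2) fun x => by positivity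
  have n4 := hn (fun x => τ.s 0 1 x ^ 2) fun x => by positivity
  have n5 := τ.obs_nonneg
  have n6 := τ.disp_nonneg 0
  have n7 := τ.disp_nonneg 1
  have hX : 0 ≤ D.L₀ ^ 4 + 4 * D.L₀ ^ 2 := by positivity
  unfold StrongTriple.ob
  nlinarith

/-- A Rellich multiplier with `q' = 1 - κ χ` and `q = 0` at both ends removes the cut-off: no
boundary term appears, and the term with `κ χ` is already controlled. -/
theorem isControlled_en_zero (hl : 0 < D.l) (hkσ : D.stiffness 0 0 = D.stiffness 0 2)
    (hspeed : D.inertia 0 0 * D.stiffness 0 1 = D.inertia 0 1 * D.stiffness 0 0) :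
    IsControlled (D := D) fun τ => τ.en 0 := by
  obtain ⟨c, C, hc, hC, hcC⟩ := exists_density_bounds (D := D)
  have hχ := continuous_cutoff (D := D)
  have hL₀ := Regular.L₀_pos (D := D)
  -- The value is dictated by `q(L₀) = 0`, since the integral of `x² (L₀ - x)²` over `(0, L₀)` is
  -- `L₀⁵ / 30`.
  set κ : ℝ := 30 / D.L₀ ^ 4 with hκ
  have hκ0 : 0 < κ := by positivity
  set q : ℝ → ℝ := fun x => x - κ * (D.L₀ ^ 2 * x ^ 3 / 3 - D.L₀ * x ^ 4 / 2 + x ^ 5 / 5) with hqdef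
  have hqc : Continuous q := by fun_prop
  have hq : IsPrimitiveOn (D.left 0) (D.right 0) q (fun x => 1 - κ * D.cutoff x) := by
    refine IsPrimitiveOn.of_hasDerivAt (fun x => ?_) (by fun_prop) (left_lt_right 0).le
    have h := (hasDerivAt_id x).sub ((((((hasDerivAt_id x).pow 3).const_mul (D.L₀ ^ 2)).div_const 3).sub
      ((((hasDerivAt_id x).pow 4).const_mul D.L₀).div_const 2)).add
      (((hasDerivAt_id x).pow 5).div_const 5) |>.const_mul κ)
    refine h.congr_deriv ?_
    simp only [cutoff, id]
    push_cast
    ring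
  have hq0 : q (D.left 0) = 0 := by simp [hqdef, left]
  have hqL : q (D.right 0) = 0 := by
    simp only [hqdef, hκ, right, Matrix.cons_val_zero]
    field_simp
    ring
  have h : IsControlled (D := D) fun τ => ∫ x in D.left 0..D.right 0, 2⁻¹ * τ.energyDensity 0 x := by
    refine IsControlled.of_flux (r := fun τ x => D.cutoff x * τ.density 0 x)
      (isRateDensity_rellich 0 hqc) (fun τ => isPrimitiveOn_rellich τ 0 hq) (fun τ => ?_)
      (fun τ => ?_) (fun τ => ?_) (fun τ => ?_) (fun τ x hx => ?_)
      (isControlled_cutoff_density hl hkσ hspeed) fun ε hε => ?_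
    · simp only [hq0, hqL, zero_mul]
    · have := τ.continuousOn_energyDensity 0
      have := τ.continuousOn_coupling 0
      fun_prop
    · have := τ.continuousOn_energyDensity 0
      fun_prop
    · have := τ.continuousOn_density 0
      fun_prop
    · exact mul_nonneg (isWeight_cutoff hx).nonneg (τ.density_nonneg 0 x)
    · obtain ⟨C', hC', h⟩ := exists_abs_coupling_le (D := D)
        ((1 + κ * (D.L₀ ^ 4 + 4 * D.L₀ ^ 2)) ^ 2) hε 0
      refine ⟨C' + κ * C, by positivity, fun τ x hx O h0 h1 h2 _ hr => ?_⟩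
      have hw := isWeight_cutoff hx
      have h3 := h τ (1 - κ * D.cutoff x) x O (by
        refine sq_le_sq' ?_ ?_
        · nlinarith [hw.le, hw.nonneg]
        · nlinarith [hw.le, hw.nonneg, hw.bound_nonneg]) h0 h1 h2
      have h4 := (le_abs_self _).trans h3
      have h5 : κ * (D.cutoff x * τ.energyDensity 0 x) ≤ κ * (C * O) := by
        refine mul_le_mul_of_nonneg_left ?_ hκ0.le
        have := mul_le_mul_of_nonneg_left (hcC 0 τ x).2 hw.nonneg
        have h6 := mul_le_mul_of_nonneg_left hr hC.le
        change D.cutoff x * τ.energyDensity 0 x ≤ _ at this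
        linarith
      have h7 : 0 ≤ κ * (D.cutoff x * τ.energyDensity 0 x) := by
        have h8 : 0 ≤ τ.energyDensity 0 x :=
          (mul_nonneg hc.le (τ.density_nonneg 0 x)).trans (hcC 0 τ x).1
        have := hw.nonneg
        positivity
      linarith
  refine h.mono ⟨2 * c⁻¹, by positivity, fun τ => ?_⟩
  have h1 : c * τ.en 0 ≤ ∫ x in D.left 0..D.right 0, τ.energyDensity 0 x := by
    rw [StrongTriple.en, ← intervalIntegral.integral_const_mul]
    exact intervalIntegral.integral_mono_on (left_lt_right 0).le
      ((intervalIntegrable_part (τ.continuousOn_density 0)).const_mul c)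
      (intervalIntegrable_part (τ.continuousOn_energyDensity 0)) fun x _ => (hcC 0 τ x).1
  rw [intervalIntegral.integral_const_mul]
  have h2 : τ.en 0 = c⁻¹ * (c * τ.en 0) := by field_simp
  have h3 := mul_le_mul_of_nonneg_left h1 (inv_pos.2 hc).le
  have h4 := mul_nonneg (inv_pos.2 hc).le τ.ob_nonneg
  linarith

/-- The displacements at the interface are controlled. -/
theorem isControlled_disp_interface : IsControlled (D := D) fun τ => τ.dispDensity 0 D.L₀ := by
  have hL₀ := Regular.L₀_pos (D := D)
  have hle := (left_lt_right (D := D) 0).le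
  refine IsControlled.of_le (g := fun _ => 0) ⟨0, fun τ => by simp [StrongTriple.rate]⟩
    IsControlled.zero fun ε hε => ?_
  have hε' : 0 < ε * D.L₀ := by positivity
  obtain ⟨C, hC, hy⟩ := exists_young hε' (K := (2 * D.L₀) ^ 2) (by positivity)
  set A : ℝ := 1 + 2 * D.L₀ + 3 * C with hA
  refine ⟨D.L₀⁻¹ * A, by positivity, fun τ => ?_⟩
  have hs := τ.isStrongPart 0
  have hid : IsPrimitiveOn (D.left 0) (D.right 0) (fun x => x) (fun _ => 1) :=
    IsPrimitiveOn.of_hasDerivAt (fun x => hasDerivAt_id x) continuous_const hle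
  -- The weight `x` removes the left end, so integrating the derivative of `x |Φ¹|²` gives `L₀
  -- |Φ¹(L₀)|²`.
  have hP := hid.mul (((hs.u_zero.mul hs.u_zero).add (hs.u_one.mul hs.u_one)).add
    (hs.u_two.mul hs.u_two))
  have h1 := hP.integral_eq
  have h2 : ∫ x in D.left 0..D.right 0, (1 * (τ.u 0 0 x * τ.u 0 0 x + τ.u 0 1 x * τ.u 0 1 x +
      τ.u 0 2 x * τ.u 0 2 x) + x * ((τ.s 0 0 x - τ.u 0 1 x - D.l * τ.u 0 2 x) * τ.u 0 0 x +
      τ.u 0 0 x * (τ.s 0 0 x - τ.u 0 1 x - D.l * τ.u 0 2 x) +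
      (τ.s 0 1 x * τ.u 0 1 x + τ.u 0 1 x * τ.s 0 1 x) +
      ((τ.s 0 2 x + D.l * τ.u 0 0 x) * τ.u 0 2 x + τ.u 0 2 x * (τ.s 0 2 x + D.l * τ.u 0 0 x)))) ≤
      ∫ x in D.left 0..D.right 0, (ε * D.L₀ * τ.density 0 x + A * τ.dispDensity 0 x) := by
    refine intervalIntegral.integral_mono_on hle hP.integrable
      (((intervalIntegrable_part (τ.continuousOn_density 0)).const_mul _).add
        ((intervalIntegrable_part (τ.continuousOn_dispDensity 0)).const_mul _)) fun x hx => ?_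
    have hx0 : 0 ≤ x := hx.1
    have hxL : x ≤ D.L₀ := hx.2
    have hx2 : (2 * x) ^ 2 ≤ (2 * D.L₀) ^ 2 := by gcongr
    have hb : ∀ i, τ.u 0 i x ^ 2 ≤ τ.dispDensity 0 x := fun i => by
      have hu0 := sq_nonneg (τ.u 0 0 x)
      have hu1 := sq_nonneg (τ.u 0 1 x)
      have hu2 := sq_nonneg (τ.u 0 2 x)
      unfold StrongTriple.dispDensity
      fin_cases i <;> simp only [Fin.zero_eta, Fin.mk_one, Fin.reduceFinMk] <;> linarith
    have y0 := hy (2 * x) (τ.s 0 0 x) (τ.u 0 0 x) _ (sq_mul_sq_le hx2 (hb 0))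
    have y1 := hy (2 * x) (τ.s 0 1 x) (τ.u 0 1 x) _ (sq_mul_sq_le hx2 (hb 1))
    have y2 := hy (2 * x) (τ.s 0 2 x) (τ.u 0 2 x) _ (sq_mul_sq_le hx2 (hb 2))
    -- The terms with `l` cancel as in a rotation; the only remaining product of two displacements
    -- comes from the `-ψ` in `φ_x`.
    have y3 : -(2 * x * (τ.u 0 0 x * τ.u 0 1 x)) ≤ 2 * D.L₀ * τ.dispDensity 0 x := by
      have e1 : -(2 * (τ.u 0 0 x * τ.u 0 1 x)) ≤ τ.u 0 0 x ^ 2 + τ.u 0 1 x ^ 2 := by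
        nlinarith [sq_nonneg (τ.u 0 0 x + τ.u 0 1 x)]
      have e2 := mul_le_mul_of_nonneg_left e1 hx0
      have e3 : τ.u 0 0 x ^ 2 + τ.u 0 1 x ^ 2 ≤ 2 * τ.dispDensity 0 x := by linarith [hb 0, hb 1]
      have e4 := mul_le_mul hxL e3 (by positivity) hL₀.le
      linarith
    have p0 := mul_nonneg hε'.le (sq_nonneg (τ.v 0 0 x))
    have p1 := mul_nonneg hε'.le (sq_nonneg (τ.v 0 1 x))
    have p2 := mul_nonneg hε'.le (sq_nonneg (τ.v 0 2 x))
    have e5 : τ.dispDensity 0 x = τ.u 0 0 x * τ.u 0 0 x + τ.u 0 1 x * τ.u 0 1 x +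
      τ.u 0 2 x * τ.u 0 2 x := by unfold StrongTriple.dispDensity; ring
    rw [← e5, hA]
    unfold StrongTriple.density
    linarith
  rw [h1, intervalIntegral.integral_add ((intervalIntegrable_part
    (τ.continuousOn_density 0)).const_mul _) ((intervalIntegrable_part
    (τ.continuousOn_dispDensity 0)).const_mul _), intervalIntegral.integral_const_mul,
    intervalIntegral.integral_const_mul] at h2
  have h3 : D.L₀ * τ.dispDensity 0 D.L₀ ≤ ε * D.L₀ * τ.en 0 +
      A * ∫ x in D.left 0..D.right 0, τ.dispDensity 0 x := by
    refine le_trans (le_of_eq ?_) h2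
    simp only [StrongTriple.dispDensity, left, right, Matrix.cons_val_zero]
    ring
  have hA0 : 0 ≤ A := by positivity
  have h4 : D.L₀ * τ.dispDensity 0 D.L₀ ≤ D.L₀ * (0 + ε * (τ.en 0 + τ.en 1) +
      D.L₀⁻¹ * A * (τ.ob + 0)) := by
    have e1 : D.L₀ * (0 + ε * (τ.en 0 + τ.en 1) + D.L₀⁻¹ * A * (τ.ob + 0)) =
        ε * D.L₀ * τ.en 0 + ε * D.L₀ * τ.en 1 + A * τ.ob := by
      field_simp
      ring
    rw [e1]
    have e2 := mul_nonneg hε'.le (τ.en_nonneg 1)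
    have e3 : ∫ x in D.left 0..D.right 0, τ.dispDensity 0 x ≤ τ.ob := by
      unfold StrongTriple.ob
      linarith [τ.obs_nonneg, τ.disp_nonneg 1]
    have e4 := mul_le_mul_of_nonneg_left e3 hA0
    linarith
  exact le_of_mul_le_mul_left h4 hL₀

end BresseBeam
end

/-! ### Interface traces, the undamped part and static observability -/

noncomputable section

namespace BresseBeam

variable {D : BresseBeam} [D.Regular]

theorem exists_abs_integral_coupling_le {ε : ℝ} (hε : 0 < ε) (j : Fin 2) : ∃ C, 0 ≤ C ∧
    ∀ τ : D.StrongTriple, |∫ x in D.left j..D.right j, τ.coupling j x| ≤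
      ε * τ.en j + C * ∫ x in D.left j..D.right j, τ.dispDensity j x := by
  obtain ⟨C, hC, h⟩ := exists_abs_coupling_le_disp (D := D) 1 hε j
  have hle := (left_lt_right (D := D) j).le
  refine ⟨C, hC, fun τ => ?_⟩
  have i1 := (intervalIntegrable_part (τ.continuousOn_density j)).const_mul ε
  have i2 := (intervalIntegrable_part (τ.continuousOn_dispDensity j)).const_mul C
  rw [StrongTriple.en, ← intervalIntegral.integral_const_mul, ← intervalIntegral.integral_const_mul,
    ← intervalIntegral.integral_add i1 i2]
  refine (intervalIntegral.abs_integral_le_integral_abs hle).trans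
    (intervalIntegral.integral_mono_on hle
      (intervalIntegrable_part (τ.continuousOn_coupling j)).abs (i1.add i2) fun x _ => ?_)
  simpa using h τ 1 x (by norm_num)

theorem exists_energy_bounds : ∃ c C : ℝ, 0 < c ∧ 0 < C ∧ ∀ (j : Fin 2) (τ : D.StrongTriple),
    (∀ x, c * τ.density j x ≤ τ.energyDensity j x ∧ τ.energyDensity j x ≤ C * τ.density j x) ∧
    c * τ.en j ≤ ∫ x in D.left j..D.right j, τ.energyDensity j x ∧
    ∫ x in D.left j..D.right j, τ.energyDensity j x ≤ C * τ.en j := by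
  obtain ⟨c, C, hc, hC, h⟩ := exists_density_bounds (D := D)
  refine ⟨c, C, hc, hC, fun j τ => ⟨fun x => h j τ x, ?_, ?_⟩⟩
  · rw [StrongTriple.en, ← intervalIntegral.integral_const_mul]
    exact intervalIntegral.integral_mono_on (left_lt_right j).le
      ((intervalIntegrable_part (τ.continuousOn_density j)).const_mul c)
      (intervalIntegrable_part (τ.continuousOn_energyDensity j)) fun x _ => (h j τ x).1
  · rw [StrongTriple.en, ← intervalIntegral.integral_const_mul]
    exact intervalIntegral.integral_mono_on (left_lt_right j).le
      (intervalIntegrable_part (τ.continuousOn_energyDensity j))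
      ((intervalIntegrable_part (τ.continuousOn_density j)).const_mul C) fun x _ => (h j τ x).2

/-- The Rellich identity with an affine weight. -/
theorem exists_rellich_affine (j : Fin 2) (x₀ : ℝ) :
    ∃ J : D.Energy →L[ℝ] D.SixL2 →L[ℝ] ℝ, ∀ τ : D.StrongTriple,
      2⁻¹ * (∫ x in D.left j..D.right j, τ.energyDensity j x) -
          (∫ x in D.left j..D.right j, τ.coupling j x) =
        τ.rate J + ((D.right j - x₀) * (2⁻¹ * τ.energyDensity j (D.right j) -
          τ.coupling j (D.right j)) - (D.left j - x₀) * (2⁻¹ * τ.energyDensity j (D.left j) -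
          τ.coupling j (D.left j))) := by
  obtain ⟨hgi, J, hJ⟩ := isRateDensity_rellich (D := D) j (q := fun x => x - x₀) (by fun_prop)
  refine ⟨J, fun τ => ?_⟩
  have hq : IsPrimitiveOn (D.left j) (D.right j) (fun x => x - x₀) (fun _ => 1) :=
    IsPrimitiveOn.of_hasDerivAt (fun x => (hasDerivAt_id x).sub_const x₀) continuous_const
      (left_lt_right j).le
  have e := τ.continuousOn_energyDensity j
  have k := τ.continuousOn_coupling j
  have h := integral_rateDensity (hgi τ) (c := fun x => 1 * (2⁻¹ * τ.energyDensity j x -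
    τ.coupling j x)) (by fun_prop) (isPrimitiveOn_rellich τ j hq)
  rw [← hJ] at h
  simp only [one_mul] at h
  rwa [intervalIntegral.integral_sub ((intervalIntegrable_part e).const_mul _)
    (intervalIntegrable_part k), intervalIntegral.integral_const_mul] at h

/-- The Rellich identity read backwards: with weight `x` the only boundary term is the one at `L₀`,
and it is bounded by the controlled energy of the damped part. This reversal is the reason for `-J`.
-/
theorem isControlled_density_interface (hl : 0 < D.l) (hkσ : D.stiffness 0 0 = D.stiffness 0 2)
    (hspeed : D.inertia 0 0 * D.stiffness 0 1 = D.inertia 0 1 * D.stiffness 0 0) :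
    IsControlled (D := D) fun τ => τ.density 0 D.L₀ := by
  have hL₀ := Regular.L₀_pos (D := D)
  obtain ⟨c, C, hc, hC, hcC⟩ := exists_energy_bounds (D := D)
  obtain ⟨C₁, hC₁, h₁⟩ := exists_abs_coupling_le_disp (D := D) 1 (show 0 < c / 4 by positivity) 0
  obtain ⟨C₂, hC₂, h₂⟩ := exists_abs_integral_coupling_le (D := D) one_pos 0
  obtain ⟨J, hJ⟩ := exists_rellich_affine (D := D) 0 0
  have h : IsControlled (D := D) fun τ => D.L₀ * (c / 4) * τ.density 0 D.L₀ := by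
    refine IsControlled.of_le (g := fun τ => τ.rate (-J)) ⟨-J, fun τ => rfl⟩
      ((isControlled_en_zero hl hkσ hspeed).add isControlled_disp_interface) fun ε hε =>
      ⟨C + 1 + C₂ + D.L₀ * C₁, by positivity, fun τ => ?_⟩
    have h3 := hJ τ
    simp only [left, right, Matrix.cons_val_zero, sub_zero, zero_mul] at h3
    have h4 := (abs_le.1 (h₂ τ)).1
    have h5 := (le_abs_self _).trans (h₁ τ 1 D.L₀ (by norm_num))
    have h6 := (hcC 0 τ).2.2
    have h7 := ((hcC 0 τ).1 D.L₀).1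
    have h8 : τ.rate (-J) = -τ.rate J := by
      simp only [StrongTriple.rate, neg_apply]
      ring
    simp only [left, right, Matrix.cons_val_zero] at h4 h6
    rw [one_mul] at h5
    have h9 := mul_le_mul_of_nonneg_left h5 hL₀.le
    have h10 := mul_le_mul_of_nonneg_left h7 hL₀.le
    have n1 := τ.en_nonneg 0
    have n2 := τ.dispDensity_nonneg 0 D.L₀
    have n3 : ∫ x in 0..D.L₀, τ.dispDensity 0 x ≤ τ.ob := by
      have e1 := τ.disp_nonneg 1
      have e2 := τ.obs_nonneg
      simp only [StrongTriple.ob, left, right, Matrix.cons_val_zero] at e1 e2 ⊢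
      linarith
    have n4 := mul_le_mul_of_nonneg_left n3 hC₂
    have n5 := τ.ob_nonneg
    have n6 := mul_nonneg hε.le (add_nonneg n1 (τ.en_nonneg 1))
    have n7 : 0 ≤ (C + 1 + C₂) * τ.dispDensity 0 D.L₀ := by positivity
    have n8 : 0 ≤ (C + 1 + D.L₀ * C₁) * τ.ob := by positivity
    have n9 : 0 ≤ (C / 2 + C₂ + D.L₀ * C₁) * τ.en 0 := by positivity
    have n10 := mul_nonneg hC.le n1
    rw [h8]
    linarith
  refine h.mono ⟨(D.L₀ * (c / 4))⁻¹, by positivity, fun τ => ?_⟩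
  have h1 : 0 ≤ (D.L₀ * (c / 4))⁻¹ * τ.ob := mul_nonneg (by positivity) τ.ob_nonneg
  rw [mul_add, inv_mul_cancel_left₀ (by positivity)]
  linarith

theorem dispDensity_interface (τ : D.StrongTriple) :
    τ.dispDensity 1 D.L₀ = τ.dispDensity 0 D.L₀ := by
  simp only [StrongTriple.dispDensity, StrongTriple.u, Hd.rep_interface]

/-- The transmission conditions: velocities and forces are continuous at `L₀`, so the strains on the
two sides differ only by ratios of stiffnesses. -/
theorem exists_density_interface_le : ∃ C, 0 ≤ C ∧ ∀ τ : D.StrongTriple,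
    τ.density 1 D.L₀ ≤ C * τ.density 0 D.L₀ := by
  set c : Fin 3 → ℝ := fun i => ((D.stiffness 1 i)⁻¹ * D.stiffness 0 i) ^ 2 with hc
  have hc0 : ∀ i, 0 ≤ c i := fun i => sq_nonneg _
  refine ⟨1 + c 0 + c 1 + c 2, by have := hc0 0; have := hc0 1; have := hc0 2; positivity,
    fun τ => ?_⟩
  have hs : ∀ i, τ.s 1 i D.L₀ ^ 2 = c i * τ.s 0 i D.L₀ ^ 2 := fun i => by
    rw [StrongTriple.s, ← τ.force_interface, ← τ.stiffness_mul_s, hc]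
    ring
  have hv : ∀ i, τ.v 1 i D.L₀ = τ.v 0 i D.L₀ := fun i => (Hd.rep_interface _ i).symm
  unfold StrongTriple.density
  rw [hs, hs, hs, hv, hv, hv]
  have h0 := hc0 0
  have h1 := hc0 1
  have h2 := hc0 2
  have : 0 ≤ (c 0 + c 1 + c 2) * (τ.v 0 0 D.L₀ ^ 2 + τ.v 0 1 D.L₀ ^ 2 + τ.v 0 2 D.L₀ ^ 2) +
    (1 + c 1 + c 2) * τ.s 0 0 D.L₀ ^ 2 + (1 + c 0 + c 2) * τ.s 0 1 D.L₀ ^ 2 +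
    (1 + c 0 + c 1) * τ.s 0 2 D.L₀ ^ 2 := by positivity
  linarith

/-- The Rellich weight `x - L` vanishes at the far clamped end, so the energy of the undamped part
is bounded by its trace at `L₀`. No relation between the coefficients of this part is used. -/
theorem isControlled_en_one (hl : 0 < D.l) (hkσ : D.stiffness 0 0 = D.stiffness 0 2)
    (hspeed : D.inertia 0 0 * D.stiffness 0 1 = D.inertia 0 1 * D.stiffness 0 0) :
    IsControlled (D := D) fun τ => τ.en 1 := by
  have hL : 0 < D.L - D.L₀ := sub_pos.2 Regular.L₀_lt
  obtain ⟨c, C, hc, hC, hcC⟩ := exists_energy_bounds (D := D)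
  obtain ⟨C₁, hC₁, h₁⟩ := exists_abs_coupling_le_disp (D := D) 1 one_pos 1
  obtain ⟨C₂, hC₂, h₂⟩ := exists_abs_integral_coupling_le (D := D) (show 0 < c / 4 by positivity) 1
  obtain ⟨C₃, hC₃, h₃⟩ := exists_density_interface_le (D := D)
  obtain ⟨J, hJ⟩ := exists_rellich_affine (D := D) 1 D.L
  have h : IsControlled (D := D) fun τ => (c / 4) * τ.en 1 := by
    refine IsControlled.of_le (g := fun τ => τ.rate J) ⟨J, fun τ => rfl⟩
      ((isControlled_density_interface hl hkσ hspeed).add isControlled_disp_interface) fun ε hε =>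
      ⟨C₂ + (D.L - D.L₀) * ((C + 1) * C₃ + C₁), by positivity, fun τ => ?_⟩
    have h3 := hJ τ
    have hl1 : D.left 1 = D.L₀ := rfl
    have hr1 : D.right 1 = D.L := rfl
    simp only [hl1, hr1, sub_self, zero_mul] at h3
    have h4 := (abs_le.1 (h₂ τ)).2
    have h5 := (abs_le.1 (h₁ τ 1 D.L₀ (by norm_num))).1
    have h6 := (hcC 1 τ).2.1
    have h7 := ((hcC 1 τ).1 D.L₀).2
    simp only [hl1, hr1] at h4 h6
    rw [one_mul, one_mul, dispDensity_interface] at h5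
    have n2 := τ.dispDensity_nonneg 0 D.L₀
    have n3 : ∫ x in D.L₀..D.L, τ.dispDensity 1 x ≤ τ.ob := by
      have e1 := τ.disp_nonneg 0
      have e2 := τ.obs_nonneg
      rw [StrongTriple.ob, hl1, hr1]
      linarith
    have n4 := mul_le_mul_of_nonneg_left n3 hC₂
    have n5 := τ.ob_nonneg
    have n6 := mul_nonneg hε.le (add_nonneg (τ.en_nonneg 0) (τ.en_nonneg 1))
    have n7 := τ.density_nonneg 0 D.L₀
    have n8 := τ.density_nonneg 1 D.L₀
    have h9 : 2⁻¹ * τ.energyDensity 1 D.L₀ - τ.coupling 1 D.L₀ ≤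
        (C + 1) * C₃ * τ.density 0 D.L₀ + C₁ * τ.dispDensity 0 D.L₀ := by
      have := mul_le_mul_of_nonneg_left (h₃ τ) (show 0 ≤ C + 1 by positivity)
      have := mul_nonneg hC.le n8
      linarith
    have h10 := mul_le_mul_of_nonneg_left h9 hL.le
    have n9 : 0 ≤ (D.L - D.L₀) * ((C + 1) * C₃ + C₁) * τ.ob +
      C₂ * τ.density 0 D.L₀ + C₂ * τ.dispDensity 0 D.L₀ +
      (D.L - D.L₀) * ((C + 1) * C₃) * τ.dispDensity 0 D.L₀ +
      (D.L - D.L₀) * C₁ * τ.density 0 D.L₀ := by positivity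
    linarith
  refine h.mono ⟨(c / 4)⁻¹, by positivity, fun τ => ?_⟩
  have h1 : 0 ≤ (c / 4)⁻¹ * τ.ob := mul_nonneg (by positivity) τ.ob_nonneg
  rw [mul_add, inv_mul_cancel_left₀ (by positivity)]
  linarith

theorem norm_sq_L2_congr {j : Fin 2} (f : D.L2 j) {F : ℝ → ℝ}
    (h : f =ᵐ[volume.restrict (Ioo (D.left j) (D.right j))] F) :
    ‖f‖ ^ 2 = ∫ x in D.left j..D.right j, F x ^ 2 := by
  rw [norm_sq_Lp_Ioo, intervalIntegral.integral_of_le (left_lt_right j).le,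
    integral_Ioc_eq_integral_Ioo]
  refine integral_congr_ae ?_
  filter_upwards [h] with x hx
  rw [hx]

theorem embX_ae_eq (Φ : D.Energy) (j : Fin 2) (i : Fin 3) : Energy.embX D Φ (j, i)
    =ᵐ[volume.restrict (Ioo (D.left j) (D.right j))]
      fun x => √(D.inertia j i) * Hd.rep (Energy.toHd Φ) j i x := by
  filter_upwards [Lp.coeFn_smul √(D.inertia j i) (Hd.fld (Energy.toHd Φ) j i),
    Hd.fld_ae_eq (Energy.toHd Φ) j i] with x h1 h2
  change (√(D.inertia j i) • Hd.fld (Energy.toHd Φ) j i : D.L2 j) x = _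
  rw [h1, Pi.smul_apply, h2]; rfl

theorem norm_sq_embX_apply (Φ : D.Energy) (j : Fin 2) (i : Fin 3) :
    ‖Energy.embX D Φ (j, i)‖ ^ 2 =
      D.inertia j i * ∫ x in D.left j..D.right j, Hd.rep (Energy.toHd Φ) j i x ^ 2 := by
  rw [norm_sq_L2_congr _ (embX_ae_eq Φ j i), ← intervalIntegral.integral_const_mul]
  simp only [mul_pow, Real.sq_sqrt (inertia_pos (D := D) j i).le]

theorem norm_sq_eq_sum_strain (Φ : D.Energy) : ‖Φ‖ ^ 2 =
    ∑ j, ∑ i, D.stiffness j i * ‖D.strain j (Energy.toHd Φ) i‖ ^ 2 := by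
  rw [Energy.norm_eq, PiLp.norm_sq_eq_of_L2, Fintype.sum_prod_type]
  refine Finset.sum_congr rfl fun j _ => Finset.sum_congr rfl fun i _ => ?_
  rw [energyEmb_apply, norm_smul, mul_pow, Real.norm_eq_abs, sq_abs,
    Real.sq_sqrt (stiffness_pos j i).le]

theorem energy_eq_integral (τ : D.StrongTriple) : ‖τ.Φ‖ ^ 2 + ‖Energy.embX D τ.V‖ ^ 2 =
    (∫ x in D.left 0..D.right 0, τ.energyDensity 0 x) +
      ∫ x in D.left 1..D.right 1, τ.energyDensity 1 x := by
  have h : ∀ j, ∫ x in D.left j..D.right j, τ.energyDensity j x =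
      (∑ i, D.stiffness j i * ∫ x in D.left j..D.right j, τ.s j i x ^ 2) +
        ∑ i, D.inertia j i * ∫ x in D.left j..D.right j, τ.v j i x ^ 2 := fun j => by
    have iv := fun i => (intervalIntegrable_part (j := j)
      ((τ.continuousOn_v j i).pow 2)).const_mul (D.inertia j i)
    have is := fun i => (intervalIntegrable_part (j := j)
      ((τ.continuousOn_s j i).pow 2)).const_mul (D.stiffness j i)
    simp only [Pi.pow_apply] at iv is
    simp only [← intervalIntegral.integral_const_mul]
    rw [← intervalIntegral.integral_finsetSum fun i _ => is i,
      ← intervalIntegral.integral_finsetSum fun i _ => iv i, ← intervalIntegral.integral_add]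
    · refine intervalIntegral.integral_congr fun x _ => ?_
      simp only [StrongTriple.energyDensity, Fin.sum_univ_three]
      ring
    · simpa only [Finset.sum_fn] using IntervalIntegrable.sum Finset.univ fun i _ => is i
    · simpa only [Finset.sum_fn] using IntervalIntegrable.sum Finset.univ fun i _ => iv i
  rw [norm_sq_eq_sum_strain, PiLp.norm_sq_eq_of_L2, Fintype.sum_prod_type, Fin.sum_univ_two,
    Fin.sum_univ_two, h, h]
  have h1 : ∀ j i, ‖Energy.embX D τ.V (j, i)‖ ^ 2 =
      D.inertia j i * ∫ x in D.left j..D.right j, τ.v j i x ^ 2 := norm_sq_embX_apply τ.V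
  have h2 := fun j i => norm_sq_L2_congr _ (τ.strain_ae_eq_s j i)
  rw [Finset.sum_congr rfl fun i _ => h1 0 i, Finset.sum_congr rfl fun i _ => h1 1 i]
  simp only [h2]
  ring

theorem exists_ob_le : ∃ C, 0 ≤ C ∧ ∀ τ : D.StrongTriple,
    τ.ob ≤ C * (‖Energy.embX D τ.V (0, 1)‖ ^ 2 + ‖Energy.embX D τ.Φ‖ ^ 2) := by
  obtain ⟨c, hc, hcR⟩ : ∃ c : ℝ, 0 < c ∧ ∀ p : Fin 2 × Fin 3, c ≤ D.inertia p.1 p.2 := by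
    obtain ⟨p, hp⟩ := Finite.exists_min (fun p : Fin 2 × Fin 3 => D.inertia p.1 p.2)
    exact ⟨_, inertia_pos p.1 p.2, hp⟩
  refine ⟨c⁻¹, by positivity, fun τ => ?_⟩
  have hn : ∀ (j : Fin 2) (F : ℝ → ℝ), 0 ≤ ∫ x in D.left j..D.right j, F x ^ 2 := fun j F =>
    intervalIntegral.integral_nonneg (left_lt_right j).le fun _ _ => sq_nonneg _
  have hd : ∀ j, ∫ x in D.left j..D.right j, τ.dispDensity j x =
      ∑ i, ∫ x in D.left j..D.right j, τ.u j i x ^ 2 := fun j => by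
    have iu : ∀ i, IntervalIntegrable (fun x => τ.u j i x ^ 2) volume (D.left j) (D.right j) :=
      fun i => intervalIntegrable_part (j := j) ((τ.continuousOn_u j i).pow 2)
    rw [← intervalIntegral.integral_finsetSum fun i _ => iu i]
    refine intervalIntegral.integral_congr fun x _ => ?_
    simp only [StrongTriple.dispDensity, Fin.sum_univ_three]
  have h : c * τ.ob ≤ ‖Energy.embX D τ.V (0, 1)‖ ^ 2 + ‖Energy.embX D τ.Φ‖ ^ 2 := by
    rw [StrongTriple.ob, hd, hd, PiLp.norm_sq_eq_of_L2, Fintype.sum_prod_type, Fin.sum_univ_two,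
      mul_add, mul_add, Finset.mul_sum, Finset.mul_sum]
    refine add_le_add ?_ (add_le_add (Finset.sum_le_sum fun i _ => ?_)
      (Finset.sum_le_sum fun i _ => ?_)) <;> rw [norm_sq_embX_apply]
    · exact mul_le_mul_of_nonneg_right (hcR (0, 1)) (hn 0 _)
    · exact mul_le_mul_of_nonneg_right (hcR (0, i)) (hn 0 _)
    · exact mul_le_mul_of_nonneg_right (hcR (1, i)) (hn 1 _)
  have := mul_le_mul_of_nonneg_left h (inv_pos.2 hc).le
  rwa [inv_mul_cancel_left₀ hc.ne'] at this

/-- The energy is bounded by the time derivative of a bounded bilinear quantity and by the observed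
quantities. -/
theorem exists_static_observability (hl : 0 < D.l) (hkσ : D.stiffness 0 0 = D.stiffness 0 2)
    (hspeed : D.inertia 0 0 * D.stiffness 0 1 = D.inertia 0 1 * D.stiffness 0 0) :
    ∃ (J : D.Energy →L[ℝ] D.SixL2 →L[ℝ] ℝ) (C : ℝ), 0 ≤ C ∧ ∀ τ : D.StrongTriple,
      ‖τ.Φ‖ ^ 2 + ‖Energy.embX D τ.V‖ ^ 2 ≤ τ.rate J +
        C * (‖Energy.embX D τ.V (0, 1)‖ ^ 2 + ‖Energy.embX D τ.Φ‖ ^ 2) := by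
  obtain ⟨c, C, hc, hC, hcC⟩ := exists_energy_bounds (D := D)
  -- With tolerance `1/2` the energy on the right is absorbed into the left, which accounts for the
  -- factor `2` in `J` and in the constant.
  obtain ⟨J, C₁, hC₁, h₁⟩ := ((isControlled_en_zero hl hkσ hspeed).add
    (isControlled_en_one hl hkσ hspeed)) 2⁻¹ (by norm_num)
  obtain ⟨C₂, hC₂, h₂⟩ := exists_ob_le (D := D)
  refine ⟨(C * 2) • J, C * 2 * (C₁ * C₂), by positivity, fun τ => ?_⟩
  have h3 : τ.rate ((C * 2) • J) = C * 2 * τ.rate J := by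
    simp only [StrongTriple.rate, smul_apply, smul_eq_mul]
    ring
  have h4 := h₁ τ
  have h5 := mul_le_mul_of_nonneg_left (h₂ τ) hC₁
  have h6 := (hcC 0 τ).2.2
  have h7 := (hcC 1 τ).2.2
  have h8 : τ.en 0 + τ.en 1 ≤ 2 * (τ.rate J +
      C₁ * (C₂ * (‖Energy.embX D τ.V (0, 1)‖ ^ 2 + ‖Energy.embX D τ.Φ‖ ^ 2))) := by linarith
  have h9 := mul_le_mul_of_nonneg_left h8 hC.le
  rw [energy_eq_integral, h3]
  linarith

end BresseBeam
end

/-! ### From static to integrated observability -/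

noncomputable section

theorem IsIsometricGroup.continuous_integral_comp {V : Type*} [NormedAddCommGroup V]
    [NormedSpace ℝ V] {U : ℝ → V →ₗᵢ[ℝ] V} (hU : IsIsometricGroup U) {f : V → ℝ}
    (hf : Continuous f) (T : ℝ) : Continuous fun z => ∫ t in (0 : ℝ)..T, f (U t z) :=
  intervalIntegral.continuous_parametric_intervalIntegral_of_continuous' (f := fun z t => f (U t z))
    (hf.comp (hU.continuous_uncurry.comp (continuous_snd.prodMk continuous_fst))) _ _

namespace Phase

variable {ι E X Y : Type*} [NormedAddCommGroup E] [InnerProductSpace ℝ E]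
  [NormedAddCommGroup X] [InnerProductSpace ℝ X] [NormedAddCommGroup Y] [InnerProductSpace ℝ Y]
  {e : HilbertBasis ι ℝ E} {b : HilbertBasis ι ℝ X} {w : ι → ℝ} {i : E →L[ℝ] X}

theorem hasDerivAt_rot_re_im (w : ι → ℝ) (z : Phase ι) (n : ι) (t : ℝ) :
    HasDerivAt (fun t => (rot w t z n).re) (w n * (rot w t z n).im) t ∧
      HasDerivAt (fun t => (rot w t z n).im) (-(w n * (rot w t z n).re)) t := by
  have h := (hasDerivWithinAt_rot_apply w (hasDerivWithinAt_const t univ z) n).hasDerivAt univ_mem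
  rw [map_zero, lp.coeFn_zero, Pi.zero_apply, add_zero] at h
  exact ⟨(Complex.reCLM.hasFDerivAt.comp_hasDerivAt t h).congr_deriv (by simp),
    (Complex.imCLM.hasFDerivAt.comp_hasDerivAt t h).congr_deriv (by simp)⟩

theorem displ_eq_sum (e : HilbertBasis ι ℝ E) {s : Finset ι} {z : Phase ι}
    (hz : ∀ n ∉ s, z n = 0) : displ e z = ∑ n ∈ s, (z n).re • e n := by
  classical
  refine e.ext_inner fun m => ?_
  rw [inner_displ, inner_sum]
  simp only [inner_smul_right, orthonormal_iff_ite.1 e.orthonormal, mul_ite, mul_one, mul_zero,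
    Finset.sum_ite_eq]
  split_ifs with h
  · rfl
  · rw [hz m h]; rfl

theorem veloc_eq_sum (b : HilbertBasis ι ℝ X) {s : Finset ι} {z : Phase ι}
    (hz : ∀ n ∉ s, z n = 0) : veloc b z = ∑ n ∈ s, (z n).im • b n := by
  classical
  refine b.ext_inner fun m => ?_
  rw [inner_veloc, inner_sum]
  simp only [inner_smul_right, orthonormal_iff_ite.1 b.orthonormal, mul_ite, mul_one, mul_zero,
    Finset.sum_ite_eq]
  split_ifs with h
  · rfl
  · rw [hz m h]; rfl

/-- A static inequality for smooth states yields an integrated inequality for states with finitely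
many modes. -/
theorem norm_sq_le_integral_of_finite_modes (hw : ∀ n, 0 < w n)
    (hi : ∀ n, i (e n) = (w n)⁻¹ • b n) {p : X →L[ℝ] Y} {J : E →L[ℝ] X →L[ℝ] ℝ} {C : ℝ}
    (hC : 0 ≤ C)
    (h : ∀ (Φ V : E) (W : X), (∀ B, inner ℝ Φ B = -inner ℝ W (i B)) →
      ‖Φ‖ ^ 2 + ‖i V‖ ^ 2 ≤ J V (i V) + J Φ W + C * (‖p (i V)‖ ^ 2 + ‖i Φ‖ ^ 2))
    {s : Finset ι} {z : Phase ι} (hz : ∀ n ∉ s, z n = 0) :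
    ‖z‖ ^ 2 ≤ C * ∫ t in (0 : ℝ)..2 * ‖J‖ + 1,
      (‖p (veloc b (rot w t z))‖ + ‖i (displ e (rot w t z))‖) ^ 2 := by
  have hzt : ∀ t, ∀ n ∉ s, rot w t z n = 0 := fun t n hn => by rw [rot_apply, hz n hn, mul_zero]
  set Φ : ℝ → E := fun t => displ e (rot w t z) with hΦ
  set v : ℝ → X := fun t => veloc b (rot w t z) with hv
  -- With finitely many modes the solution is classical: `V` is the derivative of the displacement
  -- in the energy space, and `W` is the acceleration.
  set V : ℝ → E := fun t => ∑ n ∈ s, (w n * (rot w t z n).im) • e n with hV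
  set W : ℝ → X := fun t => ∑ n ∈ s, (-(w n * (rot w t z n).re)) • b n with hW
  have hiV : ∀ t, i (V t) = v t := fun t => by
    rw [hv, hV]
    simp only [map_sum, map_smul, hi]
    rw [veloc_eq_sum b (hzt t)]
    refine Finset.sum_congr rfl fun n _ => ?_
    rw [smul_smul]
    congr 1
    have := (hw n).ne'
    field_simp
  have hΦ' : ∀ t, HasDerivAt Φ (V t) t := fun t => by
    have h1 : Φ = fun t => ∑ n ∈ s, (rot w t z n).re • e n := funext fun t => displ_eq_sum e (hzt t)
    rw [h1]
    exact HasDerivAt.fun_sum fun n _ => (hasDerivAt_rot_re_im w z n t).1.smul_const (e n)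
  have hv' : ∀ t, HasDerivAt v (W t) t := fun t => by
    have h1 : v = fun t => ∑ n ∈ s, (rot w t z n).im • b n := funext fun t => veloc_eq_sum b (hzt t)
    rw [h1]
    exact HasDerivAt.fun_sum fun n _ => (hasDerivAt_rot_re_im w z n t).2.smul_const (b n)
  have hΦc : Continuous Φ := continuous_iff_continuousAt.2 fun t => (hΦ' t).continuousAt
  have hvc : Continuous v := continuous_iff_continuousAt.2 fun t => (hv' t).continuousAt
  have hrec : ∀ n, Continuous fun t => (rot w t z n).re := fun n =>
    continuous_iff_continuousAt.2 fun t => (hasDerivAt_rot_re_im w z n t).1.continuousAt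
  have himc : ∀ n, Continuous fun t => (rot w t z n).im := fun n =>
    continuous_iff_continuousAt.2 fun t => (hasDerivAt_rot_re_im w z n t).2.continuousAt
  have hVc : Continuous V := continuous_finsetSum _ fun n _ =>
    ((himc n).const_mul _).smul continuous_const
  have hWc : Continuous W := continuous_finsetSum _ fun n _ =>
    ((hrec n).const_mul _).neg.smul continuous_const
  have hstat : ∀ t, ‖z‖ ^ 2 ≤ J (V t) (v t) + J (Φ t) (W t) + C * (‖p (v t)‖ + ‖i (Φ t)‖) ^ 2 := by
    intro t
    have h1 := h (Φ t) (V t) (W t) fun B => by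
      have h2 : Φ t = ∑ n ∈ s, (rot w t z n).re • e n := displ_eq_sum e (hzt t)
      rw [h2, hW, sum_inner, sum_inner, ← Finset.sum_neg_distrib]
      refine Finset.sum_congr rfl fun n _ => ?_
      rw [inner_smul_left, inner_smul_left, inner_embedding hi]
      have := (hw n).ne'
      simp
      field_simp
    rw [hiV] at h1
    have h3 : ‖z‖ ^ 2 = ‖Φ t‖ ^ 2 + ‖v t‖ ^ 2 := by
      rw [← (rot w t).norm_map z, norm_sq_eq e b]
    have h4 : ‖p (v t)‖ ^ 2 + ‖i (Φ t)‖ ^ 2 ≤ (‖p (v t)‖ + ‖i (Φ t)‖) ^ 2 := by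
      have := mul_nonneg (norm_nonneg (p (v t))) (norm_nonneg (i (Φ t)))
      linarith
    have := mul_le_mul_of_nonneg_left h4 hC
    linarith
  -- The rate terms of the static inequality are an exact time derivative, so after integration only
  -- the end values of `J(Φ, v)` remain.
  have hF : ∀ t, HasDerivAt (fun t => J (Φ t) (v t)) (J (V t) (v t) + J (Φ t) (W t)) t := fun t =>
    (J.hasFDerivAt.comp_hasDerivAt t (hΦ' t)).clm_apply (hv' t)
  have hFc : Continuous fun t => J (V t) (v t) + J (Φ t) (W t) := by fun_prop
  -- The end values cost at most `2 ‖J‖ ‖z‖²`, while the left side integrates to `T ‖z‖²`; the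
  -- surplus `1` leaves exactly `‖z‖²`.
  set T := 2 * ‖J‖ + 1 with hT
  have hT0 : 0 ≤ T := by positivity
  have hoc : Continuous fun t => (‖p (v t)‖ + ‖i (Φ t)‖) ^ 2 := by fun_prop
  have h5 := intervalIntegral.integral_mono hT0 (μ := volume) (f := fun _ => ‖z‖ ^ 2)
    intervalIntegrable_const ((hFc.intervalIntegrable 0 T).add
      ((hoc.intervalIntegrable 0 T).const_mul C)) hstat
  rw [intervalIntegral.integral_add (hFc.intervalIntegrable 0 T)
      ((hoc.intervalIntegrable 0 T).const_mul C), intervalIntegral.integral_eq_sub_of_hasDerivAt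
      (fun t _ => hF t) (hFc.intervalIntegrable 0 T), intervalIntegral.integral_const,
      intervalIntegral.integral_const_mul, sub_zero, smul_eq_mul] at h5
  have h6 : ∀ t, |J (Φ t) (v t)| ≤ ‖J‖ * ‖z‖ ^ 2 := fun t => by
    have h7 : ‖Φ t‖ ≤ ‖z‖ := (norm_displ_le e _).trans_eq ((rot w t).norm_map z)
    have h8 : ‖v t‖ ≤ ‖z‖ := (norm_veloc_le b _).trans_eq ((rot w t).norm_map z)
    calc |J (Φ t) (v t)| ≤ ‖J‖ * ‖Φ t‖ * ‖v t‖ := J.le_opNorm₂ _ _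
      _ ≤ ‖J‖ * ‖z‖ * ‖z‖ := by gcongr
      _ = _ := by ring
  have h9 := (abs_le.1 (h6 T)).2
  have h10 := (abs_le.1 (h6 0)).1
  have h11 : T * ‖z‖ ^ 2 = 2 * (‖J‖ * ‖z‖ ^ 2) + ‖z‖ ^ 2 := by rw [hT]; ring
  linarith

/-- States with finitely many modes are dense, and both sides are continuous for the phase space
norm; neither the constant nor the time depends on the number of modes. -/
theorem norm_sq_le_integral_of_static (hw : ∀ n, 0 < w n)
    (hi : ∀ n, i (e n) = (w n)⁻¹ • b n) {p : X →L[ℝ] Y} {J : E →L[ℝ] X →L[ℝ] ℝ} {C : ℝ}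
    (hC : 0 ≤ C)
    (h : ∀ (Φ V : E) (W : X), (∀ B, inner ℝ Φ B = -inner ℝ W (i B)) →
      ‖Φ‖ ^ 2 + ‖i V‖ ^ 2 ≤ J V (i V) + J Φ W + C * (‖p (i V)‖ ^ 2 + ‖i Φ‖ ^ 2))
    (z : Phase ι) :
    ‖z‖ ^ 2 ≤ C * ∫ t in (0 : ℝ)..2 * ‖J‖ + 1,
      (‖p (veloc b (rot w t z))‖ + ‖i (displ e (rot w t z))‖) ^ 2 := by
  classical
  have hz : Tendsto (fun s : Finset ι => ∑ n ∈ s, lp.single 2 n (z n)) atTop (𝓝 z) :=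
    lp.hasSum_single (p := 2) (by norm_num) z
  have hc := (continuous_const (y := C)).mul ((isIsometricGroup_rot w).continuous_integral_comp
    (f := fun z => (‖p (veloc b z)‖ + ‖i (displ e z)‖) ^ 2) (by fun_prop) (2 * ‖J‖ + 1))
  refine le_of_tendsto_of_tendsto' (((continuous_norm.pow 2).tendsto z).comp hz)
    ((hc.tendsto z).comp hz) fun s => ?_
  refine norm_sq_le_integral_of_finite_modes hw hi hC h (s := s) fun n hn => ?_
  rw [lp.coeFn_sum, Finset.sum_apply]
  refine Finset.sum_eq_zero fun m hm => lp.single_apply_ne 2 m _ ?_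
  rintro rfl
  exact hn hm

end Phase
end

/-! ### The nonlinear problem: energy bound and flow -/

noncomputable section

/-- A chain rule for the potential energy along a trajectory. The displacement is differentiable
only in `X`, so the remainder is measured there rather than in the energy space. -/
theorem hasDerivWithinAt_of_abs_sub_le {X : Type*} [NormedAddCommGroup X] [NormedSpace ℝ X]
    {f : ℝ → ℝ} {g : ℝ → X} {g' : X} {s : Set ℝ} {t C : ℝ} (L : X →L[ℝ] ℝ)
    (hg : HasDerivWithinAt g g' s t)
    (h : ∀ r ∈ s, |f r - f t - L (g r - g t)| ≤ C * ‖g r - g t‖ ^ 2) :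
    HasDerivWithinAt f (L g') s t := by
  rw [hasDerivWithinAt_iff_isLittleO] at hg ⊢
  have hO : (fun r => g r - g t) =O[𝓝[s] t] fun r => r - t :=
    (hasDerivWithinAt_iff_isLittleO.2 hg).hasFDerivWithinAt.isBigO_sub
  have h1 : (fun r => f r - f t - L (g r - g t)) =O[𝓝[s] t] fun r => ‖g r - g t‖ ^ 2 := by
    refine Asymptotics.IsBigO.of_bound C ?_
    filter_upwards [self_mem_nhdsWithin] with r hr
    rw [Real.norm_eq_abs, Real.norm_of_nonneg (by positivity)]
    exact h r hr
  have h2 : (fun r => ‖r - t‖ ^ 2) =o[𝓝[s] t] fun r => r - t :=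
    (Asymptotics.isLittleO_pow_sub_sub t one_lt_two).mono nhdsWithin_le_nhds
  have h3 := (h1.trans (hO.norm_norm.pow 2)).trans_isLittleO h2
  have h4 := (L.isBigO_comp (fun r => g r - g t - (r - t) • g') (𝓝[s] t)).trans_isLittleO hg
  refine (h3.add h4).congr_left fun r => ?_
  simp only [map_sub, map_smul]
  ring

namespace Phase

variable {ι E X Y : Type*} [NormedAddCommGroup E] [InnerProductSpace ℝ E]
  [NormedAddCommGroup X] [InnerProductSpace ℝ X]
  [NormedAddCommGroup Y] [InnerProductSpace ℝ Y]
  {e : HilbertBasis ι ℝ E} {b : HilbertBasis ι ℝ X} {w : ι → ℝ} {i : E →L[ℝ] X} {p : X →L[ℝ] Y}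
  {Γ : X → X} {F : E → X} {P : X} {Ψ : E → ℝ} {m : ℝ}

/-- The damping `Γ` is Lipschitz and strongly monotone with respect to the observation `p`, and the
feedback `F` derives from the potential `Ψ`. -/
structure IsAdmissible (i : E →L[ℝ] X) (p : X →L[ℝ] Y) (Γ : X → X) (F : E → X) (Ψ : E → ℝ)
    (m : ℝ) : Prop where
  damping_zero : Γ 0 = 0
  damping_lipschitz : ∃ M, 0 ≤ M ∧ ∀ V V', ‖Γ V - Γ V'‖ ≤ M * ‖p (V - V')‖
  damping_monotone : ∀ V V', m * ‖p (V - V')‖ ^ 2 ≤ inner ℝ (V - V') (Γ V - Γ V')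
  feedback_lipschitz : ∀ R, ∃ C, 0 ≤ C ∧ ∀ Φ Φ', ‖Φ‖ ≤ R → ‖Φ'‖ ≤ R →
    ‖F Φ - F Φ'‖ ≤ C * ‖i (Φ - Φ')‖
  potential : ∀ R, ∃ C, 0 ≤ C ∧ ∀ Φ Φ', ‖Φ‖ ≤ R → ‖Φ'‖ ≤ R →
    |Ψ Φ' - Ψ Φ - inner ℝ (F Φ) (i (Φ' - Φ))| ≤ C * ‖i (Φ' - Φ)‖ ^ 2
  potential_below : ∃ c, 0 ≤ c ∧ ∀ Φ, -c ≤ Ψ Φ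

/-- The nonlinear part of the first order system. -/
def nonlinearity (e : HilbertBasis ι ℝ E) (b : HilbertBasis ι ℝ X) (Γ : X → X) (F : E → X) (P : X)
    (z : Phase ι) : Phase ι :=
  mk e b (0, P - Γ (veloc b z) - F (displ e z))

theorem norm_mk_zero (e : HilbertBasis ι ℝ E) (b : HilbertBasis ι ℝ X) (V : X) :
    ‖mk e b (0, V)‖ = ‖V‖ := by
  have h := norm_sq_eq e b (mk e b (0, V))
  rw [displ_mk, veloc_mk, norm_zero] at h
  exact (sq_eq_sq₀ (norm_nonneg _) (norm_nonneg _)).1 (by rw [h]; ring)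

theorem nonlinearity_sub (z z' : Phase ι) :
    nonlinearity e b Γ F P z - nonlinearity e b Γ F P z' =
      mk e b (0, -(Γ (veloc b z) - Γ (veloc b z')) - (F (displ e z) - F (displ e z'))) := by
  rw [nonlinearity, nonlinearity, ← map_sub]
  congr 1
  rw [Prod.mk_sub_mk, sub_self]
  congr 1
  abel

/-- The damping sees only the observed velocity and the feedback only the weak norm of the
displacement; observability estimates exactly these two. -/
theorem IsAdmissible.norm_nonlinearity_sub_le (h : IsAdmissible i p Γ F Ψ m) (R : ℝ) :
    ∃ C, 0 ≤ C ∧ ∀ z z' : Phase ι, ‖z‖ ≤ R → ‖z'‖ ≤ R →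
      ‖nonlinearity e b Γ F P z - nonlinearity e b Γ F P z'‖ ≤
        C * (‖(p ∘L veloc b) (z - z')‖ + ‖(i ∘L displ e) (z - z')‖) := by
  obtain ⟨M, hM, hΓ⟩ := h.damping_lipschitz
  obtain ⟨C, hC, hF⟩ := h.feedback_lipschitz R
  refine ⟨M + C, by positivity, fun z z' hz hz' => ?_⟩
  rw [nonlinearity_sub, norm_mk_zero]
  have h1 := hΓ (veloc b z) (veloc b z')
  have h2 := hF (displ e z) (displ e z') ((norm_displ_le e z).trans hz)
    ((norm_displ_le e z').trans hz')
  have h3 := norm_sub_le (-(Γ (veloc b z) - Γ (veloc b z'))) (F (displ e z) - F (displ e z'))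
  rw [norm_neg] at h3
  rw [← map_sub] at h1 h2
  change _ ≤ (M + C) * (‖p (veloc b (z - z'))‖ + ‖i (displ e (z - z'))‖)
  have h4 := mul_nonneg hC (norm_nonneg (p (veloc b (z - z'))))
  have h5 := mul_nonneg hM (norm_nonneg (i (displ e (z - z'))))
  linarith

/-- The damping contributes the negative square by strong monotonicity. The feedback difference is
small in the weak norm and is paired with a velocity bounded by `2|R|`. -/
theorem IsAdmissible.inner_nonlinearity_sub_le (h : IsAdmissible i p Γ F Ψ m) (R : ℝ) :
    ∃ C, 0 ≤ C ∧ ∀ z z' : Phase ι, ‖z‖ ≤ R → ‖z'‖ ≤ R →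
      inner ℝ (z - z') (nonlinearity e b Γ F P z - nonlinearity e b Γ F P z') ≤
        -m * ‖(p ∘L veloc b) (z - z')‖ ^ 2 + C * ‖(i ∘L displ e) (z - z')‖ := by
  obtain ⟨C, hC, hF⟩ := h.feedback_lipschitz R
  refine ⟨2 * |R| * C, by positivity, fun z z' hz hz' => ?_⟩
  have h1 := h.damping_monotone (veloc b z) (veloc b z')
  have h2 := hF (displ e z) (displ e z') ((norm_displ_le e z).trans hz)
    ((norm_displ_le e z').trans hz')
  rw [nonlinearity_sub, inner_eq e b, displ_mk, veloc_mk, inner_zero_right, zero_add, inner_sub_right,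
    inner_neg_right]
  rw [← map_sub] at h1 h2
  change _ ≤ -m * ‖p (veloc b (z - z'))‖ ^ 2 + 2 * |R| * C * ‖i (displ e (z - z'))‖
  have h3 : ‖veloc b (z - z')‖ ≤ 2 * |R| := by
    refine (norm_veloc_le b _).trans ((norm_sub_le z z').trans ?_)
    have := le_abs_self R
    linarith
  have h4 := (abs_le.1 (abs_real_inner_le_norm (veloc b (z - z'))
    (F (displ e z) - F (displ e z')))).1
  have h5 := mul_le_mul h3 h2 (norm_nonneg _) (by positivity)
  linarith

theorem IsAdmissible.lipschitzOnWith_nonlinearity (h : IsAdmissible i p Γ F Ψ m) (R : ℝ) :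
    ∃ K : ℝ≥0, LipschitzOnWith K (nonlinearity e b Γ F P) (Metric.closedBall 0 R) := by
  obtain ⟨C, hC, hN⟩ := h.norm_nonlinearity_sub_le (e := e) (b := b) (P := P) R
  refine ⟨(C * (‖p ∘L veloc b‖ + ‖i ∘L displ e‖)).toNNReal, LipschitzOnWith.of_dist_le_mul
    fun z hz z' hz' => ?_⟩
  rw [Real.coe_toNNReal _ (by positivity), dist_eq_norm, dist_eq_norm, mul_assoc, add_mul]
  refine (hN z z' (by simpa using hz) (by simpa using hz')).trans ?_
  gcongr
  · exact (p ∘L veloc b).le_opNorm _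
  · exact (i ∘L displ e).le_opNorm _

variable [CompleteSpace X]

/-- The work of the feedback and of the load is the derivative of the potential terms, so only
dissipation remains. -/
theorem IsAdmissible.hasDerivWithinAt_energy (h : IsAdmissible i p Γ F Ψ m) (hw : ∀ n, 0 < w n)
    (hi : ∀ n, i (e n) = (w n)⁻¹ • b n) {T : ℝ} {z : ℝ → Phase ι}
    (hz : IsMild (rot w) (nonlinearity e b Γ F P) T z) {t : ℝ} (ht : t ∈ Icc 0 T) :
    HasDerivWithinAt (fun t => 2⁻¹ * ‖z t‖ ^ 2 + Ψ (displ e (z t)) - inner ℝ P (i (displ e (z t))))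
      (-inner ℝ (veloc b (z t)) (Γ (veloc b (z t)))) (Icc 0 T) t := by
  have hU := isIsometricGroup_rot w
  have hzc := IsDuhamel.continuousOn hU hz
  obtain ⟨R, hR⟩ := isCompact_Icc.exists_bound_of_continuousOn hzc
  obtain ⟨C, hC, hΨ⟩ := h.potential R
  have hR' : ∀ s ∈ Icc 0 T, ‖displ e (z s)‖ ≤ R := fun s hs => (norm_displ_le e _).trans (hR s hs)
  have h1 := (IsDuhamel.energy_hasDerivWithinAt hU hz ht).const_mul 2⁻¹
  have hd := hasDerivWithinAt_embedding_displ hw hi hz ht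
  have h2 := hasDerivWithinAt_of_abs_sub_le (f := fun t => Ψ (displ e (z t))) (C := C)
    (innerSL ℝ (F (displ e (z t)))) hd fun s hs => by
      rw [← map_sub, innerSL_apply_apply]
      exact hΨ _ _ (hR' t ht) (hR' s hs)
  have h3 := (innerSL ℝ P).hasFDerivAt.comp_hasDerivWithinAt t hd
  refine ((h1.add h2).sub h3).congr_deriv ?_
  rw [nonlinearity, inner_eq e b, displ_mk, veloc_mk, inner_zero_right, innerSL_apply_apply,
    innerSL_apply_apply, inner_sub_right, inner_sub_right, real_inner_comm (veloc b (z t)) P,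
    real_inner_comm (veloc b (z t)) (F (displ e (z t)))]
  ring

/-- The full energy does not increase, the potential is bounded below, and the load contributes only
linearly in the norm; its bound at time `0` uses the Taylor estimate of `Ψ` around `0`. -/
theorem IsAdmissible.exists_bound (h : IsAdmissible i p Γ F Ψ m) (hm : 0 ≤ m) (hw : ∀ n, 0 < w n)
    (hi : ∀ n, i (e n) = (w n)⁻¹ • b n) (r : ℝ) : ∃ R : ℝ, ∀ (T : ℝ) (z : ℝ → Phase ι), 0 ≤ T →
      IsMild (rot w) (nonlinearity e b Γ F P) T z → ‖z 0‖ ≤ r → ‖z T‖ ≤ R := by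
  obtain ⟨c, hc, hΨ⟩ := h.potential_below
  obtain ⟨C, hC, hΨ'⟩ := h.potential |r|
  set A := ‖P‖ * ‖i‖ with hA
  have hA0 : 0 ≤ A := by positivity
  set K := 2⁻¹ * |r| ^ 2 + (|Ψ 0| + ‖F 0‖ * (‖i‖ * |r|) + C * (‖i‖ * |r|) ^ 2) + A * |r| + c with hK
  have hiP : ∀ Φ : E, |inner ℝ P (i Φ)| ≤ A * ‖Φ‖ := fun Φ => by
    refine (abs_real_inner_le_norm _ _).trans ?_
    rw [hA, mul_assoc]
    exact mul_le_mul_of_nonneg_left (i.le_opNorm Φ) (norm_nonneg P)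
  refine ⟨4 * K + 4 * A ^ 2 + 1, fun T z hT hz h0 => ?_⟩
  have h0' : ‖z 0‖ ≤ |r| := h0.trans (le_abs_self r)
  have hd0 : ‖displ e (z 0)‖ ≤ |r| := (norm_displ_le e _).trans h0'
  have hmono : AntitoneOn (fun t => 2⁻¹ * ‖z t‖ ^ 2 + Ψ (displ e (z t)) -
      inner ℝ P (i (displ e (z t)))) (Icc 0 T) := by
    refine antitoneOn_of_hasDerivWithinAt_nonpos (convex_Icc 0 T)
      (fun t ht => (h.hasDerivWithinAt_energy hw hi hz ht).continuousWithinAt)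
      (fun t ht => (h.hasDerivWithinAt_energy hw hi hz (interior_subset ht)).mono interior_subset)
      fun t _ => ?_
    have h1 := h.damping_monotone (veloc b (z t)) 0
    rw [h.damping_zero, sub_zero, sub_zero] at h1
    have : 0 ≤ m * ‖p (veloc b (z t))‖ ^ 2 := by positivity
    linarith
  have h1 := hmono ⟨le_rfl, hT⟩ ⟨hT, le_rfl⟩ hT
  simp only at h1
  have h2 := hΨ (displ e (z T))
  have h3 := (abs_le.1 (hiP (displ e (z T)))).2
  have h4 := (abs_le.1 (hiP (displ e (z 0)))).1
  have h5 := (abs_le.1 (hΨ' 0 (displ e (z 0)) (by simp) hd0)).2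
  rw [sub_zero] at h5
  have h6 : ‖i (displ e (z 0))‖ ≤ ‖i‖ * |r| :=
    (i.le_opNorm _).trans (mul_le_mul_of_nonneg_left hd0 (norm_nonneg i))
  have h7 := (le_abs_self _).trans ((abs_real_inner_le_norm (F 0) (i (displ e (z 0)))).trans
    (mul_le_mul_of_nonneg_left h6 (norm_nonneg _)))
  have h8 : C * ‖i (displ e (z 0))‖ ^ 2 ≤ C * (‖i‖ * |r|) ^ 2 := by gcongr
  have h9 := le_abs_self (Ψ 0)
  have h10 := mul_le_mul_of_nonneg_left hd0 hA0
  have h11 : ‖z 0‖ ^ 2 ≤ |r| ^ 2 := by gcongr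
  have h12 := mul_le_mul_of_nonneg_left (norm_displ_le e (z T)) hA0
  have h13 : 2⁻¹ * ‖z T‖ ^ 2 ≤ K + A * ‖z T‖ := by linarith
  -- From `x²/2 ≤ K + A x` follows `x² ≤ 4K + 4A²`, and then `x ≤ (x² + 1)/2` gives the stated
  -- radius.
  nlinarith [sq_nonneg (‖z T‖ - 2 * A), sq_nonneg (‖z T‖ - 1)]

theorem IsAdmissible.exists_flow (h : IsAdmissible i p Γ F Ψ m) (hm : 0 < m) (hw : ∀ n, 0 < w n)
    (hi : ∀ n, i (e n) = (w n)⁻¹ • b n) (hc : IsCompactOperator i) {J : E →L[ℝ] X →L[ℝ] ℝ} {C : ℝ}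
    (hC : 0 ≤ C)
    (hJ : ∀ (Φ V : E) (W : X), (∀ B, inner ℝ Φ B = -inner ℝ W (i B)) →
      ‖Φ‖ ^ 2 + ‖i V‖ ^ 2 ≤ J V (i V) + J Φ W + C * (‖p (i V)‖ ^ 2 + ‖i Φ‖ ^ 2)) :
    ∃ S : Flow ℝ≥0 (Phase ι),
      (∀ z₀ T, IsMild (rot w) (nonlinearity e b Γ F P) T (fun t => S t.toNNReal z₀)) ∧
      AsymptoticallySmooth S := by
  obtain ⟨S, hS⟩ := exists_mildFlow (isIsometricGroup_rot w)
    (h.lipschitzOnWith_nonlinearity (e := e) (b := b) (P := P)) (h.exists_bound hm.le hw hi)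
  refine ⟨S, hS, asymptoticallySmooth_of_observability (isIsometricGroup_rot w) hS
    (p := p ∘L veloc b) (κ := i ∘L displ e) (hc.comp_clm _) (b := 1) (fun t z => ?_)
    -- The constant is raised by `1` because the abstract criterion requires it to be strictly
    -- positive.
    (T := 2 * ‖J‖ + 1) (C := C + 1) (by positivity) (by positivity) (fun z => ?_)
    h.norm_nonlinearity_sub_le hm h.inner_nonlinearity_sub_le⟩
  · rw [one_mul]
    exact norm_embedding_rot_sub_le hw hi t z
  · refine (norm_sq_le_integral_of_static hw hi hC hJ z).trans ?_
    refine mul_le_mul_of_nonneg_right (by linarith) ?_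
    exact intervalIntegral.integral_nonneg (by positivity) fun t _ => sq_nonneg _

end Phase
end

/-! ### Equivalence of abstract weak and mild solutions -/

noncomputable section

namespace Phase

variable {ι E X Y : Type*} [NormedAddCommGroup E] [InnerProductSpace ℝ E]
  [NormedAddCommGroup X] [InnerProductSpace ℝ X]
  [NormedAddCommGroup Y] [InnerProductSpace ℝ Y]
  {e : HilbertBasis ι ℝ E} {b : HilbertBasis ι ℝ X} {w : ι → ℝ} {i : E →L[ℝ] X} {p : X →L[ℝ] Y}
  {Γ : X → X} {F : E → X} {P : X} {Ψ : E → ℝ} {m : ℝ}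

theorem continuous_of_lipschitz_on_balls {V W : Type*} [NormedAddCommGroup V] [NormedAddCommGroup W]
    {f : V → W} (h : ∀ R, ∃ C, ∀ x y, ‖x‖ ≤ R → ‖y‖ ≤ R → ‖f x - f y‖ ≤ C * ‖x - y‖) :
    Continuous f := by
  refine continuous_iff_continuousAt.2 fun x => ?_
  obtain ⟨C, hC⟩ := h (‖x‖ + 1)
  rw [ContinuousAt, tendsto_iff_norm_sub_tendsto_zero]
  have h1 : Tendsto (fun y => C * ‖y - x‖) (𝓝 x) (𝓝 0) := by
    have : Continuous fun y => C * ‖y - x‖ := by fun_prop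
    simpa using this.tendsto x
  refine squeeze_zero' (Eventually.of_forall fun y => norm_nonneg _) ?_ h1
  filter_upwards [Metric.ball_mem_nhds x one_pos] with y hy
  refine hC y x ?_ (by linarith)
  have h2 := norm_le_insert' y x
  rw [mem_ball_iff_norm] at hy
  linarith

theorem IsAdmissible.continuous_damping (h : IsAdmissible i p Γ F Ψ m) : Continuous Γ := by
  obtain ⟨M, hM, hΓ⟩ := h.damping_lipschitz
  refine continuous_of_lipschitz_on_balls fun R => ⟨M * ‖p‖, fun x y _ _ => (hΓ x y).trans ?_⟩
  rw [mul_assoc]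
  exact mul_le_mul_of_nonneg_left (p.le_opNorm _) hM

theorem IsAdmissible.continuous_feedback (h : IsAdmissible i p Γ F Ψ m) : Continuous F := by
  refine continuous_of_lipschitz_on_balls fun R => ?_
  obtain ⟨C, hC, hF⟩ := h.feedback_lipschitz R
  refine ⟨C * ‖i‖, fun x y hx hy => (hF x y hx hy).trans ?_⟩
  rw [mul_assoc]
  exact mul_le_mul_of_nonneg_left (i.le_opNorm _) hC

theorem IsAdmissible.memLp_damping (h : IsAdmissible i p Γ F Ψ m) {T : ℝ} {V : ℝ → X}
    (hV : MemLp V ∞ (volume.restrict (Ioo 0 T))) :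
    MemLp (fun t => Γ (V t)) ∞ (volume.restrict (Ioo 0 T)) := by
  obtain ⟨M, hM, hΓ⟩ := h.damping_lipschitz
  refine hV.of_le_mul (c := M * ‖p‖) (h.continuous_damping.comp_aestronglyMeasurable hV.1)
    (ae_of_all _ fun t => ?_)
  have h1 := hΓ (V t) 0
  rw [h.damping_zero, sub_zero, sub_zero] at h1
  rw [mul_assoc]
  exact h1.trans (mul_le_mul_of_nonneg_left (p.le_opNorm _) hM)

theorem ae_norm_le_of_memLp_top {W : Type*} [NormedAddCommGroup W] {T : ℝ} {f : ℝ → W}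
    (hf : MemLp f ∞ (volume.restrict (Ioo 0 T))) :
    ∃ R, 0 ≤ R ∧ ∀ᵐ t ∂volume.restrict (Ioo 0 T), ‖f t‖ ≤ R := by
  refine ⟨(eLpNorm f ∞ (volume.restrict (Ioo 0 T))).toReal, ENNReal.toReal_nonneg, ?_⟩
  filter_upwards [ae_le_eLpNormEssSup (f := f) (μ := volume.restrict (Ioo 0 T))] with t ht
  rw [eLpNorm_exponent_top, ← toReal_enorm]
  refine ENNReal.toReal_mono ?_ ht
  rw [← eLpNorm_exponent_top]
  exact hf.2.ne

theorem IsAdmissible.memLp_feedback (h : IsAdmissible i p Γ F Ψ m) {T : ℝ} {Φ : ℝ → E}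
    (hΦ : MemLp Φ ∞ (volume.restrict (Ioo 0 T))) :
    MemLp (fun t => F (Φ t)) ∞ (volume.restrict (Ioo 0 T)) := by
  obtain ⟨R, hR0, hR⟩ := ae_norm_le_of_memLp_top hΦ
  obtain ⟨C, hC, hF⟩ := h.feedback_lipschitz R
  refine MemLp.of_bound (h.continuous_feedback.comp_aestronglyMeasurable hΦ.1)
    (‖F 0‖ + C * (‖i‖ * R)) ?_
  filter_upwards [hR] with t ht
  have h1 := hF (Φ t) 0 ht (by simpa using hR0)
  rw [sub_zero] at h1
  have h2 := norm_le_insert' (F (Φ t)) (F 0)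
  have h3 := mul_le_mul_of_nonneg_left ((i.le_opNorm (Φ t)).trans
    (mul_le_mul_of_nonneg_left ht (norm_nonneg i))) hC
  linarith

/-- Weak solutions of the abstract second order equation. -/
structure IsWeak (i : E →L[ℝ] X) (Γ : X → X) (F : E → X) (P : X) (T : ℝ) (Φ₀ : E) (V₀ : X)
    (Φ : ℝ → E) (V : ℝ → X) : Prop where
  memLp : MemLp Φ ∞ (volume.restrict (Ioo 0 T))
  memLp_t : MemLp V ∞ (volume.restrict (Ioo 0 T))
  eq_integral : ∀ᵐ t ∂volume.restrict (Ioo 0 T), i (Φ t) = i Φ₀ + ∫ s in (0 : ℝ)..t, V s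
  variational : ∀ (B : ℝ → E) (Bt : ℝ → X), MemLp B 2 (volume.restrict (Ioo 0 T)) →
    MemLp Bt 2 (volume.restrict (Ioo 0 T)) →
    (∀ᵐ t ∂volume.restrict (Ioo 0 T), i (B t) = -∫ s in t..T, Bt s) →
    (∫ t in (0 : ℝ)..T, inner ℝ (V t) (Bt t)) + inner ℝ V₀ (-∫ s in (0 : ℝ)..T, Bt s) =
      (∫ t in (0 : ℝ)..T, inner ℝ (Φ t) (B t)) -
        ∫ t in (0 : ℝ)..T, inner ℝ (P - Γ (V t) - F (Φ t)) (i (B t))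

variable [CompleteSpace X] [Countable ι]

theorem IsAdmissible.isWeak_of_isMild (h : IsAdmissible i p Γ F Ψ m) (hw : ∀ n, 0 < w n)
    (hi : ∀ n, i (e n) = (w n)⁻¹ • b n) {T : ℝ} (hT : 0 ≤ T) {z : ℝ → Phase ι}
    (hz : IsMild (rot w) (nonlinearity e b Γ F P) T z) :
    IsWeak i Γ F P T (displ e (z 0)) (veloc b (z 0)) (fun t => displ e (z t))
      (fun t => veloc b (z t)) := by
  have hzc := IsDuhamel.continuousOn (isIsometricGroup_rot w) hz
  have hd := (displ e).continuous.comp_continuousOn hzc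
  have hv := (veloc b).continuous.comp_continuousOn hzc
  refine ⟨memLp_of_continuousOn hd _, memLp_of_continuousOn hv _, ?_, fun B Bt hB hBt hBB => ?_⟩
  · filter_upwards [ae_restrict_mem measurableSet_Ioo] with t ht
    exact embedding_displ_eq_integral hw hi hz (Ioo_subset_Icc_self ht)
  · exact weak_of_isDuhamel hw hi hT ((continuousOn_const.sub
      (h.continuous_damping.comp_continuousOn hv)).sub
      (h.continuous_feedback.comp_continuousOn hd)) hz hB hBt hBB

/-- Freeze the nonlinear terms along the weak solution: they are a bounded forcing, so the solution
is given by Duhamel's formula. Its continuous representative is therefore mild, and mild solutions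
are unique. -/
theorem IsAdmissible.ae_eq_of_isWeak (h : IsAdmissible i p Γ F Ψ m) (hw : ∀ n, 0 < w n)
    (hi : ∀ n, i (e n) = (w n)⁻¹ • b n) {T : ℝ} (hT : 0 ≤ T) {z : ℝ → Phase ι}
    (hz : IsMild (rot w) (nonlinearity e b Γ F P) T z) {Φ : ℝ → E} {V : ℝ → X}
    (hΦ : IsWeak i Γ F P T (displ e (z 0)) (veloc b (z 0)) Φ V) :
    ∀ᵐ t ∂volume.restrict (Ioo 0 T), displ e (z t) = Φ t ∧ veloc b (z t) = V t := by
  have hU := isIsometricGroup_rot w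
  have hG : MemLp (fun t => P - Γ (V t) - F (Φ t)) ∞ (volume.restrict (Ioo 0 T)) :=
    ((memLp_const P).sub (h.memLp_damping hΦ.memLp_t)).sub (h.memLp_feedback hΦ.memLp)
  obtain ⟨hint, hae⟩ := ae_eq_duhamel_of_weak hw hi hT hΦ.memLp hΦ.memLp_t hG hΦ.eq_integral
    hΦ.variational
  rw [mk_displ_veloc] at hae
  -- The continuous representative of the weak solution. The forcing evaluated along `y` agrees
  -- almost everywhere with the frozen one, hence gives the same integral.
  set y : ℝ → Phase ι := fun t => rot w t (z 0 + ∫ s in (0 : ℝ)..t,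
    rot w (-s) (Phase.mk e b (0, P - Γ (V s) - F (Φ s)))) with hy
  have hyc : ContinuousOn y (Icc 0 T) := by
    refine hU.continuousOn_apply continuousOn_id (continuousOn_const.add ?_)
    have := intervalIntegral.continuousOn_primitive_interval' hint left_mem_uIcc
    rwa [uIcc_of_le hT] at this
  have hy0 : y 0 = z 0 := by simp [hy, rot_zero]
  have hyae : ∀ᵐ t ∂volume.restrict (Ioo 0 T), Phase.mk e b (0, P - Γ (V t) - F (Φ t)) =
      nonlinearity e b Γ F P (y t) := by
    filter_upwards [hae] with t ht
    change Phase.mk e b (Φ t, V t) = y t at ht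
    rw [nonlinearity, ← ht, displ_mk, veloc_mk]
  have hNc : Continuous (nonlinearity e b Γ F P) := by
    refine continuous_of_lipschitz_on_balls fun R => ?_
    obtain ⟨K, hK⟩ := h.lipschitzOnWith_nonlinearity (e := e) (b := b) (P := P) R
    refine ⟨K, fun x x' hx hx' => ?_⟩
    simpa only [dist_eq_norm] using hK.dist_le_mul x (by simpa using hx) x' (by simpa using hx')
  have hym : IsMild (rot w) (nonlinearity e b Γ F P) T y := by
    refine ⟨hNc.comp_continuousOn hyc, fun t ht => ?_⟩
    rw [hy0]
    change rot w t (z 0 + _) = _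
    congr 2
    rw [intervalIntegral_eq_integral_Ioo ht.1, intervalIntegral_eq_integral_Ioo ht.1]
    refine integral_congr_ae ?_
    filter_upwards [ae_restrict_of_ae_restrict_of_subset (Ioo_subset_Ioo_right ht.2) hyae] with s hs
    rw [hs]
  have heq := IsMild.eqOn hU (h.lipschitzOnWith_nonlinearity (e := e) (b := b) (P := P)) hym hz hy0
  filter_upwards [hae, ae_restrict_mem measurableSet_Ioo] with t ht ht'
  change Phase.mk e b (Φ t, V t) = y t at ht
  rw [← heq (Ioo_subset_Icc_self ht'), ← ht, displ_mk, veloc_mk]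
  exact ⟨rfl, rfl⟩

end Phase
end

/-! ### The feedbacks as superposition operators -/

noncomputable section

theorem IsLocLipschitz.continuous {u : EuclideanSpace ℝ (Fin 3) → ℝ} (hu : IsLocLipschitz u) :
    Continuous u :=
  Phase.continuous_of_lipschitz_on_balls hu

/-- A first order Taylor estimate for functions with a gradient which is Lipschitz on balls. -/
theorem exists_abs_sub_sub_inner_le {ψ : EuclideanSpace ℝ (Fin 3) → ℝ}
    {φ : Fin 3 → EuclideanSpace ℝ (Fin 3) → ℝ} (hφ : ∀ k, IsLocLipschitz (φ k))
    (hgrad : ∀ a, HasGradientAt ψ (WithLp.toLp 2 fun k => φ k a) a) (K : ℝ) :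
    ∃ C, 0 ≤ C ∧ ∀ a a', ‖a‖ ≤ K → ‖a'‖ ≤ K →
      |ψ a' - ψ a - ∑ k, φ k a * (a' - a) k| ≤ C * ‖a' - a‖ ^ 2 := by
  choose C hC using fun k => hφ k K
  refine ⟨∑ k, |C k|, by positivity, fun a a' ha ha' => ?_⟩
  set G : EuclideanSpace ℝ (Fin 3) → EuclideanSpace ℝ (Fin 3) := fun a => WithLp.toLp 2 fun k => φ k a
  have hseg : ∀ c ∈ segment ℝ a a', ‖c‖ ≤ K ∧ ‖c - a‖ ≤ ‖a' - a‖ := fun c hc => by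
    refine ⟨?_, norm_sub_le_of_mem_segment hc⟩
    have := (convex_closedBall (0 : EuclideanSpace ℝ (Fin 3)) K).segment_subset
      (by simpa using ha) (by simpa using ha') hc
    simpa using this
  -- Mean value inequality on the segment, which stays in the ball; there the gradient deviates from
  -- its value at `a` by at most a constant times `‖a' - a‖`.
  have h := Convex.norm_image_sub_le_of_norm_hasFDerivWithin_le' (s := segment ℝ a a')
    (f := ψ) (f' := fun c => InnerProductSpace.toDual ℝ _ (G c))
    (φ := InnerProductSpace.toDual ℝ _ (G a)) (C := (∑ k, |C k|) * ‖a' - a‖)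
    (fun c _ => (hasGradientAt_iff_hasFDerivAt.1 (hgrad c)).hasFDerivWithinAt) (fun c hc => ?_)
    (convex_segment a a') (left_mem_segment ℝ a a') (right_mem_segment ℝ a a')
  · rw [Real.norm_eq_abs, InnerProductSpace.toDual_apply_apply, PiLp.inner_apply] at h
    refine (le_of_eq ?_).trans (h.trans_eq (by ring))
    congr 2
    exact Finset.sum_congr rfl fun k _ => by simp [G, mul_comm]
  · rw [← map_sub, LinearIsometryEquiv.norm_map]
    refine (PiLp.norm_le_sum_norm _).trans ?_
    rw [Finset.sum_mul]
    refine Finset.sum_le_sum fun k _ => ?_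
    refine (hC k c a (hseg c hc).1 ha).trans ?_
    exact mul_le_mul (le_abs_self _) (hseg c hc).2 (norm_nonneg _) (abs_nonneg _)

namespace BresseBeam

variable {D : BresseBeam}

/-- The values of the displacement field on the `j`-th part. -/
def state (Φ : D.Energy) (j : Fin 2) (x : ℝ) : EuclideanSpace ℝ (Fin 3) :=
  WithLp.toLp 2 fun i => Hd.fld (Energy.toHd Φ) j i x

theorem state_sub_ae_eq (Φ Φ' : D.Energy) (j : Fin 2) :
    ∀ᵐ x ∂volume.restrict (Ioo (D.left j) (D.right j)),
      state (Φ - Φ') j x = state Φ j x - state Φ' j x := by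
  have hae : ∀ᵐ x ∂volume.restrict (Ioo (D.left j) (D.right j)), ∀ i,
      Hd.fld (Energy.toHd (Φ - Φ')) j i x =
        Hd.fld (Energy.toHd Φ) j i x - Hd.fld (Energy.toHd Φ') j i x :=
    ae_all_iff.2 fun i => by
      simp only [map_sub, Pi.sub_apply]
      exact Lp.coeFn_sub _ _
  filter_upwards [hae] with x hx
  ext i
  exact hx i

theorem norm_state_sq (Φ : D.Energy) (j : Fin 2) (x : ℝ) :
    ‖state Φ j x‖ ^ 2 = ∑ i, Hd.fld (Energy.toHd Φ) j i x ^ 2 := by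
  rw [PiLp.norm_sq_eq_of_L2]
  exact Finset.sum_congr rfl fun i _ => by simp [state]

theorem integrable_norm_state_sq (Φ : D.Energy) (j : Fin 2) :
    Integrable (fun x => ‖state Φ j x‖ ^ 2) (volume.restrict (Ioo (D.left j) (D.right j))) := by
  simp only [norm_state_sq]
  exact integrable_finsetSum _ fun i _ => (Lp.memLp (Hd.fld (Energy.toHd Φ) j i)).integrable_sq

theorem aestronglyMeasurable_state (Φ : D.Energy) (j : Fin 2) :
    AEStronglyMeasurable (state Φ j) (volume.restrict (Ioo (D.left j) (D.right j))) := by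
  have h1 : AEStronglyMeasurable (fun x i => Hd.fld (Energy.toHd Φ) j i x)
      (volume.restrict (Ioo (D.left j) (D.right j))) :=
    (aemeasurable_pi_lambda _ fun i =>
      (Lp.memLp (Hd.fld (Energy.toHd Φ) j i)).1.aemeasurable).aestronglyMeasurable
  exact (PiLp.continuous_toLp 2 _).comp_aestronglyMeasurable h1

variable [D.Regular]

/-- In one space dimension bounded energy means bounded values. Hence Lipschitz bounds on balls
suffice and no growth condition is needed. -/
theorem ae_norm_state_le : ∃ C, 0 < C ∧ ∀ (Φ : D.Energy) (j : Fin 2),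
    ∀ᵐ x ∂volume.restrict (Ioo (D.left j) (D.right j)), ‖state Φ j x‖ ≤ C * ‖Φ‖ := by
  obtain ⟨C, hC, h⟩ := abs_rep_le (D := D)
  refine ⟨3 * C, by positivity, fun Φ j => ?_⟩
  have hae : ∀ᵐ x ∂volume.restrict (Ioo (D.left j) (D.right j)), ∀ i,
      Hd.fld (Energy.toHd Φ) j i x = Hd.rep (Energy.toHd Φ) j i x :=
    ae_all_iff.2 fun i => Hd.fld_ae_eq _ j i
  filter_upwards [hae, ae_restrict_mem measurableSet_Ioo] with x hx hx'
  refine (PiLp.norm_le_sum_norm _).trans ?_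
  have h1 : ∀ i, ‖state Φ j x i‖ ≤ C * ‖Φ‖ := fun i => by
    change |Hd.fld (Energy.toHd Φ) j i x| ≤ _
    rw [hx i]
    exact h _ j i x (Ioo_subset_Icc_self hx')
  rw [Fin.sum_univ_three]
  linarith [h1 0, h1 1, h1 2]

theorem exists_integral_norm_state_sq_le : ∃ C, 0 < C ∧ ∀ (Φ : D.Energy) (j : Fin 2),
    ∫ x in Ioo (D.left j) (D.right j), ‖state Φ j x‖ ^ 2 ≤ C * ‖Energy.embX D Φ‖ ^ 2 := by
  obtain ⟨c, hc, hcR⟩ : ∃ c : ℝ, 0 < c ∧ ∀ p : Fin 2 × Fin 3, c ≤ D.inertia p.1 p.2 := by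
    obtain ⟨p, hp⟩ := Finite.exists_min (fun p : Fin 2 × Fin 3 => D.inertia p.1 p.2)
    exact ⟨_, inertia_pos p.1 p.2, hp⟩
  refine ⟨c⁻¹, by positivity, fun Φ j => ?_⟩
  have h1 : ∫ x in Ioo (D.left j) (D.right j), ‖state Φ j x‖ ^ 2 =
      ∑ i, ‖Hd.fld (Energy.toHd Φ) j i‖ ^ 2 := by
    simp only [norm_state_sq, norm_sq_Lp_Ioo]
    exact integral_finsetSum _ fun i _ => (Lp.memLp (Hd.fld (Energy.toHd Φ) j i)).integrable_sq
  have h2 : c * ∑ i, ‖Hd.fld (Energy.toHd Φ) j i‖ ^ 2 ≤ ‖Energy.embX D Φ‖ ^ 2 := by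
    rw [PiLp.norm_sq_eq_of_L2, Fintype.sum_prod_type, Finset.mul_sum]
    refine le_trans (Finset.sum_le_sum fun i _ => ?_) (Finset.single_le_sum (f := fun j =>
      ∑ i, ‖Energy.embX D Φ (j, i)‖ ^ 2) (fun j _ => Finset.sum_nonneg fun i _ => sq_nonneg _)
      (Finset.mem_univ j))
    rw [Energy.embX_apply, norm_smul, mul_pow, Real.norm_eq_abs, sq_abs,
      Real.sq_sqrt (inertia_pos j i).le]
    exact mul_le_mul_of_nonneg_right (hcR (j, i)) (sq_nonneg _)
  rw [h1]
  have := mul_le_mul_of_nonneg_left h2 (inv_pos.2 hc).le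
  rwa [inv_mul_cancel_left₀ hc.ne'] at this

theorem memLp_comp_state {u : EuclideanSpace ℝ (Fin 3) → ℝ} (hu : Continuous u) (Φ : D.Energy)
    (j : Fin 2) (q : ℝ≥0∞) :
    MemLp (fun x => u (state Φ j x)) q (volume.restrict (Ioo (D.left j) (D.right j))) := by
  obtain ⟨C, hC, h⟩ := ae_norm_state_le (D := D)
  obtain ⟨K, hK⟩ := (isCompact_closedBall (0 : EuclideanSpace ℝ (Fin 3)) (C * ‖Φ‖)
    ).exists_bound_of_continuousOn hu.continuousOn
  refine MemLp.of_bound (hu.comp_aestronglyMeasurable (aestronglyMeasurable_state Φ j)) K ?_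
  filter_upwards [h Φ j] with x hx
  exact hK _ (by simpa using hx)

/-- The superposition operator of the feedbacks `φ j k`. -/
def feedback {φ : Fin 2 → Fin 3 → EuclideanSpace ℝ (Fin 3) → ℝ}
    (hφ : ∀ j k, IsLocLipschitz (φ j k)) (Φ : D.Energy) : D.SixL2 :=
  WithLp.toLp 2 fun p => (√(D.inertia p.1 p.2))⁻¹ •
    (memLp_comp_state (hφ p.1 p.2).continuous Φ p.1 2).toLp

section Feedback

variable {φ : Fin 2 → Fin 3 → EuclideanSpace ℝ (Fin 3) → ℝ} (hφ : ∀ j k, IsLocLipschitz (φ j k))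

/-- The inverse root weight in the definitions of feedback and load cancels the root weight of the
embedding, which leaves the plain `L²` pairing of the weak formulation. -/
theorem inner_smul_embX (j : Fin 2) (i : Fin 3) (f : D.L2 j) (B : D.Energy) :
    inner ℝ ((√(D.inertia j i))⁻¹ • f) (Energy.embX D B (j, i)) =
      inner ℝ f (Hd.fld (Energy.toHd B) j i) := by
  have h := (Real.sqrt_pos.2 (inertia_pos (D := D) j i)).ne'
  rw [Energy.embX_apply, inner_smul_left, inner_smul_right, ← mul_assoc]
  simp [h]

theorem inner_feedback (Φ B : D.Energy) : inner ℝ (feedback hφ Φ) (Energy.embX D B) =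
    ∑ j, ∫ x in Ioo (D.left j) (D.right j), ∑ k, φ j k (state Φ j x) * state B j x k := by
  rw [PiLp.inner_apply, Fintype.sum_prod_type]
  refine Finset.sum_congr rfl fun j _ => ?_
  rw [integral_finsetSum]
  · refine Finset.sum_congr rfl fun k _ => ?_
    refine (inner_smul_embX j k _ B).trans ?_
    rw [L2.inner_def]
    refine integral_congr_ae ?_
    filter_upwards [(memLp_comp_state (hφ j k).continuous Φ j 2).coeFn_toLp] with x hx
    rw [hx]
    simp [state, mul_comm]
  · exact fun k _ => (memLp_comp_state (hφ j k).continuous Φ j 2).integrable_mul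
      (Lp.memLp (Hd.fld (Energy.toHd B) j k))

/-- States of energy norm at most `R` take values in one ball of `ℝ³`, so one Lipschitz constant
applies pointwise. The resulting bound involves only the `L²` norm and is thus a compact
perturbation. -/
theorem norm_feedback_sub_le (R : ℝ) : ∃ C, 0 ≤ C ∧ ∀ Φ Φ' : D.Energy, ‖Φ‖ ≤ R → ‖Φ'‖ ≤ R →
    ‖feedback hφ Φ - feedback hφ Φ'‖ ≤ C * ‖Energy.embX D (Φ - Φ')‖ := by
  obtain ⟨C₀, hC₀, h₀⟩ := ae_norm_state_le (D := D)
  obtain ⟨C₁, hC₁, h₁⟩ := exists_integral_norm_state_sq_le (D := D)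
  choose C hC using fun j k => hφ j k (C₀ * R)
  refine ⟨∑ p : Fin 2 × Fin 3, (√(D.inertia p.1 p.2))⁻¹ * (|C p.1 p.2| * √C₁), by positivity,
    fun Φ Φ' hΦ hΦ' => ?_⟩
  refine (PiLp.norm_le_sum_norm _).trans ?_
  rw [Finset.sum_mul]
  refine Finset.sum_le_sum fun p _ => ?_
  obtain ⟨j, k⟩ := p
  change ‖(√(D.inertia j k))⁻¹ • (memLp_comp_state (hφ j k).continuous Φ j 2).toLp -
    (√(D.inertia j k))⁻¹ • (memLp_comp_state (hφ j k).continuous Φ' j 2).toLp‖ ≤ _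
  rw [← smul_sub, norm_smul, Real.norm_of_nonneg (by positivity), mul_assoc]
  refine mul_le_mul_of_nonneg_left ?_ (by positivity)
  rw [← MemLp.toLp_sub]
  refine le_of_sq_le_sq ?_ (by positivity)
  rw [norm_sq_Lp_Ioo]
  have h2 : ∫ x in Ioo (D.left j) (D.right j), (MemLp.toLp _ ((memLp_comp_state (hφ j k).continuous
      Φ j 2).sub (memLp_comp_state (hφ j k).continuous Φ' j 2)) : D.L2 j) x ^ 2 ≤
      ∫ x in Ioo (D.left j) (D.right j), C j k ^ 2 * ‖state (Φ - Φ') j x‖ ^ 2 := by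
    refine integral_mono_ae (Lp.memLp _).integrable_sq
      ((integrable_norm_state_sq (Φ - Φ') j).const_mul _) ?_
    filter_upwards [((memLp_comp_state (hφ j k).continuous Φ j 2).sub
      (memLp_comp_state (hφ j k).continuous Φ' j 2)).coeFn_toLp, h₀ Φ j, h₀ Φ' j,
      state_sub_ae_eq Φ Φ' j] with x e1 e2 e3 e4
    rw [e1, e4, ← mul_pow, Pi.sub_apply]
    refine sq_le_sq' ?_ ?_
    · have := hC j k (state Φ j x) (state Φ' j x) (e2.trans (by gcongr)) (e3.trans (by gcongr))
      linarith [(abs_le.1 this).1]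
    · have := hC j k (state Φ j x) (state Φ' j x) (e2.trans (by gcongr)) (e3.trans (by gcongr))
      exact (abs_le.1 this).2
  refine h2.trans ?_
  rw [integral_const_mul, mul_pow, mul_pow, sq_abs, Real.sq_sqrt hC₁.le, mul_assoc]
  exact mul_le_mul_of_nonneg_left (h₁ _ j) (sq_nonneg _)

/-- The potential energy of the feedbacks. -/
def potentialEnergy (ψ : Fin 2 → EuclideanSpace ℝ (Fin 3) → ℝ) (Φ : D.Energy) : ℝ :=
  ∑ j, ∫ x in Ioo (D.left j) (D.right j), ψ j (state Φ j x)

variable {ψ : Fin 2 → EuclideanSpace ℝ (Fin 3) → ℝ}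

/-- The pointwise Taylor estimate integrated over the beam, with one constant for all states in a
ball of the energy space. -/
theorem abs_potentialEnergy_sub_le
    (hgrad : ∀ j a, HasGradientAt (ψ j) (WithLp.toLp 2 fun k => φ j k a) a) (R : ℝ) :
    ∃ C, 0 ≤ C ∧ ∀ Φ Φ' : D.Energy, ‖Φ‖ ≤ R → ‖Φ'‖ ≤ R →
      |potentialEnergy ψ Φ' - potentialEnergy ψ Φ -
        inner ℝ (feedback hφ Φ) (Energy.embX D (Φ' - Φ))| ≤ C * ‖Energy.embX D (Φ' - Φ)‖ ^ 2 := by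
  obtain ⟨C₀, hC₀, h₀⟩ := ae_norm_state_le (D := D)
  obtain ⟨C₁, hC₁, h₁⟩ := exists_integral_norm_state_sq_le (D := D)
  choose C hC h using fun j => exists_abs_sub_sub_inner_le (hφ j) (hgrad j) (C₀ * R)
  have hψ : ∀ j, Continuous (ψ j) := fun j => continuous_iff_continuousAt.2 fun a =>
    (hasGradientAt_iff_hasFDerivAt.1 (hgrad j a)).continuousAt
  refine ⟨∑ j, C j * C₁, Finset.sum_nonneg fun j _ => mul_nonneg (hC j) hC₁.le,
    fun Φ Φ' hΦ hΦ' => ?_⟩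
  rw [inner_feedback, potentialEnergy, potentialEnergy, ← Finset.sum_sub_distrib,
    ← Finset.sum_sub_distrib, Finset.sum_mul]
  refine (Finset.abs_sum_le_sum_abs _ _).trans (Finset.sum_le_sum fun j _ => ?_)
  have i1 := (memLp_comp_state (hψ j) Φ j 2).integrable (by norm_num)
  have i2 := (memLp_comp_state (hψ j) Φ' j 2).integrable (by norm_num)
  have i3 : Integrable (fun x => ∑ k, φ j k (state Φ j x) * state (Φ' - Φ) j x k)
      (volume.restrict (Ioo (D.left j) (D.right j))) :=
    integrable_finsetSum _ fun k _ => (memLp_comp_state (hφ j k).continuous Φ j 2).integrable_mul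
      (Lp.memLp (Hd.fld (Energy.toHd (Φ' - Φ)) j k))
  have i21 : Integrable (fun x => ψ j (state Φ' j x) - ψ j (state Φ j x))
      (volume.restrict (Ioo (D.left j) (D.right j))) := i2.sub i1
  rw [← integral_sub i2 i1, ← integral_sub i21 i3]
  refine abs_integral_le_integral_abs.trans ?_
  have h2 : ∫ x in Ioo (D.left j) (D.right j), |ψ j (state Φ' j x) - ψ j (state Φ j x) -
      ∑ k, φ j k (state Φ j x) * state (Φ' - Φ) j x k| ≤
      ∫ x in Ioo (D.left j) (D.right j), C j * ‖state (Φ' - Φ) j x‖ ^ 2 := by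
    refine integral_mono_ae (i21.sub i3).abs
      ((integrable_norm_state_sq (Φ' - Φ) j).const_mul _) ?_
    filter_upwards [h₀ Φ j, h₀ Φ' j, state_sub_ae_eq Φ' Φ j] with x e1 e2 e3
    rw [e3]
    exact h j _ _ (e1.trans (by gcongr)) (e2.trans (by gcongr))
  refine h2.trans ?_
  rw [integral_const_mul, mul_assoc]
  exact mul_le_mul_of_nonneg_left (h₁ _ j) (hC j)

theorem neg_le_potentialEnergy {δ : ℝ} (hψ : ∀ j, Continuous (ψ j)) (hδ : ∀ j a, -δ ≤ ψ j a)
    (Φ : D.Energy) : -(δ * D.L) ≤ potentialEnergy ψ Φ := by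
  have h : ∀ j, (D.right j - D.left j) * -δ ≤
      ∫ x in Ioo (D.left j) (D.right j), ψ j (state Φ j x) := fun j => by
    have h1 := integral_mono (μ := volume.restrict (Ioo (D.left j) (D.right j)))
      (integrable_const (-δ)) ((memLp_comp_state (hψ j) Φ j 2).integrable (by norm_num))
      fun x => hδ j (state Φ j x)
    rw [integral_const, smul_eq_mul, measureReal_restrict_apply_univ, Real.volume_real_Ioo_of_le
      (left_lt_right j).le] at h1
    exact h1
  rw [potentialEnergy, Fin.sum_univ_two]
  have h0 := h 0
  have h1 := h 1
  have e : (D.right 0 - D.left 0) * -δ + (D.right 1 - D.left 1) * -δ = -(δ * D.L) := by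
    simp [left, right]; ring
  linarith

end Feedback

end BresseBeam
end

/-! ### The damping, the load and admissibility -/

noncomputable section

theorem lipschitzWith_of_slope_le {γ : ℝ → ℝ} {M : ℝ}
    (h : ∀ s₁ s₂ : ℝ, s₁ ≠ s₂ → (γ s₁ - γ s₂) / (s₁ - s₂) ≤ M) (hγ : Monotone γ) :
    LipschitzWith M.toNNReal γ := by
  have key : ∀ s₁ s₂ : ℝ, s₂ < s₁ → |γ s₁ - γ s₂| ≤ (M.toNNReal : ℝ) * |s₁ - s₂| := by
    intro s₁ s₂ hs
    have h1 := h s₁ s₂ hs.ne'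
    rw [div_le_iff₀ (sub_pos.2 hs)] at h1
    rw [abs_of_nonneg (sub_nonneg.2 (hγ hs.le)), abs_of_pos (sub_pos.2 hs)]
    exact h1.trans (mul_le_mul_of_nonneg_right (Real.le_coe_toNNReal M) (sub_pos.2 hs).le)
  refine LipschitzWith.of_dist_le_mul fun s₁ s₂ => ?_
  rw [Real.dist_eq, Real.dist_eq]
  rcases lt_trichotomy s₁ s₂ with hs | rfl | hs
  · rw [abs_sub_comm, abs_sub_comm s₁]
    exact key s₂ s₁ hs
  · simp
  · exact key s₁ s₂ hs

theorem le_mul_of_le_slope {γ : ℝ → ℝ} {m : ℝ}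
    (h : ∀ s₁ s₂ : ℝ, s₁ ≠ s₂ → m ≤ (γ s₁ - γ s₂) / (s₁ - s₂)) (s₁ s₂ : ℝ) :
    m * (s₁ - s₂) ^ 2 ≤ (s₁ - s₂) * (γ s₁ - γ s₂) := by
  rcases eq_or_ne s₁ s₂ with rfl | hs
  · simp
  · have h1 := mul_le_mul_of_nonneg_right (h s₁ s₂ hs) (sq_nonneg (s₁ - s₂))
    have h2 : s₁ - s₂ ≠ 0 := sub_ne_zero.2 hs
    refine h1.trans_eq ?_
    field_simp

namespace BresseBeam

variable (D : BresseBeam)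

/-- The angular velocity of the damped part. -/
def angle : D.SixL2 →L[ℝ] D.L2 0 := PiLp.proj 2 (fun p : Fin 2 × Fin 3 => D.L2 p.1) (0, 1)

theorem angle_apply (V : D.SixL2) : D.angle V = V (0, 1) := rfl

/-- The damping operator. -/
def damping {γ : ℝ → ℝ} {K : ℝ≥0} (hγ : LipschitzWith K γ) (hγ0 : γ 0 = 0) (V : D.SixL2) :
    D.SixL2 :=
  D.angle.adjoint ((√(D.inertia 0 1))⁻¹ •
    hγ.compLp hγ0 ((√(D.inertia 0 1))⁻¹ • D.angle V))

/-- The load, in weighted coordinates. -/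
def load (P : D.Hv) : D.SixL2 :=
  WithLp.toLp 2 fun p => (√(D.inertia p.1 p.2))⁻¹ • Hv.fld P p.1 p.2

variable {D}

section Damping

variable {γ : ℝ → ℝ} {K : ℝ≥0} (hγ : LipschitzWith K γ) (hγ0 : γ 0 = 0)

theorem damping_zero : D.damping hγ hγ0 0 = 0 := by
  rw [damping, map_zero, smul_zero, LipschitzWith.compLp_zero, smul_zero, map_zero]

theorem norm_damping_sub_le : ∃ M, 0 ≤ M ∧ ∀ V V',
    ‖D.damping hγ hγ0 V - D.damping hγ hγ0 V'‖ ≤ M * ‖D.angle (V - V')‖ := by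
  set c := (√(D.inertia 0 1))⁻¹ with hc
  have hc0 : 0 ≤ c := by positivity
  refine ⟨‖D.angle.adjoint‖ * (c * (K * c)), by positivity, fun V V' => ?_⟩
  rw [damping, damping, ← map_sub, ← smul_sub, ← hc]
  refine (D.angle.adjoint.le_opNorm _).trans ?_
  rw [mul_assoc, norm_smul, Real.norm_of_nonneg hc0, mul_assoc c, mul_assoc (K : ℝ)]
  refine mul_le_mul_of_nonneg_left (mul_le_mul_of_nonneg_left ?_ hc0) (norm_nonneg _)
  refine (hγ.norm_compLp_sub_le hγ0 _ _).trans_eq ?_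
  rw [← smul_sub, norm_smul, Real.norm_of_nonneg hc0, ← map_sub]

theorem inner_compLp_sub_ge {m : ℝ} (hm : ∀ s s' : ℝ, m * (s - s') ^ 2 ≤ (s - s') * (γ s - γ s'))
    (a a' : D.L2 0) : m * ‖a - a'‖ ^ 2 ≤
      inner ℝ (a - a') (hγ.compLp hγ0 a - hγ.compLp hγ0 a') := by
  rw [norm_sq_Lp_Ioo, L2.inner_def, ← integral_const_mul]
  refine integral_mono_ae ((Lp.memLp (a - a')).integrable_sq.const_mul _)
    (L2.integrable_inner (𝕜 := ℝ) _ _) ?_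
  filter_upwards [Lp.coeFn_sub a a', Lp.coeFn_sub (hγ.compLp hγ0 a) (hγ.compLp hγ0 a'),
    hγ.coeFn_compLp hγ0 a, hγ.coeFn_compLp hγ0 a'] with x h1 h2 h3 h4
  rw [h1, h2, Pi.sub_apply, Pi.sub_apply, h3, h4]
  refine (hm (a x) (a' x)).trans_eq ?_
  simp [mul_comm]

/-- The observation returns `√β₁ ψ_t` rather than `ψ_t`, which turns the constant `m` into `m / β₁`.
-/
theorem damping_monotone {m : ℝ}
    (hm : ∀ s s' : ℝ, m * (s - s') ^ 2 ≤ (s - s') * (γ s - γ s')) (V V' : D.SixL2) :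
    m * (√(D.inertia 0 1))⁻¹ ^ 2 * ‖D.angle (V - V')‖ ^ 2 ≤
      inner ℝ (V - V') (D.damping hγ hγ0 V - D.damping hγ hγ0 V') := by
  set c := (√(D.inertia 0 1))⁻¹ with hc
  have h := inner_compLp_sub_ge hγ hγ0 hm (c • D.angle V) (c • D.angle V')
  rw [damping, damping, ← map_sub, ← smul_sub, ContinuousLinearMap.adjoint_inner_right, ← hc,
    inner_smul_right]
  rw [← smul_sub, ← map_sub, norm_smul, mul_pow, inner_smul_left, Real.norm_eq_abs, sq_abs] at h
  simpa [mul_assoc] using h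

end Damping

variable [D.Regular]

theorem fld_eq_smul_hvEmb (V : D.Hv) (j : Fin 2) (i : Fin 3) :
    (√(D.inertia j i))⁻¹ • D.hvEmb V (j, i) = Hv.fld V j i := by
  have h := (Real.sqrt_pos.2 (inertia_pos (D := D) j i)).ne'
  change (√(D.inertia j i))⁻¹ • (√(D.inertia j i) • Hv.fld V j i) = _
  rw [smul_smul, inv_mul_cancel₀ h, one_smul]

theorem inner_damping {γ : ℝ → ℝ} {K : ℝ≥0} (hγ : LipschitzWith K γ) (hγ0 : γ 0 = 0) (V : D.Hv)
    (B : D.Energy) : inner ℝ (D.damping hγ hγ0 (D.hvEmb V)) (Energy.embX D B) =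
      D.dampingPairing γ (Hv.fld V) (Hd.fld (Energy.toHd B)) := by
  rw [damping, ContinuousLinearMap.adjoint_inner_left, angle_apply, angle_apply, inner_smul_embX,
    fld_eq_smul_hvEmb, L2.inner_def]
  refine integral_congr_ae ?_
  filter_upwards [hγ.coeFn_compLp hγ0 (Hv.fld V 0 1)] with x hx
  rw [hx]
  simp [mul_comm]

theorem inner_load (P : D.Hv) (B : D.Energy) : inner ℝ (D.load P) (Energy.embX D B) =
    D.pairing (Hv.fld P) (Hd.fld (Energy.toHd B)) := by
  rw [PiLp.inner_apply, Fintype.sum_prod_type]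
  exact Finset.sum_congr rfl fun j _ => Finset.sum_congr rfl fun i _ => inner_smul_embX j i _ B

theorem inner_hvEmb (V W : D.Hv) : inner ℝ (D.hvEmb V) (D.hvEmb W) =
    D.inertiaPairing (Hv.fld V) (Hv.fld W) := by
  rw [PiLp.inner_apply, Fintype.sum_prod_type]
  refine Finset.sum_congr rfl fun j _ => Finset.sum_congr rfl fun i _ => ?_
  change inner ℝ (√(D.inertia j i) • Hv.fld V j i) (√(D.inertia j i) • Hv.fld W j i) = _
  rw [inner_smul_left, inner_smul_right, ← mul_assoc]
  simp [Real.mul_self_sqrt (inertia_pos (D := D) j i).le]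

/-- The three feedbacks of the parts, ordered as the components of the displacement. -/
def feedbacks (f h g : Fin 2 → EuclideanSpace ℝ (Fin 3) → ℝ) (j : Fin 2) (k : Fin 3) :
    EuclideanSpace ℝ (Fin 3) → ℝ := ![f j, h j, g j] k

theorem isLocLipschitz_feedbacks {f h g : Fin 2 → EuclideanSpace ℝ (Fin 3) → ℝ}
    (hf : ∀ j, IsLocLipschitz (f j)) (hh : ∀ j, IsLocLipschitz (h j))
    (hg : ∀ j, IsLocLipschitz (g j)) (j : Fin 2) (k : Fin 3) :
    IsLocLipschitz (feedbacks f h g j k) := by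
  fin_cases k
  · exact hf j
  · exact hh j
  · exact hg j

theorem inner_feedback_feedbacks {f h g : Fin 2 → EuclideanSpace ℝ (Fin 3) → ℝ}
    (hφ : ∀ j k, IsLocLipschitz (feedbacks f h g j k)) (Φ B : D.Energy) :
    inner ℝ (feedback hφ Φ) (Energy.embX D B) =
      D.feedbackPairing f h g (Hd.fld (Energy.toHd Φ)) (Hd.fld (Energy.toHd B)) := by
  have hs : ∀ j x, state Φ j x = !₂[Hd.fld (Energy.toHd Φ) j 0 x, Hd.fld (Energy.toHd Φ) j 1 x,
      Hd.fld (Energy.toHd Φ) j 2 x] := fun j x => by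
    ext i
    fin_cases i <;> rfl
  rw [inner_feedback]
  refine Finset.sum_congr rfl fun j _ => integral_congr_ae (ae_of_all _ fun x => ?_)
  simp only [Fin.sum_univ_three, hs j x]
  rfl

theorem isAdmissible {f h g : Fin 2 → EuclideanSpace ℝ (Fin 3) → ℝ}
    (hφ : ∀ j k, IsLocLipschitz (feedbacks f h g j k)) {ψ : Fin 2 → EuclideanSpace ℝ (Fin 3) → ℝ}
    (hgrad : ∀ j a, HasGradientAt (ψ j) !₂[f j a, h j a, g j a] a) {δ : ℝ} (hδ : 0 < δ)
    (hbelow : ∀ j a, -δ ≤ ψ j a) {γ : ℝ → ℝ} {K : ℝ≥0} (hγ : LipschitzWith K γ) (hγ0 : γ 0 = 0)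
    {m : ℝ} (hm : ∀ s s' : ℝ, m * (s - s') ^ 2 ≤ (s - s') * (γ s - γ s')) :
    Phase.IsAdmissible (Energy.embX D) D.angle (D.damping hγ hγ0) (feedback hφ) (potentialEnergy ψ)
      (m * (√(D.inertia 0 1))⁻¹ ^ 2) where
  damping_zero := damping_zero hγ hγ0
  damping_lipschitz := norm_damping_sub_le hγ hγ0
  damping_monotone := damping_monotone hγ hγ0 hm
  feedback_lipschitz := norm_feedback_sub_le hφ
  potential := abs_potentialEnergy_sub_le hφ fun j a => by
    convert hgrad j a using 1
    ext k
    fin_cases k <;> rfl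
  potential_below := ⟨δ * D.L, mul_nonneg hδ.le L_pos.le, neg_le_potentialEnergy
    (fun j => continuous_iff_continuousAt.2 fun a =>
      (hasGradientAt_iff_hasFDerivAt.1 (hgrad j a)).continuousAt) hbelow⟩

end BresseBeam
end

/-! ### Transport of flows and change of norms -/

noncomputable section

section Transport

variable {X Y : Type*} [PseudoMetricSpace X] [PseudoMetricSpace Y]

/-- The semiflow obtained by conjugation with a homeomorphism. -/
def Flow.conj (S : Flow ℝ≥0 X) (T : X ≃ₜ Y) : Flow ℝ≥0 Y where
  toFun t y := T (S t (T.symm y))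
  cont' := T.continuous.comp (S.continuous continuous_fst (T.symm.continuous.comp continuous_snd))
  map_add' s t y := by rw [S.map_add, T.symm_apply_apply]
  map_zero' y := by rw [S.map_zero_apply, T.apply_symm_apply]

theorem Flow.conj_apply (S : Flow ℝ≥0 X) (T : X ≃ₜ Y) (t : ℝ≥0) (y : Y) :
    S.conj T t y = T (S t (T.symm y)) := rfl

theorem LipschitzWith.infEDist_image_le {T : X → Y} {K : ℝ≥0} (hT : LipschitzWith K T) (hK : K ≠ 0)
    {C : Set X} (hC : IsCompact C) (x : X) :
    Metric.infEDist (T x) (T '' C) ≤ K * Metric.infEDist x C := by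
  rcases C.eq_empty_or_nonempty with rfl | hne
  -- For an empty compact set both distances are infinite, and the product remains infinite only
  -- because `K ≠ 0`.
  · rw [Metric.infEDist_empty, ENNReal.mul_top (by simpa using hK)]
    exact le_top
  · obtain ⟨y, hy, hxy⟩ := hC.exists_infEDist_eq_edist hne x
    rw [hxy]
    exact (Metric.infEDist_le_edist_of_mem (mem_image_of_mem T hy)).trans (hT x y)

/-- A bi-Lipschitz conjugation preserves bounded, closed and invariant sets and changes distances to
compact sets by a bounded factor. -/
theorem AsymptoticallySmooth.conj {S : Flow ℝ≥0 X} (h : AsymptoticallySmooth S) (T : X ≃ₜ Y)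
    {K K' : ℝ≥0} (hK : K ≠ 0) (hT : LipschitzWith K T) (hT' : LipschitzWith K' T.symm) :
    AsymptoticallySmooth (S.conj T) := by
  intro B hB hbdd hinv
  obtain ⟨C, hC, hlim⟩ := h (T ⁻¹' B) (hB.preimage T.continuous)
    (by rw [← T.image_symm]; exact hT'.isBounded_image hbdd) fun t x hx => by
      have := hinv t hx
      rwa [Flow.conj_apply, T.symm_apply_apply] at this
  refine ⟨T '' C, hC.image T.continuous, ?_⟩
  have h1 : Tendsto (fun t => (K : ℝ≥0∞) * ⨆ x ∈ T ⁻¹' B, Metric.infEDist (S t x) C) atTop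
      (𝓝 0) := by
    have := ENNReal.Tendsto.const_mul hlim (Or.inr (ENNReal.coe_ne_top (r := K)))
    rwa [mul_zero] at this
  refine tendsto_of_tendsto_of_tendsto_of_le_of_le tendsto_const_nhds h1 (fun _ => zero_le) fun t => ?_
  refine iSup₂_le fun y hy => ?_
  have h2 : Metric.infEDist (S t (T.symm y)) C ≤ ⨆ x ∈ T ⁻¹' B, Metric.infEDist (S t x) C :=
    le_iSup₂ (f := fun x (_ : x ∈ T ⁻¹' B) => Metric.infEDist (S t x) C) (T.symm y)
      (by simpa using hy)
  refine le_trans ?_ (mul_le_mul_right h2 (K : ℝ≥0∞))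
  exact hT.infEDist_image_le hK hC _

end Transport

/-- `H_d` and `H_v` carry only a seminorm and a module structure, so integrability is transported by
bounded additive maps. -/
theorem MemLp.comp_addMonoidHom {α E F : Type*} [MeasurableSpace α] {μ : Measure α}
    [SeminormedAddCommGroup E] [SeminormedAddCommGroup F] {p : ℝ≥0∞} {f : α → E} (hf : MemLp f p μ)
    (A : E →+ F) {C : ℝ} (hA : ∀ x, ‖A x‖ ≤ C * ‖x‖) : MemLp (fun a => A (f a)) p μ := by
  have hc : Continuous A := AddMonoidHomClass.continuous_of_bound A C hA
  refine hf.of_enorm_le_mul (c := C.toNNReal) (hc.comp_aestronglyMeasurable hf.1)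
    (ae_of_all _ fun a => ?_)
  rw [← ofReal_norm, ← ofReal_norm, ENNReal.ofReal, ENNReal.ofReal, ← ENNReal.coe_mul,
    mul_comm C.toNNReal, ← Real.toNNReal_mul (norm_nonneg _), mul_comm ‖f a‖]
  exact ENNReal.coe_le_coe.2 (Real.toNNReal_mono (hA (f a)))

namespace BresseBeam

variable {D : BresseBeam}

theorem norm_hdEmb_sq (Φ : D.Hd) : ‖D.hdEmb Φ‖ ^ 2 =
    ∑ j, ∑ i, D.stiffness j i ^ 2 * ‖D.strain j Φ i‖ ^ 2 := by
  rw [PiLp.norm_sq_eq_of_L2, Fintype.sum_prod_type]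
  refine Finset.sum_congr rfl fun j _ => ?_
  rw [Fin.sum_univ_three, Fin.sum_univ_three]
  have hQ : D.hdEmb Φ (j, 0) = D.stiffness j 0 • D.strain j Φ 0 := rfl
  have hN : D.hdEmb Φ (j, 1) = D.stiffness j 2 • D.strain j Φ 2 := rfl
  have hM : D.hdEmb Φ (j, 2) = D.stiffness j 1 • D.strain j Φ 1 := rfl
  rw [hQ, hN, hM, norm_smul, norm_smul, norm_smul, mul_pow, mul_pow, mul_pow, Real.norm_eq_abs,
    Real.norm_eq_abs, Real.norm_eq_abs, sq_abs, sq_abs, sq_abs]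
  ring

theorem integral_hvEmb_apply {a b : ℝ} {V : ℝ → D.Hv}
    (hV : IntervalIntegrable (fun t => D.hvEmb (V t)) volume a b) (j : Fin 2) (i : Fin 3) :
    (∫ t in a..b, D.hvEmb (V t)) (j, i) = √(D.inertia j i) • ∫ t in a..b, Hv.fld (V t) j i := by
  have h := (PiLp.proj 2 (fun p : Fin 2 × Fin 3 => D.L2 p.1) (j, i) :
    D.SixL2 →L[ℝ] D.L2 j).intervalIntegral_comp_comm hV
  rw [← intervalIntegral.integral_smul]
  exact h.symm

variable [D.Regular]

/-- The squared norms differ by one power of the stiffnesses, which the sum of all stiffnesses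
dominates; for the inverse map the sum of their reciprocals plays this role. -/
theorem exists_norm_toHd_le : ∃ C : ℝ, 0 ≤ C ∧ ∀ Φ : D.Energy, ‖Energy.toHd Φ‖ ≤ C * ‖Φ‖ := by
  refine ⟨√(∑ j, ∑ i, D.stiffness j i), by positivity, fun Φ => ?_⟩
  have hnn : ∀ j i, 0 ≤ D.stiffness j i := fun j i => (stiffness_pos j i).le
  refine le_of_sq_le_sq ?_ (by positivity)
  change ‖D.hdEmb (Energy.toHd Φ)‖ ^ 2 ≤ _
  rw [norm_hdEmb_sq, mul_pow, Real.sq_sqrt (Finset.sum_nonneg fun j _ => Finset.sum_nonneg fun i _ =>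
    hnn j i), norm_sq_eq_sum_strain, Finset.mul_sum]
  refine Finset.sum_le_sum fun j _ => ?_
  rw [Finset.mul_sum]
  refine Finset.sum_le_sum fun i _ => ?_
  rw [← mul_assoc, sq]
  refine mul_le_mul_of_nonneg_right (mul_le_mul_of_nonneg_right ?_ (hnn j i)) (sq_nonneg _)
  exact (Finset.single_le_sum (f := fun i => D.stiffness j i) (fun i _ => hnn j i)
    (Finset.mem_univ i)).trans (Finset.single_le_sum (f := fun j => ∑ i, D.stiffness j i)
    (fun j _ => Finset.sum_nonneg fun i _ => hnn j i) (Finset.mem_univ j))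

theorem exists_norm_toHd_symm_le :
    ∃ C : ℝ, 0 ≤ C ∧ ∀ Φ : D.Hd, ‖Energy.toHd.symm Φ‖ ≤ C * ‖Φ‖ := by
  have hnn : ∀ j i, 0 < D.stiffness j i := stiffness_pos
  refine ⟨√(∑ j, ∑ i, (D.stiffness j i)⁻¹), by positivity, fun Φ => ?_⟩
  have hi : ∀ j i, 0 ≤ (D.stiffness j i)⁻¹ := fun j i => (inv_pos.2 (hnn j i)).le
  refine le_of_sq_le_sq ?_ (by positivity)
  rw [mul_pow]
  change _ ≤ _ * ‖D.hdEmb Φ‖ ^ 2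
  rw [norm_hdEmb_sq, Real.sq_sqrt (Finset.sum_nonneg fun j _ => Finset.sum_nonneg fun i _ =>
    hi j i), norm_sq_eq_sum_strain, Finset.mul_sum, LinearEquiv.apply_symm_apply]
  refine Finset.sum_le_sum fun j _ => ?_
  rw [Finset.mul_sum]
  refine Finset.sum_le_sum fun i _ => ?_
  rw [← mul_assoc]
  refine mul_le_mul_of_nonneg_right ?_ (sq_nonneg _)
  have h1 : (D.stiffness j i)⁻¹ ≤ ∑ j, ∑ i, (D.stiffness j i)⁻¹ :=
    (Finset.single_le_sum (f := fun i => (D.stiffness j i)⁻¹) (fun i _ => hi j i)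
      (Finset.mem_univ i)).trans (Finset.single_le_sum (f := fun j => ∑ i, (D.stiffness j i)⁻¹)
      (fun j _ => Finset.sum_nonneg fun i _ => hi j i) (Finset.mem_univ j))
  have h2 := mul_le_mul_of_nonneg_right h1 (sq_nonneg (D.stiffness j i))
  have h3 := (hnn j i).ne'
  refine le_trans (le_of_eq ?_) h2
  field_simp

/-- Velocities in weighted coordinates. -/
def hvEquiv : D.Hv ≃ₗ[ℝ] D.SixL2 :=
  LinearEquiv.ofBijective D.hvEmb ⟨fun V W h => funext fun j => funext fun i => by
      have h1 := fld_eq_smul_hvEmb V j i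
      rw [h, fld_eq_smul_hvEmb] at h1
      exact h1.symm,
    fun V => ⟨fun j i => (√(D.inertia j i))⁻¹ • V (j, i), by
      ext1 ⟨j, i⟩
      have h := (Real.sqrt_pos.2 (inertia_pos (D := D) j i)).ne'
      change √(D.inertia j i) • ((√(D.inertia j i))⁻¹ • V (j, i)) = _
      rw [smul_smul, mul_inv_cancel₀ h, one_smul]⟩⟩

theorem hvEquiv_apply (V : D.Hv) : hvEquiv V = D.hvEmb V := rfl

theorem norm_hvEquiv (V : D.Hv) : ‖hvEquiv V‖ = ‖V‖ := rfl

theorem norm_hvEquiv_symm (V : D.SixL2) : ‖hvEquiv.symm V‖ = ‖V‖ := by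
  rw [← norm_hvEquiv, LinearEquiv.apply_symm_apply]

theorem memLp_toHd_symm_iff {T : ℝ} {p : ℝ≥0∞} {Φ : ℝ → D.Hd} :
    MemLp (fun t => Energy.toHd.symm (Φ t)) p (volume.restrict (Ioo 0 T)) ↔
      MemLp Φ p (volume.restrict (Ioo 0 T)) := by
  refine ⟨fun h => ?_, fun h => ?_⟩
  · obtain ⟨C, -, hC⟩ := exists_norm_toHd_le (D := D)
    simpa using MemLp.comp_addMonoidHom h (Energy.toHd (D := D)).toLinearMap.toAddMonoidHom hC
  · obtain ⟨C, -, hC⟩ := exists_norm_toHd_symm_le (D := D)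
    exact MemLp.comp_addMonoidHom h (Energy.toHd (D := D)).symm.toLinearMap.toAddMonoidHom hC

theorem memLp_hvEmb_iff {T : ℝ} {p : ℝ≥0∞} {V : ℝ → D.Hv} :
    MemLp (fun t => D.hvEmb (V t)) p (volume.restrict (Ioo 0 T)) ↔
      MemLp V p (volume.restrict (Ioo 0 T)) := by
  refine ⟨fun h => ?_, fun h => ?_⟩
  · have := MemLp.comp_addMonoidHom h (hvEquiv (D := D)).symm.toLinearMap.toAddMonoidHom (C := 1)
      fun x => by rw [one_mul]; exact (norm_hvEquiv_symm x).le
    refine this.ae_eq (ae_of_all _ fun t => ?_)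
    exact hvEquiv.symm_apply_apply (V t)
  · exact MemLp.comp_addMonoidHom h (hvEquiv (D := D)).toLinearMap.toAddMonoidHom (C := 1)
      fun x => by rw [one_mul]; exact (norm_hvEquiv x).le

theorem sixL2_ext_iff {x y : D.SixL2} {a c : D.Fields}
    (hx : ∀ j i, x (j, i) = √(D.inertia j i) • a j i)
    (hy : ∀ j i, y (j, i) = √(D.inertia j i) • c j i) : x = y ↔ ∀ j i, a j i = c j i := by
  refine ⟨fun h j i => ?_, fun h => ?_⟩
  · have h1 := (Real.sqrt_pos.2 (inertia_pos (D := D) j i)).ne'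
    refine smul_right_injective _ h1 ?_
    change √(D.inertia j i) • a j i = √(D.inertia j i) • c j i
    rw [← hx, ← hy, h]
  · ext1 ⟨j, i⟩
    rw [hx, hy, h]

theorem isTestFunction_iff {T : ℝ} (hT : 0 ≤ T) {B : ℝ → D.Hd} {Bt : ℝ → D.Hv} :
    D.IsTestFunction T B Bt ↔
      MemLp (fun t => Energy.toHd.symm (B t)) 2 (volume.restrict (Ioo 0 T)) ∧
      MemLp (fun t => D.hvEmb (Bt t)) 2 (volume.restrict (Ioo 0 T)) ∧
      ∀ᵐ t ∂volume.restrict (Ioo 0 T),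
        Energy.embX D (Energy.toHd.symm (B t)) = -∫ s in t..T, D.hvEmb (Bt s) := by
  have key : MemLp (fun t => D.hvEmb (Bt t)) 2 (volume.restrict (Ioo 0 T)) → ∀ t ∈ Ioo 0 T,
      (Energy.embX D (Energy.toHd.symm (B t)) = -∫ s in t..T, D.hvEmb (Bt s) ↔
        ∀ j i, Hd.fld (B t) j i = -∫ s in t..T, Hv.fld (Bt s) j i) := fun h t ht => by
    have hi : IntervalIntegrable (fun t => D.hvEmb (Bt t)) volume t T :=
      (Phase.intervalIntegrable_of_memLp hT (by norm_num) h).mono_set (by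
        rw [uIcc_of_le ht.2.le, uIcc_of_le hT]; exact Icc_subset_Icc_left ht.1.le)
    refine sixL2_ext_iff (c := fun j i => -∫ s in t..T, Hv.fld (Bt s) j i)
      (fun j i => Energy.embX_apply _ _) fun j i => ?_
    rw [smul_neg, ← integral_hvEmb_apply hi]
    rfl
  refine ⟨fun h => ?_, fun ⟨h1, h2, h3⟩ => ⟨memLp_toHd_symm_iff.1 h1, memLp_hvEmb_iff.1 h2, ?_⟩⟩
  · have h2 := memLp_hvEmb_iff.2 h.memLp_t
    refine ⟨memLp_toHd_symm_iff.2 h.memLp, h2, ?_⟩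
    filter_upwards [h.eq_integral, ae_restrict_mem measurableSet_Ioo] with t h1 ht
    exact (key h2 t ht).2 h1
  · filter_upwards [h3, ae_restrict_mem measurableSet_Ioo] with t h1 ht
    exact (key h2 t ht).1 h1

end BresseBeam
end

/-! ### Weak solutions in modal coordinates and conclusion -/

noncomputable section

theorem MemLp.intervalIntegrable_inner {X : Type*} [NormedAddCommGroup X] [InnerProductSpace ℝ X]
    {T : ℝ} (hT : 0 ≤ T) {f g : ℝ → X} (hf : MemLp f ∞ (volume.restrict (Ioo 0 T)))
    (hg : MemLp g 2 (volume.restrict (Ioo 0 T))) :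
    IntervalIntegrable (fun t => inner ℝ (f t) (g t)) volume 0 T := by
  rw [intervalIntegrable_iff_integrableOn_Ioo_of_le hT]
  have hf2 : MemLp f 2 (volume.restrict (Ioo 0 T)) := hf.mono_exponent le_top
  refine (hf2.norm.integrable_mul hg.norm).mono' (hf.1.inner hg.1) (ae_of_all _ fun t => ?_)
  exact norm_inner_le_norm _ _

namespace BresseBeam

variable {D : BresseBeam} [D.Regular] {f h g : Fin 2 → EuclideanSpace ℝ (Fin 3) → ℝ}
  (hφ : ∀ j k, IsLocLipschitz (feedbacks f h g j k)) {γ : ℝ → ℝ} {K : ℝ≥0} (hγ : LipschitzWith K γ)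
  (hγ0 : γ 0 = 0)

/-- Dictionary between the concrete and the abstract variational identity. The integrability
hypotheses serve to split the abstract forcing into load, damping and feedback. -/
theorem variational_eq {m : ℝ} {Ψ : D.Energy → ℝ}
    (hadm : Phase.IsAdmissible (Energy.embX D) D.angle (D.damping hγ hγ0) (feedback hφ) Ψ m)
    {P : D.Hv} {T : ℝ} (hT : 0 ≤ T) {V₀ : D.Hv} {Φ : ℝ → D.Hd} {V : ℝ → D.Hv}
    (hΦ : MemLp (fun t => Energy.toHd.symm (Φ t)) ∞ (volume.restrict (Ioo 0 T)))
    (hV : MemLp (fun t => D.hvEmb (V t)) ∞ (volume.restrict (Ioo 0 T))) {B : ℝ → D.Hd}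
    {Bt : ℝ → D.Hv} (hB : MemLp (fun t => Energy.toHd.symm (B t)) 2 (volume.restrict (Ioo 0 T)))
    (hBt : MemLp (fun t => D.hvEmb (Bt t)) 2 (volume.restrict (Ioo 0 T))) :
    -(∫ t in (0 : ℝ)..T, D.inertiaPairing (Hv.fld (V t)) (Hv.fld (Bt t)))
        - D.inertiaPairing (Hv.fld V₀) (D.testInitial T Bt)
        + (∫ t in (0 : ℝ)..T, D.energyForm (Φ t) (B t))
        + (∫ t in (0 : ℝ)..T, D.dampingPairing γ (Hv.fld (V t)) (Hd.fld (B t)))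
        + (∫ t in (0 : ℝ)..T, D.feedbackPairing f h g (Hd.fld (Φ t)) (Hd.fld (B t)))
        - (∫ t in (0 : ℝ)..T, D.pairing (Hv.fld P) (Hd.fld (B t))) =
      ((∫ t in (0 : ℝ)..T, inner ℝ (Energy.toHd.symm (Φ t)) (Energy.toHd.symm (B t))) -
        ∫ t in (0 : ℝ)..T, inner ℝ (D.load P - D.damping hγ hγ0 (D.hvEmb (V t)) -
          feedback hφ (Energy.toHd.symm (Φ t))) (Energy.embX D (Energy.toHd.symm (B t)))) -
      ((∫ t in (0 : ℝ)..T, inner ℝ (D.hvEmb (V t)) (D.hvEmb (Bt t))) +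
        inner ℝ (D.hvEmb V₀) (-∫ s in (0 : ℝ)..T, D.hvEmb (Bt s))) := by
  have hiB : MemLp (fun t => Energy.embX D (Energy.toHd.symm (B t))) 2
      (volume.restrict (Ioo 0 T)) := (Energy.embX D).comp_memLp' hB
  have i1 := MemLp.intervalIntegrable_inner hT (memLp_const (D.load P)) hiB
  have i2 := MemLp.intervalIntegrable_inner hT (hadm.memLp_damping hV) hiB
  have i3 := MemLp.intervalIntegrable_inner hT (hadm.memLp_feedback hΦ) hiB
  have e0 : D.inertiaPairing (Hv.fld V₀) (D.testInitial T Bt) =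
      inner ℝ (D.hvEmb V₀) (-∫ s in (0 : ℝ)..T, D.hvEmb (Bt s)) := by
    refine (inner_hvEmb V₀ (D.testInitial T Bt)).symm.trans ?_
    congr 1
    ext1 ⟨j, i⟩
    have h1 := integral_hvEmb_apply
      (Phase.intervalIntegrable_of_memLp hT (by norm_num) hBt) j i
    change √(D.inertia j i) • -(∫ s in (0 : ℝ)..T, Hv.fld (Bt s) j i) = _
    rw [smul_neg, ← h1]
    rfl
  simp only [inner_sub_left]
  rw [intervalIntegral.integral_sub (i1.sub i2) i3, intervalIntegral.integral_sub i1 i2]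
  simp only [inner_load, inner_damping, inner_feedback_feedbacks, inner_hvEmb, Energy.inner_eq,
    LinearEquiv.apply_symm_apply, e0]
  ring

/-- Test functions correspond bijectively on the two sides, and the time derivative relation is
multiplied by the root of the inertia in every component. -/
theorem isWeakSolution_iff {m : ℝ} {Ψ : D.Energy → ℝ}
    (hadm : Phase.IsAdmissible (Energy.embX D) D.angle (D.damping hγ hγ0) (feedback hφ) Ψ m)
    {P : D.Hv} {T : ℝ} (hT : 0 ≤ T) {U₀ : D.H} {Φ : ℝ → D.Hd} {V : ℝ → D.Hv} :
    D.IsWeakSolution f h g γ P T U₀ Φ V ↔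
      Phase.IsWeak (Energy.embX D) (D.damping hγ hγ0) (feedback hφ) (D.load P) T
        (Energy.toHd.symm U₀.1) (D.hvEmb U₀.2) (fun t => Energy.toHd.symm (Φ t))
        (fun t => D.hvEmb (V t)) := by
  have key : MemLp (fun t => D.hvEmb (V t)) ∞ (volume.restrict (Ioo 0 T)) → ∀ t ∈ Ioo 0 T,
      (Energy.embX D (Energy.toHd.symm (Φ t)) =
        Energy.embX D (Energy.toHd.symm U₀.1) + ∫ s in (0 : ℝ)..t, D.hvEmb (V s) ↔
        ∀ j i, Hd.fld (Φ t) j i = Hd.fld U₀.1 j i + ∫ s in (0 : ℝ)..t, Hv.fld (V s) j i) :=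
    fun h t ht => by
      have hi : IntervalIntegrable (fun t => D.hvEmb (V t)) volume 0 t :=
        (Phase.intervalIntegrable_of_memLp hT le_top h).mono_set (by
          rw [uIcc_of_le ht.1.le, uIcc_of_le hT]; exact Icc_subset_Icc_right ht.2.le)
      refine sixL2_ext_iff (c := fun j i => Hd.fld U₀.1 j i + ∫ s in (0 : ℝ)..t, Hv.fld (V s) j i)
        (fun j i => Energy.embX_apply _ _) fun j i => ?_
      rw [smul_add, ← integral_hvEmb_apply hi]
      rfl
  refine ⟨fun hw => ?_, fun hw => ?_⟩
  · have h1 := memLp_toHd_symm_iff.2 hw.memLp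
    have h2 := memLp_hvEmb_iff.2 hw.memLp_t
    refine ⟨h1, h2, ?_, fun B Bt hB hBt hBB => ?_⟩
    · filter_upwards [hw.eq_integral, ae_restrict_mem measurableSet_Ioo] with t ht ht'
      exact (key h2 t ht').2 ht
    · have hBt' : (fun t => D.hvEmb (hvEquiv.symm (Bt t))) = Bt := funext fun t =>
        hvEquiv.apply_symm_apply (Bt t)
      have h3 := hw.variational (fun t => Energy.toHd (B t)) (fun t => hvEquiv.symm (Bt t))
        ((isTestFunction_iff hT).2 ⟨hB, by rw [hBt']; exact hBt, by
          filter_upwards [hBB] with t ht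
          refine ht.trans ?_
          congr 1
          exact intervalIntegral.integral_congr fun s _ => (congrFun hBt' s).symm⟩)
      rw [variational_eq hφ hγ hγ0 hadm hT h1 h2 (B := fun t => Energy.toHd (B t))
        (Bt := fun t => hvEquiv.symm (Bt t)) hB (by rw [hBt']; exact hBt)] at h3
      have h4 := fun t => congrFun hBt' t
      simp only [h4, LinearEquiv.symm_apply_apply] at h3
      exact (sub_eq_zero.1 h3).symm
  · have h1 := memLp_toHd_symm_iff.1 hw.memLp
    have h2 := memLp_hvEmb_iff.1 hw.memLp_t
    refine ⟨h1, h2, ?_, fun B Bt hB => ?_⟩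
    · filter_upwards [hw.eq_integral, ae_restrict_mem measurableSet_Ioo] with t ht ht'
      exact (key hw.memLp_t t ht').1 ht
    · obtain ⟨h3, h4, h5⟩ := (isTestFunction_iff hT).1 hB
      rw [variational_eq hφ hγ hγ0 hadm hT hw.memLp hw.memLp_t h3 h4]
      exact sub_eq_zero.2 (hw.variational _ _ h3 h4 h5).symm

section Coordinates

variable {ι : Type*} (e : HilbertBasis ι ℝ D.Energy) (b : HilbertBasis ι ℝ D.SixL2)

/-- The phase space in modal coordinates. -/
def coordEquiv : Phase ι ≃ₗ[ℝ] D.H :=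
  (Phase.equivProd e b).toLinearEquiv.trans (Energy.toHd.prodCongr hvEquiv.symm)

theorem coordEquiv_apply (z : Phase ι) :
    coordEquiv e b z = (Energy.toHd (Phase.displ e z), hvEquiv.symm (Phase.veloc b z)) := rfl

theorem coordEquiv_symm_apply (U : D.H) :
    (coordEquiv e b).symm U = Phase.mk e b (Energy.toHd.symm U.1, D.hvEmb U.2) := rfl

theorem exists_norm_coordEquiv_le : ∃ C : ℝ, 0 < C ∧ ∀ z, ‖coordEquiv e b z‖ ≤ C * ‖z‖ := by
  obtain ⟨C, hC, h⟩ := exists_norm_toHd_le (D := D)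
  refine ⟨C + 1, by positivity, fun z => ?_⟩
  have hz := norm_nonneg z
  rw [coordEquiv_apply, Prod.norm_def]
  refine max_le ?_ ?_
  · refine (h _).trans ?_
    have := mul_le_mul_of_nonneg_left (Phase.norm_displ_le e z) hC
    linarith
  · rw [norm_hvEquiv_symm]
    have := Phase.norm_veloc_le b z
    have := mul_nonneg hC hz
    linarith

theorem exists_norm_coordEquiv_symm_le :
    ∃ C : ℝ, 0 < C ∧ ∀ U, ‖(coordEquiv e b).symm U‖ ≤ C * ‖U‖ := by
  obtain ⟨C, hC, h⟩ := exists_norm_toHd_symm_le (D := D)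
  refine ⟨C + 1, by positivity, fun U => ?_⟩
  refine le_of_sq_le_sq ?_ (by positivity)
  rw [coordEquiv_symm_apply, Phase.norm_sq_eq e b, Phase.displ_mk, Phase.veloc_mk]
  have h1 : ‖Energy.toHd.symm U.1‖ ≤ C * ‖U‖ :=
    (h U.1).trans (mul_le_mul_of_nonneg_left (norm_fst_le U) hC)
  have h2 : ‖D.hvEmb U.2‖ ≤ ‖U‖ := norm_snd_le U
  have h3 : ‖Energy.toHd.symm U.1‖ ^ 2 ≤ (C * ‖U‖) ^ 2 := by gcongr
  have h4 : ‖D.hvEmb U.2‖ ^ 2 ≤ ‖U‖ ^ 2 := by gcongr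
  have h5 : 0 ≤ C * ‖U‖ * ‖U‖ := by positivity
  calc ‖Energy.toHd.symm U.1‖ ^ 2 + ‖D.hvEmb U.2‖ ^ 2 ≤ (C * ‖U‖) ^ 2 + ‖U‖ ^ 2 := add_le_add h3 h4
    _ ≤ ((C + 1) * ‖U‖) ^ 2 := by nlinarith

theorem lipschitzWith_of_norm_le {E F : Type*} [SeminormedAddCommGroup E] [SeminormedAddCommGroup F]
    [Module ℝ E] [Module ℝ F] (A : E →ₗ[ℝ] F) {C : ℝ} (hA : ∀ x, ‖A x‖ ≤ C * ‖x‖) :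
    LipschitzWith C.toNNReal A :=
  AddMonoidHomClass.lipschitz_of_bound A C hA

/-- The phase space in modal coordinates, as a homeomorphism. -/
def coordHomeomorph : Phase ι ≃ₜ D.H where
  toEquiv := (coordEquiv e b).toEquiv
  continuous_toFun :=
    (lipschitzWith_of_norm_le (coordEquiv e b).toLinearMap
      (exists_norm_coordEquiv_le e b).choose_spec.2).continuous
  continuous_invFun :=
    (lipschitzWith_of_norm_le (coordEquiv e b).symm.toLinearMap
      (exists_norm_coordEquiv_symm_le e b).choose_spec.2).continuous

end Coordinates

theorem secondCountableTopology_sixL2 (D : BresseBeam) : SecondCountableTopology D.SixL2 := by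
  have : Fact ((2 : ℝ≥0∞) ≠ ∞) := ⟨by norm_num⟩
  have : ∀ p : Fin 2 × Fin 3, SecondCountableTopology (D.L2 p.1) := fun p => inferInstance
  exact (PiLp.homeomorph 2 (fun p : Fin 2 × Fin 3 => D.L2 p.1)).secondCountableTopology

/-- The transmission problem generates an asymptotically smooth dynamical system. -/
theorem exists_asymptoticallySmooth_flow {m : ℝ} {Ψ : D.Energy → ℝ} (hm : 0 < m)
    (hadm : Phase.IsAdmissible (Energy.embX D) D.angle (D.damping hγ hγ0) (feedback hφ) Ψ m)
    (P : D.Hv) (hl : 0 < D.l) (hkσ : D.stiffness 0 0 = D.stiffness 0 2)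
    (hspeed : D.inertia 0 0 * D.stiffness 0 1 = D.inertia 0 1 * D.stiffness 0 0) :
    ∃ S : Flow ℝ≥0 D.H, D.Generates f h g γ P S ∧ AsymptoticallySmooth S := by
  obtain ⟨ι, b, e, w, hw, hi⟩ := exists_modes (Energy.embX D) Energy.isCompactOperator_embX
    Energy.embX_injective Energy.denseRange_embX
  have := secondCountableTopology_sixL2 D
  have : Countable ι := b.countable_index
  obtain ⟨J, C, hC, hJ⟩ := exists_static_observability hl hkσ hspeed
  obtain ⟨S, hS, hsmooth⟩ := hadm.exists_flow (P := D.load P) hm hw hi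
    Energy.isCompactOperator_embX hC fun Φ V W heq => hJ ⟨Φ, V, W, heq⟩
  refine ⟨S.conj (coordHomeomorph e b), fun U₀ T hT => ?_, ?_⟩
  · set z : ℝ → Phase ι := fun t => S t.toNNReal ((coordEquiv e b).symm U₀) with hz
    have hmild := hS ((coordEquiv e b).symm U₀) T
    have hz0 : z 0 = (coordEquiv e b).symm U₀ := by
      simp only [hz, Real.toNNReal_zero, Flow.map_zero_apply]
    have hd0 : Phase.displ e (z 0) = Energy.toHd.symm U₀.1 := by
      rw [hz0, coordEquiv_symm_apply, Phase.displ_mk]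
    have hv0 : Phase.veloc b (z 0) = D.hvEmb U₀.2 := by
      rw [hz0, coordEquiv_symm_apply, Phase.veloc_mk]
    have hSz : ∀ t : ℝ, S.conj (coordHomeomorph e b) t.toNNReal U₀ = coordEquiv e b (z t) :=
      fun t => rfl
    refine ⟨?_, fun Φ V hΦ => ?_⟩
    · have hweak := hadm.isWeak_of_isMild hw hi hT.le hmild
      change Phase.IsWeak _ _ _ _ _ (Phase.displ e (z 0)) (Phase.veloc b (z 0))
        (fun t => Phase.displ e (z t)) (fun t => Phase.veloc b (z t)) at hweak
      rw [hd0, hv0] at hweak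
      refine (isWeakSolution_iff hφ hγ hγ0 hadm hT.le).2 ?_
      have h1 : (fun t => Energy.toHd.symm (S.conj (coordHomeomorph e b) t.toNNReal U₀).1) =
          fun t => Phase.displ e (z t) := funext fun t => by rw [hSz]; rfl
      have h2 : (fun t => D.hvEmb (S.conj (coordHomeomorph e b) t.toNNReal U₀).2) =
          fun t => Phase.veloc b (z t) := funext fun t => by
        rw [hSz]
        exact hvEquiv.apply_symm_apply _
      rw [h1, h2]
      exact hweak
    · have hweak := (isWeakSolution_iff hφ hγ hγ0 hadm hT.le).1 hΦ
      rw [← hd0, ← hv0] at hweak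
      filter_upwards [hadm.ae_eq_of_isWeak hw hi hT.le hmild hweak] with t ht
      rw [hSz, coordEquiv_apply]
      refine Prod.ext ?_ ?_
      · change Energy.toHd (Phase.displ e (z t)) = Φ t
        rw [show Phase.displ e (z t) = Energy.toHd.symm (Φ t) from ht.1, LinearEquiv.apply_symm_apply]
      · change hvEquiv.symm (Phase.veloc b (z t)) = V t
        rw [show Phase.veloc b (z t) = D.hvEmb (V t) from ht.2, ← hvEquiv_apply,
          LinearEquiv.symm_apply_apply]
  · obtain ⟨C₁, hC₁, h₁⟩ := exists_norm_coordEquiv_le e b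
    obtain ⟨C₂, hC₂, h₂⟩ := exists_norm_coordEquiv_symm_le e b
    exact hsmooth.conj (coordHomeomorph e b) (Real.toNNReal_pos.2 hC₁).ne'
      (lipschitzWith_of_norm_le (coordEquiv e b).toLinearMap h₁)
      (lipschitzWith_of_norm_le (coordEquiv e b).symm.toLinearMap h₂)

end BresseBeam

end

theorem mainTheorem3 (D : BresseBeam)
    (hL₀ : 0 < D.L₀) (hL : D.L₀ < D.L) (hl : 0 < D.l)
    (hρ : ∀ j, 0 < D.ρ j) (hβ : ∀ j, 0 < D.β j) (hk : ∀ j, 0 < D.k j)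
    (hσ : ∀ j, 0 < D.σ j) (hlam : ∀ j, 0 < D.lam j)
    (f h g : Fin 2 → EuclideanSpace ℝ (Fin 3) → ℝ)
    (hf : ∀ j, IsLocLipschitz (f j)) (hh : ∀ j, IsLocLipschitz (h j))
    (hg : ∀ j, IsLocLipschitz (g j))
    (potential : Fin 2 → EuclideanSpace ℝ (Fin 3) → ℝ)
    (hgrad : ∀ j a, HasGradientAt (potential j) !₂[f j a, h j a, g j a] a)
    (hbelow : ∃ δ > 0, ∀ j a, -δ ≤ potential j a)
    (γ : ℝ → ℝ) (hγc : Continuous γ) (hγm : Monotone γ) (hγ0 : γ 0 = 0)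
    (P : D.Hv)
    (m M : ℝ) (hm : 0 < m) (hM : 0 < M)
    (hD3 : ∀ s₁ s₂ : ℝ, s₁ ≠ s₂ → (γ s₁ - γ s₂) / (s₁ - s₂) ≤ M)
    (hD4 : ∀ s₁ s₂ : ℝ, s₁ ≠ s₂ → m ≤ (γ s₁ - γ s₂) / (s₁ - s₂))
    (hkσ : D.k 0 = D.σ 0) (hspeed : D.ρ 0 / D.k 0 = D.β 0 / D.lam 0) :
    ∃ S : Flow ℝ≥0 D.H, D.Generates f h g γ P S ∧ AsymptoticallySmooth S := by
  have : D.Regular := ⟨hL₀, hL, hρ, hβ, hk, hσ, hlam⟩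
  obtain ⟨δ, hδ, hbelow⟩ := hbelow
  have hφ := BresseBeam.isLocLipschitz_feedbacks hf hh hg
  -- Positivity of `√β₁` makes the monotonicity constant `m / β₁` of the weighted damping positive.
  have hinertia := Real.sqrt_pos.2 (BresseBeam.inertia_pos (D := D) 0 1)
  rw [div_eq_div_iff (hk 0).ne' (hlam 0).ne'] at hspeed
  exact BresseBeam.exists_asymptoticallySmooth_flow hφ (lipschitzWith_of_slope_le hD3 hγm) hγ0
    (by positivity) (BresseBeam.isAdmissible hφ hgrad hδ hbelow _ hγ0 (le_mul_of_le_slope hD4)) P hl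
    hkσ hspeed
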